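/- Let $R$ be a commutative ring with unit and let $\Sigma$ be a smooth oriented surface, possibly with boundary. **Loops.** A *generic loop* on $\Sigma$ is a (piecewise) smooth immersion $\alpha:S^1\to\Sigma\setminus\partial\Sigma$ whose self-crossings are double and transversal; finitely many corners (without cusps) are allowed, and they are distinct from the crossings. Let $\#\alpha$ be the (finite) set of crossings. A *pointed loop* is a generic loop $\alpha$ with a base point $\ast_\alpha\in\alpha(S^1)\setminus\#\alpha$. Two (pointed) loops $\alpha,\beta$ are *isotopic* if $\beta=h_1\circ\alpha\circ f$ for an orientation preserving homeomorphism $f$ of $S^1$ and a continuous family of homeomorphisms $\{h_t:\Sigma\to\Sigma\}_{t\in[0,1]}$ with $h_0=\mathrm{id}$ (and $\ast_\beta=h_1(\ast_\alpha)$). For $p\in\#\alpha$ write $\alpha^{-1}(p)=\{p_1,p_2\}$, where $p_1$ is met before $p_2$ when one starts at $\alpha^{-1}(\ast_\alpha)$ and moves counterclockwise. Put $\varepsilon_p=+1$ if the pair of tangent vectors of $\alpha$ at $p_1$ and at $p_2$ is positive, and $\varepsilon_p=-1$ otherwise. Let $\alpha_{p_1,p_2}$ and $\alpha_{p_2,p_1}$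 be the loops obtained by restricting $\alpha$ to the counterclockwise arcs $p_1p_2$ and $p_2p_1$ of $S^1$. Let $\mathcal L(\Sigma)$ be the free $R$-module on the isotopy classes of pointed loops, with $$\rho(\alpha,\ast_\alpha)=\sum_{p\in\#\alpha}\varepsilon_p\,(\alpha_{p_1,p_2},p)\otimes(\alpha_{p_2,p_1},\ast_\alpha).$$ **Trees.** A *rooted $\Phi$-tree* is a finite rooted tree with a planar structure (a cyclic order of the edges at each vertex; equivalently, an embedding in the plane up to orientation preserving homeomorphisms of the plane), with vertices labeled by isotopy classes of non-pointed loops on $\Sigma$ and edges labeled by $\pm1$. Let $\mathcal T(\Phi)$ be the free $R$-module on the homeomorphism classes (i.e. isomorphism classes respecting the root, labels and planar structure) of rooted $\Phi$-trees, with $\rho(T)=\sum_e T^1_e\otimes T^2_e$, the sum over all edges $e$ of $T$, where $T^2_e$ is the component of $T-e$ containing the root of $T$ and $T^1_e$ is the other component, rooted at its vertex incident to $e$. **Cuts.** For $p\in\#\alpha$ let $e_p$ be the straight segment in the unit disk $D^2$ with ends $p_1,p_2$. A *cut* $H$ of $\alpha$, written $H\prec\alpha$, is a set of crossings whose segments are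 pairwise disjoint. The $H$-*faces* are the regions into which $\{e_p\}_{p\in H}$ split $D^2$. Let $T_H$ be the dual tree: its vertices are the $H$-faces, and each $p\in H$ gives an edge $[p]$ joining the two faces adjacent to $e_p$. Its root is the face with $\alpha^{-1}(\ast_\alpha)$ on its boundary; its planar structure comes from embedding it in $D^2$ with each vertex inside its face and $[p]$ crossing $e_p$; the vertex given by a face $V$ is labeled by the loop obtained by moving along $\partial V$ and applying $\alpha$ on $\partial V\cap S^1$; the edge $[p]$ is labeled by $\varepsilon_p$. Put $\varepsilon_H=\prod_{p\in H}\varepsilon_p$. **Theorem.** The classes of the pointed loops $(\alpha_{p_1,p_2},p)$, $(\alpha_{p_2,p_1},\ast_\alpha)$ and of the trees $T_H$ exist and are well defined. The formulas above define $R$-linear maps $\rho:\mathcal L(\Sigma)\to\mathcal L(\Sigma)^{\otimes2}$ and $\rho:\mathcal T(\Phi)\to\mathcal T(\Phi)^{\otimes 2}$, and the formula $$\eta(\alpha)=\sum_{H\prec\alpha}\varepsilon_H\,T_H$$ defines an $R$-linear map $\eta:\mathcal L(\Sigma)\to\mathcal T(\Phi)$. Both maps $\rho$ are pre-Lie comultiplications,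 i.e. $(\mathrm{id}-P^{1,2})\big((\rho\otimes\mathrm{id})\rho-(\mathrm{id}\otimes\rho)\rho\big)=0$, where $P^{1,2}$ permutes the first two tensor factors; and $\eta$ is a homomorphism of pre-Lie coalgebras: $\rho\,\eta=(\eta\otimes\eta)\,\rho$. -/

import Mathlib

open scoped Manifold ContDiff TensorProduct

noncomputable section

/-! ### Pre-Lie coalgebras -/

section PreLie

variable {R : Type*} [CommRing R] {A B : Type*} [AddCommGroup A] [Module R A]
  [AddCommGroup B] [Module R B]

/-- `ρ : A → A ⊗ A` is a (left) pre-Lie comultiplication: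
`(id - P¹²) ((ρ ⊗ id) ρ - (id ⊗ ρ) ρ) = 0`, where `P¹²` permutes the first two tensor factors. -/
def IsPreLieComul (ρ : A →ₗ[R] A ⊗[R] A) : Prop :=
  (LinearMap.id - (TensorProduct.comm R A A).toLinearMap.rTensor A) ∘ₗ
    (ρ.rTensor A ∘ₗ ρ -
      (TensorProduct.assoc R A A A).symm.toLinearMap ∘ₗ ρ.lTensor A ∘ₗ ρ) = 0

/-- `f` commutes with the comultiplications: `ρ' f = (f ⊗ f) ρ`. -/
def IsComulHom (ρ : A →ₗ[R] A ⊗[R] A) (ρ' : B →ₗ[R] B ⊗[R] B) (f : A →ₗ[R] B) : Prop :=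
  ρ' ∘ₗ f = TensorProduct.map f f ∘ₗ ρ

end PreLie

/-! ### Oriented surfaces and generic loops

A smooth surface, possibly with boundary, is a Hausdorff space charted on the half-plane
`EuclideanHalfSpace 2` with smooth transition maps. -/

/-- The atlas of the surface is oriented: all its transition maps have positive Jacobian. Thus the
orientation of `T_x S = ℝ²` is the standard one, read through the preferred chart at `x`. -/
def IsOrientedAtlas (S : Type*) [TopologicalSpace S]
    [ChartedSpace (EuclideanHalfSpace 2) S] : Prop :=
  ∀ e ∈ atlas (EuclideanHalfSpace 2) S, ∀ e' ∈ atlas (EuclideanHalfSpace 2) S,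
    ∀ x ∈ e.source ∩ e'.source,
      0 < (fderivWithin ℝ (e'.extend (𝓡∂ 2) ∘ (e.extend (𝓡∂ 2)).symm)
        (Set.range (𝓡∂ 2)) (e.extend (𝓡∂ 2) x)).det

section Loops

variable {S : Type*} [TopologicalSpace S] [ChartedSpace (EuclideanHalfSpace 2) S]

/-- The map `α : S¹ → S` in the angular coordinate of `S¹`. -/
def angular (α : Circle → S) (t : ℝ) : S := α (Circle.exp t)

/-- Positive tangent vector of `α` at the point `exp (i t)` of the circle, as a vector of
`T S = ℝ²`. -/
def vel (α : Circle → S) (t : ℝ) : EuclideanSpace ℝ (Fin 2) :=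
  mfderiv 𝓘(ℝ, ℝ) (𝓡∂ 2) (angular α) t (1 : ℝ)

/-- Outgoing one-sided tangent vector (derivative from the right). -/
def velOut (α : Circle → S) (t : ℝ) : EuclideanSpace ℝ (Fin 2) :=
  mfderivWithin 𝓘(ℝ, ℝ) (𝓡∂ 2) (angular α) (Set.Ici t) t (1 : ℝ)

/-- Incoming one-sided tangent vector (derivative from the left). -/
def velIn (α : Circle → S) (t : ℝ) : EuclideanSpace ℝ (Fin 2) :=
  mfderivWithin 𝓘(ℝ, ℝ) (𝓡∂ 2) (angular α) (Set.Iic t) t (1 : ℝ)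

/-- The determinant of a pair of vectors of the oriented plane `ℝ²`. -/
def planeDet (v w : EuclideanSpace ℝ (Fin 2)) : ℝ := v 0 * w 1 - v 1 * w 0

/-- The set of self-crossings of a map of the circle. -/
def crossingSet (α : Circle → S) : Set S := {p | ∃ x y, x ≠ y ∧ α x = p ∧ α y = p}

variable (S) in
/-- A generic loop: a piecewise smooth immersion of the circle in the interior of `S` whose
self-crossings are double and transversal, finite in number, and distinct from the corners.
On both sides of every parameter `t` the loop is smooth up to `t` with non-zero one-sided
derivative, and the two one-sided directions form no cusp. By compactness there are finitely many
corners. Smooth immersions are the case without corners. -/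
structure GenericLoop where
  toFun : Circle → S
  interior : ∀ x, (𝓡∂ 2).IsInteriorPoint (toFun x)
  smooth_out : ∀ t : ℝ, ∃ δ > 0,
    ContMDiffOn 𝓘(ℝ, ℝ) (𝓡∂ 2) ∞ (angular toFun) (Set.Icc t (t + δ))
  smooth_in : ∀ t : ℝ, ∃ δ > 0,
    ContMDiffOn 𝓘(ℝ, ℝ) (𝓡∂ 2) ∞ (angular toFun) (Set.Icc (t - δ) t)
  velOut_ne : ∀ t, velOut toFun t ≠ 0
  velIn_ne : ∀ t, velIn toFun t ≠ 0
  no_cusp : ∀ t, ¬ SameRay ℝ (velOut toFun t) (-velIn toFun t)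
  double : ∀ x y z, toFun x = toFun y → toFun y = toFun z → x = y ∨ y = z ∨ x = z
  smooth_crossing : ∀ t : ℝ, toFun (Circle.exp t) ∈ crossingSet toFun →
    ContMDiffAt 𝓘(ℝ, ℝ) (𝓡∂ 2) ∞ (angular toFun) t
  transversal : ∀ t u : ℝ, Circle.exp t ≠ Circle.exp u →
    toFun (Circle.exp t) = toFun (Circle.exp u) → planeDet (vel toFun t) (vel toFun u) ≠ 0
  finite_crossings : (crossingSet toFun).Finite

variable (S) in
/-- A pointed loop. The base point, a point of `α(S¹)` which is not a crossing, is recorded by its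
unique preimage in `S¹`. -/
structure PointedLoop extends GenericLoop S where
  base : Circle
  base_not_crossing : toFun base ∉ crossingSet toFun

/-- Orientation preserving self-homeomorphisms of the circle. -/
def IsPositive (f : Circle ≃ₜ Circle) : Prop :=
  ∃ F : ℝ → ℝ, Continuous F ∧ StrictMono F ∧ (∀ t, F (t + 2 * Real.pi) = F t + 2 * Real.pi) ∧
    ∀ t, f (Circle.exp t) = Circle.exp (F t)

/-- `g` is the final homeomorphism `h₁` of an ambient isotopy `h_t` with `h₀ = id`. -/
def IsIsotopyEnd {X : Type*} [TopologicalSpace X] (g : X ≃ₜ X) : Prop :=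
  ∃ h : unitInterval → X ≃ₜ X, Continuous (fun z : unitInterval × X => h z.1 z.2) ∧
    h 0 = Homeomorph.refl X ∧ h 1 = g

lemma IsPositive.refl : IsPositive (Homeomorph.refl Circle) :=
  ⟨id, continuous_id, strictMono_id, fun _ => rfl, fun _ => rfl⟩

lemma IsPositive.trans {f g : Circle ≃ₜ Circle} (hf : IsPositive f) (hg : IsPositive g) :
    IsPositive (f.trans g) := by
  obtain ⟨F, hF, hF', hF2, hF3⟩ := hf
  obtain ⟨G, hG, hG', hG2, hG3⟩ := hg
  exact ⟨G ∘ F, hG.comp hF, hG'.comp hF', fun t => by simp [hF2, hG2], fun t => by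
    simp [hF3, hG3]⟩

lemma IsPositive.symm {f : Circle ≃ₜ Circle} (hf : IsPositive f) : IsPositive f.symm := by
  obtain ⟨F, hF, hF', hF2, hF3⟩ := hf
  have hnat : ∀ n : ℕ, ∀ t, F (t + n * (2 * Real.pi)) = F t + n * (2 * Real.pi) := by
    intro n
    induction n with
    | zero => simp
    | succ k ih =>
      intro t
      have : t + ((k + 1 : ℕ) : ℝ) * (2 * Real.pi)
          = (t + k * (2 * Real.pi)) + 2 * Real.pi := by push_cast; ring
      rw [this, hF2, ih]; push_cast; ring
  have hneg : ∀ n : ℕ, F (-(n * (2 * Real.pi))) = F 0 - n * (2 * Real.pi) := by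
    intro n
    have h := hnat n (-(n * (2 * Real.pi)))
    rw [neg_add_cancel] at h
    linarith
  have hsurj : Function.Surjective F := by
    intro y
    obtain ⟨n, hn⟩ := exists_nat_gt (|y - F 0| / (2 * Real.pi))
    have hpi : (0 : ℝ) < 2 * Real.pi := by positivity
    rw [div_lt_iff₀ hpi] at hn
    obtain ⟨h1, h2⟩ := abs_lt.mp hn
    have hle : -(n * (2 * Real.pi)) ≤ 0 + n * (2 * Real.pi) := by
      have : 0 ≤ (n : ℝ) * (2 * Real.pi) := by positivity
      linarith
    obtain ⟨x, -, hx⟩ := intermediate_value_Icc hle hF.continuousOn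
      (show y ∈ Set.Icc _ _ by rw [hneg, hnat]; constructor <;> linarith)
    exact ⟨x, hx⟩
  let E : ℝ ≃o ℝ := hF'.orderIsoOfSurjective F hsurj
  have hE : ∀ t, F (E.symm t) = t := fun t => E.apply_symm_apply t
  refine ⟨E.symm, E.symm.continuous, E.symm.strictMono, fun t => ?_, fun t => ?_⟩
  · apply hF'.injective
    rw [hF2, hE, hE]
  · rw [Homeomorph.symm_apply_eq, hF3, hE]

lemma IsIsotopyEnd.refl {X : Type*} [TopologicalSpace X] :
    IsIsotopyEnd (Homeomorph.refl X) :=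
  ⟨fun _ => Homeomorph.refl X, continuous_snd, rfl, rfl⟩

lemma IsIsotopyEnd.symm {X : Type*} [TopologicalSpace X] {g : X ≃ₜ X} (hg : IsIsotopyEnd g) :
    IsIsotopyEnd g.symm := by
  obtain ⟨h, hc, h0, h1⟩ := hg
  refine ⟨fun t => g.symm.trans (h (unitInterval.symm t)), ?_, ?_, ?_⟩
  · exact hc.comp (((unitInterval.continuous_symm.comp continuous_fst)).prodMk
      (g.symm.continuous.comp continuous_snd))
  · simp [h1]
  · ext x; simp [h0]

lemma IsIsotopyEnd.trans {X : Type*} [TopologicalSpace X] {f g : X ≃ₜ X}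
    (hf : IsIsotopyEnd f) (hg : IsIsotopyEnd g) : IsIsotopyEnd (f.trans g) := by
  obtain ⟨h, hc, h0, h1⟩ := hf
  obtain ⟨k, kc, k0, k1⟩ := hg
  -- the composition `k_t ∘ h_t` is again a continuous family
  exact ⟨fun t => (h t).trans (k t), kc.comp (continuous_fst.prodMk hc), by
    ext x; simp [h0, k0], by simp [h1, k1]⟩

/-- Isotopy of (non-pointed) loops: `β = h₁ ∘ α ∘ f` for an ambient isotopy `h_t` and an
orientation preserving reparametrization `f`. -/
instance GenericLoop.setoid : Setoid (GenericLoop S) where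
  r α β := ∃ g : S ≃ₜ S, IsIsotopyEnd g ∧ ∃ f : Circle ≃ₜ Circle, IsPositive f ∧
    ∀ x, β.toFun x = g (α.toFun (f x))
  iseqv := by
    refine ⟨fun α => ⟨_, .refl, _, .refl, fun _ => rfl⟩, ?_, ?_⟩
    · rintro α β ⟨g, hg, f, hf, h⟩
      exact ⟨_, hg.symm, _, hf.symm, fun x => by simp [h]⟩
    · rintro α β γ ⟨g, hg, f, hf, h⟩ ⟨g', hg', f', hf', h'⟩
      exact ⟨_, hg.trans hg', _, hf'.trans hf, fun x => by simp [h, h']⟩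

/-- Isotopy of pointed loops; the base points correspond to each other. -/
instance PointedLoop.setoid : Setoid (PointedLoop S) where
  r α β := ∃ g : S ≃ₜ S, IsIsotopyEnd g ∧ ∃ f : Circle ≃ₜ Circle, IsPositive f ∧
    (∀ x, β.toFun x = g (α.toFun (f x))) ∧ f β.base = α.base
  iseqv := by
    refine ⟨fun α => ⟨_, .refl, _, .refl, fun _ => rfl, rfl⟩, ?_, ?_⟩
    · rintro α β ⟨g, hg, f, hf, h, hb⟩
      exact ⟨_, hg.symm, _, hf.symm, fun x => by simp [h], by simp [← hb]⟩
    · rintro α β γ ⟨g, hg, f, hf, h, hb⟩ ⟨g', hg', f', hf', h', hb'⟩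
      exact ⟨_, hg.trans hg', _, hf'.trans hf, fun x => by simp [h, h'], by simp [hb, hb']⟩

variable (S) in
/-- Isotopy classes of non-pointed loops. -/
abbrev LoopClass := Quotient (GenericLoop.setoid (S := S))

variable (S) in
/-- Isotopy classes of pointed loops. -/
abbrev PointedLoopClass := Quotient (PointedLoop.setoid (S := S))

/-- The finite set `#α` of crossings. -/
def GenericLoop.crossings (α : GenericLoop S) : Finset S := α.finite_crossings.toFinset

/-- `p` is a crossing of the pointed loop `α`, and starting at the base point and moving
counterclockwise one meets `p` first at `p₁ = exp (i t)` and then at `p₂ = exp (i u)`. -/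
def PointedLoop.Visits (α : PointedLoop S) (p : S) (t u : ℝ) : Prop :=
  ∃ s : ℝ, Circle.exp s = α.base ∧ s < t ∧ t < u ∧ u < s + 2 * Real.pi ∧
    α.toFun (Circle.exp t) = p ∧ α.toFun (Circle.exp u) = p

open Classical in
/-- The sign `ε_p`: it is `+1` if (tangent of `α` at `p₁`, tangent of `α` at `p₂`) is a positive
pair, and `-1` otherwise. -/
def PointedLoop.crossingSign (α : PointedLoop S) (p : S) : ℤˣ :=
  if ∃ t u, α.Visits p t u ∧ 0 < planeDet (vel α.toFun t) (vel α.toFun u) then 1 else -1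

/-- `β` is the loop obtained by moving along the closed set `A ⊆ S¹` counterclockwise, applying `α`
and jumping over the complementary arcs of `A`. The function `c` is the lift to `ℝ` of the monotone
degree one map of the circle that collapses each complementary arc of `A` to a point and makes no
other identification; then `β ∘ c = α` on `A`. This determines `β` up to reparametrization. -/
def Traverses (α : Circle → S) (A : Set Circle) (β : Circle → S) : Prop :=
  ∃ c : ℝ → ℝ, Continuous c ∧ Monotone c ∧ (∀ t, c (t + 2 * Real.pi) = c t + 2 * Real.pi) ∧
    (∀ s t, s < t → (c s = c t ↔ ∀ u ∈ Set.Ioo s t, Circle.exp u ∉ A)) ∧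
    ∀ t, Circle.exp t ∈ A → β (Circle.exp (c t)) = α (Circle.exp t)

/-- `b` is the isotopy class of `(α_{p₁,p₂}, p)`. -/
def PointedLoop.IsInner (α : PointedLoop S) (p : S) (b : PointedLoopClass S) : Prop :=
  ∃ β : PointedLoop S, ⟦β⟧ = b ∧ ∃ t u, α.Visits p t u ∧
    Traverses α.toFun (Circle.exp '' Set.Icc t u) β.toFun ∧ β.toFun β.base = p

/-- `b` is the isotopy class of `(α_{p₂,p₁}, *_α)`. -/
def PointedLoop.IsOuter (α : PointedLoop S) (p : S) (b : PointedLoopClass S) : Prop :=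
  ∃ β : PointedLoop S, ⟦β⟧ = b ∧ ∃ t u, α.Visits p t u ∧
    Traverses α.toFun (Circle.exp '' Set.Icc u (t + 2 * Real.pi)) β.toFun ∧
    β.toFun β.base = α.toFun α.base

end Loops

/-! ### Planar rooted trees with signed edges and vertices labeled by loops -/

section Trees

variable (S : Type*) [TopologicalSpace S] [ChartedSpace (EuclideanHalfSpace 2) S]

/-- A rooted `Φ`-tree: a finite rooted tree with vertices labeled by isotopy classes of loops,
edges labeled by signs (the values of `sign` outside the edges are irrelevant), and a planar
structure, that is, a cyclic order of the edges at every vertex. Here `ccw v a b c` means that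
`a, b, c` are distinct neighbours of `v` and the edges `va, vb, vc` leave `v` in this
counterclockwise order. -/
structure LoopTree where
  V : Type
  finite : Finite V
  graph : SimpleGraph V
  isTree : graph.IsTree
  root : V
  label : V → LoopClass S
  sign : Sym2 V → ℤˣ
  ccw : V → V → V → V → Prop
  ccw_adj : ∀ v a b c, ccw v a b c → graph.Adj v a
  ccw_rotate : ∀ v a b c, ccw v a b c → ccw v b c a
  ccw_asymm : ∀ v a b c, ccw v a b c → ¬ ccw v c b a
  ccw_trans : ∀ v a b c d, ccw v a b c → ccw v a c d → ccw v a b d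
  ccw_total : ∀ v a b c, graph.Adj v a → graph.Adj v b → graph.Adj v c →
    a ≠ b → b ≠ c → c ≠ a → ccw v a b c ∨ ccw v c b a

variable {S}

/-- Homeomorphism of rooted `Φ`-trees. -/
instance LoopTree.setoid : Setoid (LoopTree S) where
  r T T' := ∃ f : T.V ≃ T'.V,
    (∀ a b, T'.graph.Adj (f a) (f b) ↔ T.graph.Adj a b) ∧ f T.root = T'.root ∧
    (∀ v, T'.label (f v) = T.label v) ∧
    (∀ a b, T.graph.Adj a b → T'.sign s(f a, f b) = T.sign s(a, b)) ∧
    ∀ v a b c, T'.ccw (f v) (f a) (f b) (f c) ↔ T.ccw v a b c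
  iseqv := by
    refine ⟨fun T => ⟨Equiv.refl _, by simp⟩, ?_, ?_⟩
    · rintro T T' ⟨f, h1, h2, h3, h4, h5⟩
      refine ⟨f.symm, fun a b => ?_, by simp [← h2], fun v => ?_, fun a b hab => ?_,
        fun v a b c => ?_⟩
      · simp [← h1]
      · simp [← h3]
      · have := h4 (f.symm a) (f.symm b) (by simpa [← h1] using hab)
        simpa using this.symm
      · simp [← h5]
    · rintro T T' T'' ⟨f, h1, h2, h3, h4, h5⟩ ⟨g, k1, k2, k3, k4, k5⟩
      refine ⟨f.trans g, fun a b => by simp [h1, k1], by simp [h2, k2], fun v => by simp [h3, k3],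
        fun a b hab => ?_, fun v a b c => by simp [h5, k5]⟩
      simp [k4 _ _ ((h1 a b).2 hab), h4 _ _ hab]

variable (S) in
/-- Homeomorphism classes of rooted `Φ`-trees. -/
abbrev LoopTreeClass := Quotient (LoopTree.setoid (S := S))

/-- The component of `T - e` that contains the vertex `r`, rooted at `r`, with the restricted
labels and planar structure. -/
def LoopTree.component (T : LoopTree S) (e : Sym2 T.V) (r : T.V) : LoopTree S where
  V := {x : T.V // (T.graph.deleteEdges {e}).Reachable r x}
  finite := haveI := T.finite; inferInstance
  graph := T.graph.induce {x | (T.graph.deleteEdges {e}).Reachable r x}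
  isTree := by
    refine ⟨?_, T.isTree.isAcyclic.induce _⟩
    let C := (T.graph.deleteEdges {e}).connectedComponentMk r
    have hC : C.supp = {x | (T.graph.deleteEdges {e}).Reachable r x} := by
      ext x
      simp [C, SimpleGraph.ConnectedComponent.mem_supp_iff, SimpleGraph.reachable_comm]
    have h : ((T.graph.deleteEdges {e}).induce C.supp).Connected := C.connected_toSimpleGraph
    rw [hC] at h
    exact h.mono fun a b hab => SimpleGraph.deleteEdges_le (G := T.graph) {e} hab
  root := ⟨r, SimpleGraph.Reachable.refl r⟩
  label v := T.label v.1
  sign d := T.sign (d.map Subtype.val)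
  ccw v a b c := T.ccw v.1 a.1 b.1 c.1
  ccw_adj v a b c h := T.ccw_adj _ _ _ _ h
  ccw_rotate v a b c h := T.ccw_rotate _ _ _ _ h
  ccw_asymm v a b c h := T.ccw_asymm _ _ _ _ h
  ccw_trans v a b c d h h' := T.ccw_trans _ _ _ _ _ h h'
  ccw_total v a b c ha hb hc h1 h2 h3 := T.ccw_total _ _ _ _ ha hb hc
    (fun h => h1 (Subtype.ext h)) (fun h => h2 (Subtype.ext h)) (fun h => h3 (Subtype.ext h))

/-- Every edge of a rooted tree has an end separated from the root by the edge. -/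
lemma LoopTree.exists_far (T : LoopTree S) (e : T.graph.edgeSet) :
    ∃ w ∈ e.1, ¬ (T.graph.deleteEdges {e.1}).Reachable T.root w := by
  obtain ⟨e, he⟩ := e
  induction e with
  | h v w =>
    have hb := (SimpleGraph.isAcyclic_iff_forall_isBridge.mp T.isTree.isAcyclic) he
    rw [SimpleGraph.isBridge_iff] at hb
    by_cases hv : (T.graph.deleteEdges {s(v, w)}).Reachable T.root v
    · exact ⟨w, by simp, fun hw => hb (hv.symm.trans hw)⟩
    · exact ⟨v, by simp, hv⟩

/-- The end of the edge `e` that is separated from the root by `e`. -/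
def LoopTree.far (T : LoopTree S) (e : T.graph.edgeSet) : T.V := (T.exists_far e).choose

/-- `T¹_e`: the part of `T - e` without the root of `T`, rooted at its vertex adjacent to `e`. -/
def LoopTree.upper (T : LoopTree S) (e : T.graph.edgeSet) : LoopTree S :=
  T.component e.1 (T.far e)

/-- `T²_e`: the part of `T - e` that contains the root of `T`. -/
def LoopTree.lower (T : LoopTree S) (e : T.graph.edgeSet) : LoopTree S :=
  T.component e.1 T.root

end Trees

/-! ### Cuts and the dual trees -/

section Cuts

variable {S : Type*} [TopologicalSpace S] [ChartedSpace (EuclideanHalfSpace 2) S]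

/-- The segment `e_p` in the unit disk whose ends are the two points of `α⁻¹(p)`. -/
def chord (α : Circle → S) (p : S) : Set ℂ :=
  convexHull ℝ ((fun z : Circle => (z : ℂ)) '' (α ⁻¹' {p}))

open Classical in
/-- The cuts of `α`: sets of pairwise unlinked crossings. -/
def GenericLoop.cuts (α : GenericLoop S) : Finset (Finset S) :=
  α.crossings.powerset.filter fun H =>
    ∀ p ∈ H, ∀ q ∈ H, p ≠ q → Disjoint (chord α.toFun p) (chord α.toFun q)

/-- The unit disk without the segments `e_p`, `p ∈ H`. -/
def cutDisk (α : Circle → S) (H : Finset S) : Set ℂ :=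
  Metric.closedBall 0 1 \ ⋃ p ∈ H, chord α p

/-- The `H`-faces: the regions into which the segments `e_p`, `p ∈ H`, split the unit disk. -/
def Face (α : Circle → S) (H : Finset S) : Type :=
  {V : Set ℂ // ∃ z ∈ cutDisk α H, V = connectedComponentIn (cutDisk α H) z}

/-- The part of the circle `S¹` on the boundary of the face. -/
def Face.arcs {α : Circle → S} {H : Finset S} (F : Face α H) : Set Circle :=
  {x | (x : ℂ) ∈ closure F.1}

/-- The two distinct faces `F, F'` are adjacent to `e_p`, where `p ∈ H`. -/
def Face.Joins {α : Circle → S} {H : Finset S} (p : S) (F F' : Face α H) : Prop :=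
  p ∈ H ∧ F ≠ F' ∧ chord α p ⊆ closure F.1 ∧ chord α p ⊆ closure F'.1

/-- `x, y, z` are distinct points of the circle in this counterclockwise order. -/
def CircleCcw (x y z : Circle) : Prop :=
  ∃ s t u : ℝ, Circle.exp s = x ∧ Circle.exp t = y ∧ Circle.exp u = z ∧
    s < t ∧ t < u ∧ u < s + 2 * Real.pi

/-- `T` is the dual tree of the splitting of the disk into `H`-faces. Its vertices correspond to
the `H`-faces and its edges to the elements of `H`; the root is the face with the base point on its
boundary; a face `F` is labeled with the loop obtained by applying `α` while moving along
`∂F ∩ S¹`; the edge `[p]` is labeled with `ε_p`. The tree is embedded in the disk with each vertex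
inside its face and `[p]` crossing `e_p`, so the edges at a face `F` have the cyclic order in which
the segments adjacent to `F`, hence their ends, follow along the boundary. -/
def PointedLoop.IsDualTree (α : PointedLoop S) (H : Finset S) (T : LoopTree S) : Prop :=
  ∃ F : T.V ≃ Face α.toFun H,
    (∀ v w, T.graph.Adj v w ↔ ∃ p, Face.Joins p (F v) (F w)) ∧
    α.base ∈ (F T.root).arcs ∧
    (∀ v, ∃ β : GenericLoop S, ⟦β⟧ = T.label v ∧ Traverses α.toFun (F v).arcs β.toFun) ∧
    (∀ v w p, Face.Joins p (F v) (F w) → T.sign s(v, w) = α.crossingSign p) ∧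
    ∀ v a b c, T.ccw v a b c ↔ ∃ x y z : Circle, CircleCcw x y z ∧ a ≠ b ∧ b ≠ c ∧ c ≠ a ∧
      Face.Joins (α.toFun x) (F v) (F a) ∧ Face.Joins (α.toFun y) (F v) (F b) ∧
      Face.Joins (α.toFun z) (F v) (F c)

/-- `τ` is the homeomorphism class of the rooted `Φ`-tree `T_H`. -/
def PointedLoop.IsCutTree (α : PointedLoop S) (H : Finset S) (τ : LoopTreeClass S) : Prop :=
  ∃ T : LoopTree S, ⟦T⟧ = τ ∧ α.IsDualTree H T

end Cuts

/-! ### The modules, the comultiplications and the map `η` -/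

section Main

variable (R : Type*) [CommRing R] (S : Type*) [TopologicalSpace S]
  [ChartedSpace (EuclideanHalfSpace 2) S]

/-- The free module on the isotopy classes of pointed loops. -/
abbrev LoopModule := PointedLoopClass S →₀ R

/-- The free module on the homeomorphism classes of rooted `Φ`-trees. -/
abbrev TreeModule := LoopTreeClass S →₀ R

variable {R S}

/-- `ρ(α, *) = ∑_p ε_p (α_{p₁,p₂}, p) ⊗ (α_{p₂,p₁}, *)` for all pointed loops. -/
def IsLoopComul (ρ : LoopModule R S →ₗ[R] LoopModule R S ⊗[R] LoopModule R S) : Prop :=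
  ∀ (α : PointedLoop S) (b c : S → PointedLoopClass S),
    (∀ p ∈ α.crossings, α.IsInner p (b p) ∧ α.IsOuter p (c p)) →
    ρ (Finsupp.single ⟦α⟧ 1) = ∑ p ∈ α.crossings,
      (α.crossingSign p : ℤ) • (Finsupp.single (b p) (1 : R) ⊗ₜ[R] Finsupp.single (c p) (1 : R))

/-- `ρ(T) = ∑_e T¹_e ⊗ T²_e` for all rooted `Φ`-trees, `e` running over the edges of `T`. -/
def IsTreeComul (ρ : TreeModule R S →ₗ[R] TreeModule R S ⊗[R] TreeModule R S) : Prop :=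
  ∀ T : LoopTree S, ρ (Finsupp.single ⟦T⟧ 1) = ∑ᶠ e : T.graph.edgeSet,
    Finsupp.single ⟦T.upper e⟧ (1 : R) ⊗ₜ[R] Finsupp.single ⟦T.lower e⟧ (1 : R)

/-- `η(α) = ∑_H ε_H T_H` for all pointed loops, `H` running over the cuts of `α` and `ε_H` being
the product of the signs `ε_p`, `p ∈ H`. -/
def IsEta (η : LoopModule R S →ₗ[R] TreeModule R S) : Prop :=
  ∀ (α : PointedLoop S) (τ : Finset S → LoopTreeClass S),
    (∀ H ∈ α.cuts, α.IsCutTree H (τ H)) →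
    η (Finsupp.single ⟦α⟧ 1) = ∑ H ∈ α.cuts,
      ((∏ p ∈ H, α.crossingSign p : ℤˣ) : ℤ) • Finsupp.single (τ H) (1 : R)

end Main

end

open scoped Manifold ContDiff TensorProduct

noncomputable section

set_option linter.unusedSectionVars false

/-! ### Collapse maps of the circle -/

/-! Everything is read on the circle. A crossing cuts off the arc between its two visits, counted
from the base point. Two crossings with disjoint chords are either nested (`Inside`) or independent
(mutually `Outside`), and a crossing linked with `p` survives in neither of the two loops cut out at
`p`. A loop that traverses a closed set of the circle is determined up to isotopy by this set and
its base point, because two collapse maps of one closed set differ by a reparametrization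
(`IsCollapse.exists_reparam`, `PointedLoop.mk_eq_of_traverses`). Cutting twice therefore amounts to
intersecting two sets, and iterated cuts are compared as sets.

Both iterated comultiplications are sums over pairs of crossings, or of edges in the case of trees.
Nested pairs contribute the same terms to `(ρ ⊗ id) ρ` and `(id ⊗ ρ) ρ` and cancel. The remaining
pairs are independent: two pieces are cut off the part that keeps the root or base point, the order
of the two cuts does not matter, and so the remainder is symmetric in the first two factors. This is
the content of `preLie_of_nested`.

For `η`, removing the edge `[p]` from `T_H` leaves the dual trees of the cuts formed by the
crossings of `H` inside and outside `p`, taken in the inner and the outer loop of `p`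
(`mk_upper_eq_cutTree`, `treeComul_cutTree`). Conversely a cut of the inner loop, a cut of the outer
loop and `p` form a cut of `α`. The pairs `(H, p)` thus correspond to triples, and the signs
multiply (`isComulHom_etaMap`).

Two points need care. The geometry of the disk is made combinatorial by one affine function for each
chord: a face is a pattern of signs (`mem_face_iff`), and adjacency, boundary arcs and root are
expressed by nesting. `CutSubLoop.isDualTree` then transfers dual trees to the inner loop, to the
outer loop and to isotopic loops.

Secondly, an isotopy is only continuous, so tangent vectors cannot be transported along it. The sign
of a crossing is recovered topologically: in a chart, the difference of the two branches over a
small circle of parameters is homotopic in `ℂ \ {0}` to the conjugation or to the identity of the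
circle, according to the sign. These are not homotopic to each other, and the homotopy class
survives isotopies and oriented changes of charts (`planeDet_pos_iff`). -/

lemma two_pi_pos : (0 : ℝ) < 2 * Real.pi := by positivity

lemma Circle.exp_add_int_mul (t : ℝ) (k : ℤ) :
    Circle.exp (t + k * (2 * Real.pi)) = Circle.exp t :=
  Circle.exp_eq_exp.2 ⟨k, rfl⟩

lemma Circle.exists_exp_eq_mem_Ico (a : ℝ) (z : Circle) :
    ∃ t ∈ Set.Ico a (a + 2 * Real.pi), Circle.exp t = z := by
  obtain ⟨t, rfl⟩ := Circle.exp_surjective z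
  obtain ⟨m, hm, -⟩ := existsUnique_add_zsmul_mem_Ico two_pi_pos t a
  refine ⟨_, hm, ?_⟩
  rw [zsmul_eq_mul, Circle.exp_add_int_mul]

lemma exists_int_shift_mem_Ico (a t : ℝ) :
    ∃ k : ℤ, t + k * (2 * Real.pi) ∈ Set.Ico a (a + 2 * Real.pi) := by
  obtain ⟨m, hm, -⟩ := existsUnique_add_zsmul_mem_Ico two_pi_pos t a
  exact ⟨m, by simpa only [zsmul_eq_mul] using hm⟩

lemma Circle.exp_injOn_half_open {a x y : ℝ} (hx : x ∈ Set.Ico a (a + 2 * Real.pi))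
    (hy : y ∈ Set.Ico a (a + 2 * Real.pi)) (h : Circle.exp x = Circle.exp y) : x = y :=
  Circle.exp_injOn_Ico (by linarith) hx hy h

lemma Circle.isQuotientMap_exp : Topology.IsQuotientMap Circle.exp :=
  isLocalHomeomorph_circleExp.isOpenMap.isQuotientMap Circle.exp.continuous Circle.exp_surjective

lemma deg_int {c : ℝ → ℝ} (hc : ∀ t, c (t + 2 * Real.pi) = c t + 2 * Real.pi) (t : ℝ) (k : ℤ) :
    c (t + k * (2 * Real.pi)) = c t + k * (2 * Real.pi) := by
  have hnat : ∀ n : ℕ, ∀ t, c (t + n * (2 * Real.pi)) = c t + n * (2 * Real.pi) := by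
    intro n
    induction n with
    | zero => simp
    | succ k ih =>
      intro t
      have : t + ((k + 1 : ℕ) : ℝ) * (2 * Real.pi)
          = (t + k * (2 * Real.pi)) + 2 * Real.pi := by push_cast; ring
      rw [this, hc, ih]; push_cast; ring
  obtain ⟨n, rfl | rfl⟩ := k.eq_nat_or_neg
  · exact_mod_cast hnat n t
  · have := hnat n (t + ((-(n : ℤ) : ℤ) : ℝ) * (2 * Real.pi))
    push_cast at this ⊢
    rw [show t + -(n : ℝ) * (2 * Real.pi) + n * (2 * Real.pi) = t by ring] at this
    linarith

lemma deg_surjective {c : ℝ → ℝ} (hcont : Continuous c)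
    (hc : ∀ t, c (t + 2 * Real.pi) = c t + 2 * Real.pi) : Function.Surjective c := by
  intro y
  obtain ⟨k, hk⟩ := exists_int_shift_mem_Ico (c 0) y
  rw [← zero_add (2 * Real.pi), add_comm (0 : ℝ), ← add_assoc, add_zero, ← hc] at hk
  obtain ⟨x, -, hx⟩ := intermediate_value_Icc (by linarith [two_pi_pos])
    hcont.continuousOn (Set.Ico_subset_Icc_self hk)
  refine ⟨x + (-k : ℤ) * (2 * Real.pi), ?_⟩
  rw [deg_int hc, hx]; push_cast; ring

/-- An increasing degree one bijection of the line covers a positive homeomorphism of the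
circle. -/
lemma exists_isPositive {k : ℝ → ℝ} (hk : StrictMono k) (hs : Function.Surjective k)
    (hd : ∀ t, k (t + 2 * Real.pi) = k t + 2 * Real.pi) :
    ∃ f : Circle ≃ₜ Circle, IsPositive f ∧ ∀ t, f (Circle.exp t) = Circle.exp (k t) := by
  -- A degree one map of the line descends to the circle, since another choice of the preimage under
  -- `Circle.exp` moves its value by a multiple of `2π`. This is applied to `k` and to its inverse.
  have key : ∀ k : ℝ → ℝ, Continuous k → (∀ t, k (t + 2 * Real.pi) = k t + 2 * Real.pi) →
      ∃ f : Circle → Circle, Continuous f ∧ ∀ t, f (Circle.exp t) = Circle.exp (k t) := by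
    intro k hk hd
    have : ∀ t, Circle.exp (k (Circle.exp_surjective (Circle.exp t)).choose)
        = Circle.exp (k t) := by
      intro t
      obtain ⟨m, hm⟩ := Circle.exp_eq_exp.1 (Circle.exp_surjective (Circle.exp t)).choose_spec
      rw [hm, deg_int hd, Circle.exp_add_int_mul]
    refine ⟨fun z => Circle.exp (k (Circle.exp_surjective z).choose), ?_, this⟩
    rw [Circle.isQuotientMap_exp.continuous_iff]
    exact (Circle.exp.continuous.comp hk).congr fun t => (this t).symm
  let E : ℝ ≃o ℝ := hk.orderIsoOfSurjective k hs
  have hE : ∀ t, E t = k t := fun t => rfl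
  obtain ⟨f, hf, hf'⟩ := key E E.continuous hd
  obtain ⟨g, hg, hg'⟩ := key E.symm E.symm.continuous (fun t => by
    apply E.injective; rw [hE (E.symm t + _), hd, ← hE]; simp)
  refine ⟨⟨⟨f, g, fun z => ?_, fun z => ?_⟩, hf, hg⟩, ⟨E, E.continuous, hk, hd, hf'⟩, hf'⟩
  · obtain ⟨t, rfl⟩ := Circle.exp_surjective z
    rw [hf', hg', E.symm_apply_apply]
  · obtain ⟨t, rfl⟩ := Circle.exp_surjective z
    rw [hg', hf', E.apply_symm_apply]

/-- `c` lifts the monotone degree one map of the circle that collapses the complementary arcs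
of `A`. -/
structure IsCollapse (A : Set Circle) (c : ℝ → ℝ) : Prop where
  cont : Continuous c
  mono : Monotone c
  deg : ∀ t, c (t + 2 * Real.pi) = c t + 2 * Real.pi
  fiber : ∀ s t, s < t → (c s = c t ↔ ∀ u ∈ Set.Ioo s t, Circle.exp u ∉ A)

lemma traverses_iff {S : Type*} {α : Circle → S} {A : Set Circle} {β : Circle → S} :
    Traverses α A β ↔ ∃ c, IsCollapse A c ∧
      ∀ t, Circle.exp t ∈ A → β (Circle.exp (c t)) = α (Circle.exp t) :=
  ⟨fun ⟨c, h1, h2, h3, h4, h5⟩ => ⟨c, ⟨h1, h2, h3, h4⟩, h5⟩,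
    fun ⟨c, ⟨h1, h2, h3, h4⟩, h5⟩ => ⟨c, h1, h2, h3, h4, h5⟩⟩

namespace IsCollapse

variable {A B D : Set Circle} {c c' : ℝ → ℝ}

lemma lt_of_mem (h : IsCollapse A c) {s t u : ℝ} (h1 : s < u) (h2 : u < t)
    (hu : Circle.exp u ∈ A) : c s < c t := by
  refine lt_of_le_of_ne (h.mono (h1.trans h2).le) fun he => ?_
  exact (h.fiber s t (h1.trans h2)).1 he u ⟨h1, h2⟩ hu

lemma exists_mem (h : IsCollapse A c) {s t : ℝ} (hst : c s < c t) :
    ∃ u ∈ Set.Ioo s t, Circle.exp u ∈ A := by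
  by_contra! hne
  have hlt : s < t := h.mono.reflect_lt hst
  exact hst.ne ((h.fiber s t hlt).2 hne)

/-- A closed set is mapped onto the circle by its collapse map. -/
lemma exists_eq (h : IsCollapse A c) (hA : IsClosed A) (y : ℝ) :
    ∃ t, Circle.exp t ∈ A ∧ c t = y := by
  obtain ⟨x, rfl⟩ := deg_surjective h.cont h.deg y
  have hbdd : BddAbove {t | c t ≤ c x} := by
    refine ⟨x + 2 * Real.pi, fun t ht => ?_⟩
    by_contra! hlt
    have h1 := h.mono hlt.le
    rw [h.deg] at h1
    have : c t ≤ c x := ht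
    linarith [two_pi_pos]
  have hne : {t | c t ≤ c x}.Nonempty := ⟨x, le_refl (c x)⟩
  have hcl : IsClosed {t | c t ≤ c x} := isClosed_le h.cont continuous_const
  -- The last point of the fibre: immediately to the right of it `c` increases, so points of `A`
  -- accumulate there, and `A` is closed.
  set t := sSup {t | c t ≤ c x} with ht
  have htmem : c t ≤ c x := hcl.csSup_mem hne hbdd
  have hxt : x ≤ t := le_csSup hbdd (le_refl (c x))
  refine ⟨t, ?_, le_antisymm htmem (h.mono hxt)⟩
  have hcl' : IsClosed {u | Circle.exp u ∈ A} := hA.preimage Circle.exp.continuous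
  refine hcl'.closure_subset (Metric.mem_closure_iff.2 fun ε hε => ?_)
  have hlt : c t < c (t + ε) := by
    by_contra! hle
    have : t + ε ≤ t := le_csSup hbdd (hle.trans htmem)
    linarith
  obtain ⟨u, hu, huA⟩ := h.exists_mem hlt
  refine ⟨u, huA, ?_⟩
  rw [Real.dist_eq, abs_lt]
  constructor <;> linarith [hu.1, hu.2]

lemma exists_exp_eq (h : IsCollapse A c) (hA : IsClosed A) (z : Circle) :
    ∃ t, Circle.exp t ∈ A ∧ Circle.exp (c t) = z := by
  obtain ⟨y, rfl⟩ := Circle.exp_surjective z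
  obtain ⟨t, ht, rfl⟩ := h.exists_eq hA y
  exact ⟨t, ht, rfl⟩

lemma univ : IsCollapse Set.univ id where
  cont := continuous_id
  mono := monotone_id
  deg _ := rfl
  fiber s t hst := by
    refine ⟨fun h => absurd h hst.ne, fun h => ?_⟩
    exact absurd (Set.mem_univ _) (h ((s + t) / 2) ⟨by linarith, by linarith⟩)

/-- Two collapse maps of the same closed set differ by a reparametrization. -/
lemma exists_reparam (h : IsCollapse A c) (h' : IsCollapse A c') (hA : IsClosed A) :
    ∃ f : Circle ≃ₜ Circle, IsPositive f ∧ ∀ t, f (Circle.exp (c' t)) = Circle.exp (c t) := by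
  -- The fibres of both maps are prescribed by `A` alone, so `c` factors through `c'`.
  have heq : ∀ s t, c' s = c' t → c s = c t := by
    intro s t hst
    rcases lt_trichotomy s t with hlt | rfl | hlt
    · exact (h.fiber s t hlt).2 ((h'.fiber s t hlt).1 hst)
    · rfl
    · exact ((h.fiber t s hlt).2 ((h'.fiber t s hlt).1 hst.symm)).symm
  choose r hr using fun y => h'.exists_eq hA y
  have hk : ∀ t, c (r (c' t)) = c t := fun t => heq _ _ (hr _).2
  have hmono : StrictMono fun y => c (r y) := by
    intro y z hyz
    have hyz' : c' (r y) < c' (r z) := by rwa [(hr y).2, (hr z).2]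
    obtain ⟨u, hu, huA⟩ := h'.exists_mem hyz'
    exact h.lt_of_mem hu.1 hu.2 huA
  have hsurj : Function.Surjective fun y => c (r y) := fun y => by
    obtain ⟨t, -, rfl⟩ := h.exists_eq hA y
    exact ⟨c' t, hk t⟩
  obtain ⟨f, hf, hf'⟩ := exists_isPositive hmono hsurj fun y => by
    obtain ⟨t, -, rfl⟩ := h'.exists_eq hA y
    show c (r (c' t + _)) = c (r (c' t)) + _
    rw [← h'.deg, hk, hk, h.deg]
  exact ⟨f, hf, fun t => by rw [hf', hk]⟩

/-- Collapse maps compose, provided that no gap of the first set is mapped to the frontier of the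
second one. -/
lemma comp (h : IsCollapse A c) (hA : IsClosed A) (h' : IsCollapse B c')
    (hB : ∀ s t, s < t → c s = c t → Circle.exp (c s) ∈ B → B ∈ nhds (Circle.exp (c s)))
    (hD : ∀ t, Circle.exp t ∈ D ↔ Circle.exp t ∈ A ∧ Circle.exp (c t) ∈ B) :
    IsCollapse D (c' ∘ c) where
  cont := h'.cont.comp h.cont
  mono := h'.mono.comp h.mono
  deg t := by simp [h.deg, h'.deg]
  fiber s t hst := by
    rcases (h.mono hst.le).eq_or_lt with he | hlt
    · refine ⟨fun _ u hu hD' => ?_, fun _ => congrArg c' he⟩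
      exact (h.fiber s t hst).1 he u hu ((hD u).1 hD').1
    -- A point of `D` in the open interval may be sent by `c` to one of the end values, about which
    -- the fibre condition of `c'` says nothing. Such an end value is the image of a gap and lies in
    -- `B`; as `B` is a neighbourhood of it, `B` also has points strictly between `c s` and `c t`.
    · have hnear : ∀ s t, s < t → c s = c t → Circle.exp (c s) ∈ B →
          {y | Circle.exp y ∈ B} ∈ nhds (c s) := fun s t h1 h2 h3 =>
        Circle.exp.continuous.continuousAt.preimage_mem_nhds (hB s t h1 h2 h3)
      refine (h'.fiber _ _ hlt).trans ⟨fun H u hu hD' => ?_, fun H y hy hB => ?_⟩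
      · obtain ⟨huA, huB⟩ := (hD u).1 hD'
        rcases (h.mono hu.1.le).eq_or_lt with h1 | h1
        · rw [← h1] at huB
          obtain ⟨y, hyB, hy⟩ := Filter.nonempty_of_mem (Filter.inter_mem
            (mem_nhdsWithin_of_mem_nhds (hnear s u hu.1 h1 huB)) (Ioo_mem_nhdsGT hlt))
          exact H y hy hyB
        · rcases (h.mono hu.2.le).eq_or_lt with h2 | h2
          · obtain ⟨y, hyB, hy⟩ := Filter.nonempty_of_mem (Filter.inter_mem
              (mem_nhdsWithin_of_mem_nhds (hnear u t hu.2 h2 huB)) (Ioo_mem_nhdsLT h1))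
            exact H y ⟨hy.1, hy.2.trans_le h2.le⟩ hyB
          · exact H _ ⟨h1, h2⟩ huB
      · obtain ⟨u, huA, rfl⟩ := h.exists_eq hA y
        refine H u ⟨h.mono.reflect_lt hy.1, h.mono.reflect_lt hy.2⟩ ((hD u).2 ⟨huA, hB⟩)

/-- An increasing degree one bijection of the line is a collapse map of the whole circle. -/
lemma of_strictMono (hc : Continuous c) (hm : StrictMono c)
    (hd : ∀ t, c (t + 2 * Real.pi) = c t + 2 * Real.pi) : IsCollapse Set.univ c where
  cont := hc
  mono := hm.monotone
  deg := hd
  fiber s t hst := by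
    refine ⟨fun h => absurd h (hm hst).ne, fun h => ?_⟩
    exact absurd (Set.mem_univ _) (h ((s + t) / 2) ⟨by linarith, by linarith⟩)

end IsCollapse

lemma isClosed_exp_image_Icc (t u : ℝ) : IsClosed (Circle.exp '' Set.Icc t u) :=
  (isCompact_Icc.image Circle.exp.continuous).isClosed

lemma isOpen_exp_image_Ioo (t u : ℝ) : IsOpen (Circle.exp '' Set.Ioo t u) :=
  isLocalHomeomorph_circleExp.isOpenMap _ isOpen_Ioo

/-- The collapse map of an arc that is affine on the arc. -/
lemma exists_isCollapse_arc {t u : ℝ} (htu : t < u) (hu : u < t + 2 * Real.pi) :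
    ∃ c, IsCollapse (Circle.exp '' Set.Icc t u) c ∧
      ∀ x ∈ Set.Icc t u, c x = (x - t) * (2 * Real.pi / (u - t)) := by
  have hpi := two_pi_pos
  set κ : ℝ := 2 * Real.pi / (u - t) with hκ
  have hκ0 : 0 < κ := div_pos hpi (by linarith)
  have hκu : (u - t) * κ = 2 * Real.pi := by rw [hκ]; field_simp [(sub_pos.2 htu).ne']
  -- on one period
  set g : ℝ → ℝ := fun r => min 1 (r * κ) with hg
  have hg0 : g 0 = 0 := by simp [hg]
  have hκ1 : 1 ≤ κ := by rw [hκ, one_le_div (by linarith)]; linarith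
  have hg1 : g 1 = 1 := by simp [hg, hκ1]
  have hgm : Monotone g := fun a b hab => min_le_min le_rfl (by gcongr)
  set y : ℝ → ℝ := fun x => (x - t) / (2 * Real.pi) with hy
  have hyc : Continuous y := by fun_prop
  set c : ℝ → ℝ := fun x => 2 * Real.pi * (⌊y x⌋ + g (Int.fract (y x))) with hc
  have hcy : ∀ x ∈ Set.Icc t (t + 2 * Real.pi), c x = 2 * Real.pi * g (y x) := by
    intro x hx
    rcases hx.2.eq_or_lt with rfl | hlt
    · have : y (t + 2 * Real.pi) = 1 := by simp only [hy]; field_simp; ring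
      simp [hc, this, hg0, hg1]
    · have h0 : 0 ≤ y x := div_nonneg (by linarith [hx.1]) hpi.le
      have h1 : y x < 1 := by simp only [hy]; rw [div_lt_one hpi]; linarith
      have hfl : ⌊y x⌋ = 0 := Int.floor_eq_zero_iff.2 ⟨h0, h1⟩
      have hfr : Int.fract (y x) = y x := Int.fract_eq_self.2 ⟨h0, h1⟩
      simp [hc, hfl, hfr]
  have hdeg : ∀ x, c (x + 2 * Real.pi) = c x + 2 * Real.pi := by
    intro x
    have : y (x + 2 * Real.pi) = y x + 1 := by simp only [hy]; field_simp; ring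
    simp only [hc, this, Int.floor_add_one, Int.fract_add_one]; push_cast; ring
  have hcont : Continuous c := by
    have h1 : Continuous fun x => g (Int.fract (y x)) - Int.fract (y x) :=
      ContinuousOn.comp_fract (f := fun _ r => g r - r)
        (by apply Continuous.continuousOn; fun_prop) hyc (by simp [hg0, hg1])
    have h2 : c = fun x => 2 * Real.pi * (y x + (g (Int.fract (y x)) - Int.fract (y x))) := by
      ext x
      simp only [hc]
      have := Int.floor_add_fract (y x)
      linear_combination (2 * Real.pi) * this
    rw [h2]; fun_prop
  have hmono : Monotone c := by
    intro a b hab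
    obtain ⟨k, hk⟩ := exists_int_shift_mem_Ico t a
    set a' := a + k * (2 * Real.pi)
    set b' := b + k * (2 * Real.pi)
    have hab' : a' ≤ b' := by simp only [a', b']; linarith
    suffices h : c a' ≤ c b' by
      simp only [a', b', deg_int hdeg] at h; linarith
    rcases le_or_gt b' (t + 2 * Real.pi) with hb | hb
    · rw [hcy a' ⟨hk.1, hk.2.le⟩, hcy b' ⟨hk.1.trans hab', hb⟩]
      have : y a' ≤ y b' := by simp only [hy]; gcongr
      have := hgm this
      gcongr
    · have h1 : c a' ≤ 2 * Real.pi := by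
        rw [hcy a' ⟨hk.1, hk.2.le⟩]
        have : g (y a') ≤ 1 := min_le_left _ _
        nlinarith
      have h2 : (1 : ℝ) ≤ ⌊y b'⌋ := by
        have : (1 : ℤ) ≤ ⌊y b'⌋ := by
          rw [Int.le_floor]; simp only [hy]; push_cast; rw [one_le_div hpi]; linarith
        exact_mod_cast this
      have h3 : 0 ≤ g (Int.fract (y b')) := by
        rw [← hg0]; exact hgm (Int.fract_nonneg _)
      have h4 : c b' = 2 * Real.pi * (⌊y b'⌋ + g (Int.fract (y b'))) := rfl
      rw [h4]
      nlinarith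
  have harc : ∀ x ∈ Set.Icc t u, c x = (x - t) * κ := by
    intro x hx
    rw [hcy x ⟨hx.1, by linarith [hx.2]⟩]
    have h1 : y x * κ ≤ 1 := by
      simp only [hy]
      rw [div_mul_eq_mul_div, div_le_one hpi, ← hκu]
      have := hx.2
      gcongr
    have h2 : g (y x) = y x * κ := min_eq_right h1
    rw [h2]; simp only [hy]; field_simp
  have hgap : ∀ x ∈ Set.Icc u (t + 2 * Real.pi), c x = 2 * Real.pi := by
    intro x hx
    have h1 : c u = 2 * Real.pi := by rw [harc u ⟨htu.le, le_rfl⟩, hκu]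
    have h2 : c (t + 2 * Real.pi) = 2 * Real.pi := by
      rw [hdeg, harc t ⟨le_rfl, htu.le⟩]; ring
    exact le_antisymm ((hmono hx.2).trans h2.le) (h1.symm.le.trans (hmono hx.1))
  have hnot : ∀ x ∈ Set.Ioo u (t + 2 * Real.pi),
      Circle.exp x ∉ Circle.exp '' Set.Icc t u := by
    rintro x hx ⟨v, hv, hvx⟩
    have := Circle.exp_injOn_half_open (a := t) ⟨hv.1, by linarith [hv.2]⟩
      ⟨by linarith [hx.1], hx.2⟩ hvx
    linarith [hv.2, hx.1]
  refine ⟨c, ⟨hcont, hmono, hdeg, fun a b hab => ?_⟩, harc⟩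
  -- Both sides of the fibre condition are invariant under a common translation by periods, so `a`
  -- may be moved to `[t, t + 2π)`. If it falls on the arc before `u`, then `c` grows at once; if it
  -- falls in the gap, the values agree exactly as long as `b` does not pass `t + 2π`.
  obtain ⟨k, hk⟩ := exists_int_shift_mem_Ico t a
  set a' := a + k * (2 * Real.pi) with ha'
  set b' := b + k * (2 * Real.pi) with hb'
  have hab' : a' < b' := by simp only [a', b']; linarith
  have e1 : c a = c b ↔ c a' = c b' := by
    simp only [a', b', deg_int hdeg]; exact (add_left_inj _).symm
  have e2 : (∀ x ∈ Set.Ioo a b, Circle.exp x ∉ Circle.exp '' Set.Icc t u) ↔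
      ∀ x ∈ Set.Ioo a' b', Circle.exp x ∉ Circle.exp '' Set.Icc t u := by
    constructor
    · intro H x hx
      have := H (x + (-k : ℤ) * (2 * Real.pi)) (by
        push_cast; constructor <;> linarith [hx.1, hx.2])
      rwa [Circle.exp_add_int_mul] at this
    · intro H x hx
      have := H (x + k * (2 * Real.pi)) (by constructor <;> linarith [hx.1, hx.2])
      rwa [Circle.exp_add_int_mul] at this
  rw [e1, e2]
  rcases lt_or_ge a' u with hau | hau
  · have hlt : c a' < c (min b' u) := by
      have hm : a' < min b' u := lt_min hab' hau
      rw [harc a' ⟨hk.1, hau.le⟩, harc _ ⟨hk.1.trans hm.le, min_le_right _ _⟩]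
      gcongr
    refine iff_of_false (hlt.trans_le (hmono (min_le_left _ _))).ne fun H => ?_
    have hm : a' < min b' u := lt_min hab' hau
    refine H ((a' + min b' u) / 2) ⟨by linarith, by linarith [min_le_left b' u]⟩
      ⟨_, ⟨by linarith [hk.1], by linarith [min_le_right b' u]⟩, rfl⟩
  · rcases le_or_gt b' (t + 2 * Real.pi) with hb | hb
    · refine iff_of_true ?_ fun x hx => hnot x ⟨by linarith [hx.1], by linarith [hx.2]⟩
      rw [hgap a' ⟨hau, hk.2.le⟩, hgap b' ⟨by linarith, hb⟩]
    · refine iff_of_false ?_ fun H => ?_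
      · have h1 := hgap a' ⟨hau, hk.2.le⟩
        set m := min b' (u + 2 * Real.pi)
        have hm : t + 2 * Real.pi < m := lt_min hb (by linarith)
        have hmu : m ≤ u + 2 * Real.pi := min_le_right _ _
        have h2 : c m = (m - 2 * Real.pi - t) * κ + 2 * Real.pi := by
          rw [← harc (m - 2 * Real.pi) ⟨by linarith, by linarith⟩, ← hdeg]; congr 1; ring
        have h3 : 0 < (m - 2 * Real.pi - t) * κ := mul_pos (by linarith) hκ0
        have h4 := hmono (min_le_left b' (u + 2 * Real.pi))
        exact (by linarith : c a' < c b').ne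
      · refine H (t + 2 * Real.pi) ⟨by linarith [hk.2], hb⟩ ⟨t, ⟨le_rfl, htu.le⟩, ?_⟩
        rw [Circle.exp_add_two_pi]

/-- Two loops traversing corresponding closed sets of corresponding loops correspond to each
other. -/
lemma exists_reparam_of_traverses {S : Type*} {α : Circle → S} {A : Set Circle}
    {β β' : Circle → S} (hA : IsClosed A) (g : S → S)
    (h : Traverses α A β) (h' : Traverses (g ∘ α) A β') :
    ∃ f : Circle ≃ₜ Circle, IsPositive f ∧ ∀ x, β' x = g (β (f x)) := by
  rw [traverses_iff] at h h'
  obtain ⟨c, hc, hβ⟩ := h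
  obtain ⟨c', hc', hβ'⟩ := h'
  obtain ⟨f, hf, hff⟩ := hc.exists_reparam hc' hA
  refine ⟨f, hf, fun x => ?_⟩
  obtain ⟨t, ht, rfl⟩ := hc'.exists_exp_eq hA x
  rw [hff, hβ' t ht, hβ t ht, Function.comp_apply]

/-! ### Isotopy of loops that traverse corresponding sets -/

section Classes

variable {S : Type*} [TopologicalSpace S] [ChartedSpace (EuclideanHalfSpace 2) S]

lemma GenericLoop.mk_eq_of_traverses {α : Circle → S} {A : Set Circle} (hA : IsClosed A)
    {g : S ≃ₜ S} (hg : IsIsotopyEnd g) {γ δ : GenericLoop S} (h : Traverses α A γ.toFun)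
    (h' : Traverses (g ∘ α) A δ.toFun) : (⟦γ⟧ : LoopClass S) = ⟦δ⟧ := by
  obtain ⟨f, hf, hff⟩ := exists_reparam_of_traverses hA g h h'
  exact Quotient.sound ⟨g, hg, f, hf, hff⟩

lemma PointedLoop.mk_eq_of_traverses {α : Circle → S} {A : Set Circle} (hA : IsClosed A)
    {g : S ≃ₜ S} (hg : IsIsotopyEnd g) {γ δ : PointedLoop S} (h : Traverses α A γ.toFun)
    (h' : Traverses (g ∘ α) A δ.toFun) (hb : δ.toFun δ.base = g (γ.toFun γ.base)) :
    (⟦γ⟧ : PointedLoopClass S) = ⟦δ⟧ := by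
  obtain ⟨f, hf, hff⟩ := exists_reparam_of_traverses hA g h h'
  refine Quotient.sound ⟨g, hg, f, hf, hff, ?_⟩
  -- The base point of `γ` is not a crossing, hence it is the only point of the circle over its
  -- image, and the reparametrization must match the base points.
  by_contra hne
  have h1 := hff δ.base
  rw [hb] at h1
  exact γ.base_not_crossing ⟨f δ.base, γ.base, hne, (g.injective h1).symm, rfl⟩

end Classes

/-! ### Continuous logarithms of quotients -/

/-- The quotient of `f` and `g` has a continuous logarithm. -/
def LogRel {X : Type*} [TopologicalSpace X] (f g : X → ℂ) : Prop :=
  ∃ L : X → ℂ, Continuous L ∧ ∀ x, f x = Complex.exp (L x) * g x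

namespace LogRel

variable {X : Type*} [TopologicalSpace X] {f g h w : X → ℂ}

lemma refl (f : X → ℂ) : LogRel f f := ⟨fun _ => 0, continuous_const, by simp⟩

lemma symm (H : LogRel f g) : LogRel g f := by
  obtain ⟨L, hL, h⟩ := H
  exact ⟨fun x => -L x, hL.neg, fun x => by
    rw [h, ← mul_assoc, ← Complex.exp_add, neg_add_cancel, Complex.exp_zero, one_mul]⟩

lemma trans (H : LogRel f g) (H' : LogRel g h) : LogRel f h := by
  obtain ⟨L, hL, h⟩ := H
  obtain ⟨L', hL', h'⟩ := H'
  exact ⟨fun x => L x + L' x, hL.add hL', fun x => by rw [h, h', Complex.exp_add, mul_assoc]⟩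

lemma of_slitPlane (hf : Continuous f) (hg : Continuous g) (h0 : ∀ x, g x ≠ 0)
    (H : ∀ x, f x / g x ∈ Complex.slitPlane) : LogRel f g := by
  refine ⟨fun x => Complex.log (f x / g x), (hf.div hg h0).clog H, fun x => ?_⟩
  rw [Complex.exp_log (Complex.slitPlane_ne_zero (H x)), div_mul_cancel₀ _ (h0 x)]

/-- A quotient equal to a real number `q ≤ 0` would make the combination with `s = -q / (1 - q)`
vanish. Hence the quotient stays in the slit plane, where the principal logarithm is continuous. -/
lemma of_segment (hf : Continuous f) (hg : Continuous g)
    (H : ∀ x, ∀ s ∈ Set.Icc (0 : ℝ) 1, ((1 - s : ℝ) : ℂ) * f x + (s : ℂ) * g x ≠ 0) :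
    LogRel f g := by
  have h0 : ∀ x, g x ≠ 0 := fun x => by simpa using H x 1 (by simp)
  refine of_slitPlane hf hg h0 fun x => ?_
  by_contra hn
  rw [Complex.mem_slitPlane_iff, not_or, not_lt, not_not] at hn
  set q := f x / g x with hq
  have hqr : q = (q.re : ℂ) := Complex.ext rfl (by simp [hn.2])
  have hfq : f x = (q.re : ℂ) * g x := by rw [← hqr, hq, div_mul_cancel₀ _ (h0 x)]
  have hpos : 0 < 1 - q.re := by linarith [hn.1]
  refine H x (-q.re / (1 - q.re)) ⟨div_nonneg (by linarith [hn.1]) hpos.le, ?_⟩ ?_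
  · rw [div_le_one hpos]; linarith
  · rw [hfq, ← mul_assoc, ← add_mul, ← Complex.ofReal_mul, ← Complex.ofReal_add]
    have : (1 - -q.re / (1 - q.re)) * q.re + -q.re / (1 - q.re) = 0 := by
      field_simp; ring
    rw [this, Complex.ofReal_zero, zero_mul]

/-- As in Rouché's theorem, the quotient stays in the unit disk about `1`, which lies in the slit
plane. -/
lemma of_norm_lt (hf : Continuous f) (hg : Continuous g) (H : ∀ x, ‖f x - g x‖ < ‖g x‖) :
    LogRel f g := by
  have h0 : ∀ x, g x ≠ 0 := fun x hx => by
    have := H x; rw [hx, norm_zero] at this; exact absurd this (norm_nonneg _).not_gt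
  refine of_slitPlane hf hg h0 fun x => ?_
  have h1 : f x / g x = 1 + (f x - g x) / g x := by field_simp [h0 x]; ring
  rw [h1]
  apply Complex.mem_slitPlane_of_norm_lt_one
  rw [norm_div, div_lt_one (norm_pos_iff.2 (h0 x))]
  exact H x

/-- Homotopic maps to `ℂ \ {0}` are related. -/
lemma of_homotopy [CompactSpace X] {Y : Type*} [TopologicalSpace Y] [PreconnectedSpace Y]
    {K : Y → X → ℂ} (hK : Continuous fun z : Y × X => K z.1 z.2) (h0 : ∀ y x, K y x ≠ 0)
    (a b : Y) : LogRel (K a) (K b) := by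
  have : Std.Symm fun a b : Y => LogRel (K a) (K b) := ⟨fun _ _ h => h.symm⟩
  have hc : ∀ y, Continuous (K y) := fun y => hK.comp (continuous_const.prodMk continuous_id)
  refine PreconnectedSpace.induction₂ (fun a b => LogRel (K a) (K b)) (fun a => ?_)
    ⟨fun _ _ _ h h' => h.trans h'⟩ a b
  -- By compactness of `X` the estimate needed for `of_norm_lt` holds at all points simultaneously
  -- when `b` is near `a`; connectedness of `Y` chains the local comparisons.
  have : ∀ᶠ b in nhds a, ∀ x ∈ (Set.univ : Set X), ‖K b x - K a x‖ < ‖K a x‖ := by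
    refine isCompact_univ.eventually_forall_of_forall_eventually fun x _ => ?_
    have h1 : Continuous fun z : Y × X => ‖K z.1 z.2 - K a z.2‖ :=
      (hK.sub ((hc a).comp continuous_snd)).norm
    have h2 : Continuous fun z : Y × X => ‖K a z.2‖ := ((hc a).comp continuous_snd).norm
    exact h1.continuousAt.eventually_lt h2.continuousAt (by simpa using h0 a x)
  filter_upwards [this] with b hb
  exact (of_norm_lt (hc b) (hc a) fun x => hb x trivial).symm

lemma const_mul {A : ℂ} (hA : A ≠ 0) (w : X → ℂ) : LogRel (fun x => A * w x) w :=
  ⟨fun _ => Complex.log A, continuous_const, fun x => by rw [Complex.exp_log hA]⟩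

end LogRel

/-- The coefficients of a real linear map of `ℂ` in terms of `z` and its conjugate. -/
lemma real_linear_eq (a b w : ℂ) : (w.re : ℂ) * a + (w.im : ℂ) * b =
    (a - Complex.I * b) / 2 * w + (a + Complex.I * b) / 2 * (starRingEnd ℂ) w := by
  apply Complex.ext <;> simp <;> ring

/-- A real linear map is `w ↦ A w + B w̄`, and its orientation is decided by which coefficient has
the larger norm; the identity translates the sign of the determinant into this comparison. -/
lemma normSq_coeff_sub (a b : ℂ) : ‖(a - Complex.I * b) / 2‖ ^ 2 - ‖(a + Complex.I * b) / 2‖ ^ 2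
    = a.re * b.im - a.im * b.re := by
  rw [← Complex.normSq_eq_norm_sq, ← Complex.normSq_eq_norm_sq]
  simp [Complex.normSq_apply]; ring

/-- Nondegeneracy means `‖A‖ ≠ ‖B‖`, and the reverse triangle inequality gives the constant `|‖A‖ -
‖B‖|`. The bound is used to absorb the errors of linear approximations. -/
lemma exists_linear_lower_bound {a b : ℂ} (hdet : a.re * b.im - a.im * b.re ≠ 0) :
    ∃ K > 0, ∀ w : ℂ, K * ‖w‖ ≤ ‖(w.re : ℂ) * a + (w.im : ℂ) * b‖ := by
  set A := (a - Complex.I * b) / 2 with hA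
  set B := (a + Complex.I * b) / 2 with hB
  have hAB : ‖A‖ ≠ ‖B‖ := by
    intro h
    have := normSq_coeff_sub a b
    rw [← hA, ← hB, h, sub_self] at this
    exact hdet this.symm
  refine ⟨|‖A‖ - ‖B‖|, abs_pos.2 (sub_ne_zero.2 hAB), fun w => ?_⟩
  rw [real_linear_eq, ← hA, ← hB]
  have h1 := abs_norm_sub_norm_le (A * w) (-(B * (starRingEnd ℂ) w))
  rwa [sub_neg_eq_add, norm_neg, norm_mul, norm_mul, Complex.norm_conj, ← sub_mul, abs_mul,
    abs_norm] at h1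

/-- Here `A` dominates, so the antiholomorphic term `B w̄` is a perturbation too small to reach
zero, and the factor `A` has a constant logarithm. -/
lemma LogRel.linear_pos {X : Type*} [TopologicalSpace X] {w : X → ℂ} (hw : Continuous w)
    (h0 : ∀ x, w x ≠ 0) {a b : ℂ} (hab : 0 < a.re * b.im - a.im * b.re) :
    LogRel (fun x => ((w x).re : ℂ) * a + ((w x).im : ℂ) * b) w := by
  set A := (a - Complex.I * b) / 2 with hA
  set B := (a + Complex.I * b) / 2 with hB
  have hlt : ‖B‖ < ‖A‖ := by
    have := normSq_coeff_sub a b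
    exact lt_of_pow_lt_pow_left₀ 2 (norm_nonneg _) (by linarith)
  have hA0 : A ≠ 0 := norm_pos_iff.1 ((norm_nonneg _).trans_lt hlt)
  refine LogRel.trans ?_ (LogRel.const_mul hA0 w)
  refine LogRel.of_norm_lt (by fun_prop) (by fun_prop) fun x => ?_
  rw [real_linear_eq, ← hA, ← hB, add_sub_cancel_left, norm_mul, norm_mul, Complex.norm_conj]
  exact mul_lt_mul_of_pos_right hlt (norm_pos_iff.2 (h0 x))

/-- Conjugating the argument replaces `b` by `-b`, which reverses the orientation and reduces the
claim to `LogRel.linear_pos`. -/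
lemma LogRel.linear_neg {X : Type*} [TopologicalSpace X] {w : X → ℂ} (hw : Continuous w)
    (h0 : ∀ x, w x ≠ 0) {a b : ℂ} (hab : a.re * b.im - a.im * b.re < 0) :
    LogRel (fun x => ((w x).re : ℂ) * a + ((w x).im : ℂ) * b)
      (fun x => (starRingEnd ℂ) (w x)) := by
  have := LogRel.linear_pos (w := fun x => (starRingEnd ℂ) (w x)) (by fun_prop)
    (fun x => by simpa using h0 x) (a := a) (b := -b) (by simp; linarith)
  refine LogRel.trans ?_ this
  convert LogRel.refl _ using 2 with x
  simp

/-- The identity of the circle and the conjugation are not homotopic in `ℂ \ {0}`. -/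
lemma not_logRel_conj :
    ¬ LogRel (fun z : Circle => (z : ℂ)) (fun z : Circle => (starRingEnd ℂ) (z : ℂ)) := by
  rintro ⟨L, hL, h⟩
  have h1 : ∀ t : ℝ, ∃ n : ℤ,
      L (Circle.exp t) = 2 * t * Complex.I + n * (2 * Real.pi * Complex.I) := by
    intro t
    have := h (Circle.exp t)
    simp only [Circle.coe_exp, ← Complex.exp_conj] at this
    have h2 : Complex.exp (L (Circle.exp t)) = Complex.exp (2 * t * Complex.I) := by
      rw [show (2 * t * Complex.I : ℂ) = t * Complex.I + t * Complex.I by ring, Complex.exp_add]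
      nth_rewrite 1 [this]
      rw [mul_assoc, ← Complex.exp_add]
      simp
    exact Complex.exp_eq_exp_iff_exists_int.1 h2
  -- Since `exp L = z / z̄ = z²`, the function `F` takes integer values. But `L` is single-valued on
  -- the circle, so `F` drops by `2` over one turn and passes through the value `F 0 - 1 / 2`, which
  -- is not an integer.
  set F : ℝ → ℝ := fun t => ((L (Circle.exp t)).im - 2 * t) / (2 * Real.pi) with hF
  have hFc : Continuous F := by
    have : Continuous fun t => L (Circle.exp t) := hL.comp Circle.exp.continuous
    fun_prop
  have hFi : ∀ t, ∃ n : ℤ, F t = n := fun t => by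
    obtain ⟨n, hn⟩ := h1 t
    refine ⟨n, ?_⟩
    simp only [hF, hn]
    simp
  have hd : F (2 * Real.pi) = F 0 - 2 := by
    simp only [hF, Circle.exp_two_pi, Circle.exp_zero]; field_simp; ring
  obtain ⟨n, hn⟩ := hFi 0
  obtain ⟨t, -, ht⟩ := intermediate_value_Icc' two_pi_pos.le hFc.continuousOn
    (show F 0 - 1 / 2 ∈ Set.Icc (F (2 * Real.pi)) (F 0) by rw [hd]; constructor <;> linarith)
  obtain ⟨m, hm⟩ := hFi t
  rw [hm, hn] at ht
  have h3 : (2 * (n - m) : ℤ) = 1 := by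
    have : (2 * ((n : ℝ) - m)) = 1 := by linarith
    exact_mod_cast this
  omega

/-- Comparison of the difference of two transversal curves with the linear model. -/
lemma eventually_logRel_curves {u₁ u₂ : ℝ → ℂ} {c : ℝ → ℝ} {a₁ a₂ : ℂ} {x₁ x₂ δ : ℝ}
    (hδ : 0 < δ) (hc : Continuous c)
    (hm₁ : StrictMonoOn c (Set.Ioo (x₁ - δ) (x₁ + δ)))
    (hm₂ : StrictMonoOn c (Set.Ioo (x₂ - δ) (x₂ + δ)))
    (h₁ : HasDerivAt u₁ a₁ (c x₁)) (h₂ : HasDerivAt u₂ a₂ (c x₂)) (h12 : u₁ (c x₁) = u₂ (c x₂))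
    (hc₁ : ∀ᶠ y in nhds (c x₁), ContinuousAt u₁ y)
    (hc₂ : ∀ᶠ y in nhds (c x₂), ContinuousAt u₂ y)
    (hdet : a₁.re * a₂.im - a₁.im * a₂.re ≠ 0) :
    ∀ᶠ ε in nhdsWithin (0 : ℝ) (Set.Ioi 0),
      LogRel (fun z : Circle => u₁ (c (x₁ + ε * (z : ℂ).re)) - u₂ (c (x₂ + ε * (z : ℂ).im)))
        (fun z => ((z : ℂ).re : ℂ) * a₁ + ((z : ℂ).im : ℂ) * (-a₂)) := by
  obtain ⟨K, hK0, hlow⟩ := exists_linear_lower_bound (a := a₁) (b := -a₂)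
    (by simp; intro h; exact hdet (by linarith))
  -- Each branch contributes a linearization error of at most `K / 4`, so that the total of `K / 2`
  -- stays below the lower bound `K` of the linear model.
  have hη : (0 : ℝ) < K / 4 := by positivity
  have e₁ := (hasDerivAt_iff_isLittleO.1 h₁).def hη
  have e₂ := (hasDerivAt_iff_isLittleO.1 h₂).def hη
  obtain ⟨r₁, hr₁, H₁⟩ := Metric.eventually_nhds_iff.1 (e₁.and hc₁)
  obtain ⟨r₂, hr₂, H₂⟩ := Metric.eventually_nhds_iff.1 (e₂.and hc₂)
  obtain ⟨s₁, hs₁, I₁⟩ := Metric.continuousAt_iff.1 (hc.continuousAt (x := x₁)) r₁ hr₁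
  obtain ⟨s₂, hs₂, I₂⟩ := Metric.continuousAt_iff.1 (hc.continuousAt (x := x₂)) r₂ hr₂
  filter_upwards [Ioo_mem_nhdsGT (show (0 : ℝ) < min δ (min s₁ s₂) from
    lt_min hδ (lt_min hs₁ hs₂))] with ε hε
  have hε0 : 0 < ε := hε.1
  have hεδ : ε < δ := hε.2.trans_le (min_le_left _ _)
  have hεs₁ : ε < s₁ := hε.2.trans_le ((min_le_right _ _).trans (min_le_left _ _))
  have hεs₂ : ε < s₂ := hε.2.trans_le ((min_le_right _ _).trans (min_le_right _ _))
  have hre : ∀ z : Circle, |ε * (z : ℂ).re| ≤ ε := fun z => by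
    rw [abs_mul, abs_of_pos hε0]
    have := (Complex.abs_re_le_norm (z : ℂ)).trans_eq (Circle.norm_coe z)
    nlinarith
  have him : ∀ z : Circle, |ε * (z : ℂ).im| ≤ ε := fun z => by
    rw [abs_mul, abs_of_pos hε0]
    have := (Complex.abs_im_le_norm (z : ℂ)).trans_eq (Circle.norm_coe z)
    nlinarith
  have J₁ : ∀ z : Circle, dist (c (x₁ + ε * (z : ℂ).re)) (c x₁) < r₁ := fun z => I₁ (by
    rw [Real.dist_eq, add_sub_cancel_left]; exact (hre z).trans_lt hεs₁)
  have J₂ : ∀ z : Circle, dist (c (x₂ + ε * (z : ℂ).im)) (c x₂) < r₂ := fun z => I₂ (by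
    rw [Real.dist_eq, add_sub_cancel_left]; exact (him z).trans_lt hεs₂)
  -- The reparametrization `c` need not be differentiable. The curves are therefore linearized in
  -- the displacements of `c`, collected in `w`, and `w` is compared with `z` by monotonicity alone.
  set w : Circle → ℂ := fun z =>
    ⟨c (x₁ + ε * (z : ℂ).re) - c x₁, c (x₂ + ε * (z : ℂ).im) - c x₂⟩ with hw
  have sgn : ∀ x r, |r| ≤ ε → StrictMonoOn c (Set.Ioo (x - δ) (x + δ)) →
      (0 < r → 0 < c (x + r) - c x) ∧ (r < 0 → c (x + r) - c x < 0) := by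
    intro x r hr hm
    have hx : x ∈ Set.Ioo (x - δ) (x + δ) := ⟨by linarith, by linarith⟩
    have := abs_le.1 hr
    have hxr : x + r ∈ Set.Ioo (x - δ) (x + δ) := ⟨by linarith, by linarith⟩
    exact ⟨fun h => sub_pos.2 (hm hx hxr (by linarith)),
      fun h => sub_neg.2 (hm hxr hx (by linarith))⟩
  have hwc : Continuous w := by
    have : w = fun z : Circle => ((c (x₁ + ε * (z : ℂ).re) - c x₁ : ℝ) : ℂ)
        + ((c (x₂ + ε * (z : ℂ).im) - c x₂ : ℝ) : ℂ) * Complex.I := by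
      ext z; exact (Complex.mk_eq_add_mul_I _ _)
    rw [this]
    fun_prop
  -- Each nonzero coordinate of `z` has the same sign as the corresponding coordinate of `w z`, so
  -- the segment between them avoids the origin.
  have hseg : ∀ z : Circle, ∀ s ∈ Set.Icc (0 : ℝ) 1,
      ((1 - s : ℝ) : ℂ) * w z + (s : ℂ) * (z : ℂ) ≠ 0 := by
    intro z s hs h0
    have hz : (z : ℂ).re ≠ 0 ∨ (z : ℂ).im ≠ 0 := by
      by_contra! hne
      exact z.coe_ne_zero (Complex.ext hne.1 hne.2)
    have key : ∀ a r : ℝ, r ≠ 0 → (0 < ε * r → 0 < a) ∧ (ε * r < 0 → a < 0) →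
        (1 - s) * a + s * r ≠ 0 := by
      intro a r hr h h0
      have hs1 : 0 ≤ 1 - s := by linarith [hs.2]
      rcases hr.lt_or_gt with hr | hr
      · have ha := h.2 (mul_neg_of_pos_of_neg hε0 hr)
        rcases hs.1.eq_or_lt with rfl | hs0
        · linarith
        · nlinarith [mul_pos_of_neg_of_neg hr (neg_lt_zero.2 hs0), mul_nonneg hs1 (neg_pos.2 ha).le]
      · have ha := h.1 (mul_pos hε0 hr)
        rcases hs.1.eq_or_lt with rfl | hs0
        · linarith
        · nlinarith [mul_pos hr hs0, mul_nonneg hs1 ha.le]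
    have h1 := congrArg Complex.re h0
    have h2 := congrArg Complex.im h0
    simp [hw] at h1 h2
    rcases hz with hz | hz
    · exact key _ _ hz (sgn x₁ _ (hre z) hm₁) h1
    · exact key _ _ hz (sgn x₂ _ (him z) hm₂) h2
  have hw0 : ∀ z, w z ≠ 0 := fun z => by simpa using hseg z 0 (by simp)
  have step₁ : LogRel (fun z : Circle => u₁ (c (x₁ + ε * (z : ℂ).re)) -
      u₂ (c (x₂ + ε * (z : ℂ).im))) (fun z => ((w z).re : ℂ) * a₁ + ((w z).im : ℂ) * (-a₂)) := by
    refine LogRel.of_norm_lt ?_ (by fun_prop) fun z => ?_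
    · rw [continuous_iff_continuousAt]
      intro z
      have k₁ : ContinuousAt (fun z : Circle => c (x₁ + ε * (z : ℂ).re)) z :=
        Continuous.continuousAt (by fun_prop)
      have k₂ : ContinuousAt (fun z : Circle => c (x₂ + ε * (z : ℂ).im)) z :=
        Continuous.continuousAt (by fun_prop)
      exact (ContinuousAt.comp (f := fun z : Circle => c (x₁ + ε * (z : ℂ).re))
        (H₁ (J₁ z)).2 k₁).sub (ContinuousAt.comp
          (f := fun z : Circle => c (x₂ + ε * (z : ℂ).im)) (H₂ (J₂ z)).2 k₂)
    · have n₁ := (H₁ (J₁ z)).1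
      have n₂ := (H₂ (J₂ z)).1
      have q₁ : ‖c (x₁ + ε * (z : ℂ).re) - c x₁‖ ≤ ‖w z‖ := Complex.abs_re_le_norm (w z)
      have q₂ : ‖c (x₂ + ε * (z : ℂ).im) - c x₂‖ ≤ ‖w z‖ := Complex.abs_im_le_norm (w z)
      have hwz : 0 < ‖w z‖ := norm_pos_iff.2 (hw0 z)
      have hl := hlow (w z)
      refine lt_of_le_of_lt (b := (K / 4) * ‖w z‖ + (K / 4) * ‖w z‖) ?_
        (lt_of_lt_of_le (b := K * ‖w z‖) ?_ hl)
      · have : u₁ (c (x₁ + ε * (z : ℂ).re)) - u₂ (c (x₂ + ε * (z : ℂ).im)) -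
            (((w z).re : ℂ) * a₁ + ((w z).im : ℂ) * (-a₂)) =
            (u₁ (c (x₁ + ε * (z : ℂ).re)) - u₁ (c x₁) - (c (x₁ + ε * (z : ℂ).re) - c x₁) • a₁) -
            (u₂ (c (x₂ + ε * (z : ℂ).im)) - u₂ (c x₂) - (c (x₂ + ε * (z : ℂ).im) - c x₂) • a₂) := by
          simp only [hw, h12, Complex.real_smul]; ring
        rw [this]
        refine (norm_sub_le _ _).trans (add_le_add (n₁.trans ?_) (n₂.trans ?_))
        · gcongr
        · gcongr
      · nlinarith
  have step₂ : LogRel (fun z => ((w z).re : ℂ) * a₁ + ((w z).im : ℂ) * (-a₂))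
      (fun z : Circle => ((z : ℂ).re : ℂ) * a₁ + ((z : ℂ).im : ℂ) * (-a₂)) := by
    refine LogRel.of_segment (by fun_prop) (by fun_prop) fun z s hs h0 => hseg z s hs ?_
    have hl := hlow (((1 - s : ℝ) : ℂ) * w z + (s : ℂ) * (z : ℂ))
    have : ((((1 - s : ℝ) : ℂ) * w z + (s : ℂ) * (z : ℂ)).re : ℂ) * a₁ +
        ((((1 - s : ℝ) : ℂ) * w z + (s : ℂ) * (z : ℂ)).im : ℂ) * (-a₂) = 0 := by
      rw [← h0]; simp; ring
    rw [this, norm_zero] at hl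
    have : ‖((1 - s : ℝ) : ℂ) * w z + (s : ℂ) * (z : ℂ)‖ ≤ 0 := by
      by_contra! hlt
      exact absurd hl (mul_pos hK0 hlt).not_ge
    exact norm_le_zero_iff.1 this
  exact step₁.trans step₂

/-- The plane as the complex line. -/
def toC : EuclideanSpace ℝ (Fin 2) ≃ₗᵢ[ℝ] ℂ := Complex.orthonormalBasisOneI.repr.symm

lemma toC_re (v : EuclideanSpace ℝ (Fin 2)) : (toC v).re = v 0 := by
  simp [toC, Complex.orthonormalBasisOneI_repr_symm_apply]

lemma toC_im (v : EuclideanSpace ℝ (Fin 2)) : (toC v).im = v 1 := by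
  simp [toC, Complex.orthonormalBasisOneI_repr_symm_apply]

lemma planeDet_eq (v w : EuclideanSpace ℝ (Fin 2)) :
    planeDet v w = (toC v).re * (toC w).im - (toC v).im * (toC w).re := by
  simp only [planeDet, toC_re, toC_im]

lemma exists_toC_linear (M : EuclideanSpace ℝ (Fin 2) →L[ℝ] EuclideanSpace ℝ (Fin 2)) :
    ∃ a b : ℂ, a.re * b.im - a.im * b.re = M.det ∧
      ∀ v, toC (M v) = ((toC v).re : ℂ) * a + ((toC v).im : ℂ) * b := by
  refine ⟨toC (M (EuclideanSpace.basisFun (Fin 2) ℝ 0)),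
    toC (M (EuclideanSpace.basisFun (Fin 2) ℝ 1)), ?_, fun v => ?_⟩
  · have : M.det = LinearMap.det M.toLinearMap := rfl
    rw [this, ← LinearMap.det_toMatrix (EuclideanSpace.basisFun (Fin 2) ℝ).toBasis,
      Matrix.det_fin_two]
    simp only [LinearMap.toMatrix_apply, toC_re, toC_im, OrthonormalBasis.coe_toBasis_repr_apply,
      EuclideanSpace.basisFun_repr, OrthonormalBasis.coe_toBasis]
    simp; ring
  · have h := (EuclideanSpace.basisFun (Fin 2) ℝ).sum_repr v
    rw [Fin.sum_univ_two] at h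
    simp only [EuclideanSpace.basisFun_repr] at h
    nth_rewrite 1 [← h]
    rw [map_add, map_smul, map_smul, map_add, map_smul, map_smul, toC_re, toC_im,
      Complex.real_smul, Complex.real_smul]

/-! ### Invariance of the sign of a crossing under continuous isotopies -/

section Sign

variable {S : Type*} [TopologicalSpace S] [ChartedSpace (EuclideanHalfSpace 2) S]

/-- The difference of two points of the surface in a chart. -/
def chartDiff (e : OpenPartialHomeomorph S (EuclideanHalfSpace 2)) (x y : S) : ℂ :=
  toC (e.extend (𝓡∂ 2) x) - toC (e.extend (𝓡∂ 2) y)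

lemma chartDiff_ne_zero {e : OpenPartialHomeomorph S (EuclideanHalfSpace 2)} {x y : S}
    (hx : x ∈ e.source) (hy : y ∈ e.source) (hxy : x ≠ y) : chartDiff e x y ≠ 0 := by
  intro h
  have := toC.injective (sub_eq_zero.1 h)
  exact hxy ((e.extend (𝓡∂ 2)).injOn (by simpa using hx) (by simpa using hy) this)

lemma continuous_toC_extend {e : OpenPartialHomeomorph S (EuclideanHalfSpace 2)}
    {X : Type*} [TopologicalSpace X] {a : X → S} (ha : Continuous a) (h : ∀ x, a x ∈ e.source) :
    Continuous fun x => toC (e.extend (𝓡∂ 2) (a x)) := by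
  refine toC.continuous.comp (continuous_iff_continuousAt.2 fun x => ?_)
  exact (e.continuousAt_extend (h x)).comp ha.continuousAt

/-- Oriented changes of charts preserve differences of nearby points up to homotopy. -/
lemma exists_nhds_logRel_chartDiff [IsManifold (𝓡∂ 2) ∞ S] (hS : IsOrientedAtlas S)
    {e e' : OpenPartialHomeomorph S (EuclideanHalfSpace 2)}
    (he : e ∈ atlas (EuclideanHalfSpace 2) S) (he' : e' ∈ atlas (EuclideanHalfSpace 2) S) {q : S}
    (hq : q ∈ e.source) (hq' : q ∈ e'.source) :
    ∃ U ∈ nhds q, ∀ a b : Circle → S, Continuous a → Continuous b → (∀ x, a x ∈ U) →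
      (∀ x, b x ∈ U) → (∀ x, a x ≠ b x) →
      LogRel (fun x => chartDiff e (a x) (b x)) (fun x => chartDiff e' (a x) (b x)) := by
  set I := 𝓡∂ 2
  set G := e'.extend I ∘ (e.extend I).symm with hG
  set y₀ := e.extend I q with hy₀
  have hdet : 0 < (fderivWithin ℝ G (Set.range I) y₀).det := hS e he e' he' q ⟨hq, hq'⟩
  set M := fderivWithin ℝ G (Set.range I) y₀ with hM
  obtain ⟨a, b, hab, hMab⟩ := exists_toC_linear M
  rw [← hab] at hdet
  obtain ⟨K, hK0, hK⟩ := exists_linear_lower_bound hdet.ne'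
  have hy₀r : y₀ ∈ Set.range I := ⟨e q, rfl⟩
  have hsm : ContDiffWithinAt ℝ ∞ G (Set.range I) y₀ :=
    I.contDiffWithinAt_extendCoordChange' (IsManifold.subset_maximalAtlas he)
      (IsManifold.subset_maximalAtlas he') hq hq'
  have hdiff : ∀ᶠ y in nhdsWithin y₀ (Set.range I), DifferentiableWithinAt ℝ G (Set.range I) y := by
    filter_upwards [I.extendCoordChange_source_mem_nhdsWithin' hq hq'] with y hy
    exact (I.contDiffWithinAt_extendCoordChange (n := ∞) (IsManifold.subset_maximalAtlas he)
      (IsManifold.subset_maximalAtlas he') hy).differentiableWithinAt (by simp)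
  have hcont : ContinuousWithinAt (fderivWithin ℝ G (Set.range I)) (Set.range I) y₀ :=
    (hsm.fderivWithin_right (m := 0) I.uniqueDiffOn (by simp) hy₀r).continuousWithinAt
  have hnear : ∀ᶠ y in nhdsWithin y₀ (Set.range I),
      ‖fderivWithin ℝ G (Set.range I) y - M‖ ≤ K / 2 := by
    have := (tendsto_iff_norm_sub_tendsto_zero.1 hcont).eventually (Iio_mem_nhds (half_pos hK0))
    exact this.mono fun y hy => le_of_lt hy
  obtain ⟨r, hr, hrs⟩ := Metric.mem_nhdsWithin_iff.1 (hdiff.and hnear)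
  set s := Metric.ball y₀ r ∩ Set.range I with hs
  have hconv : Convex ℝ s := (convex_ball y₀ r).inter I.convex_range
  -- The mean value inequality on a convex piece of the half-plane: on differences of nearby points
  -- the coordinate change deviates from its derivative at `q` by less than the lower bound `K` of
  -- that derivative.
  have hest : ∀ x ∈ s, ∀ y ∈ s, ‖G x - G y - M (x - y)‖ ≤ K / 2 * ‖x - y‖ := fun x hx y hy =>
    hconv.norm_image_sub_le_of_norm_hasFDerivWithin_le'
      (fun z hz => ((hrs hz).1.hasFDerivWithinAt).mono Set.inter_subset_right)
      (fun z hz => (hrs hz).2) hy hx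
  refine ⟨e.source ∩ e'.source ∩ (e.extend I) ⁻¹' Metric.ball y₀ r, ?_, ?_⟩
  · refine Filter.inter_mem (Filter.inter_mem (e.open_source.mem_nhds hq)
      (e'.open_source.mem_nhds hq')) ?_
    exact (e.continuousAt_extend hq).preimage_mem_nhds (Metric.ball_mem_nhds _ hr)
  · intro p p' hp hp' hpU hpU' hne
    have ha : Continuous fun x => chartDiff e (p x) (p' x) :=
      (continuous_toC_extend hp fun x => (hpU x).1.1).sub
        (continuous_toC_extend hp' fun x => (hpU' x).1.1)
    have hb : Continuous fun x => chartDiff e' (p x) (p' x) :=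
      (continuous_toC_extend hp fun x => (hpU x).1.2).sub
        (continuous_toC_extend hp' fun x => (hpU' x).1.2)
    have h0 : ∀ x, chartDiff e (p x) (p' x) ≠ 0 := fun x =>
      chartDiff_ne_zero (hpU x).1.1 (hpU' x).1.1 (hne x)
    refine LogRel.symm (LogRel.trans ?_ (LogRel.linear_pos ha h0 hdet))
    refine LogRel.of_norm_lt hb
      (((Complex.continuous_ofReal.comp (Complex.continuous_re.comp ha)).mul continuous_const).add
        ((Complex.continuous_ofReal.comp (Complex.continuous_im.comp ha)).mul continuous_const))
          fun x => ?_
    have hGe : ∀ z ∈ e.source, G (e.extend I z) = e'.extend I z := fun z hz => by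
      simp only [hG, Function.comp_apply, e.extend_left_inv hz]
    have h1 := hest (e.extend I (p x)) ⟨(hpU x).2, ⟨e (p x), rfl⟩⟩ (e.extend I (p' x))
      ⟨(hpU' x).2, ⟨e (p' x), rfl⟩⟩
    rw [hGe _ (hpU x).1.1, hGe _ (hpU' x).1.1] at h1
    have h2 : chartDiff e (p x) (p' x) = toC (e.extend I (p x) - e.extend I (p' x)) :=
      (map_sub toC _ _).symm
    have h3 : chartDiff e' (p x) (p' x) = toC (e'.extend I (p x) - e'.extend I (p' x)) :=
      (map_sub toC _ _).symm
    have hpos := norm_pos_iff.2 (h0 x)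
    have hKx := hK (chartDiff e (p x) (p' x))
    rw [h2] at hpos hKx ⊢
    rw [h3, ← hMab, ← map_sub, LinearIsometryEquiv.norm_map, LinearIsometryEquiv.norm_map]
    rw [← hMab, LinearIsometryEquiv.norm_map, LinearIsometryEquiv.norm_map] at hKx
    rw [LinearIsometryEquiv.norm_map] at hpos
    refine h1.trans_lt (lt_of_lt_of_le ?_ hKx)
    nlinarith

/-- Along an ambient isotopy, the difference of two curves that cross keeps its homotopy class. -/
lemma eventually_logRel_isotopy [IsManifold (𝓡∂ 2) ∞ S] (hS : IsOrientedAtlas S)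
    {h : ℝ → S ≃ₜ S} (hh : Continuous fun z : ℝ × S => h z.1 z.2) {γ : ℝ → S} (hγ : Continuous γ)
    {x₁ x₂ : ℝ} (hx : γ x₁ = γ x₂)
    (hne : ∀ᶠ ε in nhdsWithin (0 : ℝ) (Set.Ioi 0), ∀ z : Circle,
      γ (x₁ + ε * (z : ℂ).re) ≠ γ (x₂ + ε * (z : ℂ).im)) (τ τ' : ℝ)
    (e e' : OpenPartialHomeomorph S (EuclideanHalfSpace 2))
    (he : e ∈ atlas (EuclideanHalfSpace 2) S) (he' : e' ∈ atlas (EuclideanHalfSpace 2) S)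
    (hq : h τ (γ x₁) ∈ e.source) (hq' : h τ' (γ x₁) ∈ e'.source) :
    ∀ᶠ ε in nhdsWithin (0 : ℝ) (Set.Ioi 0), LogRel
      (fun z : Circle => chartDiff e (h τ (γ (x₁ + ε * (z : ℂ).re)))
        (h τ (γ (x₂ + ε * (z : ℂ).im))))
      (fun z : Circle => chartDiff e' (h τ' (γ (x₁ + ε * (z : ℂ).re)))
        (h τ' (γ (x₂ + ε * (z : ℂ).im)))) := by
  set I := 𝓡∂ 2
  -- The relation `P` is symmetric and transitive, so on the connected line of times it has to be
  -- verified only for nearby times. It ranges over all charts around the moving crossing, which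
  -- makes transitivity possible.
  set P : ℝ → ℝ → Prop := fun τ τ' =>
    ∀ (e e' : OpenPartialHomeomorph S (EuclideanHalfSpace 2)),
    e ∈ atlas (EuclideanHalfSpace 2) S → e' ∈ atlas (EuclideanHalfSpace 2) S →
    h τ (γ x₁) ∈ e.source → h τ' (γ x₁) ∈ e'.source →
    ∀ᶠ ε in nhdsWithin (0 : ℝ) (Set.Ioi 0), LogRel
      (fun z : Circle => chartDiff e (h τ (γ (x₁ + ε * (z : ℂ).re)))
        (h τ (γ (x₂ + ε * (z : ℂ).im))))
      (fun z : Circle => chartDiff e' (h τ' (γ (x₁ + ε * (z : ℂ).re)))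
        (h τ' (γ (x₂ + ε * (z : ℂ).im)))) with hP
  suffices H : P τ τ' from H e e' he he' hq hq'
  have hsymm : Std.Symm P := ⟨fun a b H e e' he he' hq hq' =>
    (H e' e he' he hq' hq).mono fun _ h => h.symm⟩
  have htrans : IsTrans ℝ P := ⟨fun a b c H H' e e' he he' hq hq' => by
    filter_upwards [H e (chartAt _ (h b (γ x₁))) he (chart_mem_atlas _ _) hq
      (mem_chart_source _ _), H' (chartAt _ (h b (γ x₁))) e' (chart_mem_atlas _ _) he'
      (mem_chart_source _ _) hq'] with ε h1 h2 using h1.trans h2⟩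
  have hre : ∀ (ε : ℝ) (z : Circle), 0 ≤ ε → |ε * (z : ℂ).re| ≤ ε := fun ε z h0 => by
    rw [abs_mul, abs_of_nonneg h0]
    have := (Complex.abs_re_le_norm (z : ℂ)).trans_eq (Circle.norm_coe z)
    nlinarith
  have him : ∀ (ε : ℝ) (z : Circle), 0 ≤ ε → |ε * (z : ℂ).im| ≤ ε := fun ε z h0 => by
    rw [abs_mul, abs_of_nonneg h0]
    have := (Complex.abs_im_le_norm (z : ℂ)).trans_eq (Circle.norm_coe z)
    nlinarith
  have hcon₁ : ∀ τ ε, Continuous fun z : Circle => h τ (γ (x₁ + ε * (z : ℂ).re)) := fun τ ε => by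
    have : Continuous fun z : Circle => γ (x₁ + ε * (z : ℂ).re) := by fun_prop
    exact (h τ).continuous.comp this
  have hcon₂ : ∀ τ ε, Continuous fun z : Circle => h τ (γ (x₂ + ε * (z : ℂ).im)) := fun τ ε => by
    have : Continuous fun z : Circle => γ (x₂ + ε * (z : ℂ).im) := by fun_prop
    exact (h τ).continuous.comp this
  -- smallness in space and time
  have hsmall : ∀ τ, ∀ U ∈ nhds (h τ (γ x₁)), ∃ δ > 0, ∀ τ', |τ' - τ| < δ → ∀ ε, 0 ≤ ε → ε < δ →
      ∀ z : Circle, h τ' (γ (x₁ + ε * (z : ℂ).re)) ∈ U ∧ h τ' (γ (x₂ + ε * (z : ℂ).im)) ∈ U := by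
    intro τ U hU
    have hc : Continuous fun w : ℝ × ℝ => h w.1 (γ w.2) :=
      hh.comp (continuous_fst.prodMk (hγ.comp continuous_snd))
    obtain ⟨δ₁, hδ₁, H₁⟩ := Metric.mem_nhds_iff.1
      ((hc.continuousAt (x := (τ, x₁))).preimage_mem_nhds hU)
    obtain ⟨δ₂, hδ₂, H₂⟩ := Metric.mem_nhds_iff.1
      ((hc.continuousAt (x := (τ, x₂))).preimage_mem_nhds (by simpa [← hx] using hU))
    refine ⟨min δ₁ δ₂, lt_min hδ₁ hδ₂, fun τ' hτ' ε h0 hε z => ⟨?_, ?_⟩⟩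
    · refine H₁ (show (τ', x₁ + ε * (z : ℂ).re) ∈ _ from ?_)
      rw [Metric.mem_ball, Prod.dist_eq, max_lt_iff]
      refine ⟨hτ'.trans_le (min_le_left _ _), ?_⟩
      rw [Real.dist_eq, add_sub_cancel_left]
      exact (hre ε z h0).trans_lt (hε.trans_le (min_le_left _ _))
    · refine H₂ (show (τ', x₂ + ε * (z : ℂ).im) ∈ _ from ?_)
      rw [Metric.mem_ball, Prod.dist_eq, max_lt_iff]
      refine ⟨hτ'.trans_le (min_le_right _ _), ?_⟩
      rw [Real.dist_eq, add_sub_cancel_left]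
      exact (him ε z h0).trans_lt (hε.trans_le (min_le_right _ _))
  have hfix : ∀ τ, P τ τ := by
    intro τ e e' he he' hq hq'
    obtain ⟨U, hU, HU⟩ := exists_nhds_logRel_chartDiff hS he he' hq hq'
    obtain ⟨δ, hδ, hδU⟩ := hsmall τ U hU
    filter_upwards [hne, Ioo_mem_nhdsGT hδ] with ε h1 h2
    have := hδU τ (by simpa using hδ) ε h2.1.le h2.2
    exact HU _ _ (hcon₁ τ ε) (hcon₂ τ ε) (fun z => (this z).1) (fun z => (this z).2)
      fun z hz => h1 z ((h τ).injective hz)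
  -- For times near `a` the two short branches stay in the single chart `e₀`. There the change of
  -- time is a homotopy without zeros, because every `h y` is injective.
  refine PreconnectedSpace.induction₂ P (fun a => ?_) htrans τ τ'
  set e₀ := chartAt (EuclideanHalfSpace 2) (h a (γ x₁))
  obtain ⟨δ, hδ, hδU⟩ := hsmall a e₀.source (e₀.open_source.mem_nhds (mem_chart_source _ _))
  have hN : ∀ᶠ b in nhds a, |b - a| < δ := by
    exact (Metric.ball_mem_nhds a hδ : ∀ᶠ b in nhds a, dist b a < δ)
  filter_upwards [hN] with b hb e e' he he' hq hq'
  have hb₀ : h b (γ x₁) ∈ e₀.source := by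
    simpa using (hδU b hb 0 le_rfl hδ 1).1
  filter_upwards [hfix a e e₀ he (chart_mem_atlas _ _) hq (mem_chart_source _ _),
    hfix b e₀ e' (chart_mem_atlas _ _) he' hb₀ hq', hne, Ioo_mem_nhdsGT hδ] with ε k1 k2 k3 k4
  refine k1.trans (LogRel.trans ?_ k2)
  have : PreconnectedSpace (Metric.ball a δ) :=
    Subtype.preconnectedSpace (convex_ball a δ).isPreconnected
  have hin : ∀ y : Metric.ball a δ, ∀ z : Circle, _ := fun y z =>
    hδU y.1 (Metric.mem_ball.1 y.2) ε k4.1.le k4.2 z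
  exact LogRel.of_homotopy (Y := Metric.ball a δ)
    (K := fun y (z : Circle) => chartDiff e₀ (h y (γ (x₁ + ε * (z : ℂ).re)))
        (h y (γ (x₂ + ε * (z : ℂ).im))))
    (by
      have c1 : Continuous fun w : Metric.ball a δ × Circle => h w.1 (γ (x₁ + ε * (w.2 : ℂ).re)) :=
        hh.comp ((continuous_subtype_val.comp continuous_fst).prodMk (by fun_prop))
      have c2 : Continuous fun w : Metric.ball a δ × Circle => h w.1 (γ (x₂ + ε * (w.2 : ℂ).im)) :=
        hh.comp ((continuous_subtype_val.comp continuous_fst).prodMk (by fun_prop))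
      exact (continuous_toC_extend c1 fun w => (hin w.1 w.2).1).sub
        (continuous_toC_extend c2 fun w => (hin w.1 w.2).2))
    (fun y z => chartDiff_ne_zero (hin y z).1 (hin y z).2
      fun hz => k3 z ((h y).injective hz))
    ⟨a, by simpa using hδ⟩ ⟨b, Metric.mem_ball.2 hb⟩

lemma GenericLoop.continuous_angular (α : GenericLoop S) : Continuous (angular α.toFun) := by
  refine continuous_iff_continuousAt.2 fun t => continuousAt_iff_continuous_left_right.2 ⟨?_, ?_⟩
  · obtain ⟨δ, hδ, h⟩ := α.smooth_in t
    exact (h.continuousOn t ⟨by linarith, le_rfl⟩).mono_of_mem_nhdsWithin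
      (Icc_mem_nhdsLE (by linarith))
  · obtain ⟨δ, hδ, h⟩ := α.smooth_out t
    exact (h.continuousOn t ⟨le_rfl, by linarith⟩).mono_of_mem_nhdsWithin
      (Icc_mem_nhdsGE (by linarith))

/-- The vector `vel` is by definition the derivative read in the preferred chart at the image point,
and `p` is that point. -/
lemma hasDerivAt_angular_chart {α : Circle → S} {x : ℝ}
    (h : MDifferentiableAt 𝓘(ℝ, ℝ) (𝓡∂ 2) (angular α) x) {p : S} (hp : angular α x = p) :
    HasDerivAt (fun t => toC ((chartAt (EuclideanHalfSpace 2) p).extend (𝓡∂ 2) (angular α t)))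
      (toC (vel α x)) x := by
  subst hp
  have h1 := h.hasMFDerivAt.2
  simp only [mfld_simps, writtenInExtChartAt] at h1
  have h2 : HasFDerivWithinAt
      (fun t => (chartAt (EuclideanHalfSpace 2) (angular α x)).extend (𝓡∂ 2) (angular α t))
      (mfderiv 𝓘(ℝ, ℝ) (𝓡∂ 2) (angular α) x : ℝ →L[ℝ] EuclideanSpace ℝ (Fin 2)) Set.univ x := h1
  exact ((toC.toContinuousLinearEquiv.hasFDerivAt).comp x
    (hasFDerivWithinAt_univ.1 h2)).hasDerivAt

lemma eventually_continuousAt_chart {γ : ℝ → S} (hγ : Continuous γ) {x : ℝ} {p : S}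
    (hp : γ x = p) : ∀ᶠ t in nhds x, ContinuousAt
      (fun t => toC ((chartAt (EuclideanHalfSpace 2) p).extend (𝓡∂ 2) (γ t))) t := by
  have : ∀ᶠ t in nhds x, γ t ∈ (chartAt (EuclideanHalfSpace 2) p).source :=
    hγ.continuousAt.preimage_mem_nhds ((chartAt (EuclideanHalfSpace 2) p).open_source.mem_nhds
      (hp ▸ mem_chart_source _ _))
  filter_upwards [this] with t ht
  exact toC.continuous.continuousAt.comp
    (((chartAt (EuclideanHalfSpace 2) p).continuousAt_extend ht).comp hγ.continuousAt)

lemma GenericLoop.mdifferentiableAt_crossing (α : GenericLoop S) {x y : ℝ}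
    (hxy : Circle.exp x ≠ Circle.exp y) (h : α.toFun (Circle.exp x) = α.toFun (Circle.exp y)) :
    MDifferentiableAt 𝓘(ℝ, ℝ) (𝓡∂ 2) (angular α.toFun) x :=
  (α.smooth_crossing x ⟨_, _, hxy, rfl, h.symm⟩).mdifferentiableAt (by simp)

/-- The sign of a crossing is invariant under ambient isotopies and reparametrizations. -/
theorem planeDet_pos_iff [IsManifold (𝓡∂ 2) ∞ S] (hS : IsOrientedAtlas S) (α β : GenericLoop S)
    {g : S ≃ₜ S} (hg : IsIsotopyEnd g) {c : ℝ → ℝ} (hc : Continuous c) {x₁ x₂ δ : ℝ}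
    (hδ : 0 < δ) (hm₁ : StrictMonoOn c (Set.Ioo (x₁ - δ) (x₁ + δ)))
    (hm₂ : StrictMonoOn c (Set.Ioo (x₂ - δ) (x₂ + δ)))
    (hβ₁ : ∀ x ∈ Set.Ioo (x₁ - δ) (x₁ + δ),
      β.toFun (Circle.exp (c x)) = g (α.toFun (Circle.exp x)))
    (hβ₂ : ∀ x ∈ Set.Ioo (x₂ - δ) (x₂ + δ),
      β.toFun (Circle.exp (c x)) = g (α.toFun (Circle.exp x)))
    (hx : Circle.exp x₁ ≠ Circle.exp x₂)
    (hα : α.toFun (Circle.exp x₁) = α.toFun (Circle.exp x₂))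
    (hcx : Circle.exp (c x₁) ≠ Circle.exp (c x₂)) :
    0 < planeDet (vel α.toFun x₁) (vel α.toFun x₂) ↔
      0 < planeDet (vel β.toFun (c x₁)) (vel β.toFun (c x₂)) := by
  obtain ⟨H, hH, hH0, hH1⟩ := hg
  set h : ℝ → S ≃ₜ S := fun r => H (Set.projIcc 0 1 zero_le_one r) with hh
  have hhc : Continuous fun z : ℝ × S => h z.1 z.2 :=
    hH.comp (((continuous_projIcc (h := zero_le_one' ℝ)).comp continuous_fst).prodMk continuous_snd)
  have h0 : h 0 = Homeomorph.refl S := by simpa [hh] using hH0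
  have h1 : h 1 = g := by simpa [hh] using hH1
  have hβx : β.toFun (Circle.exp (c x₁)) = β.toFun (Circle.exp (c x₂)) := by
    rw [hβ₁ x₁ ⟨by linarith, by linarith⟩, hβ₂ x₂ ⟨by linarith, by linarith⟩, hα]
  have hdα := α.transversal x₁ x₂ hx hα
  have hdβ := β.transversal (c x₁) (c x₂) hcx hβx
  set p := α.toFun (Circle.exp x₁) with hp
  set q := g p with hq
  have hβq : β.toFun (Circle.exp (c x₁)) = q := hβ₁ x₁ ⟨by linarith, by linarith⟩
  have Eα := eventually_logRel_curves (c := id) hδ continuous_id (strictMono_id.strictMonoOn _)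
    (strictMono_id.strictMonoOn _)
    (hasDerivAt_angular_chart (α.mdifferentiableAt_crossing hx hα) (p := p) rfl)
    (hasDerivAt_angular_chart (α.mdifferentiableAt_crossing hx.symm hα.symm) (p := p) hα.symm)
    (by simp only [id, angular]; rw [← hα])
    (eventually_continuousAt_chart α.continuous_angular (p := p) rfl)
    (eventually_continuousAt_chart α.continuous_angular (p := p) hα.symm)
    (by rwa [← planeDet_eq])
  have Eβ := eventually_logRel_curves hδ hc hm₁ hm₂
    (hasDerivAt_angular_chart (β.mdifferentiableAt_crossing hcx hβx) (p := q) hβq)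
    (hasDerivAt_angular_chart (β.mdifferentiableAt_crossing hcx.symm hβx.symm) (p := q)
      (hβx.symm.trans hβq))
    (by simp only [angular]; rw [← hβx])
    (eventually_continuousAt_chart β.continuous_angular (p := q) hβq)
    (eventually_continuousAt_chart β.continuous_angular (p := q) (hβx.symm.trans hβq))
    (by rwa [← planeDet_eq])
  have lin0 : ∀ a b : ℂ, a.re * b.im - a.im * b.re ≠ 0 → ∀ z : Circle,
      ((z : ℂ).re : ℂ) * a + ((z : ℂ).im : ℂ) * b ≠ 0 := by
    intro a b hab z hz
    obtain ⟨K, hK0, hK⟩ := exists_linear_lower_bound hab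
    have := hK z
    rw [hz, norm_zero, Circle.norm_coe, mul_one] at this
    exact absurd this hK0.not_ge
  have hneg : ∀ a b : EuclideanSpace ℝ (Fin 2), (toC a).re * (-toC b).im - (toC a).im * (-toC b).re
      = - planeDet a b := fun a b => by rw [planeDet_eq]; simp; ring
  have hne : ∀ᶠ ε in nhdsWithin (0 : ℝ) (Set.Ioi 0), ∀ z : Circle,
      angular α.toFun (x₁ + ε * (z : ℂ).re) ≠ angular α.toFun (x₂ + ε * (z : ℂ).im) := by
    filter_upwards [Eα] with ε hε z hz
    obtain ⟨L, -, hL⟩ := hε.symm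
    refine lin0 _ _ (by rw [hneg]; exact neg_ne_zero.2 hdα) z ((hL z).trans ?_)
    simp only [id, hz, sub_self, mul_zero]
  have Eh := eventually_logRel_isotopy hS hhc α.continuous_angular hα hne 0 1
    (chartAt (EuclideanHalfSpace 2) p) (chartAt (EuclideanHalfSpace 2) q)
    (chart_mem_atlas _ _) (chart_mem_atlas _ _) (by rw [h0]; exact mem_chart_source _ _)
    (by rw [h1]; exact mem_chart_source _ _)
  obtain ⟨ε, hα', hβ', hh', hε⟩ :=
    (Eα.and (Eβ.and (Eh.and (Ioo_mem_nhdsGT hδ : ∀ᶠ ε in _, ε ∈ Set.Ioo 0 δ)))).exists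
  have hre : ∀ z : Circle, |ε * (z : ℂ).re| < δ := fun z => by
    rw [abs_mul, abs_of_pos hε.1]
    have := (Complex.abs_re_le_norm (z : ℂ)).trans_eq (Circle.norm_coe z)
    nlinarith [hε.1, hε.2]
  have him : ∀ z : Circle, |ε * (z : ℂ).im| < δ := fun z => by
    rw [abs_mul, abs_of_pos hε.1]
    have := (Complex.abs_im_le_norm (z : ℂ)).trans_eq (Circle.norm_coe z)
    nlinarith [hε.1, hε.2]
  rw [h0, h1] at hh'
  -- The comparison passes, at one common scale `ε`, from the linear model of `α` to the difference
  -- of its branches, to the image of these under `g`, which are the branches of `β`, and to the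
  -- linear model of `β`.
  have hmid : LogRel (fun z : Circle => ((z : ℂ).re : ℂ) * toC (vel α.toFun x₁)
        + ((z : ℂ).im : ℂ) * (-toC (vel α.toFun x₂)))
      (fun z : Circle => ((z : ℂ).re : ℂ) * toC (vel β.toFun (c x₁))
        + ((z : ℂ).im : ℂ) * (-toC (vel β.toFun (c x₂)))) := by
    refine (hα'.symm.trans hh').trans (LogRel.trans ?_ hβ')
    convert LogRel.refl _ using 2 with z
    have e1 := hβ₁ (x₁ + ε * (z : ℂ).re)
      ⟨by linarith [(abs_lt.1 (hre z)).1], by linarith [(abs_lt.1 (hre z)).2]⟩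
    have e2 := hβ₂ (x₂ + ε * (z : ℂ).im)
      ⟨by linarith [(abs_lt.1 (him z)).1], by linarith [(abs_lt.1 (him z)).2]⟩
    simp only [chartDiff, angular, e1, e2]
  have hcz : Continuous fun z : Circle => (z : ℂ) := continuous_subtype_val
  -- The second branch enters the difference with a minus sign, which reverses the orientation: a
  -- positive crossing gives the conjugation and a negative one the identity.
  have pos : ∀ a b : EuclideanSpace ℝ (Fin 2), 0 < planeDet a b →
      LogRel (fun z : Circle => ((z : ℂ).re : ℂ) * toC a + ((z : ℂ).im : ℂ) * (-toC b))
        (fun z => (starRingEnd ℂ) (z : ℂ)) := fun a b hab =>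
    LogRel.linear_neg hcz (fun z => z.coe_ne_zero) (by rw [hneg]; linarith)
  have neg : ∀ a b : EuclideanSpace ℝ (Fin 2), planeDet a b < 0 →
      LogRel (fun z : Circle => ((z : ℂ).re : ℂ) * toC a + ((z : ℂ).im : ℂ) * (-toC b))
        (fun z => (z : ℂ)) := fun a b hab =>
    LogRel.linear_pos hcz (fun z => z.coe_ne_zero) (by rw [hneg]; linarith)
  constructor
  · intro hpos
    by_contra hn
    have := lt_of_le_of_ne (not_lt.1 hn) hdβ
    exact not_logRel_conj ((neg _ _ this).symm.trans (hmid.symm.trans (pos _ _ hpos)))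
  · intro hpos
    by_contra hn
    have := lt_of_le_of_ne (not_lt.1 hn) hdα
    exact not_logRel_conj ((neg _ _ this).symm.trans (hmid.trans (pos _ _ hpos)))

end Sign

/-! ### Cutting a loop at a crossing -/

section Cut

variable {S : Type*} [TopologicalSpace S] [ChartedSpace (EuclideanHalfSpace 2) S]

lemma GenericLoop.mdifferentiable_out (α : GenericLoop S) (t : ℝ) :
    MDifferentiableWithinAt 𝓘(ℝ, ℝ) (𝓡∂ 2) (angular α.toFun) (Set.Ici t) t := by
  obtain ⟨δ, hδ, h⟩ := α.smooth_out t
  exact ((h t ⟨le_rfl, by linarith⟩).mdifferentiableWithinAt (by simp)).mono_of_mem_nhdsWithin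
    (Icc_mem_nhdsGE (by linarith))

lemma GenericLoop.mdifferentiable_in (α : GenericLoop S) (t : ℝ) :
    MDifferentiableWithinAt 𝓘(ℝ, ℝ) (𝓡∂ 2) (angular α.toFun) (Set.Iic t) t := by
  obtain ⟨δ, hδ, h⟩ := α.smooth_in t
  exact ((h t ⟨by linarith, le_rfl⟩).mdifferentiableWithinAt (by simp)).mono_of_mem_nhdsWithin
    (Icc_mem_nhdsLE (by linarith))

lemma mfderivWithin_comp_affine {γ γ' : ℝ → S} {κ d y : ℝ} {s s' : Set ℝ}
    (hs : Set.MapsTo (fun x => κ * x + d) s s') (hy : y ∈ s) (hu : UniqueDiffWithinAt ℝ s y)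
    (hd : MDifferentiableWithinAt 𝓘(ℝ, ℝ) (𝓡∂ 2) γ s' (κ * y + d))
    (he : γ' =ᶠ[nhdsWithin y s] fun x => γ (κ * x + d)) :
    (mfderivWithin 𝓘(ℝ, ℝ) (𝓡∂ 2) γ' s y (1 : ℝ) : EuclideanSpace ℝ (Fin 2)) =
      κ • (mfderivWithin 𝓘(ℝ, ℝ) (𝓡∂ 2) γ s' (κ * y + d) (1 : ℝ) :
        EuclideanSpace ℝ (Fin 2)) := by
  have ha : HasDerivWithinAt (fun x => κ * x + d) κ s y := by
    simpa using ((hasDerivAt_id y).const_mul κ).add_const d |>.hasDerivWithinAt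
  have ha' : HasMFDerivWithinAt 𝓘(ℝ, ℝ) 𝓘(ℝ, ℝ) (fun x => κ * x + d) s y
      (ContinuousLinearMap.toSpanSingleton ℝ κ : ℝ →L[ℝ] ℝ) :=
    ha.hasFDerivWithinAt.hasMFDerivWithinAt
  have h1 := (HasMFDerivWithinAt.comp y hd.hasMFDerivWithinAt ha' hs)
  have h2 := (h1.congr_of_eventuallyEq he (he.self_of_nhdsWithin hy)).mfderivWithin
    (uniqueMDiffWithinAt_iff_uniqueDiffWithinAt.2 hu)
  rw [h2]
  have h3 : ((ContinuousLinearMap.toSpanSingleton ℝ κ : ℝ →L[ℝ] ℝ) (1 : ℝ)) = κ • (1 : ℝ) := by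
    simp
  refine Eq.trans ?_ (map_smul (mfderivWithin 𝓘(ℝ, ℝ) (𝓡∂ 2) γ s' (κ * y + d)) κ (1 : ℝ))
  exact congrArg (mfderivWithin 𝓘(ℝ, ℝ) (𝓡∂ 2) γ s' (κ * y + d)) h3

lemma velOut_comp_affine {γ γ' : Circle → S} {κ d y δ : ℝ} (hκ : 0 < κ) (hδ : 0 < δ)
    (hd : MDifferentiableWithinAt 𝓘(ℝ, ℝ) (𝓡∂ 2) (angular γ) (Set.Ici (κ * y + d)) (κ * y + d))
    (he : ∀ x ∈ Set.Icc y (y + δ), angular γ' x = angular γ (κ * x + d)) :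
    velOut γ' y = κ • velOut γ (κ * y + d) := by
  refine mfderivWithin_comp_affine (fun x hx => ?_) Set.self_mem_Ici (uniqueDiffOn_Ici y y
    Set.self_mem_Ici) hd (Filter.eventuallyEq_of_mem (Icc_mem_nhdsGE (by linarith)) he)
  have : y ≤ x := hx
  show κ * y + d ≤ κ * x + d
  gcongr

lemma velIn_comp_affine {γ γ' : Circle → S} {κ d y δ : ℝ} (hκ : 0 < κ) (hδ : 0 < δ)
    (hd : MDifferentiableWithinAt 𝓘(ℝ, ℝ) (𝓡∂ 2) (angular γ) (Set.Iic (κ * y + d)) (κ * y + d))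
    (he : ∀ x ∈ Set.Icc (y - δ) y, angular γ' x = angular γ (κ * x + d)) :
    velIn γ' y = κ • velIn γ (κ * y + d) := by
  refine mfderivWithin_comp_affine (fun x hx => ?_) Set.self_mem_Iic (uniqueDiffOn_Iic y y
    Set.self_mem_Iic) hd (Filter.eventuallyEq_of_mem (Icc_mem_nhdsLE (by linarith)) he)
  have : x ≤ y := hx
  show κ * x + d ≤ κ * y + d
  gcongr

lemma vel_comp_affine {γ γ' : Circle → S} {κ d y δ : ℝ} (hδ : 0 < δ)
    (hd : MDifferentiableAt 𝓘(ℝ, ℝ) (𝓡∂ 2) (angular γ) (κ * y + d))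
    (he : ∀ x ∈ Set.Icc (y - δ) (y + δ), angular γ' x = angular γ (κ * x + d)) :
    vel γ' y = κ • vel γ (κ * y + d) := by
  unfold vel
  rw [← mfderivWithin_univ, ← mfderivWithin_univ]
  refine mfderivWithin_comp_affine (Set.mapsTo_univ _ _) trivial uniqueDiffWithinAt_univ
    hd.mdifferentiableWithinAt (Filter.eventuallyEq_of_mem ?_ he)
  rw [nhdsWithin_univ]
  exact Icc_mem_nhds (by linarith) (by linarith)

lemma contMDiff_affine (κ d : ℝ) : ContMDiff 𝓘(ℝ, ℝ) 𝓘(ℝ, ℝ) ∞ fun x : ℝ => κ * x + d :=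
  ((contDiff_const.mul contDiff_id).add contDiff_const).contMDiff

lemma GenericLoop.velOut_eq_vel {α : GenericLoop S} {t : ℝ}
    (h : MDifferentiableAt 𝓘(ℝ, ℝ) (𝓡∂ 2) (angular α.toFun) t) :
    velOut α.toFun t = vel α.toFun t := by
  unfold velOut vel
  rw [mfderivWithin_eq_mfderiv (uniqueMDiffWithinAt_iff_uniqueDiffWithinAt.2
    (uniqueDiffOn_Ici t t Set.self_mem_Ici)) h]

lemma GenericLoop.velIn_eq_vel {α : GenericLoop S} {t : ℝ}
    (h : MDifferentiableAt 𝓘(ℝ, ℝ) (𝓡∂ 2) (angular α.toFun) t) :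
    velIn α.toFun t = vel α.toFun t := by
  unfold velIn vel
  rw [mfderivWithin_eq_mfderiv (uniqueMDiffWithinAt_iff_uniqueDiffWithinAt.2
    (uniqueDiffOn_Iic t t Set.self_mem_Iic)) h]

lemma sameRay_of_smul {v w : EuclideanSpace ℝ (Fin 2)} {κ : ℝ} (hκ : 0 < κ)
    (h : SameRay ℝ (κ • v) (κ • w)) : SameRay ℝ v w := by
  have := (h.pos_smul_left (inv_pos.2 hκ)).pos_smul_right (inv_pos.2 hκ)
  rwa [inv_smul_smul₀ hκ.ne', inv_smul_smul₀ hκ.ne'] at this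

/-- A cusp makes the two directions parallel. Hence the corner created by cutting a loop at a
crossing is not a cusp, as the branches are transversal there. -/
lemma planeDet_eq_zero_of_sameRay {v w : EuclideanSpace ℝ (Fin 2)} (h : SameRay ℝ v (-w)) :
    planeDet v w = 0 := by
  rcases h with rfl | h | ⟨r, s, hr, hs, h⟩
  · simp [planeDet]
  · rw [neg_eq_zero.1 h]; simp [planeDet]
  · have h0 := congrArg (fun x : EuclideanSpace ℝ (Fin 2) => x 0) h
    have h1 := congrArg (fun x : EuclideanSpace ℝ (Fin 2) => x 1) h
    simp at h0 h1
    have : r * planeDet v w = 0 := by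
      simp only [planeDet]
      linear_combination w 1 * h0 - w 0 * h1
    exact (mul_eq_zero.1 this).resolve_left hr.ne'

/-- The loop obtained by restricting a loop to an arc between the two preimages of a crossing. -/
lemma GenericLoop.exists_traverses_arc (α : GenericLoop S) {t u : ℝ} (htu : t < u)
    (hu : u < t + 2 * Real.pi) (h : α.toFun (Circle.exp t) = α.toFun (Circle.exp u)) :
    ∃ β : GenericLoop S, Traverses α.toFun (Circle.exp '' Set.Icc t u) β.toFun := by
  have hpi := two_pi_pos
  set κ : ℝ := (u - t) / (2 * Real.pi) with hκ
  have hκ0 : 0 < κ := div_pos (by linarith) hpi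
  have hκu : κ * (2 * Real.pi) = u - t := by rw [hκ]; field_simp
  have hne : Circle.exp t ≠ Circle.exp u := fun he =>
    htu.ne (Circle.exp_injOn_half_open (a := t) ⟨le_rfl, by linarith⟩ ⟨htu.le, hu⟩ he)
  choose τ hτ hτe using Circle.exists_exp_eq_mem_Ico 0
  rw [zero_add] at hτ
  set b : Circle → S := fun z => α.toFun (Circle.exp (κ * τ z + t)) with hb
  -- At `y = 2π` the chosen angle jumps back to `0`; the formula survives because both ends of the
  -- arc have the same image.
  have key : ∀ y ∈ Set.Icc 0 (2 * Real.pi), b (Circle.exp y) = angular α.toFun (κ * y + t) := by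
    intro y hy
    rcases hy.2.eq_or_lt with rfl | hlt
    · have : τ (Circle.exp (2 * Real.pi)) = 0 := by
        refine Circle.exp_injOn_half_open (a := 0) (by simpa using hτ _)
          ⟨le_rfl, by linarith⟩ ?_
        rw [hτe, Circle.exp_two_pi, Circle.exp_zero]
      simp only [hb, this, hκu, angular, mul_zero, zero_add, sub_add_cancel, h]
    · have : τ (Circle.exp y) = y :=
        Circle.exp_injOn_half_open (a := 0) (by simpa using hτ _) ⟨hy.1, by linarith⟩ (hτe _)
      simp only [hb, this, angular]
  -- local affine form
  have keyk : ∀ k : ℤ, ∀ y, y + k * (2 * Real.pi) ∈ Set.Icc 0 (2 * Real.pi) →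
      angular b y = angular α.toFun (κ * y + (t + k * (u - t))) := by
    intro k y hy
    have := key _ hy
    rw [Circle.exp_add_int_mul] at this
    rw [angular, this, ← hκu]; congr 1; ring
  -- Away from the angle `0` the new loop is locally one affine reparametrization of `α`. At the
  -- angle `0` two of them meet, one from the beginning and one from the end of the arc, which is
  -- the only place where a new corner may appear.
  have loc : ∀ y, (∃ d δ, 0 < δ ∧ t < κ * y + d ∧ κ * y + d < u ∧
        κ * y + d = κ * τ (Circle.exp y) + t ∧
        ∀ x ∈ Set.Icc (y - δ) (y + δ), angular b x = angular α.toFun (κ * x + d)) ∨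
      (Circle.exp y = 1 ∧ ∃ d d' δ, 0 < δ ∧ κ * y + d = t ∧ κ * y + d' = u ∧
        (∀ x ∈ Set.Icc y (y + δ), angular b x = angular α.toFun (κ * x + d)) ∧
        ∀ x ∈ Set.Icc (y - δ) y, angular b x = angular α.toFun (κ * x + d')) := by
    intro y
    obtain ⟨k, hk⟩ := exists_int_shift_mem_Ico 0 y
    rw [zero_add] at hk
    rcases hk.1.eq_or_lt with h0 | h0
    · right
      have hy : y = (-k : ℤ) * (2 * Real.pi) := by push_cast; linarith
      refine ⟨Circle.exp_eq_one.2 ⟨_, hy⟩, t + k * (u - t), t + ((k + 1 : ℤ) : ℝ) * (u - t),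
        2 * Real.pi, hpi, ?_, ?_, fun x hx => keyk k x ?_, fun x hx => keyk (k + 1) x ?_⟩
      · rw [hy]; push_cast; rw [← hκu]; ring
      · rw [hy]; push_cast; rw [← hκu]; linear_combination hκu
      · constructor <;> linarith [hx.1, hx.2]
      · push_cast; constructor <;> linarith [hx.1, hx.2]
    · left
      set r := y + k * (2 * Real.pi)
      have hr : κ * y + (t + k * (u - t)) = κ * r + t := by simp only [r]; rw [← hκu]; ring
      refine ⟨t + k * (u - t), min r (2 * Real.pi - r), lt_min h0 (by linarith [hk.2]), ?_, ?_, ?_,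
        fun x hx => keyk k x ?_⟩
      · rw [hr]; nlinarith
      · rw [hr]; nlinarith [hk.2]
      · rw [hr]
        have : τ (Circle.exp y) = r :=
          Circle.exp_injOn_half_open (a := 0) (by simpa using hτ _) (by simpa using hk)
            (by rw [hτe, Circle.exp_add_int_mul])
        rw [this]
      · have h1 := min_le_left r (2 * Real.pi - r)
        have h2 := min_le_right r (2 * Real.pi - r)
        constructor <;> simp only [r] at h1 h2 ⊢ <;> linarith [hx.1, hx.2]
  have locR : ∀ y, ∃ d δ, 0 < δ ∧
      ∀ x ∈ Set.Icc y (y + δ), angular b x = angular α.toFun (κ * x + d) := by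
    intro y
    rcases loc y with ⟨d, δ, hδ, -, -, -, H⟩ | ⟨-, d, -, δ, hδ, -, -, H, -⟩
    · exact ⟨d, δ, hδ, fun x hx => H x ⟨by linarith [hx.1], hx.2⟩⟩
    · exact ⟨d, δ, hδ, H⟩
  have locL : ∀ y, ∃ d δ, 0 < δ ∧
      ∀ x ∈ Set.Icc (y - δ) y, angular b x = angular α.toFun (κ * x + d) := by
    intro y
    rcases loc y with ⟨d, δ, hδ, -, -, -, H⟩ | ⟨-, -, d, δ, hδ, -, -, -, H⟩
    · exact ⟨d, δ, hδ, fun x hx => H x ⟨hx.1, by linarith [hx.2]⟩⟩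
    · exact ⟨d, δ, hδ, H⟩
  have hτa : ∀ z, κ * τ z + t ∈ Set.Ico t (t + 2 * Real.pi) ∧ κ * τ z + t < u := by
    intro z
    have h1 := hτ z
    have h3 : κ * τ z < u - t := by rw [← hκu]; exact mul_lt_mul_of_pos_left h1.2 hκ0
    exact ⟨⟨by nlinarith [h1.1], by linarith⟩, by linarith⟩
  have hinj : ∀ z w, Circle.exp (κ * τ z + t) = Circle.exp (κ * τ w + t) → z = w := by
    intro z w hzw
    have := Circle.exp_injOn_half_open (hτa z).1 (hτa w).1 hzw
    have h2 : τ z = τ w := by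
      have : κ * τ z = κ * τ w := by linarith
      exact mul_left_cancel₀ hκ0.ne' this
    rw [← hτe z, ← hτe w, h2]
  -- at a crossing the loop is interior to the arc
  have hcross : ∀ z, b z ∈ crossingSet b → Circle.exp (κ * τ z + t) ≠ Circle.exp t := by
    rintro z ⟨x, y, hxy, hx, hy⟩ hz
    have hbz : b z = α.toFun (Circle.exp t) := by simp only [hb, hz]
    have hno : ∀ w, Circle.exp (κ * τ w + t) ≠ Circle.exp u := by
      intro w hw
      have := Circle.exp_injOn_half_open (hτa w).1 ⟨htu.le, hu⟩ hw
      linarith [(hτa w).2]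
    rcases α.double (Circle.exp (κ * τ x + t)) (Circle.exp (κ * τ y + t)) (Circle.exp u)
      (hx.trans hy.symm) (hy.trans (hbz.trans h)) with e | e | e
    · exact hxy (hinj _ _ e)
    · exact hno _ e
    · exact hno _ e
  have hsub : crossingSet b ⊆ crossingSet α.toFun := by
    rintro p ⟨x, y, hxy, hx, hy⟩
    exact ⟨_, _, fun e => hxy (hinj _ _ e), hx, hy⟩
  have hlocc : ∀ y, b (Circle.exp y) ∈ crossingSet b → ∃ d δ, 0 < δ ∧
      (∀ x ∈ Set.Icc (y - δ) (y + δ), angular b x = angular α.toFun (κ * x + d)) ∧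
      Circle.exp (κ * y + d) = Circle.exp (κ * τ (Circle.exp y) + t) ∧
      ContMDiffAt 𝓘(ℝ, ℝ) (𝓡∂ 2) ∞ (angular α.toFun) (κ * y + d) := by
    intro y hy
    rcases loc y with ⟨d, δ, hδ, h1, h2, h3, H⟩ | ⟨h1, -⟩
    · refine ⟨d, δ, hδ, H, by rw [h3], α.smooth_crossing _ (hsub ?_)⟩
      rw [h3]; exact hy
    · refine absurd ?_ (hcross _ hy)
      have : τ (Circle.exp y) = 0 := by
        refine Circle.exp_injOn_half_open (a := 0) (by simpa using hτ _)
          ⟨le_rfl, by linarith⟩ ?_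
        rw [hτe, h1, Circle.exp_zero]
      rw [this, mul_zero, zero_add]
  have hvt := α.mdifferentiableAt_crossing hne h
  have hvu := α.mdifferentiableAt_crossing hne.symm h.symm
  let β : GenericLoop S :=
    { toFun := b
      interior := fun x => α.interior _
      smooth_out := fun y => by
        obtain ⟨d, δ, hδ, H⟩ := locR y
        obtain ⟨r, hr, Hr⟩ := α.smooth_out (κ * y + d)
        refine ⟨min δ (r / κ), lt_min hδ (div_pos hr hκ0), ?_⟩
        have h1 : ContMDiffOn 𝓘(ℝ, ℝ) (𝓡∂ 2) ∞ (angular α.toFun ∘ fun x => κ * x + d)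
            (Set.Icc y (y + min δ (r / κ))) := by
          refine Hr.comp (contMDiff_affine κ d).contMDiffOn fun x hx => ?_
          have h2 : κ * (x - y) ≤ r := by
            rw [mul_comm, ← le_div_iff₀ hκ0]
            linarith [hx.2, min_le_right δ (r / κ)]
          exact ⟨by nlinarith [hx.1], by linarith⟩
        exact h1.congr fun x hx => H x ⟨hx.1, by linarith [hx.2, min_le_left δ (r / κ)]⟩
      smooth_in := fun y => by
        obtain ⟨d, δ, hδ, H⟩ := locL y
        obtain ⟨r, hr, Hr⟩ := α.smooth_in (κ * y + d)
        refine ⟨min δ (r / κ), lt_min hδ (div_pos hr hκ0), ?_⟩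
        have h1 : ContMDiffOn 𝓘(ℝ, ℝ) (𝓡∂ 2) ∞ (angular α.toFun ∘ fun x => κ * x + d)
            (Set.Icc (y - min δ (r / κ)) y) := by
          refine Hr.comp (contMDiff_affine κ d).contMDiffOn fun x hx => ?_
          have h2 : κ * (y - x) ≤ r := by
            rw [mul_comm, ← le_div_iff₀ hκ0]
            linarith [hx.1, min_le_right δ (r / κ)]
          exact ⟨by linarith, by nlinarith [hx.2]⟩
        exact h1.congr fun x hx => H x ⟨by linarith [hx.1, min_le_left δ (r / κ)], hx.2⟩
      velOut_ne := fun y => by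
        obtain ⟨d, δ, hδ, H⟩ := locR y
        rw [velOut_comp_affine hκ0 hδ (α.mdifferentiable_out _) H]
        exact smul_ne_zero hκ0.ne' (α.velOut_ne _)
      velIn_ne := fun y => by
        obtain ⟨d, δ, hδ, H⟩ := locL y
        rw [velIn_comp_affine hκ0 hδ (α.mdifferentiable_in _) H]
        exact smul_ne_zero hκ0.ne' (α.velIn_ne _)
      no_cusp := fun y => by
        rcases loc y with ⟨d, δ, hδ, -, -, -, H⟩ | ⟨-, d, d', δ, hδ, h1, h2, H, H'⟩
        · rw [velOut_comp_affine hκ0 hδ (α.mdifferentiable_out _)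
            (fun x hx => H x ⟨by linarith [hx.1], hx.2⟩), velIn_comp_affine hκ0 hδ
            (α.mdifferentiable_in _) (fun x hx => H x ⟨hx.1, by linarith [hx.2]⟩), ← smul_neg]
          exact fun hray => α.no_cusp _ (sameRay_of_smul hκ0 hray)
        · rw [velOut_comp_affine hκ0 hδ (α.mdifferentiable_out _) H, velIn_comp_affine hκ0 hδ
            (α.mdifferentiable_in _) H', ← smul_neg, h1, h2, GenericLoop.velOut_eq_vel hvt,
            GenericLoop.velIn_eq_vel hvu]
          intro hray
          refine α.transversal t u hne h (planeDet_eq_zero_of_sameRay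
            (sameRay_of_smul hκ0 hray))
      double := fun x y z hxy hyz => by
        rcases α.double _ _ _ hxy hyz with e | e | e
        · exact Or.inl (hinj _ _ e)
        · exact Or.inr (Or.inl (hinj _ _ e))
        · exact Or.inr (Or.inr (hinj _ _ e))
      smooth_crossing := fun y hy => by
        obtain ⟨d, δ, hδ, H, -, hs⟩ := hlocc y hy
        exact (ContMDiffAt.comp y (f := fun x => κ * x + d) hs
          (contMDiff_affine κ d).contMDiffAt).congr_of_eventuallyEq
          (Filter.eventuallyEq_of_mem (Icc_mem_nhds (by linarith) (by linarith)) H)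
      transversal := fun x y hxy he => by
        obtain ⟨d, δ, hδ, H, h1, hs⟩ := hlocc x ⟨_, _, hxy, rfl, he.symm⟩
        obtain ⟨d', δ', hδ', H', h1', hs'⟩ := hlocc y ⟨_, _, hxy, he, rfl⟩
        rw [vel_comp_affine hδ (hs.mdifferentiableAt (by simp)) H,
          vel_comp_affine hδ' (hs'.mdifferentiableAt (by simp)) H']
        have h2 := α.transversal (κ * x + d) (κ * y + d')
          (fun e => hxy (hinj _ _ (h1.symm.trans (e.trans h1')))) (by rw [h1, h1']; exact he)
        intro h0
        have h3 : κ * κ * planeDet (vel α.toFun (κ * x + d)) (vel α.toFun (κ * y + d')) = 0 := by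
          rw [← h0]; simp [planeDet]; ring
        exact h2 ((mul_eq_zero.1 h3).resolve_left (mul_pos hκ0 hκ0).ne')
      finite_crossings := α.finite_crossings.subset hsub }
  obtain ⟨c, hc, hcx⟩ := exists_isCollapse_arc htu hu
  refine ⟨β, traverses_iff.2 ⟨c, hc, ?_⟩⟩
  rintro x ⟨v, hv, hvx⟩
  obtain ⟨k, rfl⟩ := Circle.exp_eq_exp.1 hvx.symm
  rw [deg_int hc.deg, Circle.exp_add_int_mul, Circle.exp_add_int_mul, hcx v hv]
  have h1 : κ * ((v - t) * (2 * Real.pi / (u - t))) = v - t := by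
    rw [hκ]; field_simp [(sub_pos.2 htu).ne']
  have h2 := key ((v - t) * (2 * Real.pi / (u - t)))
    ⟨mul_nonneg (by linarith [hv.1]) (div_nonneg hpi.le (by linarith)), by
      rw [← mul_div_assoc, div_le_iff₀ (by linarith), mul_comm]
      have := hv.2
      gcongr⟩
  rw [h1, sub_add_cancel] at h2
  exact h2

end Cut

/-! ### Arcs cut off by crossings -/

lemma mem_exp_image {s : Set ℝ} {x : ℝ} :
    Circle.exp x ∈ Circle.exp '' s ↔ ∃ k : ℤ, x + k * (2 * Real.pi) ∈ s := by
  constructor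
  · rintro ⟨v, hv, hvx⟩
    obtain ⟨k, rfl⟩ := Circle.exp_eq_exp.1 hvx
    exact ⟨k, hv⟩
  · rintro ⟨k, hk⟩
    exact ⟨_, hk, Circle.exp_add_int_mul _ _⟩

lemma int_eq_zero_of_small {k : ℤ} (h1 : -(2 * Real.pi) < k * (2 * Real.pi))
    (h2 : k * (2 * Real.pi) < 2 * Real.pi) : k = 0 := by
  have hpi := two_pi_pos
  have h3 : (-1 : ℝ) < k := by nlinarith
  have h4 : (k : ℝ) < 1 := by nlinarith
  have h5 : -1 < k := by exact_mod_cast h3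
  have h6 : k < 1 := by exact_mod_cast h4
  omega

/-- Within a closed window of length `2π` only the two ends have the same image on the circle, so it
suffices that `s` contains both of them or neither. -/
lemma exp_mem_image_iff_of_window {s : Set ℝ} {a x : ℝ} (hs : s ⊆ Set.Icc a (a + 2 * Real.pi))
    (h2 : a + 2 * Real.pi ∈ s → a ∈ s) (h3 : a ∈ s → a + 2 * Real.pi ∈ s)
    (hx : x ∈ Set.Icc a (a + 2 * Real.pi)) :
    Circle.exp x ∈ Circle.exp '' s ↔ x ∈ s := by
  rw [mem_exp_image]
  refine ⟨?_, fun h => ⟨0, by simpa using h⟩⟩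
  rintro ⟨k, hk⟩
  have hpi := two_pi_pos
  have hk' := hs hk
  have h4 : (k : ℝ) ≤ 1 := by nlinarith [hk'.2, hx.1]
  have h5 : (-1 : ℝ) ≤ k := by nlinarith [hk'.1, hx.2]
  have h4' : k ≤ 1 := by exact_mod_cast h4
  have h5' : -1 ≤ k := by exact_mod_cast h5
  have : k = -1 ∨ k = 0 ∨ k = 1 := by omega
  rcases this with rfl | rfl | rfl
  · push_cast at hk hk'
    have : x = a + 2 * Real.pi := by linarith [hk'.1, hx.2]
    subst this
    exact h3 (by convert hk using 1; ring)
  · simpa using hk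
  · push_cast at hk hk'
    have : x = a := by linarith [hk'.2, hx.1]
    subst this
    exact h2 (by convert hk using 1; ring)

section Arcs

variable {S : Type*} [TopologicalSpace S] [ChartedSpace (EuclideanHalfSpace 2) S]

lemma GenericLoop.mem_crossings {α : GenericLoop S} {p : S} :
    p ∈ α.crossings ↔ p ∈ crossingSet α.toFun := by
  simp [GenericLoop.crossings]

namespace PointedLoop

variable {α : PointedLoop S} {p q : S} {s t u t' u' x : ℝ}

/-- Starting at the lift `s` of the base point one meets the crossing `p` at `t` and then at
`u`. -/
def VisitsFrom (α : PointedLoop S) (s : ℝ) (p : S) (t u : ℝ) : Prop :=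
  Circle.exp s = α.base ∧ s < t ∧ t < u ∧ u < s + 2 * Real.pi ∧
    α.toFun (Circle.exp t) = p ∧ α.toFun (Circle.exp u) = p

lemma VisitsFrom.visits (h : α.VisitsFrom s p t u) : α.Visits p t u := ⟨s, h⟩

lemma exists_lift (α : PointedLoop S) : ∃ s, Circle.exp s = α.base := Circle.exp_surjective _

lemma exists_visitsFrom (hs : Circle.exp s = α.base) (hp : p ∈ α.crossings) :
    ∃ t u, α.VisitsFrom s p t u := by
  obtain ⟨x, y, hxy, hx, hy⟩ := GenericLoop.mem_crossings.1 hp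
  obtain ⟨t, ht, rfl⟩ := Circle.exists_exp_eq_mem_Ico s x
  obtain ⟨u, hu, rfl⟩ := Circle.exists_exp_eq_mem_Ico s y
  have hb : ∀ v, α.toFun (Circle.exp v) = p → s ≤ v → s < v := by
    rintro v hv hsv
    refine lt_of_le_of_ne hsv ?_
    rintro rfl
    refine α.base_not_crossing ?_
    rw [← hs, hv]; exact GenericLoop.mem_crossings.1 hp
  have hne : t ≠ u := by rintro rfl; exact hxy rfl
  rcases hne.lt_or_gt with h | h
  · exact ⟨t, u, hs, hb t hx ht.1, h, hu.2, hx, hy⟩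
  · exact ⟨u, t, hs, hb u hy hu.1, h, ht.2, hy, hx⟩

lemma VisitsFrom.exp_ne (h : α.VisitsFrom s p t u) : Circle.exp t ≠ Circle.exp u := by
  obtain ⟨_, h1, h2, h3, _⟩ := h
  intro he
  exact h2.ne (Circle.exp_injOn_half_open (a := s) ⟨by linarith, by linarith⟩
    ⟨by linarith, h3⟩ he)

lemma VisitsFrom.mem_crossings (h : α.VisitsFrom s p t u) : p ∈ α.crossings :=
  GenericLoop.mem_crossings.2 ⟨_, _, h.exp_ne, h.2.2.2.2.1, h.2.2.2.2.2⟩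

lemma VisitsFrom.eq_or (h : α.VisitsFrom s p t u) {z : Circle} (hz : α.toFun z = p) :
    z = Circle.exp t ∨ z = Circle.exp u := by
  have h5 := h.2.2.2.2.1
  have h6 := h.2.2.2.2.2
  rcases α.double z (Circle.exp t) (Circle.exp u) (hz.trans h5.symm) (h5.trans h6.symm) with
    e | e | e
  · exact Or.inl e
  · exact absurd e h.exp_ne
  · exact Or.inr e

lemma VisitsFrom.eq_or' (h : α.VisitsFrom s p t u) (hx : x ∈ Set.Icc s (s + 2 * Real.pi))
    (hz : α.toFun (Circle.exp x) = p) : x = t ∨ x = u := by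
  have hx' : x ∈ Set.Ico s (s + 2 * Real.pi) := by
    refine ⟨hx.1, lt_of_le_of_ne hx.2 ?_⟩
    rintro rfl
    rw [Circle.exp_add_two_pi, h.1] at hz
    exact α.base_not_crossing (hz ▸ GenericLoop.mem_crossings.1 h.mem_crossings)
  obtain ⟨_, h1, h2, h3, _⟩ := id h
  rcases h.eq_or hz with e | e
  · exact Or.inl (Circle.exp_injOn_half_open hx' ⟨by linarith, by linarith⟩ e)
  · exact Or.inr (Circle.exp_injOn_half_open hx' ⟨by linarith, by linarith⟩ e)

lemma VisitsFrom.unique (h : α.VisitsFrom s p t u) (h' : α.VisitsFrom s p t' u') :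
    t' = t ∧ u' = u := by
  obtain ⟨_, h1, h2, h3, h4, h5⟩ := id h
  obtain ⟨_, h1', h2', h3', h4', h5'⟩ := id h'
  rcases h.eq_or' ⟨by linarith, by linarith⟩ h4' with rfl | rfl <;>
  rcases h.eq_or' ⟨by linarith, by linarith⟩ h5' with rfl | rfl <;>
  first | exact ⟨rfl, rfl⟩ | (exfalso; linarith)

lemma VisitsFrom.shift (h : α.VisitsFrom s p t u) (k : ℤ) :
    α.VisitsFrom (s + k * (2 * Real.pi)) p (t + k * (2 * Real.pi)) (u + k * (2 * Real.pi)) := by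
  obtain ⟨h0, h1, h2, h3, h4, h5⟩ := h
  refine ⟨by rw [Circle.exp_add_int_mul, h0], by linarith, by linarith, by linarith, ?_, ?_⟩ <;>
  rwa [Circle.exp_add_int_mul]

lemma Visits.exists_from (h : α.Visits p t u) (hs : Circle.exp s = α.base) :
    ∃ k : ℤ, α.VisitsFrom s p (t + k * (2 * Real.pi)) (u + k * (2 * Real.pi)) := by
  obtain ⟨s', h⟩ := h
  obtain ⟨k, hk⟩ := Circle.exp_eq_exp.1 (hs.trans h.1.symm)
  exact ⟨k, hk ▸ VisitsFrom.shift h k⟩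

lemma Visits.shift (h : α.Visits p t u) (k : ℤ) :
    α.Visits p (t + k * (2 * Real.pi)) (u + k * (2 * Real.pi)) := by
  obtain ⟨s', h⟩ := h
  exact ⟨_, VisitsFrom.shift h k⟩

lemma Visits.mem_crossings (h : α.Visits p t u) : p ∈ α.crossings := by
  obtain ⟨s', h⟩ := h
  exact VisitsFrom.mem_crossings h

lemma Visits.eq_shift (h : α.Visits p t u) (h' : α.Visits p t' u') :
    ∃ k : ℤ, t' = t + k * (2 * Real.pi) ∧ u' = u + k * (2 * Real.pi) := by
  obtain ⟨s, h⟩ := h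
  obtain ⟨k, hk⟩ := h'.exists_from (s := s) h.1
  obtain ⟨h1, h2⟩ := VisitsFrom.unique h hk
  exact ⟨-k, by push_cast; linarith, by push_cast; linarith⟩

lemma exists_visits (hp : p ∈ α.crossings) : ∃ t u, α.Visits p t u := by
  obtain ⟨s, hs⟩ := α.exists_lift
  obtain ⟨t, u, h⟩ := exists_visitsFrom hs hp
  exact ⟨t, u, h.visits⟩

/-- The open arc of the circle between the first and the second visit of a crossing. -/
def arc (α : PointedLoop S) (p : S) : Set Circle :=
  {z | ∃ t u, α.Visits p t u ∧ z ∈ Circle.exp '' Set.Ioo t u}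

/-- The closed arc of the circle between the first and the second visit of a crossing. -/
def carc (α : PointedLoop S) (p : S) : Set Circle :=
  {z | ∃ t u, α.Visits p t u ∧ z ∈ Circle.exp '' Set.Icc t u}

lemma Visits.arc_eq (h : α.Visits p t u) : α.arc p = Circle.exp '' Set.Ioo t u := by
  ext z
  refine ⟨?_, fun hz => ⟨t, u, h, hz⟩⟩
  rintro ⟨t', u', h', v, hv, rfl⟩
  obtain ⟨k, rfl, rfl⟩ := h.eq_shift h'
  exact mem_exp_image.2 ⟨-k, by push_cast; linarith [hv.1], by push_cast; linarith [hv.2]⟩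

lemma Visits.carc_eq (h : α.Visits p t u) : α.carc p = Circle.exp '' Set.Icc t u := by
  ext z
  refine ⟨?_, fun hz => ⟨t, u, h, hz⟩⟩
  rintro ⟨t', u', h', v, hv, rfl⟩
  obtain ⟨k, rfl, rfl⟩ := h.eq_shift h'
  exact mem_exp_image.2 ⟨-k, by push_cast; linarith [hv.1], by push_cast; linarith [hv.2]⟩

lemma VisitsFrom.mem_arc (h : α.VisitsFrom s p t u) (hx : x ∈ Set.Icc s (s + 2 * Real.pi)) :
    Circle.exp x ∈ α.arc p ↔ x ∈ Set.Ioo t u := by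
  rw [h.visits.arc_eq]
  obtain ⟨_, h1, h2, h3, h4, h5⟩ := h
  refine exp_mem_image_iff_of_window (a := s) (fun v hv => ⟨by linarith [hv.1], by linarith [hv.2]⟩)
    (fun hv => ?_) (fun hv => ?_) hx
  · linarith [hv.2]
  · linarith [hv.1]

lemma VisitsFrom.mem_carc (h : α.VisitsFrom s p t u) (hx : x ∈ Set.Icc s (s + 2 * Real.pi)) :
    Circle.exp x ∈ α.carc p ↔ x ∈ Set.Icc t u := by
  rw [h.visits.carc_eq]
  obtain ⟨_, h1, h2, h3, h4, h5⟩ := h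
  refine exp_mem_image_iff_of_window (a := s) (fun v hv => ⟨by linarith [hv.1], by linarith [hv.2]⟩)
    (fun hv => ?_) (fun hv => ?_) hx
  · linarith [hv.2]
  · linarith [hv.1]

lemma Visits.compl_arc_eq (h : α.Visits p t u) :
    (α.arc p)ᶜ = Circle.exp '' Set.Icc u (t + 2 * Real.pi) := by
  have ha := h.arc_eq
  obtain ⟨s, h⟩ := h
  obtain ⟨_, h1, h2, h3, h4, h5⟩ := id h
  ext z
  obtain ⟨x, hx, rfl⟩ := Circle.exists_exp_eq_mem_Ico t z
  have hx' : x ∈ Set.Icc t (t + 2 * Real.pi) := ⟨hx.1, hx.2.le⟩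
  rw [Set.mem_compl_iff, ha, exp_mem_image_iff_of_window (a := t) (s := Set.Ioo t u)
    (fun v hv => ⟨hv.1.le, by linarith [hv.2]⟩) (fun hv => by linarith [hv.2])
    (fun hv => by linarith [hv.1]) hx']
  constructor
  · intro hn
    rcases hx.1.eq_or_lt with rfl | hlt
    · exact ⟨t + 2 * Real.pi, ⟨by linarith, le_rfl⟩, Circle.exp_add_two_pi _⟩
    · exact ⟨x, ⟨not_lt.1 fun hu => hn ⟨hlt, hu⟩, hx.2.le⟩, rfl⟩
  · intro hm hn
    obtain ⟨k, hk⟩ := mem_exp_image.1 hm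
    have hpi := two_pi_pos
    have := int_eq_zero_of_small (k := k) (by linarith [hk.1, hn.2]) (by linarith [hk.2, hn.1])
    subst this
    simp at hk
    linarith [hk.1, hn.2]

lemma isOpen_arc (hp : p ∈ α.crossings) : IsOpen (α.arc p) := by
  obtain ⟨t, u, h⟩ := exists_visits hp
  rw [h.arc_eq]; exact isOpen_exp_image_Ioo _ _

lemma isClosed_carc (hp : p ∈ α.crossings) : IsClosed (α.carc p) := by
  obtain ⟨t, u, h⟩ := exists_visits hp
  rw [h.carc_eq]; exact isClosed_exp_image_Icc _ _

lemma arc_subset_carc : α.arc p ⊆ α.carc p := by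
  rintro z ⟨t, u, h, hz⟩
  exact ⟨t, u, h, Set.image_mono Set.Ioo_subset_Icc_self hz⟩

lemma mem_carc_iff (hp : p ∈ α.crossings) {z : Circle} :
    z ∈ α.carc p ↔ z ∈ α.arc p ∨ α.toFun z = p := by
  obtain ⟨s, hs⟩ := α.exists_lift
  obtain ⟨t, u, h⟩ := exists_visitsFrom hs hp
  obtain ⟨x, hx, rfl⟩ := Circle.exists_exp_eq_mem_Ico s z
  have hx' : x ∈ Set.Icc s (s + 2 * Real.pi) := ⟨hx.1, hx.2.le⟩
  rw [h.mem_arc hx', h.mem_carc hx']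
  obtain ⟨_, h1, h2, h3, h4, h5⟩ := id h
  constructor
  · intro hm
    rcases hm.1.eq_or_lt with rfl | h6
    · exact Or.inr h4
    rcases hm.2.eq_or_lt with rfl | h7
    · exact Or.inr h5
    exact Or.inl ⟨h6, h7⟩
  · rintro (hm | hm)
    · exact ⟨hm.1.le, hm.2.le⟩
    · rcases h.eq_or' hx' hm with rfl | rfl
      · exact ⟨le_rfl, h2.le⟩
      · exact ⟨h2.le, le_rfl⟩

lemma not_mem_arc_self {z : Circle} (hz : α.toFun z = p) : z ∉ α.arc p := by
  rintro ⟨t, u, ⟨s, h⟩, hz'⟩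
  change α.VisitsFrom s p t u at h
  obtain ⟨v, hv, rfl⟩ := hz'
  obtain ⟨_, h1, h2, h3, h4, h5⟩ := id h
  rcases h.eq_or' ⟨by linarith [hv.1], by linarith [hv.2]⟩ hz with rfl | rfl
  · exact hv.1.ne rfl
  · exact hv.2.ne rfl

lemma base_not_mem_carc (hp : p ∈ α.crossings) : α.base ∉ α.carc p := by
  obtain ⟨s, hs⟩ := α.exists_lift
  obtain ⟨t, u, h⟩ := exists_visitsFrom hs hp
  rw [← hs, h.mem_carc ⟨le_rfl, by linarith [two_pi_pos]⟩]
  exact fun hm => by linarith [hm.1, h.2.1]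

/-- Both visits of `q` lie between the two visits of `p`. -/
def Inside (α : PointedLoop S) (q p : S) : Prop := ∀ z, α.toFun z = q → z ∈ α.arc p

/-- Both visits of `q` lie outside the closed arc between the two visits of `p`. -/
def Outside (α : PointedLoop S) (q p : S) : Prop := ∀ z, α.toFun z = q → z ∉ α.carc p

lemma VisitsFrom.forall_iff (h : α.VisitsFrom s p t u) {P : Circle → Prop} :
    (∀ z, α.toFun z = p → P z) ↔ P (Circle.exp t) ∧ P (Circle.exp u) := by
  refine ⟨fun H => ⟨H _ h.2.2.2.2.1, H _ h.2.2.2.2.2⟩, fun H z hz => ?_⟩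
  rcases h.eq_or hz with rfl | rfl
  exacts [H.1, H.2]

lemma inside_iff (h : α.VisitsFrom s p t u) (h' : α.VisitsFrom s q t' u') :
    α.Inside q p ↔ t < t' ∧ u' < u := by
  obtain ⟨_, h1, h2, h3, _⟩ := id h
  obtain ⟨_, h1', h2', h3', _⟩ := id h'
  rw [Inside, h'.forall_iff, h.mem_arc ⟨by linarith, by linarith⟩,
    h.mem_arc ⟨by linarith, by linarith⟩]
  simp only [Set.mem_Ioo]
  constructor
  · rintro ⟨⟨a, b⟩, c, d⟩; exact ⟨a, d⟩
  · rintro ⟨a, b⟩; refine ⟨⟨a, ?_⟩, ?_, b⟩ <;> linarith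

lemma outside_iff (h : α.VisitsFrom s p t u) (h' : α.VisitsFrom s q t' u') :
    α.Outside q p ↔ (t' < t ∨ u < t') ∧ (u' < t ∨ u < u') := by
  obtain ⟨_, h1, h2, h3, _⟩ := id h
  obtain ⟨_, h1', h2', h3', _⟩ := id h'
  rw [Outside, h'.forall_iff, h.mem_carc ⟨by linarith, by linarith⟩,
    h.mem_carc ⟨by linarith, by linarith⟩]
  simp only [Set.mem_Icc, not_and_or, not_le]

lemma not_inside_self (hp : p ∈ α.crossings) : ¬ α.Inside p p := by
  obtain ⟨x, y, hxy, hx, hy⟩ := GenericLoop.mem_crossings.1 hp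
  exact fun h => not_mem_arc_self hx (h x hx)

lemma not_outside_self (hp : p ∈ α.crossings) : ¬ α.Outside p p := by
  obtain ⟨x, y, hxy, hx, hy⟩ := GenericLoop.mem_crossings.1 hp
  exact fun h => h x hx ((mem_carc_iff hp).2 (Or.inr hx))

lemma Inside.not_outside (hq : q ∈ α.crossings) (h : α.Inside q p) : ¬ α.Outside q p := by
  obtain ⟨x, y, hxy, hx, hy⟩ := GenericLoop.mem_crossings.1 hq
  exact fun h' => h' x hx (arc_subset_carc (h x hx))

lemma Inside.outside (hp : p ∈ α.crossings) (hq : q ∈ α.crossings) (h : α.Inside p q) :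
    α.Outside q p := by
  obtain ⟨s, hs⟩ := α.exists_lift
  obtain ⟨t, u, h1⟩ := exists_visitsFrom hs hp
  obtain ⟨t', u', h2⟩ := exists_visitsFrom hs hq
  rw [inside_iff h2 h1] at h
  rw [outside_iff h1 h2]
  exact ⟨Or.inl h.1, Or.inr h.2⟩

lemma Inside.asymm (hp : p ∈ α.crossings) (hq : q ∈ α.crossings) (h : α.Inside p q) :
    ¬ α.Inside q p := fun h' => h'.not_outside hq (h.outside hp hq)

/-- Seen from the base point, the visits of `q` come both before those of `p`, both after them, or
one on each side; in the last case `p` is nested in `q`, and otherwise the arcs are disjoint. -/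
lemma Outside.inside_or (hp : p ∈ α.crossings) (hq : q ∈ α.crossings) (h : α.Outside q p) :
    α.Inside p q ∨ α.Outside p q := by
  obtain ⟨s, hs⟩ := α.exists_lift
  obtain ⟨t, u, h1⟩ := exists_visitsFrom hs hp
  obtain ⟨t', u', h2⟩ := exists_visitsFrom hs hq
  rw [outside_iff h1 h2] at h
  rw [inside_iff h2 h1, outside_iff h2 h1]
  obtain ⟨_, a1, a2, a3, _⟩ := h1
  obtain ⟨_, b1, b2, b3, _⟩ := h2
  grind

lemma Inside.trans {r : S} (hp : p ∈ α.crossings) (hq : q ∈ α.crossings) (hr : r ∈ α.crossings)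
    (h : α.Inside p q) (h' : α.Inside q r) : α.Inside p r := by
  obtain ⟨s, hs⟩ := α.exists_lift
  obtain ⟨t, u, h1⟩ := exists_visitsFrom hs hp
  obtain ⟨t', u', h2⟩ := exists_visitsFrom hs hq
  obtain ⟨t'', u'', h3⟩ := exists_visitsFrom hs hr
  rw [inside_iff h2 h1] at h
  rw [inside_iff h3 h2] at h'
  rw [inside_iff h3 h1]
  exact ⟨h'.1.trans h.1, h.2.trans h'.2⟩

/-- Velocities are attached to real parameters. The loop is smooth at a crossing, so its periodicity
passes to the derivative there. -/
lemma vel_shift (hp : p ∈ α.crossings) (h : α.toFun (Circle.exp t) = p) (k : ℤ) :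
    vel α.toFun (t + k * (2 * Real.pi)) = vel α.toFun t := by
  have hd : MDifferentiableAt 𝓘(ℝ, ℝ) (𝓡∂ 2) (angular α.toFun)
      (1 * (t + k * (2 * Real.pi)) + -(k * (2 * Real.pi))) := by
    rw [one_mul, add_neg_cancel_right]
    exact (α.smooth_crossing t (h ▸ GenericLoop.mem_crossings.1 hp)).mdifferentiableAt (by simp)
  have := vel_comp_affine (γ' := α.toFun) (y := t + k * (2 * Real.pi)) one_pos hd
    fun x hx => by
      have := Circle.exp_add_int_mul x (-k)
      push_cast at this
      rw [angular, angular, one_mul, ← this]; congr 2; ring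
  rw [this, one_smul, one_mul, add_neg_cancel_right]

/-- All pairs of parameters of the two visits differ by a common multiple of the period, so the
existential statement defining the sign may be tested on any single pair. -/
lemma crossingSign_eq_one_iff (h : α.Visits p t u) :
    α.crossingSign p = 1 ↔ 0 < planeDet (vel α.toFun t) (vel α.toFun u) := by
  have : α.crossingSign p = 1 ↔
      ∃ t u, α.Visits p t u ∧ 0 < planeDet (vel α.toFun t) (vel α.toFun u) := by
    unfold crossingSign
    split_ifs with h1
    · simp [h1]
    · simp only [h1, iff_false]; decide
  rw [this]
  refine ⟨?_, fun h' => ⟨t, u, h, h'⟩⟩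
  rintro ⟨t', u', h', hd⟩
  obtain ⟨k, rfl, rfl⟩ := h.eq_shift h'
  obtain ⟨s, h⟩ := h
  rwa [vel_shift h'.mem_crossings h.2.2.2.2.1, vel_shift h'.mem_crossings h.2.2.2.2.2] at hd

end PointedLoop

end Arcs

/-! ### Loops obtained by collapsing arcs -/

lemma exists_Ioo_of_nhds {A : Set Circle} {v : ℝ} (h : A ∈ nhds (Circle.exp v)) :
    ∃ δ > 0, ∀ y ∈ Set.Ioo (v - δ) (v + δ), Circle.exp y ∈ A := by
  obtain ⟨δ, hδ, H⟩ := Metric.mem_nhds_iff.1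
    (Circle.exp.continuous.continuousAt.preimage_mem_nhds h)
  exact ⟨δ, hδ, fun y hy => H (by rwa [Real.ball_eq_Ioo])⟩

/-- Immediately to the right of an interior point of `A` there are points of `A`, so the value of
`c` there is exceeded at every later parameter, even one in a gap. Surviving crossings can thus
serve as markers for the order of parameters. -/
lemma IsCollapse.lt_right_of_nhds {A : Set Circle} {c : ℝ → ℝ} {v x : ℝ} (hc : IsCollapse A c)
    (h : A ∈ nhds (Circle.exp v)) (hx : v < x) : c v < c x := by
  obtain ⟨δ, hδ, H⟩ := exists_Ioo_of_nhds h
  have h1 : 0 < min δ (x - v) := lt_min hδ (by linarith)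
  refine hc.lt_of_mem (u := v + min δ (x - v) / 2) (by linarith) ?_ (H _ ⟨?_, ?_⟩)
  · linarith [min_le_right δ (x - v)]
  · linarith
  · linarith [min_le_left δ (x - v)]

lemma IsCollapse.lt_left_of_nhds {A : Set Circle} {c : ℝ → ℝ} {v x : ℝ} (hc : IsCollapse A c)
    (h : A ∈ nhds (Circle.exp v)) (hx : x < v) : c x < c v := by
  obtain ⟨δ, hδ, H⟩ := exists_Ioo_of_nhds h
  have h1 : 0 < min δ (v - x) := lt_min hδ (by linarith)
  refine hc.lt_of_mem (u := v - min δ (v - x) / 2) ?_ (by linarith) (H _ ⟨?_, ?_⟩)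
  · linarith [min_le_right δ (v - x)]
  · linarith [min_le_left δ (v - x)]
  · linarith

section SubLoops

variable {S : Type*} [TopologicalSpace S] [ChartedSpace (EuclideanHalfSpace 2) S]

open PointedLoop

/-- Up to the ambient homeomorphism `g`, the pointed loop `β` traverses `α` along `A` by means of
the collapse map `c`, and the crossings in `N` are the ones that survive. -/
structure SubLoop (α β : PointedLoop S) (g : S ≃ₜ S) (A : Set Circle) (c : ℝ → ℝ)
    (N : Finset S) : Prop where
  iso : IsIsotopyEnd g
  closed : IsClosed A
  collapse : IsCollapse A c
  map : ∀ t, Circle.exp t ∈ A → β.toFun (Circle.exp (c t)) = g (α.toFun (Circle.exp t))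
  N_sub : N ⊆ α.crossings
  crossings : ∀ y, y ∈ β.crossings ↔ ∃ q ∈ N, g q = y
  nhds : ∀ q ∈ N, ∀ z, α.toFun z = q → A ∈ nhds z
  visits : ∀ q ∈ N, ∀ t u, α.Visits q t u → β.Visits (g q) (c t) (c u)
  gap : ∀ s t, s < t → c s = c t → β.toFun (Circle.exp (c s)) ∉ β.crossings

namespace SubLoop

variable {α β : PointedLoop S} {g : S ≃ₜ S} {A : Set Circle} {c : ℝ → ℝ} {N : Finset S}
  {p q r : S} {x v : ℝ}

lemma exists_Ioo (h : SubLoop α β g A c N) (hq : q ∈ N) (hv : α.toFun (Circle.exp v) = q) :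
    ∃ δ > 0, ∀ y ∈ Set.Ioo (v - δ) (v + δ), Circle.exp y ∈ A :=
  exists_Ioo_of_nhds (h.nhds q hq _ hv)

lemma lt_right (h : SubLoop α β g A c N) (hq : q ∈ N) (hv : α.toFun (Circle.exp v) = q)
    (hx : v < x) : c v < c x := h.collapse.lt_right_of_nhds (h.nhds q hq _ hv) hx

lemma lt_left (h : SubLoop α β g A c N) (hq : q ∈ N) (hv : α.toFun (Circle.exp v) = q)
    (hx : x < v) : c x < c v := h.collapse.lt_left_of_nhds (h.nhds q hq _ hv) hx

lemma lt_iff_right (h : SubLoop α β g A c N) (hq : q ∈ N) (hv : α.toFun (Circle.exp v) = q) :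
    c v < c x ↔ v < x := ⟨h.collapse.mono.reflect_lt, h.lt_right hq hv⟩

lemma lt_iff_left (h : SubLoop α β g A c N) (hq : q ∈ N) (hv : α.toFun (Circle.exp v) = q) :
    c x < c v ↔ x < v := ⟨h.collapse.mono.reflect_lt, h.lt_left hq hv⟩

/-- The ends of the arc are visits of a surviving crossing, hence interior to `A`; there `c`
preserves and reflects strict comparison with every parameter, including those in gaps. -/
lemma mem_arc (h : SubLoop α β g A c N) (hq : q ∈ N) (x : ℝ) :
    Circle.exp (c x) ∈ β.arc (g q) ↔ Circle.exp x ∈ α.arc q := by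
  obtain ⟨t, u, hv⟩ := exists_visits (h.N_sub hq)
  have hv' := h.visits q hq t u hv
  rw [hv.arc_eq, hv'.arc_eq, mem_exp_image, mem_exp_image]
  obtain ⟨s, -, -, -, -, ht, hu⟩ := hv
  refine exists_congr fun k => ?_
  rw [← deg_int h.collapse.deg, Set.mem_Ioo, Set.mem_Ioo, h.lt_iff_right hq ht,
    h.lt_iff_left hq hu]

lemma mem_carc (h : SubLoop α β g A c N) (hq : q ∈ N) (x : ℝ) :
    Circle.exp (c x) ∈ β.carc (g q) ↔ Circle.exp x ∈ α.carc q := by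
  obtain ⟨t, u, hv⟩ := exists_visits (h.N_sub hq)
  have hv' := h.visits q hq t u hv
  rw [hv.carc_eq, hv'.carc_eq, mem_exp_image, mem_exp_image]
  obtain ⟨s, -, -, -, -, ht, hu⟩ := hv
  refine exists_congr fun k => ?_
  rw [← deg_int h.collapse.deg, Set.mem_Icc, Set.mem_Icc, ← not_lt, ← not_lt, ← not_lt, ← not_lt,
    h.lt_iff_right hq hu, h.lt_iff_left hq ht]

lemma mem_of_over (h : SubLoop α β g A c N) (hq : q ∈ N) {z : Circle} (hz : α.toFun z = q) :
    z ∈ A := mem_of_mem_nhds (h.nhds q hq z hz)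

lemma mem_crossings (h : SubLoop α β g A c N) (hq : q ∈ N) : g q ∈ β.crossings :=
  (h.crossings _).2 ⟨q, hq, rfl⟩

lemma mem_crossings_iff (h : SubLoop α β g A c N) : g q ∈ β.crossings ↔ q ∈ N := by
  rw [h.crossings]
  exact ⟨fun ⟨r, hr, he⟩ => g.injective he ▸ hr, fun hq => ⟨q, hq, rfl⟩⟩

/-- The points of `β` over a crossing are the images of the points of `α`. -/
lemma forall_over (h : SubLoop α β g A c N) (hr : r ∈ N) {P : Circle → Prop} :
    (∀ w, β.toFun w = g r → P w) ↔ ∀ v, α.toFun (Circle.exp v) = r → P (Circle.exp (c v)) := by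
  constructor
  · intro H v hv
    exact H _ (by rw [h.map v (h.mem_of_over hr hv), hv])
  · intro H w hw
    obtain ⟨v, hv, rfl⟩ := h.collapse.exists_exp_eq h.closed w
    rw [h.map v hv] at hw
    exact H v (g.injective hw)

lemma inside_iff (h : SubLoop α β g A c N) (hq : q ∈ N) (hr : r ∈ N) :
    β.Inside (g r) (g q) ↔ α.Inside r q := by
  rw [Inside, h.forall_over hr]
  simp only [h.mem_arc hq]
  exact ⟨fun H z hz => by obtain ⟨v, rfl⟩ := Circle.exp_surjective z; exact H v hz,
    fun H v hv => H _ hv⟩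

lemma outside_iff (h : SubLoop α β g A c N) (hq : q ∈ N) (hr : r ∈ N) :
    β.Outside (g r) (g q) ↔ α.Outside r q := by
  rw [Outside, h.forall_over hr]
  simp only [h.mem_carc hq]
  exact ⟨fun H z hz => by obtain ⟨v, rfl⟩ := Circle.exp_surjective z; exact H v hz,
    fun H v hv => H _ hv⟩

/-- Near both visits of a surviving crossing all parameters belong to `A`, so `c` is strictly
increasing there and `planeDet_pos_iff` applies. -/
lemma crossingSign_eq [IsManifold (𝓡∂ 2) ∞ S] (hS : IsOrientedAtlas S)
    (h : SubLoop α β g A c N) (hq : q ∈ N) : β.crossingSign (g q) = α.crossingSign q := by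
  obtain ⟨t, u, hv⟩ := exists_visits (h.N_sub hq)
  have hv' := h.visits q hq t u hv
  have key : β.crossingSign (g q) = 1 ↔ α.crossingSign q = 1 := by
    rw [crossingSign_eq_one_iff hv, crossingSign_eq_one_iff hv']
    obtain ⟨s, hv⟩ := hv
    obtain ⟨s', hv'⟩ := hv'
    have ht := hv.2.2.2.2.1
    have hu := hv.2.2.2.2.2
    obtain ⟨δ₁, hδ₁, H₁⟩ := h.exists_Ioo hq ht
    obtain ⟨δ₂, hδ₂, H₂⟩ := h.exists_Ioo hq hu
    have mono : ∀ a b, (∀ y ∈ Set.Ioo a b, Circle.exp y ∈ A) → StrictMonoOn c (Set.Ioo a b) := by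
      intro a b H y hy z hz hyz
      exact h.collapse.lt_of_mem (u := (y + z) / 2) (by linarith) (by linarith)
        (H _ ⟨by linarith [hy.1], by linarith [hz.2]⟩)
    have H₁' : ∀ y ∈ Set.Ioo (t - min δ₁ δ₂) (t + min δ₁ δ₂), Circle.exp y ∈ A := fun y hy =>
      H₁ y ⟨by linarith [hy.1, min_le_left δ₁ δ₂], by linarith [hy.2, min_le_left δ₁ δ₂]⟩
    have H₂' : ∀ y ∈ Set.Ioo (u - min δ₁ δ₂) (u + min δ₁ δ₂), Circle.exp y ∈ A := fun y hy =>
      H₂ y ⟨by linarith [hy.1, min_le_right δ₁ δ₂], by linarith [hy.2, min_le_right δ₁ δ₂]⟩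
    exact (planeDet_pos_iff hS α.toGenericLoop β.toGenericLoop h.iso h.collapse.cont
      (lt_min hδ₁ hδ₂) (mono _ _ H₁') (mono _ _ H₂') (fun y hy => h.map y (H₁' y hy))
      (fun y hy => h.map y (H₂' y hy)) (VisitsFrom.exp_ne hv) (ht.trans hu.symm)
      (VisitsFrom.exp_ne hv')).symm
  by_cases h1 : α.crossingSign q = 1
  · rw [key.2 h1, h1]
  · rw [(Int.units_eq_one_or _).resolve_left h1, (Int.units_eq_one_or _).resolve_left (mt key.1 h1)]

/-- A loop traversing the subloop traverses the original loop. -/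
lemma traverses (h : SubLoop α β g A c N) {B D : Set Circle} {γ : Circle → S}
    (hγ : Traverses β.toFun B γ)
    (hB : ∀ z ∈ B, B ∉ _root_.nhds z → β.toFun z ∈ β.crossings)
    (hD : ∀ t, Circle.exp t ∈ D ↔ Circle.exp t ∈ A ∧ Circle.exp (c t) ∈ B) :
    Traverses (g ∘ α.toFun) D γ := by
  obtain ⟨c', hc', H⟩ := traverses_iff.1 hγ
  refine traverses_iff.2 ⟨c' ∘ c, h.collapse.comp h.closed hc' (fun s t hst he hs => ?_) hD,
    fun t ht => ?_⟩
  · by_contra hn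
    exact h.gap s t hst he (hB _ hs hn)
  · obtain ⟨h1, h2⟩ := (hD t).1 ht
    simp only [Function.comp_apply]
    rw [H _ h2, h.map t h1]

end SubLoop

/-- Only the ends of an arc can be frontier points, and they lie over the crossing. This is the
hypothesis on `B` in `SubLoop.traverses`. -/
lemma PointedLoop.carc_frontier {β : PointedLoop S} {q : S} (hq : q ∈ β.crossings) {z : Circle}
    (hz : z ∈ β.carc q) (hn : β.carc q ∉ nhds z) : β.toFun z ∈ β.crossings := by
  rcases (mem_carc_iff hq).1 hz with h | h
  · exact absurd (Filter.mem_of_superset ((isOpen_arc hq).mem_nhds h) arc_subset_carc) hn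
  · rwa [h]

lemma PointedLoop.compl_arc_frontier {β : PointedLoop S} {q : S} (hq : q ∈ β.crossings)
    {z : Circle} (hz : z ∈ (β.arc q)ᶜ) (hn : (β.arc q)ᶜ ∉ nhds z) :
    β.toFun z ∈ β.crossings := by
  by_cases h : z ∈ β.carc q
  · rwa [((mem_carc_iff hq).1 h).resolve_left hz]
  · refine absurd (Filter.mem_of_superset ((isClosed_carc hq).isOpen_compl.mem_nhds h) ?_) hn
    exact Set.compl_subset_compl.2 arc_subset_carc

/-! ### The inner and the outer loop of a crossing -/

section Arc

variable {α : PointedLoop S} {p : S} {t u : ℝ} {b : Circle → S} {c : ℝ → ℝ}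

lemma IsCollapse.arc_lt (hc : IsCollapse (Circle.exp '' Set.Icc t u) c) {x y : ℝ}
    (hx : t ≤ x) (hy : y ≤ u) (hxy : x < y) : c x < c y :=
  hc.lt_of_mem (u := (x + y) / 2) (by linarith) (by linarith)
    ⟨_, ⟨by linarith, by linarith⟩, rfl⟩

/-- No point strictly between `u` and `t + 2π` is on the arc, so this gap is collapsed to one point.
-/
lemma IsCollapse.arc_end (hc : IsCollapse (Circle.exp '' Set.Icc t u) c) (htu : t < u)
    (hu : u < t + 2 * Real.pi) : c u = c t + 2 * Real.pi := by
  rw [← hc.deg, hc.fiber _ _ hu]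
  intro x hx hm
  obtain ⟨k, hk⟩ := mem_exp_image.1 hm
  have := int_eq_zero_of_small (k := k) (by linarith [hk.1, hx.2]) (by linarith [hk.2, hx.1])
  subst this
  simp at hk
  linarith [hk.2, hx.1]

/-- A point of an arc in the fibre of an inner point. -/
lemma IsCollapse.arc_inj (hc : IsCollapse (Circle.exp '' Set.Icc t u) c) (htu : t < u)
    (hu : u < t + 2 * Real.pi) {x y : ℝ} (hx : x ∈ Set.Icc t u) (hy : y ∈ Set.Icc t u)
    (h : Circle.exp (c x) = Circle.exp (c y)) : x = y ∨ (x = t ∧ y = u) ∨ (x = u ∧ y = t) := by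
  obtain ⟨k, hk⟩ := Circle.exp_eq_exp.1 h
  have hend := hc.arc_end htu hu
  have hpi := two_pi_pos
  have m : ∀ z ∈ Set.Icc t u, (z ≤ t ∨ c t < c z) ∧ (u ≤ z ∨ c z < c u) ∧ c t ≤ c z ∧ c z ≤ c u :=
    fun z hz => ⟨or_iff_not_imp_left.2 fun h => hc.arc_lt le_rfl hz.2 (not_le.1 h),
      or_iff_not_imp_left.2 fun h => hc.arc_lt hz.1 le_rfl (not_le.1 h), hc.mono hz.1,
      hc.mono hz.2⟩
  obtain ⟨x1, x2, x3, x4⟩ := m x hx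
  obtain ⟨y1, y2, y3, y4⟩ := m y hy
  have h4 : (k : ℝ) ≤ 1 := by nlinarith
  have h5 : (-1 : ℝ) ≤ k := by nlinarith
  have h4' : k ≤ 1 := by exact_mod_cast h4
  have h5' : -1 ≤ k := by exact_mod_cast h5
  have : k = -1 ∨ k = 0 ∨ k = 1 := by omega
  rcases this with rfl | rfl | rfl
  · push_cast at hk
    right; left
    exact ⟨le_antisymm (x1.resolve_right (by linarith)) hx.1,
      le_antisymm hy.2 (y2.resolve_right (by linarith))⟩
  · left
    simp at hk
    rcases lt_trichotomy x y with h | h | h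
    · exact absurd hk (hc.arc_lt hx.1 hy.2 h).ne
    · exact h
    · exact absurd hk (hc.arc_lt hy.1 hx.2 h).ne'
  · push_cast at hk
    right; right
    exact ⟨le_antisymm hx.2 (x2.resolve_right (by linarith)),
      le_antisymm (y1.resolve_right (by linarith)) hy.1⟩

/-- The crossings of the loop cut out by an arc. -/
lemma crossingSet_arc (htu : t < u) (hu : u < t + 2 * Real.pi)
    (hc : IsCollapse (Circle.exp '' Set.Icc t u) c)
    (hb : ∀ x, Circle.exp x ∈ Circle.exp '' Set.Icc t u →
      b (Circle.exp (c x)) = α.toFun (Circle.exp x))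
    (ht : α.toFun (Circle.exp t) = p) (hu' : α.toFun (Circle.exp u) = p) (y : S) :
    y ∈ crossingSet b ↔ y ∈ crossingSet α.toFun ∧
      ∀ z, α.toFun z = y → z ∈ Circle.exp '' Set.Ioo t u := by
  have hA := isClosed_exp_image_Icc t u
  have hpi := two_pi_pos
  have lift : ∀ z, ∃ x ∈ Set.Icc t u, Circle.exp (c x) = z := by
    intro z
    obtain ⟨x, ⟨v, hv, hvx⟩, rfl⟩ := hc.exists_exp_eq hA z
    obtain ⟨k, rfl⟩ := Circle.exp_eq_exp.1 hvx.symm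
    exact ⟨v, hv, by rw [deg_int hc.deg, Circle.exp_add_int_mul]⟩
  have hend := hc.arc_end htu hu
  have htu' : Circle.exp t ≠ Circle.exp u := fun e => htu.ne
    (Circle.exp_injOn_half_open (a := t) ⟨le_rfl, by linarith⟩ ⟨htu.le, hu⟩ e)
  have hinj : ∀ x ∈ Set.Icc t u, ∀ y ∈ Set.Icc t u, Circle.exp x = Circle.exp y → x = y :=
    fun x hx y hy e => Circle.exp_injOn_half_open (a := t) ⟨hx.1, by linarith [hx.2]⟩
      ⟨hy.1, by linarith [hy.2]⟩ e
  constructor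
  · rintro ⟨z, w, hzw, hz, hw⟩
    obtain ⟨x, hx, rfl⟩ := lift z
    obtain ⟨x', hx', rfl⟩ := lift w
    rw [hb x ⟨x, hx, rfl⟩] at hz
    rw [hb x' ⟨x', hx', rfl⟩] at hw
    have hxx : x ≠ x' := by rintro rfl; exact hzw rfl
    have hexx : Circle.exp x ≠ Circle.exp x' := fun e => hxx (hinj x hx x' hx' e)
    -- The two visits of `p` are the ends of the arc and become one point of the new loop, so `p`
    -- ceases to be a crossing.
    have hyp : y ≠ p := by
      rintro rfl
      have e1 : ∀ v ∈ Set.Icc t u, α.toFun (Circle.exp v) = y → v = t ∨ v = u := by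
        intro v hv hvy
        rcases α.double _ _ _ (hvy.trans ht.symm) (ht.trans hu'.symm) with e | e | e
        · exact Or.inl (hinj _ hv _ ⟨le_rfl, htu.le⟩ e)
        · exact absurd e htu'
        · exact Or.inr (hinj _ hv _ ⟨htu.le, le_rfl⟩ e)
      have e2 : Circle.exp (c t) = Circle.exp (c u) := by rw [hend, Circle.exp_add_two_pi]
      rcases e1 x hx hz with rfl | rfl <;> rcases e1 x' hx' hw with rfl | rfl
      · exact hxx rfl
      · exact hzw e2
      · exact hzw e2.symm
      · exact hxx rfl
    refine ⟨⟨_, _, hexx, hz, hw⟩, fun z hz' => ?_⟩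
    have hin : ∀ v ∈ Set.Icc t u, α.toFun (Circle.exp v) = y →
        Circle.exp v ∈ Circle.exp '' Set.Ioo t u := by
      intro v hv hvy
      refine ⟨v, ⟨lt_of_le_of_ne hv.1 ?_, lt_of_le_of_ne hv.2 ?_⟩, rfl⟩
      · rintro rfl; exact hyp (hvy.symm.trans ht)
      · rintro rfl; exact hyp (hvy.symm.trans hu')
    rcases α.double _ _ _ (hz'.trans hz.symm) (hz.trans hw.symm) with e | e | e
    · rw [e]; exact hin x hx hz
    · exact absurd e hexx
    · rw [e]; exact hin x' hx' hw
  · rintro ⟨⟨z, w, hzw, hz, hw⟩, H⟩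
    obtain ⟨x, hx, rfl⟩ := H z hz
    obtain ⟨x', hx', rfl⟩ := H w hw
    have hx1 := Set.Ioo_subset_Icc_self hx
    have hx1' := Set.Ioo_subset_Icc_self hx'
    refine ⟨Circle.exp (c x), Circle.exp (c x'), fun e => ?_, ?_, ?_⟩
    · rcases hc.arc_inj htu hu hx1 hx1' e with rfl | ⟨rfl, -⟩ | ⟨rfl, -⟩
      · exact hzw rfl
      · exact hx.1.ne rfl
      · exact hx.2.ne rfl
    · rw [hb x ⟨x, hx1, rfl⟩, hz]
    · rw [hb x' ⟨x', hx1', rfl⟩, hw]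

/-- Up to periods the gap is the only fibre with more than one point, and its image is the point
where the two ends of the arc are glued. -/
lemma gap_arc (htu : t < u) (hu : u < t + 2 * Real.pi)
    (hc : IsCollapse (Circle.exp '' Set.Icc t u) c)
    (hb : ∀ x, Circle.exp x ∈ Circle.exp '' Set.Icc t u →
      b (Circle.exp (c x)) = α.toFun (Circle.exp x))
    (hu' : α.toFun (Circle.exp u) = p) {x y : ℝ} (hxy : x < y) (h : c x = c y) :
    b (Circle.exp (c x)) = p := by
  obtain ⟨k, hk⟩ := exists_int_shift_mem_Ico t x
  set x' := x + k * (2 * Real.pi) with hx'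
  have hcx : Circle.exp (c x) = Circle.exp (c x') := by
    rw [hx', deg_int hc.deg, Circle.exp_add_int_mul]
  have hux : u ≤ x' := by
    by_contra! hlt
    set m := min (y + k * (2 * Real.pi)) u with hm
    have h1 : x' < m := lt_min (by linarith) hlt
    have h2 := hc.arc_lt hk.1 (min_le_right _ _) h1
    have h3 := hc.mono (min_le_left (y + k * (2 * Real.pi)) u)
    rw [← hm, deg_int hc.deg, ← h, ← deg_int hc.deg] at h3
    exact absurd h3 h2.not_ge
  have h4 : c x' = c u := by
    refine le_antisymm ?_ (hc.mono hux)
    rw [hc.arc_end htu hu, ← hc.deg]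
    exact hc.mono hk.2.le
  rw [hcx, h4, hb u ⟨u, ⟨htu.le, le_rfl⟩, rfl⟩, hu']

end Arc

end SubLoops

section InnerOuter

variable {S : Type*} [TopologicalSpace S] [ChartedSpace (EuclideanHalfSpace 2) S]

namespace PointedLoop

variable {α β : PointedLoop S} {p q : S}

lemma isInner_iff (hp : p ∈ α.crossings) {b : PointedLoopClass S} :
    α.IsInner p b ↔ ∃ β : PointedLoop S, ⟦β⟧ = b ∧ Traverses α.toFun (α.carc p) β.toFun ∧
      β.toFun β.base = p := by
  constructor
  · rintro ⟨β, hb, t, u, hv, h1, h2⟩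
    exact ⟨β, hb, by rwa [hv.carc_eq], h2⟩
  · rintro ⟨β, hb, h1, h2⟩
    obtain ⟨t, u, hv⟩ := exists_visits hp
    exact ⟨β, hb, t, u, hv, by rwa [← hv.carc_eq], h2⟩

lemma isOuter_iff (hp : p ∈ α.crossings) {b : PointedLoopClass S} :
    α.IsOuter p b ↔ ∃ β : PointedLoop S, ⟦β⟧ = b ∧ Traverses α.toFun (α.arc p)ᶜ β.toFun ∧
      β.toFun β.base = α.toFun α.base := by
  constructor
  · rintro ⟨β, hb, t, u, hv, h1, h2⟩
    exact ⟨β, hb, by rwa [hv.compl_arc_eq], h2⟩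
  · rintro ⟨β, hb, h1, h2⟩
    obtain ⟨t, u, hv⟩ := exists_visits hp
    exact ⟨β, hb, t, u, hv, by rwa [← hv.compl_arc_eq], h2⟩

open Classical in
/-- The crossings inside `p`. -/
def innerSet (α : PointedLoop S) (p : S) : Finset S := α.crossings.filter fun q => α.Inside q p

open Classical in
/-- The crossings outside `p`. -/
def outerSet (α : PointedLoop S) (p : S) : Finset S := α.crossings.filter fun q => α.Outside q p

lemma mem_innerSet : q ∈ α.innerSet p ↔ q ∈ α.crossings ∧ α.Inside q p := by
  simp [innerSet]

lemma mem_outerSet : q ∈ α.outerSet p ↔ q ∈ α.crossings ∧ α.Outside q p := by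
  simp [outerSet]

lemma base_eq_of_map {x : Circle} (h : β.toFun β.base = β.toFun x) : x = β.base := by
  by_contra hne
  exact β.base_not_crossing ⟨x, β.base, hne, h.symm, rfl⟩

lemma Visits.outer_arc_eq {t u : ℝ} (h : α.Visits p t u) :
    (α.carc p)ᶜ = Circle.exp '' Set.Ioo u (t + 2 * Real.pi) := by
  ext z
  have hz : z ∈ (α.carc p)ᶜ ↔ z ∈ (α.arc p)ᶜ ∧ α.toFun z ≠ p := by
    rw [Set.mem_compl_iff, mem_carc_iff h.mem_crossings, not_or, Set.mem_compl_iff]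
  rw [hz, h.compl_arc_eq]
  obtain ⟨s, h⟩ := h
  change α.VisitsFrom s p t u at h
  obtain ⟨hs, h1, h2, h3, h4, h5⟩ := id h
  constructor
  · rintro ⟨⟨x, hx, rfl⟩, hne⟩
    refine ⟨x, ⟨lt_of_le_of_ne hx.1 ?_, lt_of_le_of_ne hx.2 ?_⟩, rfl⟩
    · rintro rfl; exact hne h5
    · rintro rfl; exact hne (by rw [Circle.exp_add_two_pi, h4])
  · rintro ⟨x, hx, rfl⟩
    refine ⟨⟨x, Set.Ioo_subset_Icc_self hx, rfl⟩, fun hp => ?_⟩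
    rcases h.eq_or hp with e | e
    · have := Circle.exp_injOn_Ioc (a := u) (b := u + 2 * Real.pi) (by linarith)
        ⟨hx.1, by linarith [hx.2]⟩ (show t + 2 * Real.pi ∈ _ from ⟨by linarith, by linarith⟩)
        (e.trans (Circle.exp_add_two_pi t).symm)
      exact hx.2.ne this
    · have := Circle.exp_injOn_half_open (a := u) ⟨hx.1.le, by linarith [hx.2]⟩
        ⟨le_rfl, by linarith⟩ e
      exact hx.1.ne' this

lemma crossingSet_inner {b : Circle → S} {c : ℝ → ℝ} (hp : p ∈ α.crossings)
    (hc : IsCollapse (α.carc p) c)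
    (hb : ∀ x, Circle.exp x ∈ α.carc p → b (Circle.exp (c x)) = α.toFun (Circle.exp x)) (y : S) :
    y ∈ crossingSet b ↔ y ∈ α.innerSet p := by
  obtain ⟨t, u, hv⟩ := exists_visits hp
  rw [hv.carc_eq] at hc hb
  rw [mem_innerSet, GenericLoop.mem_crossings, Inside, hv.arc_eq]
  obtain ⟨s, -, h1, h2, h3, h4, h5⟩ := hv
  exact crossingSet_arc h2 (by linarith) hc hb h4 h5 y

lemma crossingSet_outer {b : Circle → S} {c : ℝ → ℝ} (hp : p ∈ α.crossings)
    (hc : IsCollapse (α.arc p)ᶜ c)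
    (hb : ∀ x, Circle.exp x ∈ (α.arc p)ᶜ → b (Circle.exp (c x)) = α.toFun (Circle.exp x))
    (y : S) : y ∈ crossingSet b ↔ y ∈ α.outerSet p := by
  obtain ⟨t, u, hv⟩ := exists_visits hp
  rw [hv.compl_arc_eq] at hc hb
  have : α.Outside y p ↔ ∀ z, α.toFun z = y → z ∈ (α.carc p)ᶜ := Iff.rfl
  rw [mem_outerSet, GenericLoop.mem_crossings, this, hv.outer_arc_eq]
  obtain ⟨s, -, h1, h2, h3, h4, h5⟩ := hv
  exact crossingSet_arc (by linarith) (by linarith) hc hb h5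
    (by rw [Circle.exp_add_two_pi, h4]) y

/-- The inner loop of a crossing as a subloop. -/
lemma exists_subLoop_inner (hp : p ∈ α.crossings)
    (h : Traverses α.toFun (α.carc p) β.toFun) (hbase : β.toFun β.base = p) :
    ∃ c, SubLoop α β (Homeomorph.refl S) (α.carc p) c (α.innerSet p) := by
  obtain ⟨c, hc, hb⟩ := traverses_iff.1 h
  have hcr := crossingSet_inner hp hc hb
  obtain ⟨t, u, hv⟩ := exists_visits hp
  have hv0 := hv
  have hca := hv.carc_eq
  obtain ⟨s, hv⟩ := hv
  change α.VisitsFrom s p t u at hv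
  obtain ⟨hs, h1, h2, h3, h4, h5⟩ := id hv
  have hc' := hc
  rw [hca] at hc'
  have hend := hc'.arc_end h2 (by linarith)
  -- The base point of the inner loop is the glued end of the arc. Counting from its lift `c t`, the
  -- crossings on the arc are met in the same order as in `α`, so the first and second visits are
  -- preserved.
  have hct : Circle.exp (c t) = β.base := by
    refine base_eq_of_map ?_
    rw [hb t (by rw [hca]; exact ⟨t, ⟨le_rfl, h2.le⟩, rfl⟩), hbase, h4]
  have hnhds : ∀ q ∈ α.innerSet p, ∀ z, α.toFun z = q → α.carc p ∈ nhds z := fun q hq z hz =>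
    Filter.mem_of_superset ((isOpen_arc hp).mem_nhds ((mem_innerSet.1 hq).2 z hz)) arc_subset_carc
  refine ⟨c, IsIsotopyEnd.refl, isClosed_carc hp, hc, hb,
    fun q hq => (mem_innerSet.1 hq).1, fun y => ?_,
    hnhds, fun q hq t' u' hv' => ?_, fun x y hxy he => ?_⟩
  · rw [GenericLoop.mem_crossings, hcr]; simp
  · obtain ⟨k, hk⟩ := hv'.exists_from hs
    have hin := (inside_iff hv hk).1 (mem_innerSet.1 hq).2
    have hk' := hk.2.2.1
    have e1 := hc'.arc_lt le_rfl (by linarith) hin.1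
    have e2 := hc'.arc_lt (by linarith) (by linarith) hk'
    have e3 := hc'.arc_lt (by linarith) le_rfl hin.2
    have e4 : β.VisitsFrom (c t) q (c (t' + k * (2 * Real.pi))) (c (u' + k * (2 * Real.pi))) := by
      refine ⟨hct, e1, e2, by linarith, ?_, ?_⟩
      · rw [hb _ (mem_of_mem_nhds (hnhds q hq _ hk.2.2.2.2.1)), hk.2.2.2.2.1]
      · rw [hb _ (mem_of_mem_nhds (hnhds q hq _ hk.2.2.2.2.2)), hk.2.2.2.2.2]
    have := e4.visits.shift (-k)
    rw [deg_int hc.deg, deg_int hc.deg] at this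
    push_cast at this
    simpa using this
  · have := gap_arc (p := p) h2 (by linarith) hc' (by rwa [hca] at hb) h5 hxy he
    rw [this, GenericLoop.mem_crossings, hcr, mem_innerSet]
    exact fun hh => not_inside_self hp hh.2

/-- The outer loop of a crossing as a subloop. -/
lemma exists_subLoop_outer (hp : p ∈ α.crossings)
    (h : Traverses α.toFun (α.arc p)ᶜ β.toFun) (hbase : β.toFun β.base = α.toFun α.base) :
    ∃ c, SubLoop α β (Homeomorph.refl S) (α.arc p)ᶜ c (α.outerSet p) := by
  obtain ⟨c, hc, hb⟩ := traverses_iff.1 h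
  have hcr := crossingSet_outer hp hc hb
  obtain ⟨t, u, hv⟩ := exists_visits hp
  have hca := hv.compl_arc_eq
  obtain ⟨s, hv⟩ := hv
  change α.VisitsFrom s p t u at hv
  obtain ⟨hs, h1, h2, h3, h4, h5⟩ := id hv
  have hc' := hc
  rw [hca] at hc'
  have hcs : Circle.exp (c s) = β.base := by
    refine base_eq_of_map ?_
    rw [hb s (by rw [hs]; exact fun hm => base_not_mem_carc hp (arc_subset_carc hm)), hbase, hs]
  have hnhds : ∀ q ∈ α.outerSet p, ∀ z, α.toFun z = q → (α.arc p)ᶜ ∈ nhds z := fun q hq z hz =>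
    Filter.mem_of_superset ((isClosed_carc hp).isOpen_compl.mem_nhds ((mem_outerSet.1 hq).2 z hz))
      (Set.compl_subset_compl.2 arc_subset_carc)
  refine ⟨c, IsIsotopyEnd.refl, (isOpen_arc hp).isClosed_compl, hc, hb,
    fun q hq => (mem_outerSet.1 hq).1,
    fun y => ?_, hnhds, fun q hq t' u' hv' => ?_, fun x y hxy he => ?_⟩
  · rw [GenericLoop.mem_crossings, hcr]; simp
  · obtain ⟨k, hk⟩ := hv'.exists_from hs
    obtain ⟨-, k1, k2, k3, k4, k5⟩ := id hk
    have e1 := hc.lt_left_of_nhds (hnhds q hq _ k4) k1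
    have e2 := hc.lt_left_of_nhds (hnhds q hq _ k5) k2
    have e3 := hc.lt_right_of_nhds (hnhds q hq _ k5) k3
    rw [hc.deg] at e3
    have e4 : β.VisitsFrom (c s) q (c (t' + k * (2 * Real.pi))) (c (u' + k * (2 * Real.pi))) := by
      refine ⟨hcs, e1, e2, e3, ?_, ?_⟩
      · rw [hb _ (mem_of_mem_nhds (hnhds q hq _ k4)), k4]
      · rw [hb _ (mem_of_mem_nhds (hnhds q hq _ k5)), k5]
    have := e4.visits.shift (-k)
    rw [deg_int hc.deg, deg_int hc.deg] at this
    push_cast at this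
    simpa using this
  · have := gap_arc (p := p) (t := u) (u := t + 2 * Real.pi) (by linarith) (by linarith) hc'
      (by rwa [hca] at hb) (by rw [Circle.exp_add_two_pi, h4]) hxy he
    rw [this, GenericLoop.mem_crossings, hcr, mem_outerSet]
    exact fun hh => not_outside_self hp hh.2

lemma exists_inner (hp : p ∈ α.crossings) : ∃ β : PointedLoop S,
    Traverses α.toFun (α.carc p) β.toFun ∧ β.toFun β.base = p := by
  obtain ⟨t, u, hv⟩ := exists_visits hp
  have hca := hv.carc_eq
  obtain ⟨s, hs, h1, h2, h3, h4, h5⟩ := hv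
  obtain ⟨β, hβ⟩ := α.toGenericLoop.exists_traverses_arc h2 (by linarith) (h4.trans h5.symm)
  rw [← hca] at hβ
  obtain ⟨c, hc, hb⟩ := traverses_iff.1 hβ
  have hbt : β.toFun (Circle.exp (c t)) = p := by
    rw [hb t (by rw [hca]; exact ⟨t, ⟨le_rfl, h2.le⟩, rfl⟩), h4]
  refine ⟨⟨β, Circle.exp (c t), ?_⟩, hβ, hbt⟩
  rw [hbt, crossingSet_inner hp hc hb, mem_innerSet]
  exact fun hh => not_inside_self hp hh.2

lemma exists_outer (hp : p ∈ α.crossings) : ∃ β : PointedLoop S,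
    Traverses α.toFun (α.arc p)ᶜ β.toFun ∧ β.toFun β.base = α.toFun α.base := by
  obtain ⟨t, u, hv⟩ := exists_visits hp
  have hca := hv.compl_arc_eq
  obtain ⟨s, hs, h1, h2, h3, h4, h5⟩ := hv
  obtain ⟨β, hβ⟩ := α.toGenericLoop.exists_traverses_arc (t := u) (u := t + 2 * Real.pi)
    (by linarith) (by linarith) (by rw [Circle.exp_add_two_pi, h4, h5])
  rw [← hca] at hβ
  obtain ⟨c, hc, hb⟩ := traverses_iff.1 hβ
  have hbs : β.toFun (Circle.exp (c s)) = α.toFun α.base := by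
    rw [hb s (by rw [hs]; exact fun hm => base_not_mem_carc hp (arc_subset_carc hm)), hs]
  refine ⟨⟨β, Circle.exp (c s), ?_⟩, hβ, hbs⟩
  rw [hbs, crossingSet_outer hp hc hb, mem_outerSet, GenericLoop.mem_crossings]
  exact fun hh => α.base_not_crossing hh.1

/-- Isotopic loops as subloops. -/
lemma exists_subLoop_of_equiv (h : α ≈ β) :
    ∃ g c, SubLoop α β g Set.univ c α.crossings ∧ Circle.exp '' (c '' {t | Circle.exp t = α.base})
      ⊆ {β.base} := by
  obtain ⟨g, hg, f, hf, hfg, hbase⟩ := h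
  -- The map `f` takes parameters of `β` to parameters of `α`, whereas `c` goes in the opposite
  -- direction; hence it lifts the inverse of `f`.
  obtain ⟨c, hc, hm, hd, hcf⟩ := hf.symm
  have hmap : ∀ t, β.toFun (Circle.exp (c t)) = g (α.toFun (Circle.exp t)) := fun t => by
    rw [hfg, ← hcf, f.apply_symm_apply]
  have hb : ∀ t, Circle.exp t = α.base → Circle.exp (c t) = β.base := fun t ht => by
    rw [← hcf, ht, ← hbase, f.symm_apply_apply]
  refine ⟨g, c, ⟨hg, isClosed_univ, IsCollapse.of_strictMono hc hm hd,
     fun t _ => hmap t, subset_rfl,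
    fun y => ?_, fun _ _ _ _ => Filter.univ_mem, fun q hq t u hv => ?_, fun s t hst he => ?_⟩, ?_⟩
  · constructor
    · intro hy
      obtain ⟨z, w, hzw, hz, hw⟩ := GenericLoop.mem_crossings.1 hy
      refine ⟨g.symm y, GenericLoop.mem_crossings.2
        ⟨f z, f w, f.injective.ne hzw, ?_, ?_⟩, g.apply_symm_apply y⟩
      · rw [← hz, hfg, g.symm_apply_apply]
      · rw [← hw, hfg, g.symm_apply_apply]
    · rintro ⟨q, hq, rfl⟩
      obtain ⟨z, w, hzw, hz, hw⟩ := GenericLoop.mem_crossings.1 hq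
      refine GenericLoop.mem_crossings.2 ⟨f.symm z, f.symm w, f.symm.injective.ne hzw, ?_, ?_⟩
      · rw [hfg, f.apply_symm_apply, hz]
      · rw [hfg, f.apply_symm_apply, hw]
  · obtain ⟨s, hs, h1, h2, h3, h4, h5⟩ := hv
    refine ⟨c s, hb s hs, hm h1, hm h2, ?_, by rw [hmap, h4], by rw [hmap, h5]⟩
    rw [← hd]; exact hm h3
  · exact absurd he (hm hst).ne
  · rintro _ ⟨_, ⟨t, ht, rfl⟩, rfl⟩
    exact hb t ht

/-- Two pointed loops traversing the same closed set with the same base point are isotopic. -/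
lemma mk_eq_of_traverses_same {a : Circle → S} {A : Set Circle} (hA : IsClosed A)
    {γ δ : PointedLoop S} (h : Traverses a A γ.toFun) (h' : Traverses a A δ.toFun)
    (hb : δ.toFun δ.base = γ.toFun γ.base) : (⟦γ⟧ : PointedLoopClass S) = ⟦δ⟧ :=
  PointedLoop.mk_eq_of_traverses (g := Homeomorph.refl S) hA IsIsotopyEnd.refl h h' hb

lemma existsUnique_isInner (hp : p ∈ α.crossings) : ∃! b, α.IsInner p b := by
  obtain ⟨β, h1, h2⟩ := exists_inner hp
  refine ⟨⟦β⟧, (isInner_iff hp).2 ⟨β, rfl, h1, h2⟩, fun b hb => ?_⟩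
  obtain ⟨γ, rfl, h3, h4⟩ := (isInner_iff hp).1 hb
  exact mk_eq_of_traverses_same (isClosed_carc hp) h3 h1 (h2.trans h4.symm)

lemma existsUnique_isOuter (hp : p ∈ α.crossings) : ∃! b, α.IsOuter p b := by
  obtain ⟨β, h1, h2⟩ := exists_outer hp
  refine ⟨⟦β⟧, (isOuter_iff hp).2 ⟨β, rfl, h1, h2⟩, fun b hb => ?_⟩
  obtain ⟨γ, rfl, h3, h4⟩ := (isOuter_iff hp).1 hb
  exact mk_eq_of_traverses_same (isOpen_arc hp).isClosed_compl h3 h1 (h2.trans h4.symm)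

end PointedLoop

end InnerOuter

/-! ### The faces of the disk -/

section Sides

variable {S : Type*} [TopologicalSpace S] [ChartedSpace (EuclideanHalfSpace 2) S]

/-- The function `Re (w / exp (i a)) - cos δ` on the circle. -/
lemma cos_sub_cos_pos_iff {a δ y : ℝ} (hδ : δ ∈ Set.Ioo 0 Real.pi)
    (hy : y ∈ Set.Ico (a - Real.pi) (a + Real.pi)) :
    (0 < Real.cos (y - a) - Real.cos δ ↔ y ∈ Set.Ioo (a - δ) (a + δ)) ∧
      (Real.cos (y - a) - Real.cos δ = 0 ↔ y = a - δ ∨ y = a + δ) := by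
  have h1 : |y - a| ∈ Set.Icc 0 Real.pi :=
    ⟨abs_nonneg _, abs_le.2 ⟨by linarith [hy.1], by linarith [hy.2]⟩⟩
  have h2 : δ ∈ Set.Icc 0 Real.pi := ⟨hδ.1.le, hδ.2.le⟩
  rw [← Real.cos_abs (y - a), sub_pos, sub_eq_zero, Real.strictAntiOn_cos.lt_iff_gt h2 h1,
    Real.injOn_cos.eq_iff h1 h2, abs_lt, abs_eq hδ.1.le, Set.mem_Ioo]
  refine ⟨⟨fun h => ⟨by linarith, by linarith⟩, fun h => ⟨by linarith, by linarith⟩⟩, ?_⟩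
  constructor
  · rintro (h | h)
    · right; linarith
    · left; linarith
  · rintro (h | h)
    · right; linarith
    · left; linarith

/-- The line through `w` perpendicular to `m` meets the circle in two points, and `w` lies between
them. Statements about points of the disk are thereby reduced to points of the circle at the same
level. -/
lemma exists_segment_of_re {m w : ℂ} (hm : ‖m‖ = 1) (hw : ‖w‖ ≤ 1) :
    ∃ z₁ z₂ : Circle, ((z₁ : ℂ) * (starRingEnd ℂ) m).re = (w * (starRingEnd ℂ) m).re ∧
      ((z₂ : ℂ) * (starRingEnd ℂ) m).re = (w * (starRingEnd ℂ) m).re ∧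
      w ∈ segment ℝ (z₁ : ℂ) z₂ := by
  set w' := w * (starRingEnd ℂ) m with hw'
  have hmm : m * (starRingEnd ℂ) m = 1 := by
    rw [Complex.mul_conj, Complex.normSq_eq_norm_sq, hm]; simp
  have hww : w = w' * m := by rw [hw', mul_assoc, mul_comm _ m, hmm, mul_one]
  have hn : w'.re ^ 2 + w'.im ^ 2 ≤ 1 := by
    have h1 : ‖w'‖ ≤ 1 := by rw [hw', norm_mul, Complex.norm_conj, hm, mul_one]; exact hw
    have h2 := Complex.sq_norm w'
    rw [Complex.normSq_apply] at h2
    nlinarith [norm_nonneg w']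
  set s := Real.sqrt (1 - w'.re ^ 2) with hs
  have hs2 : s ^ 2 = 1 - w'.re ^ 2 := Real.sq_sqrt (by nlinarith)
  have hs0 : 0 ≤ s := Real.sqrt_nonneg _
  have hbs : |w'.im| ≤ s := by
    apply Real.le_sqrt_of_sq_le; rw [sq_abs]; linarith
  obtain ⟨hb1, hb2⟩ := abs_le.1 hbs
  have key : ∀ r : ℝ, r ^ 2 = s ^ 2 → ∃ z : Circle, (z : ℂ) = (⟨w'.re, r⟩ : ℂ) * m := by
    intro r hr
    refine ⟨⟨(⟨w'.re, r⟩ : ℂ) * m, ?_⟩, rfl⟩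
    refine mem_sphere_zero_iff_norm.2 ?_
    rw [norm_mul, hm, mul_one, Complex.norm_def, Complex.normSq_apply,
      Real.sqrt_eq_one]
    simp only []
    nlinarith
  obtain ⟨z₁, h₁⟩ := key s rfl
  obtain ⟨z₂, h₂⟩ := key (-s) (by ring)
  have hre : ∀ r : ℝ, ((⟨w'.re, r⟩ : ℂ) * m * (starRingEnd ℂ) m).re = w'.re := by
    intro r; rw [mul_assoc, hmm, mul_one]
  refine ⟨z₁, z₂, by rw [h₁, hre], by rw [h₂, hre], ?_⟩
  rw [h₁, h₂, hww]
  rcases hs0.eq_or_lt with h0 | h0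
  · have hb : w'.im = 0 := by rw [← h0] at hb1 hb2; linarith
    have : w' = ⟨w'.re, s⟩ := Complex.ext rfl (by simp [hb, ← h0])
    rw [← this]; exact left_mem_segment _ _ _
  · refine ⟨(s + w'.im) / (2 * s), (s - w'.im) / (2 * s), by apply div_nonneg <;> linarith,
      by apply div_nonneg <;> linarith, by field_simp; ring, ?_⟩
    rw [← smul_mul_assoc, ← smul_mul_assoc, ← add_mul]
    congr 1
    apply Complex.ext
    · simp only [Complex.add_re, Complex.smul_re, smul_eq_mul]; field_simp; ring
    · simp only [Complex.add_im, Complex.smul_im, smul_eq_mul]; field_simp; ring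

namespace PointedLoop

variable {α : PointedLoop S} {p q : S}

/-- A function separating the two sides of a chord. -/
structure IsSide (α : PointedLoop S) (p : S) (l : ℂ → ℝ) : Prop where
  cont : Continuous l
  affine : ∀ x y : ℂ, ∀ a b : ℝ, a + b = 1 → l (a • x + b • y) = a * l x + b * l y
  pos_iff : ∀ z : Circle, 0 < l z ↔ z ∈ α.arc p
  eq_zero_iff : ∀ z : Circle, l z = 0 ↔ α.toFun z = p
  level : ∀ w ∈ Metric.closedBall (0 : ℂ) 1, ∃ z₁ z₂ : Circle, l z₁ = l w ∧ l z₂ = l w ∧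
    w ∈ segment ℝ (z₁ : ℂ) z₂

/-- With `m` the midpoint of the arc and `δ` half its angle, the two visits lie on the line `Re (w
m̄) = cos δ`, and the arc is the part of the circle beyond it. -/
lemma exists_isSide (hp : p ∈ α.crossings) : ∃ l, α.IsSide p l := by
  obtain ⟨t, u, hv⟩ := exists_visits hp
  have harc := hv.arc_eq
  obtain ⟨s, h⟩ := hv
  change α.VisitsFrom s p t u at h
  obtain ⟨-, h1, h2, h3, h4, h5⟩ := id h
  have hpi := Real.pi_pos
  set a := (t + u) / 2 with ha
  set δ := (u - t) / 2 with hδ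
  have hδ' : δ ∈ Set.Ioo 0 Real.pi := ⟨by linarith, by linarith⟩
  have e1 : a - δ = t := by rw [ha, hδ]; ring
  have e2 : a + δ = u := by rw [ha, hδ]; ring
  set m : ℂ := (Circle.exp a : ℂ) with hm
  have hre : ∀ y : ℝ, ((Circle.exp y : ℂ) * (starRingEnd ℂ) m).re = Real.cos (y - a) := by
    intro y
    rw [hm, ← Circle.coe_inv_eq_conj, ← Circle.exp_neg, ← Circle.coe_mul, ← Circle.exp_add,
      Circle.coe_exp, Complex.exp_ofReal_mul_I_re, sub_eq_add_neg]
  have rep : ∀ z : Circle, ∃ y ∈ Set.Ico (a - Real.pi) (a + Real.pi), Circle.exp y = z := by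
    intro z
    obtain ⟨y, hy, e⟩ := Circle.exists_exp_eq_mem_Ico (a - Real.pi) z
    exact ⟨y, ⟨hy.1, by linarith [hy.2]⟩, e⟩
  have inj : ∀ x ∈ Set.Ico (a - Real.pi) (a + Real.pi), ∀ y ∈ Set.Ico (a - Real.pi) (a + Real.pi),
      Circle.exp x = Circle.exp y → x = y := fun x hx y hy e =>
    Circle.exp_injOn_half_open (a := a - Real.pi) ⟨hx.1, by linarith [hx.2]⟩
      ⟨hy.1, by linarith [hy.2]⟩ e
  refine ⟨fun w => (w * (starRingEnd ℂ) m).re - Real.cos δ, ?_, ?_, ?_, ?_, ?_⟩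
  · fun_prop
  · intro x y b c hbc
    simp only [add_mul, smul_mul_assoc, Complex.add_re, Complex.smul_re, smul_eq_mul]
    linear_combination Real.cos δ * hbc
  · intro z
    obtain ⟨y, hy, rfl⟩ := rep z
    rw [hre, (cos_sub_cos_pos_iff hδ' hy).1, e1, e2, harc]
    refine ⟨fun h => ⟨y, h, rfl⟩, ?_⟩
    rintro ⟨x, hx, e⟩
    rwa [← inj x ⟨by linarith [hx.1, hδ'.2], by linarith [hx.2, hδ'.2]⟩ y hy e]
  · intro z
    obtain ⟨y, hy, rfl⟩ := rep z
    rw [hre, (cos_sub_cos_pos_iff hδ' hy).2, e1, e2]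
    constructor
    · rintro (rfl | rfl)
      · exact h4
      · exact h5
    · intro hz
      rcases h.eq_or hz with e | e
      · exact Or.inl (inj _ hy _ ⟨by linarith [hδ'.2], by linarith [hδ'.2]⟩ e)
      · exact Or.inr (inj _ hy _ ⟨by linarith [hδ'.2], by linarith [hδ'.2]⟩ e)
  · intro w hw
    obtain ⟨z₁, z₂, k1, k2, k3⟩ := exists_segment_of_re (m := m) (Circle.norm_coe _)
      (by simpa using hw : ‖w‖ ≤ 1)
    exact ⟨z₁, z₂, by rw [k1], by rw [k2], k3⟩

namespace IsSide

variable {l l' : ℂ → ℝ}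

lemma mem_segment (h : α.IsSide p l) {x y w : ℂ} (hw : w ∈ segment ℝ x y) :
    ∃ a b : ℝ, 0 ≤ a ∧ 0 ≤ b ∧ a + b = 1 ∧ l w = a * l x + b * l y := by
  obtain ⟨a, b, ha, hb, hab, rfl⟩ := hw
  exact ⟨a, b, ha, hb, hab, h.affine x y a b hab⟩

lemma pos_of_segment (h : α.IsSide p l) {x y w : ℂ} (hw : w ∈ segment ℝ x y) (hx : 0 < l x)
    (hy : 0 < l y) : 0 < l w := by
  obtain ⟨a, b, ha, hb, hab, e⟩ := h.mem_segment hw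
  rw [e]
  rcases ha.eq_or_lt with rfl | ha
  · simp at hab; subst hab; simpa using hy
  · positivity

lemma neg_of_segment (h : α.IsSide p l) {x y w : ℂ} (hw : w ∈ segment ℝ x y) (hx : l x < 0)
    (hy : l y < 0) : l w < 0 := by
  obtain ⟨a, b, ha, hb, hab, e⟩ := h.mem_segment hw
  rw [e]
  rcases ha.eq_or_lt with rfl | ha
  · simp at hab; subst hab; simpa using hy
  · nlinarith

lemma nonneg_iff (h : α.IsSide p l) (hp : p ∈ α.crossings) (z : Circle) :
    0 ≤ l z ↔ z ∈ α.carc p := by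
  rw [mem_carc_iff hp, ← h.pos_iff, ← h.eq_zero_iff, le_iff_lt_or_eq, eq_comm (a := (0 : ℝ))]

lemma neg_iff (h : α.IsSide p l) (hp : p ∈ α.crossings) (z : Circle) :
    l z < 0 ↔ z ∉ α.carc p := by rw [← h.nonneg_iff hp, not_le]

lemma nonpos_iff (h : α.IsSide p l) (z : Circle) :
    l z ≤ 0 ↔ z ∉ α.arc p := by rw [← h.pos_iff, not_lt]

end IsSide

lemma chord_eq_segment {t u : ℝ} (h : α.Visits p t u) :
    chord α.toFun p = segment ℝ (Circle.exp t : ℂ) (Circle.exp u) := by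
  obtain ⟨s, h⟩ := h
  change α.VisitsFrom s p t u at h
  have : α.toFun ⁻¹' {p} = {Circle.exp t, Circle.exp u} := by
    ext z
    exact ⟨fun hz => h.eq_or hz, by rintro (rfl | rfl); exacts [h.2.2.2.2.1, h.2.2.2.2.2]⟩
  rw [chord, this, Set.image_pair, convexHull_pair]

lemma chord_subset_disk : chord α.toFun p ⊆ Metric.closedBall 0 1 := by
  refine convexHull_min ?_ (convex_closedBall _ _)
  rintro _ ⟨z, -, rfl⟩
  rw [mem_closedBall_zero_iff, Circle.norm_coe]

lemma mem_chord_of_over {z : Circle} (hz : α.toFun z = p) : (z : ℂ) ∈ chord α.toFun p :=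
  subset_convexHull _ _ ⟨z, hz, rfl⟩

/-- A point of the disk at level `0` lies on a segment between two points of the circle at level
`0`, and these lie over `p`. -/
lemma mem_chord_iff {l : ℂ → ℝ} (hp : p ∈ α.crossings) (h : α.IsSide p l) {w : ℂ} :
    w ∈ chord α.toFun p ↔ w ∈ Metric.closedBall (0 : ℂ) 1 ∧ l w = 0 := by
  constructor
  · refine fun hw => ⟨chord_subset_disk hw, ?_⟩
    obtain ⟨t, u, hv⟩ := exists_visits hp
    rw [chord_eq_segment hv] at hw
    obtain ⟨s, -, -, -, -, h4, h5⟩ := hv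
    obtain ⟨a, b, -, -, -, e⟩ := h.mem_segment hw
    rw [e, (h.eq_zero_iff _).2 h4, (h.eq_zero_iff _).2 h5]; simp
  · rintro ⟨hw, hl⟩
    obtain ⟨z₁, z₂, h1, h2, h3⟩ := h.level w hw
    rw [hl, h.eq_zero_iff] at h1 h2
    exact (convex_convexHull ℝ _).segment_subset (mem_chord_of_over h1) (mem_chord_of_over h2) h3

lemma Inside.carc_subset (hp : p ∈ α.crossings) (hq : q ∈ α.crossings) (h : α.Inside p q) :
    α.carc p ⊆ α.arc q := by
  obtain ⟨s, hs⟩ := α.exists_lift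
  obtain ⟨t, u, h1⟩ := exists_visitsFrom hs hp
  obtain ⟨t', u', h2⟩ := exists_visitsFrom hs hq
  obtain ⟨k1, k2⟩ := (inside_iff h2 h1).1 h
  rw [h1.visits.carc_eq, h2.visits.arc_eq]
  exact Set.image_mono fun x hx => ⟨by linarith [hx.1], by linarith [hx.2]⟩

lemma Outside.disjoint_carc (hp : p ∈ α.crossings) (hq : q ∈ α.crossings) (h : α.Outside p q)
    (h' : α.Outside q p) : Disjoint (α.carc p) (α.carc q) := by
  obtain ⟨s, hs⟩ := α.exists_lift
  obtain ⟨t, u, h1⟩ := exists_visitsFrom hs hp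
  obtain ⟨t', u', h2⟩ := exists_visitsFrom hs hq
  have k1 := (outside_iff h2 h1).1 h
  have k2 := (outside_iff h1 h2).1 h'
  obtain ⟨-, a1, a2, a3, -⟩ := id h1
  obtain ⟨-, b1, b2, b3, -⟩ := id h2
  rw [Set.disjoint_left]
  intro z hz hz'
  obtain ⟨x, hx, rfl⟩ := Circle.exists_exp_eq_mem_Ico s z
  have hx' : x ∈ Set.Icc s (s + 2 * Real.pi) := ⟨hx.1, hx.2.le⟩
  rw [h1.mem_carc hx'] at hz
  rw [h2.mem_carc hx'] at hz'
  obtain ⟨z1, z2⟩ := hz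
  obtain ⟨z3, z4⟩ := hz'
  rcases k1 with ⟨c1 | c1, c2 | c2⟩ <;> rcases k2 with ⟨d1 | d1, d2 | d2⟩ <;> linarith

/-- Chords of distinct crossings are disjoint if and only if the crossings are unlinked. -/
lemma disjoint_chord_iff (hp : p ∈ α.crossings) (hq : q ∈ α.crossings) (hpq : p ≠ q) :
    Disjoint (chord α.toFun p) (chord α.toFun q) ↔ α.Inside q p ∨ α.Outside q p := by
  obtain ⟨l, hl⟩ := exists_isSide hp
  obtain ⟨s, hs⟩ := α.exists_lift
  obtain ⟨t, u, hv⟩ := exists_visitsFrom hs hq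
  have hchord := chord_eq_segment hv.visits
  rw [Inside, Outside, hv.forall_iff, hv.forall_iff (P := fun z => z ∉ α.carc p), ← hl.pos_iff,
    ← hl.pos_iff, ← hl.neg_iff hp, ← hl.neg_iff hp]
  have ht : l (Circle.exp t) ≠ 0 := fun h =>
    hpq (((hl.eq_zero_iff _).1 h).symm.trans hv.2.2.2.2.1)
  have hu : l (Circle.exp u) ≠ 0 := fun h =>
    hpq (((hl.eq_zero_iff _).1 h).symm.trans hv.2.2.2.2.2)
  constructor
  · intro hd
    by_contra hcon
    -- If the ends of the chord of `q` are on opposite sides, the intermediate value theorem gives a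
    -- zero of `l` on it, that is, a common point of the chords.
    have h0 : (0 : ℝ) ∈ l '' segment ℝ (Circle.exp t : ℂ) (Circle.exp u) := by
      have hc : IsPreconnected (l '' segment ℝ (Circle.exp t : ℂ) (Circle.exp u)) :=
        (convex_segment _ _).isPreconnected.image _ hl.cont.continuousOn
      have hord := hc.ordConnected
      have m1 := Set.mem_image_of_mem l (left_mem_segment ℝ (Circle.exp t : ℂ) (Circle.exp u))
      have m2 := Set.mem_image_of_mem l (right_mem_segment ℝ (Circle.exp t : ℂ) (Circle.exp u))
      rcases ht.lt_or_gt with h1 | h1 <;> rcases hu.lt_or_gt with h2 | h2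
      · exact absurd (Or.inr ⟨h1, h2⟩) hcon
      · exact hord.out m1 m2 ⟨h1.le, h2.le⟩
      · exact hord.out m2 m1 ⟨h2.le, h1.le⟩
      · exact absurd (Or.inl ⟨h1, h2⟩) hcon
    obtain ⟨w, hw, hw0⟩ := h0
    rw [← hchord] at hw
    exact Set.disjoint_left.1 hd ((mem_chord_iff hp hl).2 ⟨chord_subset_disk hw, hw0⟩) hw
  · intro h
    rw [Set.disjoint_left]
    intro w hw hw'
    rw [hchord] at hw'
    have hw0 := ((mem_chord_iff hp hl).1 hw).2
    rcases h with h | h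
    · exact (hl.pos_of_segment hw' h.1 h.2).ne' hw0
    · exact (hl.neg_of_segment hw' h.1 h.2).ne hw0

end PointedLoop

end Sides

/-! ### Faces as sign patterns, and the dual graph -/

section Faces

variable {S : Type*} [TopologicalSpace S] [ChartedSpace (EuclideanHalfSpace 2) S]

namespace PointedLoop

variable {α : PointedLoop S} {p q : S} {H : Finset S}

lemma mem_cuts : H ∈ α.cuts ↔ (∀ p ∈ H, p ∈ α.crossings) ∧
    ∀ p ∈ H, ∀ q ∈ H, p ≠ q → α.Inside q p ∨ α.Outside q p := by
  classical
  rw [GenericLoop.cuts, Finset.mem_filter, Finset.mem_powerset]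
  refine and_congr_right fun h => ?_
  refine forall₂_congr fun p hp => forall₂_congr fun q hq => forall_congr' fun hpq => ?_
  exact disjoint_chord_iff (h hp) (h hq) hpq

open Classical in
/-- A function that is positive on the side of the chord of `p` between its two visits. -/
def side (α : PointedLoop S) (p : S) : ℂ → ℝ :=
  if h : p ∈ α.crossings then (exists_isSide h).choose else 0

lemma isSide_side (hp : p ∈ α.crossings) : α.IsSide p (α.side p) := by
  rw [side, dif_pos hp]; exact (exists_isSide hp).choose_spec

/-- The point lies on a segment between two points of the circle at the same level for `p`. Both
belong to the closed arc of `p` and so to the arc of `q`, and the affine function of `q` stays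
positive between them. -/
lemma Inside.side_pos (hp : p ∈ α.crossings) (hq : q ∈ α.crossings) (h : α.Inside p q) {w : ℂ}
    (hw : w ∈ Metric.closedBall (0 : ℂ) 1) (h0 : 0 ≤ α.side p w) : 0 < α.side q w := by
  have hl := isSide_side hp
  have hl' := isSide_side hq
  obtain ⟨z₁, z₂, h1, h2, h3⟩ := hl.level w hw
  have hs := h.carc_subset hp hq
  exact hl'.pos_of_segment h3
    ((hl'.pos_iff _).2 (hs ((hl.nonneg_iff hp _).1 (by rwa [h1]))))
    ((hl'.pos_iff _).2 (hs ((hl.nonneg_iff hp _).1 (by rwa [h2]))))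

lemma Outside.side_neg (hp : p ∈ α.crossings) (hq : q ∈ α.crossings) (h : α.Outside p q)
    (h' : α.Outside q p) {w : ℂ} (hw : w ∈ Metric.closedBall (0 : ℂ) 1) (h0 : 0 ≤ α.side p w) :
    α.side q w < 0 := by
  have hl := isSide_side hp
  have hl' := isSide_side hq
  obtain ⟨z₁, z₂, h1, h2, h3⟩ := hl.level w hw
  have hd := Set.disjoint_left.1 (h.disjoint_carc hp hq h')
  exact hl'.neg_of_segment h3
    ((hl'.neg_iff hq _).2 (hd ((hl.nonneg_iff hp _).1 (by rwa [h1]))))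
    ((hl'.neg_iff hq _).2 (hd ((hl.nonneg_iff hp _).1 (by rwa [h2]))))

lemma mem_cutDisk_iff (hH : H ∈ α.cuts) {w : ℂ} : w ∈ cutDisk α.toFun H ↔
    w ∈ Metric.closedBall (0 : ℂ) 1 ∧ ∀ q ∈ H, α.side q w ≠ 0 := by
  rw [cutDisk, Set.mem_sdiff]
  refine and_congr_right fun hw => ?_
  simp only [Set.mem_iUnion, not_exists]
  refine forall₂_congr fun q hq => not_congr ?_
  have hq' := (mem_cuts.1 hH).1 q hq
  rw [mem_chord_iff hq' (isSide_side hq')]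
  exact and_iff_right hw

/-- On a connected set that avoids a chord the corresponding function keeps its sign. Conversely two
points with equal signs are joined by a segment that meets no chord, since the functions are affine.
-/
lemma mem_component_iff (hH : H ∈ α.cuts) {z w : ℂ} (hz : z ∈ cutDisk α.toFun H) :
    w ∈ connectedComponentIn (cutDisk α.toFun H) z ↔ w ∈ Metric.closedBall (0 : ℂ) 1 ∧
      ∀ q ∈ H, (0 < α.side q w ∧ 0 < α.side q z) ∨ (α.side q w < 0 ∧ α.side q z < 0) := by
  have hz' := (mem_cutDisk_iff hH).1 hz
  constructor
  · intro hw
    have hw' := (mem_cutDisk_iff hH).1 (connectedComponentIn_subset _ _ hw)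
    refine ⟨hw'.1, fun q hq => ?_⟩
    have hl := isSide_side ((mem_cuts.1 hH).1 q hq)
    have hc : IsPreconnected (α.side q '' connectedComponentIn (cutDisk α.toFun H) z) :=
      isPreconnected_connectedComponentIn.image _ hl.cont.continuousOn
    have h0 : (0 : ℝ) ∉ α.side q '' connectedComponentIn (cutDisk α.toFun H) z := by
      rintro ⟨v, hv, hv0⟩
      exact ((mem_cutDisk_iff hH).1 (connectedComponentIn_subset _ _ hv)).2 q hq hv0
    have m1 := Set.mem_image_of_mem (α.side q) hw
    have m2 := Set.mem_image_of_mem (α.side q) (mem_connectedComponentIn hz)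
    rcases (hw'.2 q hq).lt_or_gt with h1 | h1 <;> rcases (hz'.2 q hq).lt_or_gt with h2 | h2
    · exact Or.inr ⟨h1, h2⟩
    · exact absurd (hc.ordConnected.out m1 m2 ⟨h1.le, h2.le⟩) h0
    · exact absurd (hc.ordConnected.out m2 m1 ⟨h2.le, h1.le⟩) h0
    · exact Or.inl ⟨h1, h2⟩
  · rintro ⟨hw, hs⟩
    have hsub : segment ℝ z w ⊆ cutDisk α.toFun H := by
      intro v hv
      refine (mem_cutDisk_iff hH).2 ⟨(convex_closedBall _ _).segment_subset hz'.1 hw hv,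
        fun q hq => ?_⟩
      have hl := isSide_side ((mem_cuts.1 hH).1 q hq)
      rcases hs q hq with h | h
      · exact (hl.pos_of_segment hv h.2 h.1).ne'
      · exact (hl.neg_of_segment hv h.2 h.1).ne
    exact (convex_segment z w).isPreconnected.subset_connectedComponentIn
      (left_mem_segment _ _ _) hsub (right_mem_segment _ _ _)

/-- The face lies on the side of the chord of `q` between the two visits of `q`. -/
def FaceIn (F : Face α.toFun H) (q : S) : Prop := ∃ w ∈ F.1, 0 < α.side q w

variable {F F' : Face α.toFun H}

lemma exists_mem_face (F : Face α.toFun H) : ∃ z ∈ F.1, z ∈ cutDisk α.toFun H := by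
  obtain ⟨V, z, hz, rfl⟩ := F
  exact ⟨z, mem_connectedComponentIn hz, hz⟩

lemma face_subset_cutDisk (F : Face α.toFun H) : F.1 ⊆ cutDisk α.toFun H := by
  obtain ⟨V, z, hz, rfl⟩ := F
  exact connectedComponentIn_subset _ _

lemma face_eq_component {z : ℂ} (hz : z ∈ F.1) :
    F.1 = connectedComponentIn (cutDisk α.toFun H) z := by
  obtain ⟨V, z', hz', rfl⟩ := F
  exact connectedComponentIn_eq hz

lemma faceIn_iff (hH : H ∈ α.cuts) {w : ℂ} (hw : w ∈ F.1) (hq : q ∈ H) :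
    FaceIn F q ↔ 0 < α.side q w := by
  refine ⟨?_, fun h => ⟨w, hw, h⟩⟩
  rintro ⟨v, hv, h⟩
  rw [face_eq_component hw, mem_component_iff hH (face_subset_cutDisk F hw)] at hv
  rcases hv.2 q hq with h' | h'
  · exact h'.2
  · exact absurd h h'.1.not_gt

lemma not_faceIn_iff (hH : H ∈ α.cuts) {w : ℂ} (hw : w ∈ F.1) (hq : q ∈ H) :
    ¬ FaceIn F q ↔ α.side q w < 0 := by
  rw [faceIn_iff hH hw hq, not_lt, le_iff_lt_or_eq]
  exact or_iff_left (((mem_cutDisk_iff hH).1 (face_subset_cutDisk F hw)).2 q hq)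

lemma mem_face_iff (hH : H ∈ α.cuts) {w : ℂ} : w ∈ F.1 ↔ w ∈ Metric.closedBall (0 : ℂ) 1 ∧
    ∀ q ∈ H, (FaceIn F q → 0 < α.side q w) ∧ (¬ FaceIn F q → α.side q w < 0) := by
  constructor
  · exact fun hw => ⟨((mem_cutDisk_iff hH).1 (face_subset_cutDisk F hw)).1, fun q hq =>
      ⟨(faceIn_iff hH hw hq).1, (not_faceIn_iff hH hw hq).1⟩⟩
  · rintro ⟨hw, h⟩
    obtain ⟨z, hz, hzc⟩ := exists_mem_face F
    rw [face_eq_component hz, mem_component_iff hH hzc]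
    refine ⟨hw, fun q hq => ?_⟩
    by_cases hF : FaceIn F q
    · exact Or.inl ⟨(h q hq).1 hF, (faceIn_iff hH hz hq).1 hF⟩
    · exact Or.inr ⟨(h q hq).2 hF, (not_faceIn_iff hH hz hq).1 hF⟩

lemma face_ext (hH : H ∈ α.cuts) (h : ∀ q ∈ H, FaceIn F q ↔ FaceIn F' q) : F = F' := by
  refine Subtype.ext (Set.ext fun w => ?_)
  rw [mem_face_iff hH, mem_face_iff hH]
  refine and_congr_right fun _ => forall₂_congr fun q hq => ?_
  rw [h q hq]

lemma exists_face_of_circle (hH : H ∈ α.cuts) {x : Circle} (hx : α.toFun x ∉ H) :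
    ∃ F : Face α.toFun H, ∀ q ∈ H, FaceIn F q ↔ x ∈ α.arc q := by
  have hz : (x : ℂ) ∈ cutDisk α.toFun H := by
    refine (mem_cutDisk_iff hH).2 ⟨by rw [mem_closedBall_zero_iff, Circle.norm_coe],
      fun q hq h0 => ?_⟩
    rw [(isSide_side ((mem_cuts.1 hH).1 q hq)).eq_zero_iff] at h0
    exact hx (h0 ▸ hq)
  refine ⟨⟨_, _, hz, rfl⟩, fun q hq => ?_⟩
  exact (faceIn_iff hH (mem_connectedComponentIn hz) hq).trans
    ((isSide_side ((mem_cuts.1 hH).1 q hq)).pos_iff x)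

/-- If `w` satisfies the weak inequalities, the open segment from a point of the face to `w`
satisfies the strict ones, so `w` is a limit of points of the face. -/
lemma mem_closure_face_iff (hH : H ∈ α.cuts) {w : ℂ} : w ∈ closure F.1 ↔
    w ∈ Metric.closedBall (0 : ℂ) 1 ∧
      ∀ q ∈ H, (FaceIn F q → 0 ≤ α.side q w) ∧ (¬ FaceIn F q → α.side q w ≤ 0) := by
  constructor
  · intro hw
    refine ⟨closure_minimal (fun v hv => ((mem_face_iff hH).1 hv).1) Metric.isClosed_closedBall hw,
      fun q hq => ⟨fun hF => ?_, fun hF => ?_⟩⟩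
    · have hc := (isSide_side ((mem_cuts.1 hH).1 q hq)).cont
      exact closure_minimal (fun v hv => (((mem_face_iff hH).1 hv).2 q hq).1 hF |>.le)
        (isClosed_le continuous_const hc) hw
    · have hc := (isSide_side ((mem_cuts.1 hH).1 q hq)).cont
      exact closure_minimal (fun v hv => (((mem_face_iff hH).1 hv).2 q hq).2 hF |>.le)
        (isClosed_le hc continuous_const) hw
  · rintro ⟨hw, h⟩
    obtain ⟨z, hz, -⟩ := exists_mem_face F
    have hz' := (mem_face_iff hH).1 hz
    have hsub : openSegment ℝ z w ⊆ F.1 := by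
      intro v hv
      refine (mem_face_iff hH).2 ⟨(convex_closedBall _ _).segment_subset hz'.1 hw
        (openSegment_subset_segment _ _ _ hv), fun q hq => ?_⟩
      obtain ⟨a, b, ha, hb, hab, rfl⟩ := hv
      rw [(isSide_side ((mem_cuts.1 hH).1 q hq)).affine _ _ _ _ hab]
      refine ⟨fun hF => ?_, fun hF => ?_⟩
      · have h1 := (hz'.2 q hq).1 hF
        have h2 := (h q hq).1 hF
        positivity
      · have h1 := (hz'.2 q hq).2 hF
        have h2 := (h q hq).2 hF
        nlinarith
    exact closure_mono hsub (segment_subset_closure_openSegment (right_mem_segment _ _ _))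

lemma mem_arcs_iff (hH : H ∈ α.cuts) {x : Circle} : x ∈ F.arcs ↔
    ∀ q ∈ H, (FaceIn F q → x ∈ α.carc q) ∧ (¬ FaceIn F q → x ∉ α.arc q) := by
  have : x ∈ F.arcs ↔ (x : ℂ) ∈ closure F.1 := Iff.rfl
  rw [this, mem_closure_face_iff hH]
  have hx : (x : ℂ) ∈ Metric.closedBall (0 : ℂ) 1 := by
    rw [mem_closedBall_zero_iff, Circle.norm_coe]
  rw [and_iff_right hx]
  refine forall₂_congr fun q hq => ?_
  have hq' := (mem_cuts.1 hH).1 q hq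
  rw [(isSide_side hq').nonneg_iff hq', (isSide_side hq').nonpos_iff]

lemma isClosed_arcs (F : Face α.toFun H) : IsClosed F.arcs :=
  isClosed_closure.preimage continuous_subtype_val

/-- The part of the circle that is near a point of a face which is not over the cut belongs to the
face. -/
lemma arcs_frontier (hH : H ∈ α.cuts) {x : Circle} (hx : x ∈ F.arcs) (hn : F.arcs ∉ nhds x) :
    α.toFun x ∈ H := by
  by_contra hxH
  refine hn ?_
  have key : ∀ q ∈ H, ∀ᶠ y in nhds x,
      (FaceIn F q → y ∈ α.carc q) ∧ (¬ FaceIn F q → y ∉ α.arc q) := by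
    intro q hq
    have hq' := (mem_cuts.1 hH).1 q hq
    have hne : α.toFun x ≠ q := fun e => hxH (e ▸ hq)
    obtain ⟨h1, h2⟩ := (mem_arcs_iff hH).1 hx q hq
    by_cases hF : FaceIn F q
    · filter_upwards [(isOpen_arc hq').mem_nhds (((mem_carc_iff hq').1 (h1 hF)).resolve_right hne)]
        with y hy
      exact ⟨fun _ => arc_subset_carc hy, fun h => absurd hF h⟩
    · have : x ∈ (α.carc q)ᶜ := fun hc => (((mem_carc_iff hq').1 hc).elim (h2 hF) hne)
      filter_upwards [(isClosed_carc hq').isOpen_compl.mem_nhds this] with y hy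
      exact ⟨fun h => absurd h hF, fun _ hy' => hy (arc_subset_carc hy')⟩
  filter_upwards [(Filter.eventually_all_finset H).2 key] with y hy
  exact (mem_arcs_iff hH).2 hy

lemma FaceIn.up (hH : H ∈ α.cuts) (hp : p ∈ H) (hq : q ∈ H) (h : α.Inside p q)
    (hF : FaceIn F p) : FaceIn F q := by
  obtain ⟨w, hw, h0⟩ := hF
  exact ⟨w, hw, h.side_pos ((mem_cuts.1 hH).1 p hp) ((mem_cuts.1 hH).1 q hq)
    ((mem_face_iff hH).1 hw).1 h0.le⟩

/-- For independent crossings the closed arcs are disjoint, and no point of the disk is on the inner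
side of both chords. Hence the crossings around a face form a chain. -/
lemma FaceIn.comparable (hH : H ∈ α.cuts) (hp : p ∈ H) (hq : q ∈ H) (hF : FaceIn F p)
    (hF' : FaceIn F q) : q = p ∨ α.Inside p q ∨ α.Inside q p := by
  by_contra! hcon
  obtain ⟨h1, h2, h3⟩ := hcon
  have hp' := (mem_cuts.1 hH).1 p hp
  have hq' := (mem_cuts.1 hH).1 q hq
  have ho := ((mem_cuts.1 hH).2 p hp q hq h1.symm).resolve_left h3
  have ho' := ((mem_cuts.1 hH).2 q hq p hp h1).resolve_left h2
  obtain ⟨w, hw, h0⟩ := hF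
  have := ho'.side_neg hp' hq' ho ((mem_face_iff hH).1 hw).1 h0.le
  exact ((faceIn_iff hH hw hq).1 hF').not_gt this

/-- A face is either the root face or the face adjacent to the chord of some `p` on its inner
side. -/
lemma face_cases (hH : H ∈ α.cuts) (F : Face α.toFun H) : (∀ q ∈ H, ¬ FaceIn F q) ∨
    ∃ p ∈ H, ∀ q ∈ H, FaceIn F q ↔ q = p ∨ α.Inside p q := by
  classical
  refine or_iff_not_imp_left.2 fun hne => ?_
  push Not at hne
  obtain ⟨p₀, hp₀, hF₀⟩ := hne
  let X := {q : H // FaceIn F q.1}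
  let r : X → X → Prop := fun a b => α.Inside a.1.1 b.1.1
  have hcr : ∀ a : X, a.1.1 ∈ α.crossings := fun a => (mem_cuts.1 hH).1 _ a.1.2
  have : IsTrans X r := ⟨fun a b c h h' => Inside.trans (hcr a) (hcr b) (hcr c) h h'⟩
  have : Std.Irrefl r := ⟨fun a => not_inside_self (hcr a)⟩
  -- The innermost of the crossings around the face determines all the others: they are those in
  -- which it is nested.
  have wf : WellFounded r := Finite.wellFounded_of_trans_of_irrefl r
  obtain ⟨⟨⟨p, hp⟩, hF⟩, -, hmin⟩ := wf.has_min Set.univ ⟨⟨⟨p₀, hp₀⟩, hF₀⟩, trivial⟩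
  refine ⟨p, hp, fun q hq => ⟨fun hq' => ?_, ?_⟩⟩
  · rcases hF.comparable hH hp hq hq' with h | h | h
    · exact Or.inl h
    · exact Or.inr h
    · exact absurd h (hmin ⟨⟨q, hq⟩, hq'⟩ trivial)
  · rintro (rfl | h)
    · exact hF
    · exact hF.up hH hp hq h

/-- Near a point over `p` the other arcs do not change. -/
lemma eventually_arc_iff (hH : H ∈ α.cuts) (hp : p ∈ H) {x : Circle} (hx : α.toFun x = p) :
    ∀ᶠ y in nhds x, ∀ q ∈ H, q ≠ p → (y ∈ α.arc q ↔ α.Inside p q) ∧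
      (y ∈ α.carc q ↔ α.Inside p q) := by
  refine (Filter.eventually_all_finset H).2 fun q hq => ?_
  by_cases hqp : q = p
  · exact Filter.Eventually.of_forall fun y h => absurd hqp h
  have hp' := (mem_cuts.1 hH).1 p hp
  have hq' := (mem_cuts.1 hH).1 q hq
  rcases (mem_cuts.1 hH).2 q hq p hp hqp with h | h
  · filter_upwards [(isOpen_arc hq').mem_nhds (h x hx)] with y hy _
    exact ⟨iff_of_true hy h, iff_of_true (arc_subset_carc hy) h⟩
  · have hn : ¬ α.Inside p q := fun h' => h'.not_outside hp' h
    filter_upwards [(isClosed_carc hq').isOpen_compl.mem_nhds (h x hx)] with y hy _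
    exact ⟨iff_of_false (fun h => hy (arc_subset_carc h)) hn, iff_of_false hy hn⟩

lemma exists_face_root (hH : H ∈ α.cuts) : ∃ F : Face α.toFun H, ∀ q ∈ H, ¬ FaceIn F q := by
  obtain ⟨F, hF⟩ := exists_face_of_circle (x := α.base) hH fun h =>
    α.base_not_crossing (GenericLoop.mem_crossings.1 ((mem_cuts.1 hH).1 _ h))
  exact ⟨F, fun q hq h => base_not_mem_carc ((mem_cuts.1 hH).1 _ hq)
    (arc_subset_carc ((hF q hq).1 h))⟩

lemma base_mem_arcs_iff (hH : H ∈ α.cuts) : α.base ∈ F.arcs ↔ ∀ q ∈ H, ¬ FaceIn F q := by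
  rw [mem_arcs_iff hH]
  refine forall₂_congr fun q hq => ⟨fun h hF => ?_,
    fun h => ⟨fun h' => absurd h' h, fun _ h' => ?_⟩⟩
  · exact base_not_mem_carc ((mem_cuts.1 hH).1 _ hq) (h.1 hF)
  · exact base_not_mem_carc ((mem_cuts.1 hH).1 _ hq) (arc_subset_carc h')

/-- Points just after and just before the first visit of `p` lie on different sides of its chord,
while no other chord of the cut has an end that near. They produce the two faces adjacent to the
chord. -/
lemma exists_nearby (hH : H ∈ α.cuts) (hp : p ∈ H) :
    (∃ x : Circle, x ∈ α.arc p ∧ ∀ q ∈ H, q ≠ p → (x ∈ α.arc q ↔ α.Inside p q) ∧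
      (x ∈ α.carc q ↔ α.Inside p q)) ∧
    (∃ x : Circle, x ∉ α.carc p ∧ ∀ q ∈ H, q ≠ p → (x ∈ α.arc q ↔ α.Inside p q) ∧
      (x ∈ α.carc q ↔ α.Inside p q)) := by
  obtain ⟨s, hs⟩ := α.exists_lift
  obtain ⟨t, u, h⟩ := exists_visitsFrom hs ((mem_cuts.1 hH).1 p hp)
  obtain ⟨-, h1, h2, h3, h4, h5⟩ := id h
  obtain ⟨δ, hδ, H'⟩ := exists_Ioo_of_nhds (eventually_arc_iff hH hp h4)
  constructor
  · refine ⟨Circle.exp (t + min δ (u - t) / 2), ?_, H' _ ?_⟩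
    · have := lt_min hδ (sub_pos.2 h2)
      rw [h.mem_arc ⟨by linarith, by linarith [min_le_right δ (u - t)]⟩]
      exact ⟨by linarith, by linarith [min_le_right δ (u - t)]⟩
    · have := lt_min hδ (sub_pos.2 h2)
      exact ⟨by linarith, by linarith [min_le_left δ (u - t)]⟩
  · refine ⟨Circle.exp (t - min δ (t - s) / 2), ?_, H' _ ?_⟩
    · have := lt_min hδ (sub_pos.2 h1)
      rw [h.mem_carc ⟨by linarith [min_le_right δ (t - s)], by linarith⟩]
      exact fun hh => by linarith [hh.1]
    · have := lt_min hδ (sub_pos.2 h1)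
      exact ⟨by linarith [min_le_left δ (t - s)], by linarith⟩

/-- The face adjacent to the chord of `p` on its inner side. -/
lemma exists_face_inner (hH : H ∈ α.cuts) (hp : p ∈ H) :
    ∃ F : Face α.toFun H, ∀ q ∈ H, FaceIn F q ↔ q = p ∨ α.Inside p q := by
  obtain ⟨⟨x, hx, hx'⟩, -⟩ := exists_nearby hH hp
  have hxH : α.toFun x ∉ H := by
    intro hm
    have hc := (mem_cuts.1 hH).1 _ hm
    by_cases e : α.toFun x = p
    · exact not_mem_arc_self e hx
    · exact not_mem_arc_self rfl ((hx' _ hm e).1.2 ((hx' _ hm e).2.1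
        ((mem_carc_iff hc).2 (Or.inr rfl))))
  obtain ⟨F, hF⟩ := exists_face_of_circle hH hxH
  refine ⟨F, fun q hq => ?_⟩
  rw [hF q hq]
  by_cases e : q = p
  · subst e; exact iff_of_true hx (Or.inl rfl)
  · rw [(hx' q hq e).1]; simp [e]

/-- The face adjacent to the chord of `p` on its outer side. -/
lemma exists_face_outer (hH : H ∈ α.cuts) (hp : p ∈ H) :
    ∃ F : Face α.toFun H, ∀ q ∈ H, FaceIn F q ↔ α.Inside p q := by
  obtain ⟨-, x, hx, hx'⟩ := exists_nearby hH hp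
  have hpc := (mem_cuts.1 hH).1 p hp
  have hxH : α.toFun x ∉ H := by
    intro hm
    have hc := (mem_cuts.1 hH).1 _ hm
    by_cases e : α.toFun x = p
    · exact hx ((mem_carc_iff hpc).2 (Or.inr e))
    · exact not_mem_arc_self rfl ((hx' _ hm e).1.2 ((hx' _ hm e).2.1
        ((mem_carc_iff hc).2 (Or.inr rfl))))
  obtain ⟨F, hF⟩ := exists_face_of_circle hH hxH
  refine ⟨F, fun q hq => ?_⟩
  rw [hF q hq]
  by_cases e : q = p
  · subst e; exact iff_of_false (fun h => hx (arc_subset_carc h)) (not_inside_self hpc)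
  · rw [(hx' q hq e).1]

lemma inside_iff_side (hH : H ∈ α.cuts) (hp : p ∈ H) (hq : q ∈ H) (hqp : q ≠ p) {w : ℂ}
    (hw : w ∈ chord α.toFun p) :
    (α.Inside p q → 0 < α.side q w) ∧ (¬ α.Inside p q → α.side q w < 0) := by
  have hp' := (mem_cuts.1 hH).1 p hp
  have hq' := (mem_cuts.1 hH).1 q hq
  have hl := isSide_side hq'
  obtain ⟨t, u, hv⟩ := exists_visits hp'
  rw [chord_eq_segment hv] at hw
  obtain ⟨s, -, -, -, -, h4, h5⟩ := hv
  refine ⟨fun h => hl.pos_of_segment hw ((hl.pos_iff _).2 (h _ h4)) ((hl.pos_iff _).2 (h _ h5)),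
    fun h => ?_⟩
  have h := ((mem_cuts.1 hH).2 q hq p hp hqp).resolve_left h
  exact hl.neg_of_segment hw ((hl.neg_iff hq' _).2 (h _ h4)) ((hl.neg_iff hq' _).2 (h _ h5))

/-- Along the chord of `p` the functions of the other chords have strict signs, given by whether `p`
is nested in `q`; the weak inequalities that describe the closure then determine the pattern of the
face except at `p`. -/
lemma chord_subset_closure_iff (hH : H ∈ α.cuts) (hp : p ∈ H) :
    chord α.toFun p ⊆ closure F.1 ↔ ∀ q ∈ H, q ≠ p → (FaceIn F q ↔ α.Inside p q) := by
  have hp' := (mem_cuts.1 hH).1 p hp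
  constructor
  · intro h q hq hqp
    obtain ⟨t, u, s, -, -, -, -, h4, -⟩ := exists_visits hp'
    have hw := mem_chord_of_over h4
    obtain ⟨h1, h2⟩ := inside_iff_side hH hp hq hqp hw
    obtain ⟨h3, h4⟩ := ((mem_closure_face_iff hH).1 (h hw)).2 q hq
    refine ⟨fun hF => ?_, fun hI => ?_⟩
    · by_contra hI; exact (h3 hF).not_gt (h2 hI)
    · by_contra hF; exact (h4 hF).not_gt (h1 hI)
  · intro h w hw
    refine (mem_closure_face_iff hH).2 ⟨chord_subset_disk hw, fun q hq => ?_⟩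
    by_cases e : q = p
    · subst e
      rw [((mem_chord_iff hp' (isSide_side hp')).1 hw).2]
      exact ⟨fun _ => le_rfl, fun _ => le_rfl⟩
    · obtain ⟨h1, h2⟩ := inside_iff_side hH hp hq e hw
      rw [h q hq e]
      exact ⟨fun hI => (h1 hI).le, fun hI => (h2 hI).le⟩

lemma joins_iff (hH : H ∈ α.cuts) : Face.Joins p F F' ↔ p ∈ H ∧ F ≠ F' ∧
    (∀ q ∈ H, q ≠ p → (FaceIn F q ↔ α.Inside p q)) ∧
      ∀ q ∈ H, q ≠ p → (FaceIn F' q ↔ α.Inside p q) := by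
  refine and_congr_right fun hp => ?_
  rw [chord_subset_closure_iff hH hp, chord_subset_closure_iff hH hp]

/-- Two faces adjacent to the chord of `p` lie on different sides of it. -/
lemma faceIn_of_joins (hH : H ∈ α.cuts) (h : Face.Joins p F F') : FaceIn F p ↔ ¬ FaceIn F' p := by
  obtain ⟨hp, hne, h1, h2⟩ := (joins_iff hH).1 h
  by_contra hcon
  refine hne (face_ext hH fun q hq => ?_)
  by_cases e : q = p
  · subst e; tauto
  · rw [h1 q hq e, h2 q hq e]

lemma joins_symm (h : Face.Joins p F F') : Face.Joins p F' F :=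
  ⟨h.1, h.2.1.symm, h.2.2.2, h.2.2.1⟩

lemma faceIn_iff_of_joins (hH : H ∈ α.cuts) (h : Face.Joins p F F') (hq : q ∈ H) (hqp : q ≠ p) :
    FaceIn F q ↔ FaceIn F' q := by
  obtain ⟨hp, hne, h1, h2⟩ := (joins_iff hH).1 h
  rw [h1 q hq hqp, h2 q hq hqp]

lemma joins_unique (hH : H ∈ α.cuts) (h : Face.Joins p F F') (h' : Face.Joins q F F') : p = q := by
  by_contra hne
  have := faceIn_of_joins hH h
  have := faceIn_iff_of_joins hH h' h.1 hne
  tauto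

lemma joins_right_unique (hH : H ∈ α.cuts) {F'' : Face α.toFun H} (h : Face.Joins p F F')
    (h' : Face.Joins p F F'') : F' = F'' := by
  refine face_ext hH fun q hq => ?_
  by_cases e : q = p
  · subst e
    have := faceIn_of_joins hH h
    have := faceIn_of_joins hH h'
    tauto
  · rw [← faceIn_iff_of_joins hH h hq e, faceIn_iff_of_joins hH h' hq e]

lemma exists_joins (hH : H ∈ α.cuts) (hp : p ∈ H) :
    ∃ F F' : Face α.toFun H, Face.Joins p F F' ∧ FaceIn F p ∧ ¬ FaceIn F' p := by
  obtain ⟨F, hF⟩ := exists_face_inner hH hp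
  obtain ⟨F', hF'⟩ := exists_face_outer hH hp
  have h1 : FaceIn F p := (hF p hp).2 (Or.inl rfl)
  have h2 : ¬ FaceIn F' p := fun h => not_inside_self ((mem_cuts.1 hH).1 p hp) ((hF' p hp).1 h)
  refine ⟨F, F', (joins_iff hH).2 ⟨hp, ?_, fun q hq e => ?_, fun q hq _ => hF' q hq⟩, h1, h2⟩
  · rintro rfl; exact h2 h1
  · rw [hF q hq]; simp [e]

lemma finite_face (hH : H ∈ α.cuts) : Finite (Face α.toFun H) := by
  refine Finite.of_injective (β := Set H) (fun F => {q | FaceIn F q.1}) fun F F' h => ?_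
  exact face_ext hH fun q hq => Set.ext_iff.1 h ⟨q, hq⟩

/-- The dual graph of the splitting of the disk. -/
def faceGraph (α : PointedLoop S) (H : Finset S) : SimpleGraph (Face α.toFun H) where
  Adj F F' := ∃ p, Face.Joins p F F'
  symm := ⟨fun _ _ ⟨p, h⟩ => ⟨p, joins_symm h⟩⟩
  loopless := ⟨fun _ ⟨_, h⟩ => h.2.1 rfl⟩

/-- Removing the edge `[p]` separates the faces on the two sides of the chord of `p`. -/
lemma faceIn_iff_of_reachable (hH : H ∈ α.cuts) {F₁ F₂ : Face α.toFun H}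
    (h : Face.Joins p F F') (hr : ((α.faceGraph H).deleteEdges {s(F, F')}).Reachable F₁ F₂) :
    FaceIn F₁ p ↔ FaceIn F₂ p := by
  obtain ⟨w⟩ := hr
  induction w with
  | nil => rfl
  | @cons a b c hab _ ih =>
    rw [← ih]
    obtain ⟨⟨q, hq⟩, hne⟩ := SimpleGraph.deleteEdges_adj.1 hab
    refine faceIn_iff_of_joins hH hq h.1 fun e => hne ?_
    subst e
    obtain ⟨-, -, h1, h2⟩ := (joins_iff hH).1 h
    obtain ⟨-, -, k1, k2⟩ := (joins_iff hH).1 hq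
    have e1 := faceIn_of_joins hH h
    have e2 := faceIn_of_joins hH hq
    rw [Set.mem_singleton_iff, Sym2.eq_iff]
    have ext : ∀ {A B : Face α.toFun H}, (∀ q ∈ H, q ≠ p → (FaceIn A q ↔ α.Inside p q)) →
        (∀ q ∈ H, q ≠ p → (FaceIn B q ↔ α.Inside p q)) → (FaceIn A p ↔ FaceIn B p) → A = B := by
      intro A B hA hB hAB
      refine face_ext hH fun q hq => ?_
      by_cases e : q = p
      · rw [e, hAB]
      · rw [hA q hq e, hB q hq e]
    by_cases hc : FaceIn a p ↔ FaceIn F p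
    · exact Or.inl ⟨ext k1 h1 hc, ext k2 h2 (by tauto)⟩
    · exact Or.inr ⟨ext k1 h2 (by tauto), ext k2 h1 (by tauto)⟩

/-- Leaving a face through the chord of the innermost crossing around it reduces the number of
crossings around it, so each face is connected with the root face. Each edge is a bridge, because
passing through other chords does not change the side of its own chord. -/
lemma faceGraph_isTree (hH : H ∈ α.cuts) : (α.faceGraph H).IsTree := by
  classical
  obtain ⟨R, hR⟩ := exists_face_root hH
  have hreach : ∀ n, ∀ F : Face α.toFun H, (H.filter fun q => FaceIn F q).card = n →
      (α.faceGraph H).Reachable F R := by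
    intro n
    induction n using Nat.strong_induction_on with
    | _ n ih =>
      intro F hn
      rcases face_cases hH F with h | ⟨p, hp, h⟩
      · rw [face_ext hH (F := F) (F' := R) fun q hq => iff_of_false (h q hq) (hR q hq)]
      · obtain ⟨F', hF'⟩ := exists_face_outer hH hp
        have hpc := (mem_cuts.1 hH).1 p hp
        have hJ : Face.Joins p F F' := (joins_iff hH).2 ⟨hp, by
            rintro rfl
            exact not_inside_self hpc ((hF' p hp).1 ((h p hp).2 (Or.inl rfl))),
          fun q hq e => by rw [h q hq]; simp [e], fun q hq _ => hF' q hq⟩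
        have hadj : (α.faceGraph H).Adj F F' := ⟨p, hJ⟩
        refine hadj.reachable.trans (ih _ ?_ F' rfl)
        rw [← hn]
        refine Finset.card_lt_card ((Finset.ssubset_iff_of_subset ?_).2 ⟨p, ?_, ?_⟩)
        · intro q hq
          rw [Finset.mem_filter] at hq ⊢
          exact ⟨hq.1, (h q hq.1).2 (Or.inr ((hF' q hq.1).1 hq.2))⟩
        · exact Finset.mem_filter.2 ⟨hp, (h p hp).2 (Or.inl rfl)⟩
        · rw [Finset.mem_filter]
          exact fun hh => not_inside_self hpc ((hF' p hp).1 hh.2)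
  have : Nonempty (Face α.toFun H) := ⟨R⟩
  refine ⟨⟨fun F F' => (hreach _ F rfl).trans (hreach _ F' rfl).symm⟩, ?_⟩
  rw [SimpleGraph.isAcyclic_iff_forall_adj_isBridge]
  rintro F F' ⟨p, h⟩
  rw [SimpleGraph.isBridge_iff]
  intro hr
  have := faceIn_iff_of_reachable hH h hr
  have := faceIn_of_joins hH h
  tauto

end PointedLoop

end Faces

/-! ### The cyclic order of the circle -/

lemma circleCcw_iff_of_lift {s : ℝ} {y z : Circle} : CircleCcw (Circle.exp s) y z ↔
    ∃ t u, Circle.exp t = y ∧ Circle.exp u = z ∧ s < t ∧ t < u ∧ u < s + 2 * Real.pi := by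
  constructor
  · rintro ⟨s', t, u, hs, rfl, rfl, h1, h2, h3⟩
    obtain ⟨k, rfl⟩ := Circle.exp_eq_exp.1 hs
    refine ⟨t + (-k : ℤ) * (2 * Real.pi), u + (-k : ℤ) * (2 * Real.pi),
      Circle.exp_add_int_mul _ _, Circle.exp_add_int_mul _ _, ?_, ?_, ?_⟩ <;> push_cast <;> linarith
  · rintro ⟨t, u, ht, hu, h⟩
    exact ⟨s, t, u, rfl, ht, hu, h⟩

namespace CircleCcw

variable {w x y z : Circle}

lemma rotate (h : CircleCcw x y z) : CircleCcw y z x := by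
  obtain ⟨s, t, u, rfl, rfl, rfl, h1, h2, h3⟩ := h
  exact ⟨t, u, s + 2 * Real.pi, rfl, rfl, Circle.exp_add_two_pi _, h2, h3, by linarith⟩

lemma ne (h : CircleCcw x y z) : x ≠ y := by
  obtain ⟨s, t, u, rfl, rfl, rfl, h1, h2, h3⟩ := h
  exact fun e => h1.ne (Circle.exp_injOn_half_open (a := s) ⟨le_rfl, by linarith⟩
    ⟨h1.le, by linarith⟩ e)

lemma asymm (h : CircleCcw x y z) : ¬ CircleCcw z y x := by
  intro h'
  obtain ⟨s, rfl⟩ := Circle.exp_surjective x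
  obtain ⟨t, u, rfl, rfl, h1, h2, h3⟩ := circleCcw_iff_of_lift.1 h
  obtain ⟨u', t', e1, e2, k1, k2, k3⟩ := circleCcw_iff_of_lift.1 h'.rotate.rotate
  have := Circle.exp_injOn_half_open (a := s) ⟨by linarith, by linarith⟩
    ⟨by linarith, by linarith⟩ e1
  have := Circle.exp_injOn_half_open (a := s) ⟨by linarith, by linarith⟩
    ⟨by linarith, by linarith⟩ e2
  linarith

lemma trans (h : CircleCcw w x y) (h' : CircleCcw w y z) : CircleCcw w x z := by
  obtain ⟨s, rfl⟩ := Circle.exp_surjective w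
  obtain ⟨t, u, rfl, rfl, h1, h2, h3⟩ := circleCcw_iff_of_lift.1 h
  obtain ⟨u', v, e1, rfl, k1, k2, k3⟩ := circleCcw_iff_of_lift.1 h'
  have := Circle.exp_injOn_half_open (a := s) ⟨by linarith, by linarith⟩
    ⟨by linarith, by linarith⟩ e1
  exact circleCcw_iff_of_lift.2 ⟨t, v, rfl, rfl, h1, by linarith, k3⟩

lemma total (h1 : x ≠ y) (h2 : y ≠ z) (h3 : z ≠ x) : CircleCcw x y z ∨ CircleCcw z y x := by
  obtain ⟨s, rfl⟩ := Circle.exp_surjective x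
  obtain ⟨t, ht, rfl⟩ := Circle.exists_exp_eq_mem_Ico s y
  obtain ⟨u, hu, rfl⟩ := Circle.exists_exp_eq_mem_Ico s z
  have h1' : s < t := lt_of_le_of_ne ht.1 (by rintro rfl; exact h1 rfl)
  have h3' : s < u := lt_of_le_of_ne hu.1 (by rintro rfl; exact h3 rfl)
  rcases lt_trichotomy t u with h | h | h
  · exact Or.inl ⟨s, t, u, rfl, rfl, rfl, h1', h, hu.2⟩
  · exact absurd (by rw [h]) h2
  · exact Or.inr (rotate ⟨s, u, t, rfl, rfl, rfl, h3', h, ht.2⟩)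

end CircleCcw

lemma IsCollapse.exp_congr {A : Set Circle} {c : ℝ → ℝ} (hc : IsCollapse A c) {x y : ℝ}
    (h : Circle.exp x = Circle.exp y) : Circle.exp (c x) = Circle.exp (c y) := by
  obtain ⟨k, rfl⟩ := Circle.exp_eq_exp.1 h
  rw [deg_int hc.deg, Circle.exp_add_int_mul]

/-- A monotone map of degree one preserves the weak cyclic order, and the order is strict because
the three images are distinct. -/
lemma IsCollapse.circleCcw_iff {A : Set Circle} {c : ℝ → ℝ} (hc : IsCollapse A c) {x y z : ℝ}
    (hxy : Circle.exp (c x) ≠ Circle.exp (c y)) (hyz : Circle.exp (c y) ≠ Circle.exp (c z))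
    (hzx : Circle.exp (c z) ≠ Circle.exp (c x)) :
    CircleCcw (Circle.exp (c x)) (Circle.exp (c y)) (Circle.exp (c z)) ↔
      CircleCcw (Circle.exp x) (Circle.exp y) (Circle.exp z) := by
  rw [circleCcw_iff_of_lift, circleCcw_iff_of_lift]
  constructor
  · rintro ⟨t, u, ht, hu, h1, h2, h3⟩
    obtain ⟨k, rfl⟩ := Circle.exp_eq_exp.1 ht
    obtain ⟨l, rfl⟩ := Circle.exp_eq_exp.1 hu
    rw [← deg_int hc.deg] at h1 h2 h3
    rw [← deg_int hc.deg] at h2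
    rw [← hc.deg] at h3
    exact ⟨_, _, Circle.exp_add_int_mul y k, Circle.exp_add_int_mul z l, hc.mono.reflect_lt h1,
      hc.mono.reflect_lt h2, hc.mono.reflect_lt h3⟩
  · rintro ⟨t, u, ht, hu, h1, h2, h3⟩
    rw [← hc.exp_congr ht, ← hc.exp_congr hu] at *
    refine ⟨c t, c u, rfl, rfl, lt_of_le_of_ne (hc.mono h1.le) fun e => hxy (by rw [e]),
      lt_of_le_of_ne (hc.mono h2.le) fun e => hyz (by rw [e]), ?_⟩
    rw [← hc.deg]
    refine lt_of_le_of_ne (hc.mono h3.le) fun e => hzx ?_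
    rw [e, hc.deg, Circle.exp_add_two_pi]

/-! ### The dual tree of a cut -/

section DualTree

variable {S : Type*} [TopologicalSpace S] [ChartedSpace (EuclideanHalfSpace 2) S]

namespace PointedLoop

variable {α : PointedLoop S} {p q : S} {H : Finset S} {F F' : Face α.toFun H} {c : ℝ → ℝ}

/-- The two visits of a crossing whose chord is adjacent to a face are not separated by that
face. -/
lemma collapse_chord_eq (hH : H ∈ α.cuts) (hc : IsCollapse F.arcs c) (h : Face.Joins p F F')
    {x y : ℝ} (hx : α.toFun (Circle.exp x) = p) (hy : α.toFun (Circle.exp y) = p) :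
    Circle.exp (c x) = Circle.exp (c y) := by
  obtain ⟨t, u, hv⟩ := exists_visits ((mem_cuts.1 hH).1 p h.1)
  have key : Circle.exp (c t) = Circle.exp (c u) := by
    have hv' := hv
    obtain ⟨s, -, h1, h2, h3, -⟩ := hv'
    -- The face lies on one side of the chord, so the open arc on the other side contains no point
    -- of its boundary; it is collapsed, which identifies the two ends of the chord.
    by_cases hF : FaceIn F p
    · have : c u = c (t + 2 * Real.pi) := by
        rw [hc.fiber _ _ (by linarith)]
        intro v hv' hm
        have h4 := ((mem_arcs_iff hH).1 hm p h.1).1 hF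
        have h5 : Circle.exp v ∈ (α.carc p)ᶜ := by rw [hv.outer_arc_eq]; exact ⟨v, hv', rfl⟩
        exact h5 h4
      rw [this, hc.deg, Circle.exp_add_two_pi]
    · have : c t = c u := by
        rw [hc.fiber _ _ h2]
        intro v hv' hm
        refine ((mem_arcs_iff hH).1 hm p h.1).2 hF ?_
        rw [hv.arc_eq]; exact ⟨v, hv', rfl⟩
      rw [this]
  obtain ⟨s, hv⟩ := hv
  have : ∀ z, α.toFun (Circle.exp z) = p → Circle.exp (c z) = Circle.exp (c t) := by
    intro z hz
    rcases VisitsFrom.eq_or hv hz with e | e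
    · exact hc.exp_congr e
    · rw [hc.exp_congr e, key]
  rw [this x hx, this y hy]

/-- Moving along the boundary of the face, one leaves the chord at the first visit of `p` if the
face is inside `p`, and at the second visit otherwise; a short arc after that visit belongs to the
face. Such arcs keep the images of different chords apart in `collapse_chord_ne`. -/
lemma exists_right_nhd (hH : H ∈ α.cuts) (h : Face.Joins p F F') :
    ∃ x, α.toFun (Circle.exp x) = p ∧ ∃ δ > 0, ∀ y ∈ Set.Ioo x (x + δ), Circle.exp y ∈ F.arcs := by
  obtain ⟨t, u, hv⟩ := exists_visits ((mem_cuts.1 hH).1 p h.1)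
  have hv' := hv
  obtain ⟨s, -, h1, h2, h3, h4, h5⟩ := hv'
  obtain ⟨-, -, hF, -⟩ := (joins_iff hH).1 h
  have rest : ∀ y, (∀ q ∈ H, q ≠ p → (Circle.exp y ∈ α.arc q ↔ α.Inside p q) ∧
      (Circle.exp y ∈ α.carc q ↔ α.Inside p q)) →
      (FaceIn F p → Circle.exp y ∈ α.carc p) ∧ (¬ FaceIn F p → Circle.exp y ∉ α.arc p) →
      Circle.exp y ∈ F.arcs := by
    intro y hy hp
    refine (mem_arcs_iff hH).2 fun q hq => ?_
    by_cases e : q = p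
    · rwa [e]
    · rw [(hy q hq e).1, (hy q hq e).2, hF q hq e]
      exact ⟨id, id⟩
  by_cases hFp : FaceIn F p
  · obtain ⟨δ, hδ, H'⟩ := exists_Ioo_of_nhds (eventually_arc_iff hH h.1 h4)
    refine ⟨t, h4, min δ (u - t), lt_min hδ (by linarith), fun y hy => rest y (H' _ ?_) ?_⟩
    · exact ⟨by linarith [hy.1], by linarith [hy.2, min_le_left δ (u - t)]⟩
    · refine ⟨fun _ => arc_subset_carc ?_, fun hn => absurd hFp hn⟩
      rw [hv.arc_eq]
      exact ⟨y, ⟨hy.1, by linarith [hy.2, min_le_right δ (u - t)]⟩, rfl⟩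
  · obtain ⟨δ, hδ, H'⟩ := exists_Ioo_of_nhds (eventually_arc_iff hH h.1 h5)
    have hpos : 0 < t + 2 * Real.pi - u := by linarith
    refine ⟨u, h5, min δ (t + 2 * Real.pi - u), lt_min hδ hpos, fun y hy => rest y (H' _ ?_) ?_⟩
    · exact ⟨by linarith [hy.1], by linarith [hy.2, min_le_left δ (t + 2 * Real.pi - u)]⟩
    · refine ⟨fun hn => absurd hn hFp, fun _ hm => ?_⟩
      have : Circle.exp y ∈ (α.carc p)ᶜ := by
        rw [hv.outer_arc_eq]
        exact ⟨y, ⟨hy.1, by linarith [hy.2, min_le_right δ (t + 2 * Real.pi - u)]⟩, rfl⟩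
      exact this (arc_subset_carc hm)

lemma collapse_chord_ne (hH : H ∈ α.cuts) (hc : IsCollapse F.arcs c) {F'' : Face α.toFun H}
    (h : Face.Joins p F F') (h' : Face.Joins q F F'') (hpq : p ≠ q)
    {x y : ℝ} (hx : α.toFun (Circle.exp x) = p) (hy : α.toFun (Circle.exp y) = q) :
    Circle.exp (c x) ≠ Circle.exp (c y) := by
  intro he
  obtain ⟨x', hx', δ, hδ, hxδ⟩ := exists_right_nhd hH h
  obtain ⟨y', hy', ε, hε, hyε⟩ := exists_right_nhd hH h'
  rw [collapse_chord_eq hH hc h hx hx', collapse_chord_eq hH hc h' hy hy'] at he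
  obtain ⟨k, hk⟩ := Circle.exp_eq_exp.1 he
  rw [← deg_int hc.deg] at hk
  rcases lt_trichotomy x' (y' + k * (2 * Real.pi)) with hlt | heq | hlt
  · have := lt_min hδ (sub_pos.2 hlt)
    set μ := min δ (y' + k * (2 * Real.pi) - x')
    refine (hc.lt_of_mem (u := x' + μ / 2) (by linarith) ?_ (hxδ _ ⟨by linarith, ?_⟩)).ne hk
    · linarith [min_le_right δ (y' + k * (2 * Real.pi) - x')]
    · linarith [min_le_left δ (y' + k * (2 * Real.pi) - x')]
  · rw [heq, Circle.exp_add_int_mul] at hx'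
    exact hpq (hx'.symm.trans hy')
  · have := lt_min hε (sub_pos.2 hlt)
    set μ := min ε (x' - (y' + k * (2 * Real.pi)))
    refine (hc.lt_of_mem (s := y' + k * (2 * Real.pi)) (t := x')
      (u := y' + μ / 2 + k * (2 * Real.pi)) (by linarith) ?_ ?_).ne' hk
    · linarith [min_le_right ε (x' - (y' + k * (2 * Real.pi)))]
    · rw [Circle.exp_add_int_mul]
      exact hyε _ ⟨by linarith, by linarith [min_le_left ε (x' - (y' + k * (2 * Real.pi)))]⟩

/-- The counterclockwise order of the faces around a face. -/
def FaceCcw (v a b c : Face α.toFun H) : Prop :=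
  ∃ x y z : Circle, CircleCcw x y z ∧ a ≠ b ∧ b ≠ c ∧ c ≠ a ∧
    Face.Joins (α.toFun x) v a ∧ Face.Joins (α.toFun y) v b ∧ Face.Joins (α.toFun z) v c

/-- Collapsing the gaps turns each chord adjacent to the face into one point of the circle, and
different chords into different points. The order of the neighbours becomes the cyclic order of
these points and inherits its axioms, whichever ends of the chords are used as witnesses. -/
lemma exists_ccw_model (hH : H ∈ α.cuts) (hc : ∃ c, IsCollapse F.arcs c) :
    ∃ ξ : Face α.toFun H → Circle,
      (∀ a b, (α.faceGraph H).Adj F a → (α.faceGraph H).Adj F b → a ≠ b → ξ a ≠ ξ b) ∧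
      ∀ a b d, FaceCcw F a b d ↔ ((α.faceGraph H).Adj F a ∧ (α.faceGraph H).Adj F b ∧
        (α.faceGraph H).Adj F d) ∧ CircleCcw (ξ a) (ξ b) (ξ d) := by
  classical
  obtain ⟨c, hc⟩ := hc
  have hx : ∀ a, (α.faceGraph H).Adj F a → ∃ x : ℝ, Face.Joins (α.toFun (Circle.exp x)) F a := by
    rintro a ⟨p, hp⟩
    obtain ⟨t, u, s, -, -, -, -, h4, -⟩ := exists_visits ((mem_cuts.1 hH).1 p hp.1)
    exact ⟨t, by rwa [h4]⟩
  choose X hX using hx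
  let ξ : Face α.toFun H → Circle := fun a =>
    if h : (α.faceGraph H).Adj F a then Circle.exp (c (X a h)) else 1
  have hξ : ∀ a x, Face.Joins (α.toFun (Circle.exp x)) F a → Circle.exp (c x) = ξ a := by
    intro a x h
    have hadj : (α.faceGraph H).Adj F a := ⟨_, h⟩
    simp only [ξ, dif_pos hadj]
    exact collapse_chord_eq hH hc h rfl (joins_unique hH (hX a hadj) h)
  have hne : ∀ a b, (α.faceGraph H).Adj F a → (α.faceGraph H).Adj F b → a ≠ b → ξ a ≠ ξ b := by
    intro a b ha hb hab
    rw [← hξ a _ (hX a ha), ← hξ b _ (hX b hb)]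
    refine collapse_chord_ne hH hc (hX a ha) (hX b hb) (fun e => hab ?_) rfl rfl
    have := hX a ha
    rw [e] at this
    exact joins_right_unique hH this (hX b hb)
  refine ⟨ξ, hne, fun a b d => ⟨?_, ?_⟩⟩
  · rintro ⟨x, y, z, h, hab, hbd, hda, ha, hb, hd⟩
    obtain ⟨x, rfl⟩ := Circle.exp_surjective x
    obtain ⟨y, rfl⟩ := Circle.exp_surjective y
    obtain ⟨z, rfl⟩ := Circle.exp_surjective z
    refine ⟨⟨⟨_, ha⟩, ⟨_, hb⟩, ⟨_, hd⟩⟩, ?_⟩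
    have h1 := hne a b ⟨_, ha⟩ ⟨_, hb⟩ hab
    have h2 := hne b d ⟨_, hb⟩ ⟨_, hd⟩ hbd
    have h3 := hne d a ⟨_, hd⟩ ⟨_, ha⟩ hda
    rw [← hξ a _ ha, ← hξ b _ hb, ← hξ d _ hd]
    rw [← hξ a _ ha, ← hξ b _ hb] at h1
    rw [← hξ b _ hb, ← hξ d _ hd] at h2
    rw [← hξ d _ hd, ← hξ a _ ha] at h3
    exact (hc.circleCcw_iff h1 h2 h3).2 h
  · rintro ⟨⟨ha, hb, hd⟩, h⟩
    have h1 := h.ne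
    have h2 := h.rotate.ne
    have h3 := h.rotate.rotate.ne
    refine ⟨Circle.exp (X a ha), Circle.exp (X b hb), Circle.exp (X d hd), ?_,
      fun e => h1 (by rw [e]), fun e => h2 (by rw [e]), fun e => h3 (by rw [e]),
      hX a ha, hX b hb, hX d hd⟩
    rw [← hξ a _ (hX a ha), ← hξ b _ (hX b hb), ← hξ d _ (hX d hd)] at h
    rw [← hξ a _ (hX a ha), ← hξ b _ (hX b hb)] at h1
    rw [← hξ b _ (hX b hb), ← hξ d _ (hX d hd)] at h2
    rw [← hξ d _ (hX d hd), ← hξ a _ (hX a ha)] at h3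
    exact (hc.circleCcw_iff h1 h2 h3).1 h

open Classical in
/-- The sign of an edge of the dual graph. -/
def faceSign (α : PointedLoop S) (H : Finset S) (e : Sym2 (Face α.toFun H)) : ℤˣ :=
  if h : ∃ p, ∃ F F' : Face α.toFun H, e = s(F, F') ∧ Face.Joins p F F' then
    α.crossingSign h.choose else 1

lemma faceSign_eq (hH : H ∈ α.cuts) (h : Face.Joins p F F') :
    α.faceSign H s(F, F') = α.crossingSign p := by
  have hex : ∃ p, ∃ G G' : Face α.toFun H, s(F, F') = s(G, G') ∧ Face.Joins p G G' :=
    ⟨p, F, F', rfl, h⟩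
  rw [faceSign, dif_pos hex]
  obtain ⟨G, G', he, hJ⟩ := hex.choose_spec
  congr 1
  rcases Sym2.eq_iff.1 he with ⟨rfl, rfl⟩ | ⟨rfl, rfl⟩
  · exact joins_unique hH hJ h
  · exact joins_unique hH (joins_symm hJ) h

/-- The dual tree of a cut exists if all its faces can be labeled. -/
lemma exists_isDualTree_of_labels (hH : H ∈ α.cuts)
    (hl : ∀ F : Face α.toFun H, ∃ β : GenericLoop S, Traverses α.toFun F.arcs β.toFun) :
    ∃ T : LoopTree S, α.IsDualTree H T := by
  choose L hL using hl
  have hc : ∀ F : Face α.toFun H, ∃ c, IsCollapse F.arcs c := fun F => by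
    obtain ⟨c, hc, -⟩ := traverses_iff.1 (hL F)
    exact ⟨c, hc⟩
  choose ξ hξ hccw using fun F : Face α.toFun H => exists_ccw_model hH (hc F)
  obtain ⟨R, hR⟩ := exists_face_root hH
  refine ⟨{
    V := Face α.toFun H
    finite := finite_face hH
    graph := α.faceGraph H
    isTree := faceGraph_isTree hH
    root := R
    label := fun F => ⟦L F⟧
    sign := α.faceSign H
    ccw := FaceCcw
    ccw_adj := fun v a b c h => ((hccw v a b c).1 h).1.1
    ccw_rotate := fun v a b c h => by
      rw [hccw] at h ⊢
      exact ⟨⟨h.1.2.1, h.1.2.2, h.1.1⟩, h.2.rotate⟩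
    ccw_asymm := fun v a b c h h' => by
      rw [hccw] at h h'
      exact h.2.asymm h'.2
    ccw_trans := fun v a b c d h h' => by
      rw [hccw] at h h' ⊢
      exact ⟨⟨h.1.1, h.1.2.1, h'.1.2.2⟩, h.2.trans h'.2⟩
    ccw_total := fun v a b c ha hb hc h1 h2 h3 => by
      rw [hccw, hccw]
      rcases CircleCcw.total (hξ v a b ha hb h1) (hξ v b c hb hc h2) (hξ v c a hc ha h3) with h | h
      · exact Or.inl ⟨⟨ha, hb, hc⟩, h⟩
      · exact Or.inr ⟨⟨hc, hb, ha⟩, h⟩ }, Equiv.refl _, fun v w => Iff.rfl,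
    (base_mem_arcs_iff hH).2 hR, fun v => ⟨L v, rfl, hL v⟩, fun v w p h => faceSign_eq hH h,
    fun v a b c => Iff.rfl⟩

/-- All the conditions refer to faces, so the two identifications of vertices with faces compose to
a homeomorphism. Only one face can be the root, and the labels agree because they come from loops
traversing the same arcs. -/
lemma IsDualTree.equiv (hH : H ∈ α.cuts) {T T' : LoopTree S} (h : α.IsDualTree H T)
    (h' : α.IsDualTree H T') : T ≈ T' := by
  obtain ⟨F, h1, h2, h3, h4, h5⟩ := h
  obtain ⟨G, k1, k2, k3, k4, k5⟩ := h'
  refine ⟨F.trans G.symm, fun a b => ?_, ?_, fun v => ?_, fun a b hab => ?_, fun v a b c => ?_⟩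
  · simp [h1, k1]
  · rw [Equiv.trans_apply, Equiv.symm_apply_eq]
    refine face_ext hH fun q hq => ?_
    exact iff_of_false ((base_mem_arcs_iff hH).1 h2 q hq) ((base_mem_arcs_iff hH).1 k2 q hq)
  · obtain ⟨β, hβ, hb⟩ := h3 v
    obtain ⟨γ, hγ, hg⟩ := k3 (G.symm (F v))
    rw [Equiv.apply_symm_apply] at hg
    rw [Equiv.trans_apply, ← hβ, ← hγ]
    exact (GenericLoop.mk_eq_of_traverses (g := Homeomorph.refl S) (isClosed_arcs _)
      IsIsotopyEnd.refl hb hg).symm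
  · obtain ⟨p, hp⟩ := (h1 a b).1 hab
    rw [h4 a b p hp]
    exact k4 _ _ p (by simpa using hp)
  · rw [h5, k5]
    simp

end PointedLoop

end DualTree

/-! ### Transfer of dual trees to subloops -/

section Transfer

variable {S : Type*} [TopologicalSpace S] [ChartedSpace (EuclideanHalfSpace 2) S]

/-- `T₁` is a part of the tree `T`, with the restricted structure. -/
structure LoopTree.IsSub (T₁ T : LoopTree S) (j : T₁.V → T.V) : Prop where
  inj : Function.Injective j
  adj : ∀ a b, T.graph.Adj (j a) (j b) ↔ T₁.graph.Adj a b
  label : ∀ v, T.label (j v) = T₁.label v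
  sign : ∀ a b, T₁.graph.Adj a b → T.sign s(j a, j b) = T₁.sign s(a, b)
  ccw : ∀ v a b c, T.ccw (j v) (j a) (j b) (j c) ↔ T₁.ccw v a b c

open PointedLoop

/-- A cut `H` of `α` induces the cut `H'` of the subloop `β`, whose root face lies in the face
`F₀`; the subloop runs along those faces that are not separated from `F₀` by the crossings of `H`
that do not survive. -/
structure CutSubLoop (α β : PointedLoop S) (g : S ≃ₜ S) (A : Set Circle) (c : ℝ → ℝ)
    (N H H' : Finset S) (F₀ : Face α.toFun H) : Prop extends SubLoop α β g A c N where
  cut : H ∈ α.cuts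
  cut' : H' ∈ β.cuts
  mem_cut' : ∀ y, y ∈ H' ↔ ∃ q ∈ H, q ∈ N ∧ g q = y
  root_out : ∀ q ∈ H, q ∈ N → ¬ FaceIn F₀ q
  mem_A : ∀ x, x ∈ A ↔
    ∀ q ∈ H, q ∉ N → (FaceIn F₀ q → x ∈ α.carc q) ∧ (¬ FaceIn F₀ q → x ∉ α.arc q)

/-- The crossings of `H` outside `N` do not separate the faces `F` and `F₀`. -/
def PointedLoop.SameSide {α : PointedLoop S} {H : Finset S} (N : Finset S)
    (F₀ F : Face α.toFun H) : Prop :=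
  ∀ q ∈ H, q ∉ N → (FaceIn F q ↔ FaceIn F₀ q)

/-- The face `F'` of the subloop corresponds to the face `F`. -/
def PointedLoop.FaceCorr {α β : PointedLoop S} {H H' : Finset S} (g : S ≃ₜ S) (N : Finset S)
    (F : Face α.toFun H) (F' : Face β.toFun H') : Prop :=
  ∀ q ∈ H, q ∈ N → (FaceIn F q ↔ FaceIn F' (g q))

namespace CutSubLoop

variable {α β : PointedLoop S} {g : S ≃ₜ S} {A : Set Circle} {c : ℝ → ℝ} {N H H' : Finset S}
  {F₀ F G K L : Face α.toFun H} {F' G' K' L' : Face β.toFun H'} {p q : S}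

lemma mem' (h : CutSubLoop α β g A c N H H' F₀) (hp : p ∈ H) (hpN : p ∈ N) : g p ∈ H' :=
  (h.mem_cut' _).2 ⟨p, hp, hpN, rfl⟩

/-- The points over a surviving crossing lie in `A`, hence on the same side of the chord of a lost
crossing `q` as `F₀`. -/
lemma root_iff_inside (h : CutSubLoop α β g A c N H H' F₀) (hp : p ∈ H) (hpN : p ∈ N)
    (hq : q ∈ H) (hqN : q ∉ N) : FaceIn F₀ q ↔ α.Inside p q := by
  obtain ⟨t, u, s, -, -, -, -, hz, -⟩ := exists_visits ((mem_cuts.1 h.cut).1 p hp)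
  obtain ⟨h1, h2⟩ := (h.mem_A _).1 (h.mem_of_over hpN hz) q hq hqN
  have hqp : q ≠ p := by rintro rfl; exact hqN hpN
  obtain ⟨h3, h4⟩ := (eventually_arc_iff h.cut hp hz).self_of_nhds q hq hqp
  rw [h4] at h1
  rw [h3] at h2
  tauto

/-- The innermost crossing around `F` decides. If it survives, its image gives the inner face
wanted. If it is lost, it is also around `F₀`; a surviving crossing around `F` would then be around
`F₀` as well, which `root_out` excludes, so the root face corresponds to `F`. -/
lemma exists_corr (h : CutSubLoop α β g A c N H H' F₀) (hF : SameSide N F₀ F) :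
    ∃ F' : Face β.toFun H', FaceCorr g N F F' := by
  have root : (∀ q ∈ H, q ∈ N → ¬ FaceIn F q) →
      ∃ F' : Face β.toFun H', FaceCorr g N F F' := by
    intro hroot
    obtain ⟨F', hF'⟩ := exists_face_root h.cut'
    exact ⟨F', fun q hq hqN => iff_of_false (hroot q hq hqN) (hF' _ (h.mem' hq hqN))⟩
  rcases face_cases h.cut F with h0 | ⟨p, hp, h0⟩
  · exact root fun q hq _ => h0 q hq
  · by_cases hpN : p ∈ N
    · obtain ⟨F', hF'⟩ := exists_face_inner h.cut' (h.mem' hp hpN)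
      refine ⟨F', fun q hq hqN => ?_⟩
      rw [h0 q hq, hF' _ (h.mem' hq hqN), h.inside_iff hqN hpN, g.injective.eq_iff]
    · refine root fun q hq hqN hFq => h.root_out q hq hqN ?_
      have hFp : FaceIn F₀ p := (hF p hp hpN).1 ((h0 p hp).2 (Or.inl rfl))
      rcases (h0 q hq).1 hFq with rfl | hI
      · exact absurd hqN hpN
      · exact hFp.up h.cut hp hq hI

lemma exists_corr' (h : CutSubLoop α β g A c N H H' F₀) (F' : Face β.toFun H') :
    ∃ F : Face α.toFun H, SameSide N F₀ F ∧ FaceCorr g N F F' := by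
  rcases face_cases h.cut' F' with h0 | ⟨y, hy, h0⟩
  · exact ⟨F₀, fun _ _ _ => Iff.rfl, fun q hq hqN =>
      iff_of_false (h.root_out q hq hqN) (h0 _ (h.mem' hq hqN))⟩
  · obtain ⟨p, hp, hpN, rfl⟩ := (h.mem_cut' y).1 hy
    obtain ⟨F, hF⟩ := exists_face_inner h.cut hp
    refine ⟨F, fun q hq hqN => ?_, fun q hq hqN => ?_⟩
    · rw [hF q hq, h.root_iff_inside hp hpN hq hqN]
      have : q ≠ p := by rintro rfl; exact hqN hpN
      tauto
    · rw [hF q hq, h0 _ (h.mem' hq hqN), h.inside_iff hqN hpN, g.injective.eq_iff]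

lemma corr_unique (h : CutSubLoop α β g A c N H H' F₀) (h1 : FaceCorr g N F F')
    (h2 : FaceCorr g N F G') : F' = G' := by
  refine face_ext h.cut' fun y hy => ?_
  obtain ⟨q, hq, hqN, rfl⟩ := (h.mem_cut' y).1 hy
  rw [← h1 q hq hqN, h2 q hq hqN]

lemma corr_unique' (h : CutSubLoop α β g A c N H H' F₀) (hF : SameSide N F₀ F)
    (hG : SameSide N F₀ G) (h1 : FaceCorr g N F F') (h2 : FaceCorr g N G F') : F = G := by
  refine face_ext h.cut fun q hq => ?_
  by_cases hqN : q ∈ N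
  · rw [h1 q hq hqN, h2 q hq hqN]
  · rw [hF q hq hqN, hG q hq hqN]

/-- The conditions that describe the arcs of `F` split in two: those of the lost crossings describe
`A`, and those of the surviving ones describe the arcs of `F'` seen through `c`. -/
lemma mem_arcs_iff (h : CutSubLoop α β g A c N H H' F₀) (hF : SameSide N F₀ F)
    (h1 : FaceCorr g N F F') (x : ℝ) :
    Circle.exp x ∈ F.arcs ↔ Circle.exp x ∈ A ∧ Circle.exp (c x) ∈ F'.arcs := by
  rw [PointedLoop.mem_arcs_iff h.cut, PointedLoop.mem_arcs_iff h.cut', h.mem_A]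
  constructor
  · intro H1
    refine ⟨fun q hq hqN => ?_, fun y hy => ?_⟩
    · rw [← hF q hq hqN]; exact H1 q hq
    · obtain ⟨q, hq, hqN, rfl⟩ := (h.mem_cut' y).1 hy
      rw [← h1 q hq hqN, h.mem_arc hqN, h.mem_carc hqN]
      exact H1 q hq
  · rintro ⟨H1, H2⟩ q hq
    by_cases hqN : q ∈ N
    · have := H2 _ (h.mem' hq hqN)
      rwa [← h1 q hq hqN, h.mem_arc hqN, h.mem_carc hqN] at this
    · rw [hF q hq hqN]; exact H1 q hq hqN

lemma traverses_face (h : CutSubLoop α β g A c N H H' F₀) (hF : SameSide N F₀ F)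
    (h1 : FaceCorr g N F F') {γ : Circle → S} (hγ : Traverses β.toFun F'.arcs γ) :
    Traverses (g ∘ α.toFun) F.arcs γ :=
  h.traverses hγ (fun _ hz hn => (mem_cuts.1 h.cut').1 _ (arcs_frontier h.cut' hz hn))
    (h.mem_arcs_iff hF h1)

lemma mem_of_joins (h : CutSubLoop α β g A c N H H' F₀) (hF : SameSide N F₀ F)
    (hG : SameSide N F₀ G) (hJ : Face.Joins p F G) : p ∈ N := by
  by_contra hpN
  have h1 := hF p hJ.1 hpN
  have h2 := hG p hJ.1 hpN
  have h3 := faceIn_of_joins h.cut hJ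
  tauto

/-- Adjacency is expressed by nesting, which is preserved for surviving crossings; the conditions at
the lost ones hold automatically by `root_iff_inside`. -/
lemma joins_iff (h : CutSubLoop α β g A c N H H' F₀) (hF : SameSide N F₀ F)
    (hG : SameSide N F₀ G) (h1 : FaceCorr g N F F') (h2 : FaceCorr g N G G') (hpN : p ∈ N) :
    Face.Joins p F G ↔ Face.Joins (g p) F' G' := by
  rw [PointedLoop.joins_iff h.cut, PointedLoop.joins_iff h.cut']
  have hm : p ∈ H ↔ g p ∈ H' := by
    refine ⟨fun hp => h.mem' hp hpN, fun hp => ?_⟩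
    obtain ⟨q, hq, -, e⟩ := (h.mem_cut' _).1 hp
    rwa [← g.injective e]
  rw [← hm]
  refine and_congr_right fun hp => and_congr (not_congr ?_) ?_
  · constructor
    · rintro rfl; exact h.corr_unique h1 h2
    · rintro rfl; exact h.corr_unique' hF hG h1 h2
  · have key : ∀ {K : Face α.toFun H} {K' : Face β.toFun H'}, SameSide N F₀ K →
        FaceCorr g N K K' → ((∀ q ∈ H, q ≠ p → (FaceIn K q ↔ α.Inside p q)) ↔
          ∀ y ∈ H', y ≠ g p → (FaceIn K' y ↔ β.Inside (g p) y)) := by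
      intro K K' hK hKK
      constructor
      · intro H1 y hy hyp
        obtain ⟨q, hq, hqN, rfl⟩ := (h.mem_cut' y).1 hy
        rw [← hKK q hq hqN, h.inside_iff hqN hpN]
        exact H1 q hq fun e => hyp (by rw [e])
      · intro H1 q hq hqp
        by_cases hqN : q ∈ N
        · rw [hKK q hq hqN, H1 _ (h.mem' hq hqN) fun e => hqp (g.injective e),
            h.inside_iff hqN hpN]
        · rw [hK q hq hqN, h.root_iff_inside hp hpN hq hqN]
    exact and_congr (key hF h1) (key hG h2)

lemma exists_joins_iff (h : CutSubLoop α β g A c N H H' F₀) (hF : SameSide N F₀ F)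
    (hG : SameSide N F₀ G) (h1 : FaceCorr g N F F') (h2 : FaceCorr g N G G') :
    (∃ p, Face.Joins p F G) ↔ ∃ y, Face.Joins y F' G' := by
  constructor
  · rintro ⟨p, hp⟩
    exact ⟨g p, (h.joins_iff hF hG h1 h2 (h.mem_of_joins hF hG hp)).1 hp⟩
  · rintro ⟨y, hy⟩
    obtain ⟨p, hp, hpN, rfl⟩ := (h.mem_cut' y).1 hy.1
    exact ⟨p, (h.joins_iff hF hG h1 h2 hpN).2 hy⟩

/-- Witnesses of the order lie over surviving crossings. These can be moved forward and lifted back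
through `c`, and `c` respects the cyclic order of points with distinct images. -/
lemma faceCcw_iff (h : CutSubLoop α β g A c N H H' F₀) (hF : SameSide N F₀ F)
    (hG : SameSide N F₀ G) (hK : SameSide N F₀ K) (hL : SameSide N F₀ L)
    (h1 : FaceCorr g N F F') (h2 : FaceCorr g N G G') (h3 : FaceCorr g N K K')
    (h4 : FaceCorr g N L L') : FaceCcw F G K L ↔ FaceCcw F' G' K' L' := by
  have hne : ∀ {a b : Face α.toFun H} {x y : ℝ}, a ≠ b →
      Face.Joins (α.toFun (Circle.exp x)) F a → Face.Joins (α.toFun (Circle.exp y)) F b →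
      α.toFun (Circle.exp x) ∈ N → α.toFun (Circle.exp y) ∈ N →
      Circle.exp (c x) ≠ Circle.exp (c y) := by
    intro a b x y hab ha hb hx hy e
    have e1 := h.map x (h.mem_of_over hx rfl)
    have e2 := h.map y (h.mem_of_over hy rfl)
    rw [e, e2] at e1
    rw [← g.injective e1] at ha
    exact hab (joins_right_unique h.cut ha hb)
  constructor
  · rintro ⟨x, y, z, hc, hab, hbd, hda, ha, hb, hd⟩
    obtain ⟨x, rfl⟩ := Circle.exp_surjective x
    obtain ⟨y, rfl⟩ := Circle.exp_surjective y
    obtain ⟨z, rfl⟩ := Circle.exp_surjective z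
    have hx := h.mem_of_joins hF hG ha
    have hy := h.mem_of_joins hF hK hb
    have hz := h.mem_of_joins hF hL hd
    refine ⟨Circle.exp (c x), Circle.exp (c y), Circle.exp (c z),
      (h.collapse.circleCcw_iff (hne hab ha hb hx hy) (hne hbd hb hd hy hz)
        (hne hda hd ha hz hx)).2 hc, fun e => hab ?_, fun e => hbd ?_, fun e => hda ?_, ?_, ?_, ?_⟩
    · subst e; exact h.corr_unique' hG hK h2 h3
    · subst e; exact h.corr_unique' hK hL h3 h4
    · subst e; exact h.corr_unique' hL hG h4 h2
    · rw [h.map x (h.mem_of_over hx rfl)]; exact (h.joins_iff hF hG h1 h2 hx).1 ha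
    · rw [h.map y (h.mem_of_over hy rfl)]; exact (h.joins_iff hF hK h1 h3 hy).1 hb
    · rw [h.map z (h.mem_of_over hz rfl)]; exact (h.joins_iff hF hL h1 h4 hz).1 hd
  · rintro ⟨x, y, z, hc, hab, hbd, hda, ha, hb, hd⟩
    have lift : ∀ (w : Circle) {a : Face α.toFun H} {a' : Face β.toFun H'}, SameSide N F₀ a →
        FaceCorr g N a a' → Face.Joins (β.toFun w) F' a' → ∃ v, Circle.exp (c v) = w ∧
          α.toFun (Circle.exp v) ∈ N ∧ Face.Joins (α.toFun (Circle.exp v)) F a := by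
      intro w a a' hS hC hJ
      obtain ⟨v, hv, rfl⟩ := h.collapse.exists_exp_eq h.closed w
      rw [h.map v hv] at hJ
      obtain ⟨p, hp, hpN, e⟩ := (h.mem_cut' _).1 hJ.1
      have e' := g.injective e
      refine ⟨v, rfl, e' ▸ hpN, ?_⟩
      rw [← e'] at hJ ⊢
      exact (h.joins_iff hF hS h1 hC hpN).2 hJ
    obtain ⟨x, rfl, hx, ha⟩ := lift x hG h2 ha
    obtain ⟨y, rfl, hy, hb⟩ := lift y hK h3 hb
    obtain ⟨z, rfl, hz, hd⟩ := lift z hL h4 hd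
    have hab : G ≠ K := by rintro rfl; exact hab (h.corr_unique h2 h3)
    have hbd : K ≠ L := by rintro rfl; exact hbd (h.corr_unique h3 h4)
    have hda : L ≠ G := by rintro rfl; exact hda (h.corr_unique h4 h2)
    exact ⟨_, _, _, (h.collapse.circleCcw_iff (hne hab ha hb hx hy) (hne hbd hb hd hy hz)
        (hne hda hd ha hz hx)).1 hc, hab, hbd, hda, ha, hb, hd⟩

/-- The part of the dual tree of `H` formed by the faces along which the subloop runs is the dual
tree of the induced cut. -/
lemma isDualTree [IsManifold (𝓡∂ 2) ∞ S] (hS : IsOrientedAtlas S)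
    (h : CutSubLoop α β g A c N H H' F₀) {T T₁ : LoopTree S} {j : T₁.V → T.V}
    (hj : T₁.IsSub T j) (f : T.V ≃ Face α.toFun H)
    (hadj : ∀ v w, T.graph.Adj v w ↔ ∃ p, Face.Joins p (f v) (f w))
    (hlabel : ∀ v, ∃ β : GenericLoop S, ⟦β⟧ = T.label v ∧ Traverses α.toFun (f v).arcs β.toFun)
    (hsign : ∀ v w p, Face.Joins p (f v) (f w) → T.sign s(v, w) = α.crossingSign p)
    (hccw : ∀ v a b c, T.ccw v a b c ↔ FaceCcw (f v) (f a) (f b) (f c))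
    (hrange : ∀ v, v ∈ Set.range j ↔ SameSide N F₀ (f v)) (hroot : f (j T₁.root) = F₀)
    (hl : ∀ F' : Face β.toFun H', ∃ γ : GenericLoop S, Traverses β.toFun F'.arcs γ.toFun) :
    β.IsDualTree H' T₁ := by
  have hs : ∀ v, SameSide N F₀ (f (j v)) := fun v => (hrange _).1 ⟨v, rfl⟩
  choose k hk using fun v => h.exists_corr (hs v)
  have hbij : Function.Bijective k := by
    constructor
    · intro v w e
      refine hj.inj (f.injective (h.corr_unique' (hs v) (hs w) (hk v) ?_))
      rw [e]; exact hk w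
    · intro F'
      obtain ⟨F, hF, hC⟩ := h.exists_corr' F'
      obtain ⟨v, hv⟩ := (hrange (f.symm F)).2 (by rwa [f.apply_symm_apply])
      refine ⟨v, h.corr_unique (hk v) ?_⟩
      rwa [hv, f.apply_symm_apply]
  refine ⟨Equiv.ofBijective k hbij, fun v w => ?_, ?_, fun v => ?_, fun v w y hy => ?_,
    fun v a b d => ?_⟩
  · rw [← hj.adj, hadj]
    exact h.exists_joins_iff (hs v) (hs w) (hk v) (hk w)
  · refine (base_mem_arcs_iff h.cut').2 fun y hy => ?_
    obtain ⟨q, hq, hqN, rfl⟩ := (h.mem_cut' y).1 hy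
    have := hk T₁.root q hq hqN
    rw [hroot] at this
    exact fun hF => h.root_out q hq hqN (this.2 hF)
  · obtain ⟨γ, hγ⟩ := hl (k v)
    refine ⟨γ, ?_, hγ⟩
    obtain ⟨δ, hδ, hδ'⟩ := hlabel (j v)
    rw [← hj.label, ← hδ]
    exact (GenericLoop.mk_eq_of_traverses (isClosed_arcs _) h.iso hδ'
      (h.traverses_face (hs v) (hk v) hγ)).symm
  · obtain ⟨p, hp, hpN, rfl⟩ := (h.mem_cut' y).1 hy.1
    have hJ := (h.joins_iff (hs v) (hs w) (hk v) (hk w) hpN).2 hy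
    rw [h.crossingSign_eq hS hpN, ← hsign _ _ _ hJ]
    refine (hj.sign v w ?_).symm
    rw [← hj.adj, hadj]
    exact ⟨p, hJ⟩
  · rw [← hj.ccw, hccw]
    refine (h.faceCcw_iff (hs v) (hs a) (hs b) (hs d) (hk v) (hk a) (hk b) (hk d)).trans ?_
    simp only [FaceCcw, Equiv.ofBijective_apply, hbij.1.ne_iff]

end CutSubLoop

end Transfer

/-! ### Cuts induced on the inner and outer loops, and the labels of faces -/

section CutTrees

variable {S : Type*} [TopologicalSpace S] [ChartedSpace (EuclideanHalfSpace 2) S]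

open PointedLoop

variable {α β : PointedLoop S} {g : S ≃ₜ S} {A : Set Circle} {c : ℝ → ℝ} {N H H' : Finset S}
  {F₀ F : Face α.toFun H} {p q : S}

lemma SubLoop.mem_cuts (h : SubLoop α β g A c N) (hH : H ∈ α.cuts)
    (hH' : ∀ y, y ∈ H' ↔ ∃ q ∈ H, q ∈ N ∧ g q = y) : H' ∈ β.cuts := by
  refine PointedLoop.mem_cuts.2 ⟨fun y hy => ?_, fun y hy z hz hyz => ?_⟩
  · obtain ⟨q, hq, hqN, rfl⟩ := (hH' y).1 hy
    exact h.mem_crossings hqN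
  · obtain ⟨q, hq, hqN, rfl⟩ := (hH' y).1 hy
    obtain ⟨r, hr, hrN, rfl⟩ := (hH' z).1 hz
    rw [h.inside_iff hqN hrN, h.outside_iff hqN hrN]
    exact (PointedLoop.mem_cuts.1 hH).2 q hq r hr fun e => hyz (by rw [e])

/-- A cut containing `p` induces a cut of the inner loop of `p`. -/
lemma SubLoop.cutSubLoop_inner (h : SubLoop α β (Homeomorph.refl S) (α.carc p) c (α.innerSet p))
    (hH : H ∈ α.cuts) (hp : p ∈ H) (hF₀ : ∀ q ∈ H, FaceIn F₀ q ↔ q = p ∨ α.Inside p q)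
    (hH' : ∀ q, q ∈ H' ↔ q ∈ H ∧ q ∈ α.innerSet p) :
    CutSubLoop α β (Homeomorph.refl S) (α.carc p) c (α.innerSet p) H H' F₀ := by
  have hcr := (PointedLoop.mem_cuts.1 hH).1
  have hpc := hcr p hp
  have hH'' : ∀ y, y ∈ H' ↔ ∃ q ∈ H, q ∈ α.innerSet p ∧ Homeomorph.refl S q = y := fun y => by
    rw [hH']; simp
  refine ⟨h, hH, h.mem_cuts hH hH'', hH'', fun q hq hqN hF => ?_, fun x => ⟨fun hx q hq hqN => ?_,
    fun hx => ?_⟩⟩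
  · rcases (hF₀ q hq).1 hF with rfl | hI
    · exact not_inside_self hpc (mem_innerSet.1 hqN).2
    · exact hI.asymm hpc (hcr q hq) (mem_innerSet.1 hqN).2
  · rw [hF₀ q hq]
    constructor
    · rintro (rfl | hI)
      · exact hx
      · exact arc_subset_carc (hI.carc_subset hpc (hcr q hq) hx)
    · intro hn hx'
      push Not at hn
      have h1 := ((PointedLoop.mem_cuts.1 hH).2 p hp q hq hn.1.symm).resolve_left
        fun hI => hqN (mem_innerSet.2 ⟨hcr q hq, hI⟩)
      have h2 := ((PointedLoop.mem_cuts.1 hH).2 q hq p hp hn.1).resolve_left hn.2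
      exact Set.disjoint_left.1 (h2.disjoint_carc hpc (hcr q hq) h1) hx (arc_subset_carc hx')
  · exact (hx p hp fun hm => not_inside_self hpc (mem_innerSet.1 hm).2).1
      ((hF₀ p hp).2 (Or.inl rfl))

/-- A cut containing `p` induces a cut of the outer loop of `p`. -/
lemma SubLoop.cutSubLoop_outer (h : SubLoop α β (Homeomorph.refl S) (α.arc p)ᶜ c (α.outerSet p))
    (hH : H ∈ α.cuts) (hp : p ∈ H) (hF₀ : ∀ q ∈ H, ¬ FaceIn F₀ q)
    (hH' : ∀ q, q ∈ H' ↔ q ∈ H ∧ q ∈ α.outerSet p) :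
    CutSubLoop α β (Homeomorph.refl S) (α.arc p)ᶜ c (α.outerSet p) H H' F₀ := by
  have hcr := (PointedLoop.mem_cuts.1 hH).1
  have hpc := hcr p hp
  have hH'' : ∀ y, y ∈ H' ↔ ∃ q ∈ H, q ∈ α.outerSet p ∧ Homeomorph.refl S q = y := fun y => by
    rw [hH']; simp
  refine ⟨h, hH, h.mem_cuts hH hH'', hH'', fun q hq _ => hF₀ q hq,
    fun x => ⟨fun hx q hq hqN => ⟨fun hF => absurd hF (hF₀ q hq), fun _ hx' => hx ?_⟩,
    fun hx => (hx p hp fun hm => not_outside_self hpc (mem_outerSet.1 hm).2).2 (hF₀ p hp)⟩⟩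
  by_cases e : p = q
  · rwa [e]
  · have hI := ((PointedLoop.mem_cuts.1 hH).2 p hp q hq e).resolve_right
      fun hO => hqN (mem_outerSet.2 ⟨hcr q hq, hO⟩)
    exact hI.carc_subset (hcr q hq) hpc (arc_subset_carc hx')

/-- The crossings around a face form a chain, so with `p` among them any other one is nested in `p`
or contains `p`, and the former are excluded. -/
lemma PointedLoop.faceIn_iff_of_faceIn (hH : H ∈ α.cuts) (hp : p ∈ H) (hF : FaceIn F p)
    (hq : q ∈ H) (hqN : q ∉ α.innerSet p) : FaceIn F q ↔ q = p ∨ α.Inside p q := by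
  constructor
  · intro hFq
    have := hF.comparable hH hp hq hFq
    have hn : ¬ α.Inside q p := fun h => hqN (mem_innerSet.2 ⟨(mem_cuts.1 hH).1 q hq, h⟩)
    tauto
  · rintro (rfl | hI)
    · exact hF
    · exact hF.up hH hp hq hI

lemma PointedLoop.not_faceIn_of_not_faceIn (hH : H ∈ α.cuts) (hp : p ∈ H) (hF : ¬ FaceIn F p)
    (hq : q ∈ H) (hqN : q ∉ α.outerSet p) : ¬ FaceIn F q := by
  intro hFq
  have hcr := (mem_cuts.1 hH).1
  by_cases e : p = q
  · subst e; exact hF hFq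
  · have hI := ((mem_cuts.1 hH).2 p hp q hq e).resolve_right
      fun hO => hqN (mem_outerSet.2 ⟨hcr q hq, hO⟩)
    exact hF (hFq.up hH hq hp hI)

/-- The loops labeling the faces exist. -/
lemma PointedLoop.exists_traverses_face (hH : H ∈ α.cuts) (F : Face α.toFun H) :
    ∃ γ : GenericLoop S, Traverses α.toFun F.arcs γ.toFun := by
  classical
  obtain ⟨n, hn⟩ : ∃ n, H.card = n := ⟨_, rfl⟩
  induction n using Nat.strong_induction_on generalizing α H with
  | _ n ih =>
    have hcr := (mem_cuts.1 hH).1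
    rcases H.eq_empty_or_nonempty with rfl | ⟨p, hp⟩
    · refine ⟨α.toGenericLoop, traverses_iff.2 ⟨id, ?_, fun _ _ => rfl⟩⟩
      have : F.arcs = Set.univ := Set.eq_univ_of_forall fun x => (mem_arcs_iff hH).2 (by simp)
      rw [this]
      exact IsCollapse.univ
    · have hpc := hcr p hp
      -- A face on one side of the chord of `p` corresponds to a face of the inner or of the outer
      -- loop, for a cut that has lost at least `p`; a label found there by induction serves here
      -- too.
      by_cases hF : FaceIn F p
      · obtain ⟨β, h1, h2⟩ := exists_inner hpc
        obtain ⟨c, h⟩ := exists_subLoop_inner hpc h1 h2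
        obtain ⟨F₀, hF₀⟩ := exists_face_inner hH hp
        have hc := h.cutSubLoop_inner (H' := H.filter (· ∈ α.innerSet p)) hH hp hF₀
          fun q => Finset.mem_filter
        have hs : SameSide (α.innerSet p) F₀ F := fun q hq hqN => by
          rw [hF₀ q hq, faceIn_iff_of_faceIn hH hp hF hq hqN]
        obtain ⟨F', hF'⟩ := hc.exists_corr hs
        obtain ⟨γ, hγ⟩ := ih _ (by
          rw [← hn]
          refine Finset.card_lt_card (Finset.filter_ssubset.2 ⟨p, hp, fun hm => ?_⟩)
          exact not_inside_self hpc (mem_innerSet.1 hm).2) hc.cut' F' rfl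
        exact ⟨γ, hc.traverses_face hs hF' hγ⟩
      · obtain ⟨β, h1, h2⟩ := exists_outer hpc
        obtain ⟨c, h⟩ := exists_subLoop_outer hpc h1 h2
        obtain ⟨F₀, hF₀⟩ := exists_face_root hH
        have hc := h.cutSubLoop_outer (H' := H.filter (· ∈ α.outerSet p)) hH hp hF₀
          fun q => Finset.mem_filter
        have hs : SameSide (α.outerSet p) F₀ F := fun q hq hqN =>
          iff_of_false (not_faceIn_of_not_faceIn hH hp hF hq hqN) (hF₀ q hq)
        obtain ⟨F', hF'⟩ := hc.exists_corr hs
        obtain ⟨γ, hγ⟩ := ih _ (by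
          rw [← hn]
          refine Finset.card_lt_card (Finset.filter_ssubset.2 ⟨p, hp, fun hm => ?_⟩)
          exact not_outside_self hpc (mem_outerSet.1 hm).2) hc.cut' F' rfl
        exact ⟨γ, hc.traverses_face hs hF' hγ⟩

lemma PointedLoop.existsUnique_isCutTree (hH : H ∈ α.cuts) : ∃! τ, α.IsCutTree H τ := by
  obtain ⟨T, hT⟩ := exists_isDualTree_of_labels hH (exists_traverses_face hH)
  refine ⟨⟦T⟧, ⟨T, rfl, hT⟩, ?_⟩
  rintro _ ⟨T', rfl, hT'⟩
  exact Quotient.sound (hT'.equiv hH hT)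

/-- Isotopic pointed loops have the same cut trees. -/
lemma SubLoop.isCutTree [IsManifold (𝓡∂ 2) ∞ S] (hS : IsOrientedAtlas S)
    (h : SubLoop α β g Set.univ c α.crossings) (hH : H ∈ α.cuts)
    (hH' : ∀ y, y ∈ H' ↔ ∃ q ∈ H, g q = y) {τ : LoopTreeClass S} (hτ : α.IsCutTree H τ) :
    β.IsCutTree H' τ := by
  obtain ⟨T, rfl, f, h1, h2, h3, h4, h5⟩ := hτ
  have hcr := (PointedLoop.mem_cuts.1 hH).1
  have hH'' : ∀ y, y ∈ H' ↔ ∃ q ∈ H, q ∈ α.crossings ∧ g q = y := fun y => by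
    rw [hH']
    exact exists_congr fun q => and_congr_right fun hq => (and_iff_right (hcr q hq)).symm
  have hs : ∀ F, SameSide α.crossings (f T.root) F := fun F q hq hqN => absurd (hcr q hq) hqN
  -- For isotopic loops no crossing is lost, so the condition on `A` is empty and every face lies on
  -- the required side.
  have hc : CutSubLoop α β g Set.univ c α.crossings H H' (f T.root) :=
    ⟨h, hH, h.mem_cuts hH hH'', hH'', fun q hq _ => (base_mem_arcs_iff hH).1 h2 q hq,
      fun x => ⟨fun _ q hq hqN => absurd (hcr q hq) hqN, fun _ => trivial⟩⟩
  refine ⟨T, rfl, hc.isDualTree hS (T := T) (j := id) ⟨Function.injective_id, fun _ _ => Iff.rfl,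
    fun _ => rfl, fun _ _ _ => rfl, fun _ _ _ _ => Iff.rfl⟩ f h1 h3 h4 ?_ (fun v => ?_) rfl
    (exists_traverses_face hc.cut')⟩
  · refine fun v a b d => (h5 v a b d).trans ?_
    simp only [FaceCcw, f.injective.ne_iff]
  · exact iff_of_true ⟨v, rfl⟩ (hs _)

end CutTrees

/-! ### Branches of trees -/

section DeleteEdge

variable {V : Type*} {G : SimpleGraph V} {e e' : Sym2 V} {a b r u v w : V}

/-- After its last passage through the edge the walk continues from one of the ends of the edge and
avoids it. -/
lemma SimpleGraph.Walk.reachable_deleteEdge_or (p : G.Walk u v) (a b : V) :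
    (G.deleteEdges {s(a, b)}).Reachable u v ∨ (G.deleteEdges {s(a, b)}).Reachable a v ∨
      (G.deleteEdges {s(a, b)}).Reachable b v := by
  induction p with
  | nil => exact Or.inl (SimpleGraph.Reachable.refl _)
  | @cons u u' v h p ih =>
    rcases ih with ih | ih
    · by_cases he : s(u, u') = s(a, b)
      · rcases Sym2.eq_iff.1 he with ⟨-, rfl⟩ | ⟨-, rfl⟩
        · exact Or.inr (Or.inr ih)
        · exact Or.inr (Or.inl ih)
      · exact Or.inl ((SimpleGraph.Adj.reachable (SimpleGraph.deleteEdges_adj.2 ⟨h, he⟩)).trans ih)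
    · exact Or.inr ih

/-- A walk that avoids `e` stays in the component of `r`, to which the end `w` of `e'` does not
belong; hence it avoids `e'` too. -/
lemma SimpleGraph.Reachable.deleteEdge_change (h : (G.deleteEdges {e}).Reachable r v)
    (hw : w ∈ e') (hrw : ¬ (G.deleteEdges {e}).Reachable r w) :
    (G.deleteEdges {e'}).Reachable r v := by
  obtain ⟨p⟩ := h
  induction p with
  | nil => exact SimpleGraph.Reachable.refl _
  | @cons u u' v h p ih =>
    have hadj := SimpleGraph.deleteEdges_adj.1 h
    have ih' := ih fun h' => hrw ((SimpleGraph.Adj.reachable h).trans h')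
    refine (SimpleGraph.Adj.reachable (SimpleGraph.deleteEdges_adj.2 ⟨hadj.1, ?_⟩)).trans ih'
    rintro rfl
    rcases Sym2.mem_iff.1 hw with rfl | rfl
    · exact hrw (SimpleGraph.Reachable.refl _)
    · exact hrw (SimpleGraph.Adj.reachable h)

lemma SimpleGraph.IsAcyclic.not_reachable (hG : G.IsAcyclic) (h : s(a, b) ∈ G.edgeSet) :
    ¬ (G.deleteEdges {s(a, b)}).Reachable a b := by
  have := SimpleGraph.isAcyclic_iff_forall_isBridge.1 hG h
  rwa [SimpleGraph.isBridge_iff] at this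

end DeleteEdge

section LoopTrees

variable {S : Type*} [TopologicalSpace S] [ChartedSpace (EuclideanHalfSpace 2) S]

namespace LoopTree

variable {T T₁ T₂ : LoopTree S} {e e' : T.graph.edgeSet} {v w : T.V}

/-- The edge `e` separates the vertex from the root. -/
def Beyond (T : LoopTree S) (e : T.graph.edgeSet) (v : T.V) : Prop :=
  ¬ (T.graph.deleteEdges {e.1}).Reachable T.root v

/-- The edge `e` separates the edge `e'` from the root. -/
def EdgeLT (T : LoopTree S) (e' e : T.graph.edgeSet) : Prop := ∀ v ∈ e'.1, T.Beyond e v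

lemma far_mem (e : T.graph.edgeSet) : T.far e ∈ e.1 := (T.exists_far e).choose_spec.1

lemma far_beyond (e : T.graph.edgeSet) : T.Beyond e (T.far e) := (T.exists_far e).choose_spec.2

lemma exists_near (e : T.graph.edgeSet) : ∃ a, e.1 = s(a, T.far e) ∧ ¬ T.Beyond e a := by
  obtain ⟨a, ha⟩ := Sym2.mem_iff_exists.1 (far_mem e)
  rw [Sym2.eq_swap] at ha
  refine ⟨a, ha, not_not.2 ?_⟩
  obtain ⟨p⟩ := T.isTree.connected.preconnected (T.far e) T.root
  have hb := far_beyond e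
  have := p.reachable_deleteEdge_or a (T.far e)
  rw [← ha] at this
  rcases this with h | h | h
  · exact absurd h.symm hb
  · exact h.symm
  · exact absurd h.symm hb

/-- Removing an edge splits a tree into exactly two parts, that of the root and that of the far end.
-/
lemma beyond_iff : T.Beyond e v ↔ (T.graph.deleteEdges {e.1}).Reachable (T.far e) v := by
  constructor
  · intro hv
    obtain ⟨a, ha, hna⟩ := exists_near e
    obtain ⟨p⟩ := T.isTree.connected.preconnected T.root v
    have := p.reachable_deleteEdge_or a (T.far e)
    rw [← ha] at this
    rcases this with h | h | h
    · exact absurd h hv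
    · exact absurd ((not_not.1 hna).trans h) hv
    · exact h
  · exact fun h h' => far_beyond e (h'.trans h.symm)

lemma eq_far (hv : v ∈ e.1) (hb : T.Beyond e v) : v = T.far e := by
  obtain ⟨a, ha, hna⟩ := exists_near e
  rw [ha] at hv
  rcases Sym2.mem_iff.1 hv with rfl | rfl
  · exact absurd hb hna
  · rfl

lemma beyond_congr (hv : v ∈ e'.1) (hw : w ∈ e'.1) (hne : e' ≠ e) :
    T.Beyond e v ↔ T.Beyond e w := by
  by_cases hvw : v = w
  · rw [hvw]
  have he : e'.1 = s(v, w) := (Sym2.mem_and_mem_iff hvw).1 ⟨hv, hw⟩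
  have hadj : (T.graph.deleteEdges {e.1}).Adj v w := by
    refine SimpleGraph.deleteEdges_adj.2 ⟨?_, fun h => hne (Subtype.ext (he.trans h))⟩
    have := e'.2
    rwa [he] at this
  exact not_congr ⟨fun h => h.trans hadj.reachable, fun h => h.trans hadj.symm.reachable⟩

lemma edgeLT_irrefl : ¬ T.EdgeLT e e := by
  obtain ⟨a, ha, hna⟩ := exists_near e
  exact fun h => hna (h a (by rw [ha]; simp))

lemma edgeLT_of_mem (hv : v ∈ e'.1) (hne : e' ≠ e) (hb : T.Beyond e v) : T.EdgeLT e' e :=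
  fun _ hw => (beyond_congr hv hw hne).1 hb

lemma not_edgeLT_iff (hne : e' ≠ e) : ¬ T.EdgeLT e' e ↔ ∀ v ∈ e'.1, ¬ T.Beyond e v :=
  ⟨fun h _ hv hb => h (edgeLT_of_mem hv hne hb), fun h h' => h _ (far_mem e') (h' _ (far_mem e'))⟩

lemma EdgeLT.beyond (h : T.EdgeLT e' e) (hv : T.Beyond e' v) : T.Beyond e v := fun hr =>
  hv (hr.deleteEdge_change (far_mem e') (h _ (far_mem e')))

lemma EdgeLT.asymm (h : T.EdgeLT e' e) : ¬ T.EdgeLT e e' := by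
  obtain ⟨a, ha, hna⟩ := exists_near e
  exact fun h' => hna (h.beyond (h' a (by rw [ha]; simp)))

lemma EdgeLT.not_beyond_far (h : T.EdgeLT e' e) : ¬ T.Beyond e' (T.far e) := by
  obtain ⟨a, ha, hna⟩ := exists_near e
  have hne : e ≠ e' := by rintro rfl; exact edgeLT_irrefl h
  rw [← beyond_congr (v := a) (by rw [ha]; simp) (far_mem e) hne]
  exact not_not.2 ((not_not.1 hna).deleteEdge_change (far_mem e') (h _ (far_mem e')))

/-- The far end of `e` is joined to the root without using `e'`. Everything beyond `e` is joined to
this far end within a part that contains no end of `e'` separated from the root by `e'`, hence also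
without using `e'`. -/
lemma not_beyond_of_par (hne : e' ≠ e) (h : ¬ T.EdgeLT e' e) (h' : ¬ T.EdgeLT e e')
    (hv : T.Beyond e v) : ¬ T.Beyond e' v := by
  have h1 := (not_edgeLT_iff hne).1 h (T.far e') (far_mem e')
  have h2 := (not_edgeLT_iff hne.symm).1 h' (T.far e) (far_mem e)
  rw [beyond_iff] at h1 hv
  exact not_not.2 ((not_not.1 h2).trans (hv.deleteEdge_change (far_mem e') h1))

namespace IsSub

variable {j : T₁.V → T.V} {j₂ : T₂.V → T₁.V}

lemma trans (h : T₁.IsSub T j) (h₂ : T₂.IsSub T₁ j₂) : T₂.IsSub T (j ∘ j₂) where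
  inj := h.inj.comp h₂.inj
  adj a b := by simp [h.adj, h₂.adj]
  label v := by simp [h.label, h₂.label]
  sign a b hab := by simp [h.sign _ _ ((h₂.adj a b).2 hab), h₂.sign _ _ hab]
  ccw v a b c := by simp [h.ccw, h₂.ccw]

/-- The structure of a part is restricted from `T`, so nothing but its vertices and its root
matters. All identities between iterated cuts of a tree are reduced to this. -/
lemma equiv {k : T₂.V → T.V} (h : T₁.IsSub T j) (h₂ : T₂.IsSub T k)
    (hr : ∀ v, v ∈ Set.range j ↔ v ∈ Set.range k) (hroot : j T₁.root = k T₂.root) : T₁ ≈ T₂ := by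
  have hr' : Set.range j = Set.range k := Set.ext hr
  let f : T₁.V ≃ T₂.V := ((Equiv.ofInjective j h.inj).trans (Equiv.setCongr hr')).trans
    (Equiv.ofInjective k h₂.inj).symm
  have hf : ∀ v, k (f v) = j v := fun v => by
    simp only [f, Equiv.trans_apply]
    rw [Equiv.apply_ofInjective_symm h₂.inj]
    rfl
  refine ⟨f, fun a b => ?_, h₂.inj ?_, fun v => ?_, fun a b hab => ?_, fun v a b c => ?_⟩
  · rw [← h₂.adj, hf, hf, h.adj]
  · rw [hf, hroot]
  · rw [← h₂.label, hf, h.label]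
  · rw [← h₂.sign, hf, hf, h.sign _ _ hab]
    rwa [← h₂.adj, hf, hf, h.adj]
  · rw [← h₂.ccw, hf, hf, hf, hf, h.ccw]

/-- The edge of a tree given by an edge of a part of it. -/
def edge (h : T₁.IsSub T j) (e : T₁.graph.edgeSet) : T.graph.edgeSet :=
  ⟨e.1.map j, by
    obtain ⟨e, he⟩ := e
    induction e with
    | h a b => exact (h.adj a b).2 he⟩

lemma edge_injective (h : T₁.IsSub T j) : Function.Injective h.edge := fun _ _ he =>
  Subtype.ext (Sym2.map.injective h.inj (Subtype.ext_iff.1 he))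

lemma mem_range_edge (h : T₁.IsSub T j) (e : T.graph.edgeSet) :
    e ∈ Set.range h.edge ↔ ∀ v ∈ e.1, v ∈ Set.range j := by
  constructor
  · rintro ⟨e, rfl⟩ v hv
    obtain ⟨w, -, rfl⟩ := Sym2.mem_map.1 hv
    exact ⟨w, rfl⟩
  · obtain ⟨e, he⟩ := e
    induction e with
    | h a b =>
      intro H
      obtain ⟨a, rfl⟩ := H a (by simp)
      obtain ⟨b, rfl⟩ := H b (by simp)
      exact ⟨⟨s(a, b), (h.adj a b).1 he⟩, rfl⟩

/-- If two vertices were separated by `e` in the part but not in `T`, the two ends of the edge would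
be joined in `T` without it, although every edge of a tree is a bridge. -/
lemma reachable_iff (h : T₁.IsSub T j) (e : T₁.graph.edgeSet) {x y : T₁.V} :
    (T.graph.deleteEdges {(h.edge e).1}).Reachable (j x) (j y) ↔
      (T₁.graph.deleteEdges {e.1}).Reachable x y := by
  have hmap : ∀ {x y}, (T₁.graph.deleteEdges {e.1}).Reachable x y →
      (T.graph.deleteEdges {(h.edge e).1}).Reachable (j x) (j y) := by
    intro x y hr
    refine hr.map (⟨j, fun {a b} hab => ?_⟩ :
      T₁.graph.deleteEdges {e.1} →g T.graph.deleteEdges {(h.edge e).1})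
    obtain ⟨h1, h2⟩ := SimpleGraph.deleteEdges_adj.1 hab
    exact SimpleGraph.deleteEdges_adj.2 ⟨(h.adj a b).2 h1, fun he =>
      h2 (Sym2.map.injective h.inj he)⟩
  refine ⟨fun hr => ?_, hmap⟩
  obtain ⟨e, he⟩ := e
  induction e with
  | h a b =>
    have hb := T.isTree.isAcyclic.not_reachable (h.edge ⟨s(a, b), he⟩).2
    have hab : ∀ z, (T₁.graph.deleteEdges {s(a, b)}).Reachable a z ∨
        (T₁.graph.deleteEdges {s(a, b)}).Reachable b z := fun z => by
      obtain ⟨p⟩ := T₁.isTree.connected.preconnected a z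
      rcases p.reachable_deleteEdge_or a b with h | h | h
      · exact Or.inl h
      · exact Or.inl h
      · exact Or.inr h
    rcases hab x with hx | hx <;> rcases hab y with hy | hy
    · exact hx.symm.trans hy
    · exact absurd (((hmap hx).trans hr).trans (hmap hy).symm) hb
    · exact absurd (((hmap hy).trans hr.symm).trans (hmap hx).symm) hb
    · exact hx.symm.trans hy

lemma beyond_iff (h : T₁.IsSub T j) {e : T₁.graph.edgeSet}
    (hroot : ¬ T.Beyond (h.edge e) (j T₁.root)) (v : T₁.V) :
    T.Beyond (h.edge e) (j v) ↔ T₁.Beyond e v := by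
  refine not_congr ?_
  rw [← h.reachable_iff]
  exact ⟨fun hr => (not_not.1 hroot).symm.trans hr, fun hr => (not_not.1 hroot).trans hr⟩

lemma far_eq (h : T₁.IsSub T j) {e : T₁.graph.edgeSet}
    (hroot : ¬ T.Beyond (h.edge e) (j T₁.root)) : j (T₁.far e) = T.far (h.edge e) :=
  eq_far (Sym2.mem_map.2 ⟨_, far_mem e, rfl⟩) ((h.beyond_iff hroot _).2 (far_beyond e))

end IsSub

lemma component_isSub (T : LoopTree S) (e : Sym2 T.V) (r : T.V) :
    (T.component e r).IsSub T Subtype.val where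
  inj := Subtype.val_injective
  adj _ _ := Iff.rfl
  label _ := rfl
  sign _ _ _ := rfl
  ccw _ _ _ _ := Iff.rfl

/-- The inclusion of the upper part. -/
def upperVal (e : T.graph.edgeSet) : (T.upper e).V → T.V := Subtype.val

/-- The inclusion of the lower part. -/
def lowerVal (e : T.graph.edgeSet) : (T.lower e).V → T.V := Subtype.val

lemma upper_isSub (e : T.graph.edgeSet) : (T.upper e).IsSub T (upperVal e) :=
  T.component_isSub _ _

lemma lower_isSub (e : T.graph.edgeSet) : (T.lower e).IsSub T (lowerVal e) :=
  T.component_isSub _ _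

lemma mem_range_upper (e : T.graph.edgeSet) {v : T.V} :
    v ∈ Set.range (upperVal e) ↔ T.Beyond e v := by
  rw [beyond_iff]
  exact ⟨fun ⟨w, hw⟩ => hw ▸ w.2, fun h => ⟨⟨v, h⟩, rfl⟩⟩

lemma mem_range_lower (e : T.graph.edgeSet) {v : T.V} :
    v ∈ Set.range (lowerVal e) ↔ ¬ T.Beyond e v := by
  rw [Beyond, not_not]
  exact ⟨fun ⟨w, hw⟩ => hw ▸ w.2, fun h => ⟨⟨v, h⟩, rfl⟩⟩

lemma upper_root (e : T.graph.edgeSet) : upperVal e (T.upper e).root = T.far e := rfl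

lemma lower_root (e : T.graph.edgeSet) : lowerVal e (T.lower e).root = T.root := rfl

lemma not_beyond_root : ¬ T.Beyond e T.root := not_not.2 (SimpleGraph.Reachable.refl _)

namespace IsSub

variable {j : T₁.V → T.V} {j₂ : T₂.V → T.V}

lemma comp_upper (h : T₁.IsSub T j) (e : T₁.graph.edgeSet) :
    (T₁.upper e).IsSub T (j ∘ upperVal e) := h.trans (upper_isSub e)

lemma comp_lower (h : T₁.IsSub T j) (e : T₁.graph.edgeSet) :
    (T₁.lower e).IsSub T (j ∘ lowerVal e) := h.trans (lower_isSub e)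

lemma mem_range_upper (h : T₁.IsSub T j) {e : T₁.graph.edgeSet}
    (hroot : ¬ T.Beyond (h.edge e) (j T₁.root)) (v : T.V) :
    v ∈ Set.range (j ∘ upperVal e) ↔
      v ∈ Set.range j ∧ T.Beyond (h.edge e) v := by
  rw [Set.range_comp, Set.mem_image]
  constructor
  · rintro ⟨w, hw, rfl⟩
    exact ⟨⟨w, rfl⟩, (h.beyond_iff hroot w).2 ((LoopTree.mem_range_upper e).1 hw)⟩
  · rintro ⟨⟨w, rfl⟩, hb⟩
    exact ⟨w, (LoopTree.mem_range_upper e).2 ((h.beyond_iff hroot w).1 hb), rfl⟩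

lemma mem_range_lower (h : T₁.IsSub T j) {e : T₁.graph.edgeSet}
    (hroot : ¬ T.Beyond (h.edge e) (j T₁.root)) (v : T.V) :
    v ∈ Set.range (j ∘ lowerVal e) ↔
      v ∈ Set.range j ∧ ¬ T.Beyond (h.edge e) v := by
  rw [Set.range_comp, Set.mem_image]
  constructor
  · rintro ⟨w, hw, rfl⟩
    exact ⟨⟨w, rfl⟩, fun hb => (LoopTree.mem_range_lower e).1 hw ((h.beyond_iff hroot w).1 hb)⟩
  · rintro ⟨⟨w, rfl⟩, hb⟩
    exact ⟨w, (LoopTree.mem_range_lower e).2 fun hb' => hb ((h.beyond_iff hroot w).2 hb'), rfl⟩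

lemma finsum_edge {M : Type*} [AddCommMonoid M] (h : T₁.IsSub T j) [Fintype T.graph.edgeSet]
    (P : T.graph.edgeSet → Prop) [DecidablePred P] (hP : ∀ e, P e ↔ e ∈ Set.range h.edge)
    (F : T.graph.edgeSet → M) :
    ∑ᶠ e, F (h.edge e) = ∑ e ∈ Finset.univ.filter P, F e := by
  rw [← finsum_mem_range h.edge_injective, ← finsum_mem_coe_finset]
  congr! 3 with e
  simp [hP]

end IsSub

end LoopTree

end LoopTrees

/-! ### The pre-Lie identity for nested and independent cuts -/

section PreLieSum

variable {R A ι : Type*} [CommRing R] [AddCommGroup A] [Module R A]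

/-- The defect of the pre-Lie identity of a comultiplication. -/
def preLieDefect (ρ : A →ₗ[R] A ⊗[R] A) : A →ₗ[R] (A ⊗[R] A) ⊗[R] A :=
  (LinearMap.id - (TensorProduct.comm R A A).toLinearMap.rTensor A) ∘ₗ
    (ρ.rTensor A ∘ₗ ρ -
      (TensorProduct.assoc R A A A).symm.toLinearMap ∘ₗ ρ.lTensor A ∘ₗ ρ)

open TensorProduct Classical in
/-- The pre-Lie identity for a comultiplication given by cutting along the elements of a finite
set, where `lt` describes nested cuts and `par` independent cuts. -/
lemma preLie_of_nested (ρ : A →ₗ[R] A ⊗[R] A) (E : Finset ι) (lt par : ι → ι → Prop)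
    (hpar : ∀ e e', par e e' → par e' e) (x : A)
    (ε : ι → R) (u l : ι → A) (m w : ι → ι → A)
    (hx : ρ x = ∑ e ∈ E, ε e • (u e ⊗ₜ[R] l e))
    (hu : ∀ e ∈ E, ρ (u e) = ∑ e' ∈ E with lt e' e, ε e' • (u e' ⊗ₜ[R] m e' e))
    (hl : ∀ e ∈ E, ρ (l e) = ∑ e' ∈ E with lt e e', ε e' • (m e e' ⊗ₜ[R] l e') +
      ∑ e' ∈ E with par e e', ε e' • (u e' ⊗ₜ[R] w e e'))
    (hw : ∀ e ∈ E, ∀ e' ∈ E, par e e' → w e e' = w e' e) :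
    preLieDefect ρ x = 0 := by
  have h1 : ρ.rTensor A (ρ x) = ∑ e ∈ E, ∑ e' ∈ E, if lt e' e then
      ε e • ε e' • ((u e' ⊗ₜ[R] m e' e) ⊗ₜ[R] l e) else 0 := by
    rw [hx, map_sum]
    refine Finset.sum_congr rfl fun e he => ?_
    rw [map_smul, LinearMap.rTensor_tmul, hu e he, sum_tmul, Finset.smul_sum, Finset.sum_filter]
    refine Finset.sum_congr rfl fun e' _ => ?_
    split_ifs <;> simp [TensorProduct.smul_tmul']
  have h2 : (TensorProduct.assoc R A A A).symm.toLinearMap (ρ.lTensor A (ρ x)) =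
      (∑ e ∈ E, ∑ e' ∈ E, if lt e e' then
        ε e • ε e' • ((u e ⊗ₜ[R] m e e') ⊗ₜ[R] l e') else 0) +
      ∑ e ∈ E, ∑ e' ∈ E, if par e e' then
        ε e • ε e' • ((u e ⊗ₜ[R] u e') ⊗ₜ[R] w e e') else 0 := by
    rw [hx, map_sum, map_sum, ← Finset.sum_add_distrib]
    refine Finset.sum_congr rfl fun e he => ?_
    rw [map_smul, map_smul, LinearMap.lTensor_tmul, hl e he, tmul_add, map_add, smul_add,
      tmul_sum, tmul_sum, map_sum, map_sum, Finset.smul_sum, Finset.smul_sum, Finset.sum_filter,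
      Finset.sum_filter]
    simp only [TensorProduct.tmul_smul, map_smul, LinearEquiv.coe_coe,
      TensorProduct.assoc_symm_tmul]
  -- Nested pairs give the same three factors in both iterated cuts, with the names of the two cuts
  -- exchanged.
  have h3 : ∑ e ∈ E, ∑ e' ∈ E, (if lt e' e then
      ε e • ε e' • ((u e' ⊗ₜ[R] m e' e) ⊗ₜ[R] l e) else 0) =
      ∑ e ∈ E, ∑ e' ∈ E, if lt e e' then
        ε e • ε e' • ((u e ⊗ₜ[R] m e e') ⊗ₜ[R] l e') else 0 := by
    rw [Finset.sum_comm]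
    refine Finset.sum_congr rfl fun e _ => Finset.sum_congr rfl fun e' _ => ?_
    rw [smul_comm]
  -- Only independent pairs remain. Exchanging the first two factors is the same as exchanging the
  -- two cuts, because `w` is symmetric.
  rw [preLieDefect, LinearMap.comp_apply, LinearMap.sub_apply _ _ x, LinearMap.comp_apply,
    LinearMap.comp_apply, LinearMap.comp_apply, h1, h2, h3, sub_add_cancel_left, map_neg, neg_eq_zero,
    LinearMap.sub_apply, sub_eq_zero,
    LinearMap.id_apply, map_sum, Finset.sum_comm]
  refine Finset.sum_congr rfl fun e he => ?_
  rw [map_sum]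
  refine Finset.sum_congr rfl fun e' he' => ?_
  by_cases h : par e' e
  · have h' := hpar _ _ h
    rw [if_pos h, if_pos h', map_smul, map_smul, LinearMap.rTensor_tmul, LinearEquiv.coe_coe,
      TensorProduct.comm_tmul, hw e he e' he' h', smul_comm]
  · rw [if_neg h, if_neg fun h' => h (hpar _ _ h'), map_zero]

lemma isPreLieComul_finsupp {X : Type*} {ρ : (X →₀ R) →ₗ[R] (X →₀ R) ⊗[R] (X →₀ R)}
    (h : ∀ x : X, preLieDefect ρ (Finsupp.single x 1) = 0) : IsPreLieComul ρ := by
  refine Finsupp.lhom_ext' fun x => LinearMap.ext_ring ?_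
  exact h x

end PreLieSum

/-! ### The comultiplication of trees -/

section TreeComul

variable {S : Type*} [TopologicalSpace S] [ChartedSpace (EuclideanHalfSpace 2) S]

namespace LoopTree

variable {T T₁ : LoopTree S} {e e' : T.graph.edgeSet} {j : T₁.V → T.V}

open Classical in
/-- The class of the upper part of a part of `T` cut along an edge of `T`. -/
def IsSub.upperClass (h : T₁.IsSub T j) (e : T.graph.edgeSet) : LoopTreeClass S :=
  if h' : e ∈ Set.range h.edge then ⟦T₁.upper h'.choose⟧ else ⟦T₁⟧

open Classical in
/-- The class of the lower part of a part of `T` cut along an edge of `T`. -/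
def IsSub.lowerClass (h : T₁.IsSub T j) (e : T.graph.edgeSet) : LoopTreeClass S :=
  if h' : e ∈ Set.range h.edge then ⟦T₁.lower h'.choose⟧ else ⟦T₁⟧

lemma IsSub.upperClass_eq (h : T₁.IsSub T j) {e₁ : T₁.graph.edgeSet} (he : h.edge e₁ = e) :
    h.upperClass e = ⟦T₁.upper e₁⟧ := by
  have h' : e ∈ Set.range h.edge := ⟨e₁, he⟩
  rw [upperClass, dif_pos h', h.edge_injective (h'.choose_spec.trans he.symm)]

lemma IsSub.lowerClass_eq (h : T₁.IsSub T j) {e₁ : T₁.graph.edgeSet} (he : h.edge e₁ = e) :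
    h.lowerClass e = ⟦T₁.lower e₁⟧ := by
  have h' : e ∈ Set.range h.edge := ⟨e₁, he⟩
  rw [lowerClass, dif_pos h', h.edge_injective (h'.choose_spec.trans he.symm)]

lemma mem_range_upper_edge : e' ∈ Set.range (upper_isSub e).edge ↔ T.EdgeLT e' e := by
  rw [IsSub.mem_range_edge]
  exact forall₂_congr fun v _ => mem_range_upper e

lemma mem_range_lower_edge :
    e' ∈ Set.range (lower_isSub e).edge ↔ e' ≠ e ∧ ¬ T.EdgeLT e' e := by
  rw [IsSub.mem_range_edge]
  constructor
  · intro h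
    have hne : e' ≠ e := by
      rintro rfl
      exact (mem_range_lower e').1 (h _ (far_mem e')) (far_beyond e')
    exact ⟨hne, (not_edgeLT_iff hne).2 fun v hv => (mem_range_lower e).1 (h v hv)⟩
  · rintro ⟨hne, h⟩ v hv
    exact (mem_range_lower e).2 ((not_edgeLT_iff hne).1 h v hv)

lemma EdgeLT.ne (h : T.EdgeLT e' e) : e' ≠ e := by rintro rfl; exact edgeLT_irrefl h

/-- The upper part of the upper part. -/
lemma upperClass_upper (h : T.EdgeLT e' e) : (upper_isSub e).upperClass e' = ⟦T.upper e'⟧ := by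
  obtain ⟨e₁, he⟩ := mem_range_upper_edge.2 h
  have hroot : ¬ T.Beyond ((upper_isSub e).edge e₁) (upperVal e (T.upper e).root) := by
    rw [he]; exact h.not_beyond_far
  rw [(upper_isSub e).upperClass_eq he]
  refine Quotient.sound (((upper_isSub e).comp_upper e₁).equiv (upper_isSub e') (fun v => ?_) ?_)
  · rw [(upper_isSub e).mem_range_upper hroot, he, mem_range_upper, mem_range_upper]
    exact and_iff_right_of_imp h.beyond
  · rw [Function.comp_apply, upper_root, upper_root, (upper_isSub e).far_eq hroot, he]

/-- The upper part of the lower part, for nested edges. -/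
lemma upperClass_lower (h : T.EdgeLT e e') :
    (lower_isSub e).upperClass e' = (upper_isSub e').lowerClass e := by
  obtain ⟨e₁, he₁⟩ := mem_range_lower_edge.2 ⟨h.ne.symm, h.asymm⟩
  obtain ⟨e₂, he₂⟩ := mem_range_upper_edge.2 h
  have hroot₁ : ¬ T.Beyond ((lower_isSub e).edge e₁) (lowerVal e (T.lower e).root) :=
    not_beyond_root
  have hroot₂ : ¬ T.Beyond ((upper_isSub e').edge e₂) (upperVal e' (T.upper e').root) := by
    rw [he₂]; exact h.not_beyond_far
  rw [(lower_isSub e).upperClass_eq he₁, (upper_isSub e').lowerClass_eq he₂]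
  refine Quotient.sound (((lower_isSub e).comp_upper e₁).equiv
    ((upper_isSub e').comp_lower e₂) (fun v => ?_) ?_)
  · rw [(lower_isSub e).mem_range_upper hroot₁, (upper_isSub e').mem_range_lower hroot₂, he₁, he₂,
      mem_range_lower, mem_range_upper, and_comm]
  · rw [Function.comp_apply, Function.comp_apply, lower_root, upper_root, upper_root,
      (lower_isSub e).far_eq hroot₁, he₁]

/-- The lower part of the lower part, for nested edges. -/
lemma lowerClass_lower (h : T.EdgeLT e e') : (lower_isSub e).lowerClass e' = ⟦T.lower e'⟧ := by
  obtain ⟨e₁, he₁⟩ := mem_range_lower_edge.2 ⟨h.ne.symm, h.asymm⟩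
  have hroot₁ : ¬ T.Beyond ((lower_isSub e).edge e₁) (lowerVal e (T.lower e).root) :=
    not_beyond_root
  rw [(lower_isSub e).lowerClass_eq he₁]
  refine Quotient.sound (((lower_isSub e).comp_lower e₁).equiv (lower_isSub e') (fun v => ?_) rfl)
  rw [(lower_isSub e).mem_range_lower hroot₁, he₁, mem_range_lower, mem_range_lower]
  exact and_iff_right_of_imp fun hn hb => hn (h.beyond hb)

/-- The upper part of the lower part, for edges that are not nested. -/
lemma upperClass_lower_of_par (hne : e' ≠ e) (h : ¬ T.EdgeLT e e') (h' : ¬ T.EdgeLT e' e) :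
    (lower_isSub e).upperClass e' = ⟦T.upper e'⟧ := by
  obtain ⟨e₁, he₁⟩ := mem_range_lower_edge.2 ⟨hne, h'⟩
  have hroot₁ : ¬ T.Beyond ((lower_isSub e).edge e₁) (lowerVal e (T.lower e).root) :=
    not_beyond_root
  rw [(lower_isSub e).upperClass_eq he₁]
  refine Quotient.sound (((lower_isSub e).comp_upper e₁).equiv (upper_isSub e') (fun v => ?_) ?_)
  · rw [(lower_isSub e).mem_range_upper hroot₁, he₁, mem_range_lower, mem_range_upper]
    exact and_iff_right_of_imp fun hb => not_beyond_of_par hne.symm h h' hb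
  · rw [Function.comp_apply, upper_root, upper_root, (lower_isSub e).far_eq hroot₁, he₁]

/-- The lower part of the lower part is symmetric in edges that are not nested. -/
lemma lowerClass_lower_of_par (hne : e' ≠ e) (h : ¬ T.EdgeLT e e') (h' : ¬ T.EdgeLT e' e) :
    (lower_isSub e).lowerClass e' = (lower_isSub e').lowerClass e := by
  obtain ⟨e₁, he₁⟩ := mem_range_lower_edge.2 ⟨hne, h'⟩
  obtain ⟨e₂, he₂⟩ := mem_range_lower_edge.2 ⟨hne.symm, h⟩
  have hroot₁ : ¬ T.Beyond ((lower_isSub e).edge e₁) (lowerVal e (T.lower e).root) :=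
    not_beyond_root
  have hroot₂ : ¬ T.Beyond ((lower_isSub e').edge e₂) (lowerVal e' (T.lower e').root) :=
    not_beyond_root
  rw [(lower_isSub e).lowerClass_eq he₁, (lower_isSub e').lowerClass_eq he₂]
  refine Quotient.sound (((lower_isSub e).comp_lower e₁).equiv
    ((lower_isSub e').comp_lower e₂) (fun v => ?_) rfl)
  rw [(lower_isSub e).mem_range_lower hroot₁, (lower_isSub e').mem_range_lower hroot₂, he₁, he₂,
    mem_range_lower, mem_range_lower, and_comm]

variable (R : Type*) [CommRing R]

/-- The sum of the products of the two parts of the tree over all edges. -/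
def cutSum (T : LoopTree S) : TreeModule R S ⊗[R] TreeModule R S :=
  ∑ᶠ e : T.graph.edgeSet,
    Finsupp.single ⟦T.upper e⟧ (1 : R) ⊗ₜ[R] Finsupp.single ⟦T.lower e⟧ (1 : R)

/-- A homeomorphism presents `T` as a part of `T'` with all the vertices, so the pieces cut off by
corresponding edges have the same vertices and roots. -/
lemma cutSum_congr {T T' : LoopTree S} (h : T ≈ T') : T.cutSum R = T'.cutSum R := by
  obtain ⟨f, h1, h2, h3, h4, h5⟩ := h
  have hs : T.IsSub T' f := ⟨f.injective, h1, h3, h4, h5⟩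
  have hbij : Function.Bijective hs.edge := by
    refine ⟨hs.edge_injective, fun e => ?_⟩
    exact (hs.mem_range_edge e).2 fun v _ => f.surjective v
  refine finsum_eq_of_bijective hs.edge hbij fun e => ?_
  have hroot : ¬ T'.Beyond (hs.edge e) (f T.root) := by rw [h2]; exact not_beyond_root
  have hu : T.upper e ≈ T'.upper (hs.edge e) := by
    refine (hs.comp_upper e).equiv (upper_isSub _) (fun v => ?_) ?_
    · rw [hs.mem_range_upper hroot, mem_range_upper]
      exact and_iff_right (f.surjective v)
    · rw [Function.comp_apply, upper_root, upper_root, hs.far_eq hroot]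
  have hl : T.lower e ≈ T'.lower (hs.edge e) := by
    refine (hs.comp_lower e).equiv (lower_isSub _) (fun v => ?_) ?_
    · rw [hs.mem_range_lower hroot, mem_range_lower]
      exact and_iff_right (f.surjective v)
    · rw [Function.comp_apply, lower_root, lower_root, h2]
  rw [Quotient.sound hu, Quotient.sound hl]

open Classical in
-- Indexing the edges of a part by edges of the ambient tree puts all iterated cuts over one set, as
-- `preLie_of_nested` requires. The default values of `upperClass` and `lowerClass` never enter.
lemma cutSum_eq_of_isSub [Fintype T.graph.edgeSet] (h : T₁.IsSub T j)
    (P : T.graph.edgeSet → Prop) (hP : ∀ e, P e ↔ e ∈ Set.range h.edge) :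
    T₁.cutSum R = ∑ e with P e,
      Finsupp.single (h.upperClass e) (1 : R) ⊗ₜ[R] Finsupp.single (h.lowerClass e) (1 : R) := by
  rw [← h.finsum_edge P hP fun e =>
    Finsupp.single (h.upperClass e) (1 : R) ⊗ₜ[R] Finsupp.single (h.lowerClass e) (1 : R)]
  refine finsum_congr fun e => ?_
  rw [h.upperClass_eq rfl, h.lowerClass_eq rfl]

end LoopTree

variable (R : Type*) [CommRing R]

variable (S) in
/-- The comultiplication of trees. -/
def treeComul : TreeModule R S →ₗ[R] TreeModule R S ⊗[R] TreeModule R S :=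
  Finsupp.linearCombination R fun τ => τ.out.cutSum R

lemma treeComul_single (T : LoopTree S) :
    treeComul S R (Finsupp.single ⟦T⟧ 1) = T.cutSum R := by
  rw [treeComul, Finsupp.linearCombination_single, one_smul]
  exact LoopTree.cutSum_congr R (Quotient.exact (Quotient.out_eq _))

lemma isTreeComul_treeComul : IsTreeComul (treeComul S R) := treeComul_single R

open Classical LoopTree in
-- Two distinct edges are nested or independent with respect to the root. For nested edges the
-- middle factor is the part of the tree between them; for independent ones the last factor is what
-- remains after both upper parts are removed.
lemma isPreLieComul_treeComul : IsPreLieComul (treeComul S R) := by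
  refine isPreLieComul_finsupp fun τ => ?_
  induction τ using Quotient.inductionOn with
  | h T =>
    have := T.finite
    have : Fintype T.graph.edgeSet := Fintype.ofFinite _
    refine preLie_of_nested (treeComul S R) Finset.univ T.EdgeLT
      (fun e e' => e' ≠ e ∧ ¬ T.EdgeLT e e' ∧ ¬ T.EdgeLT e' e)
      (fun e e' h => ⟨h.1.symm, h.2.2, h.2.1⟩) (Finsupp.single ⟦T⟧ 1) (fun _ => 1)
      (fun e => Finsupp.single ⟦T.upper e⟧ 1) (fun e => Finsupp.single ⟦T.lower e⟧ 1)
      (fun e' e => Finsupp.single ((upper_isSub e).lowerClass e') 1)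
      (fun e e' => Finsupp.single ((lower_isSub e).lowerClass e') 1) ?_ (fun e _ => ?_)
      (fun e _ => ?_) (fun e _ e' _ ⟨h1, h2, h3⟩ => ?_)
    · simp only [one_smul]
      rw [treeComul_single, cutSum, finsum_eq_sum_of_fintype]
    · simp only [one_smul]
      rw [treeComul_single, cutSum_eq_of_isSub R (upper_isSub e) (fun e' => T.EdgeLT e' e)
        fun e' => mem_range_upper_edge.symm]
      refine Finset.sum_congr rfl fun e' he' => ?_
      rw [upperClass_upper (Finset.mem_filter.1 he').2]
    · simp only [one_smul]
      rw [treeComul_single, cutSum_eq_of_isSub R (lower_isSub e)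
        (fun e' => T.EdgeLT e e' ∨ (e' ≠ e ∧ ¬ T.EdgeLT e e' ∧ ¬ T.EdgeLT e' e)) fun e' => ?_]
      · refine (Finset.sum_congr (s₂ := Finset.univ.filter (fun e' => T.EdgeLT e e') ∪
          Finset.univ.filter fun e' => e' ≠ e ∧ ¬ T.EdgeLT e e' ∧ ¬ T.EdgeLT e' e)
          (by ext; simp) fun _ _ => rfl).trans ?_
        rw [Finset.sum_union]
        · refine congr_arg₂ _ (Finset.sum_congr rfl fun e' he' => ?_)
            (Finset.sum_congr (by ext; simp) fun e' he' => ?_)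
          · have h := (Finset.mem_filter.1 he').2
            rw [upperClass_lower h, lowerClass_lower h]
          · obtain ⟨h1, h2, h3⟩ : e' ≠ e ∧ ¬ T.EdgeLT e e' ∧ ¬ T.EdgeLT e' e := by simpa using he'
            rw [upperClass_lower_of_par h1 h2 h3]
        · exact Finset.disjoint_filter.2 fun e' _ h h' => h'.2.1 h
      · rw [mem_range_lower_edge]
        constructor
        · rintro (h | h)
          · exact ⟨h.ne.symm, h.asymm⟩
          · exact ⟨h.1, h.2.2⟩
        · intro h
          by_cases h' : T.EdgeLT e e'
          · exact Or.inl h'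
          · exact Or.inr ⟨h.1, h', h.2⟩
    · rw [lowerClass_lower_of_par h1 h2 h3]

end TreeComul

/-! ### The comultiplication of loops -/

section LoopComul

variable {S : Type*} [TopologicalSpace S] [ChartedSpace (EuclideanHalfSpace 2) S]

namespace PointedLoop

variable {α β : PointedLoop S} {p q : S}

open Classical in
/-- A loop in the class `(α_{p₁,p₂}, p)`. -/
def innerLoop (α : PointedLoop S) (p : S) : PointedLoop S :=
  if hp : p ∈ α.crossings then (exists_inner hp).choose else α

open Classical in
/-- A loop in the class `(α_{p₂,p₁}, *_α)`. -/
def outerLoop (α : PointedLoop S) (p : S) : PointedLoop S :=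
  if hp : p ∈ α.crossings then (exists_outer hp).choose else α

lemma innerLoop_spec (hp : p ∈ α.crossings) :
    Traverses α.toFun (α.carc p) (α.innerLoop p).toFun ∧
      (α.innerLoop p).toFun (α.innerLoop p).base = p := by
  rw [innerLoop, dif_pos hp]; exact (exists_inner hp).choose_spec

lemma outerLoop_spec (hp : p ∈ α.crossings) :
    Traverses α.toFun (α.arc p)ᶜ (α.outerLoop p).toFun ∧
      (α.outerLoop p).toFun (α.outerLoop p).base = α.toFun α.base := by
  rw [outerLoop, dif_pos hp]; exact (exists_outer hp).choose_spec

lemma isInner_innerLoop (hp : p ∈ α.crossings) : α.IsInner p ⟦α.innerLoop p⟧ :=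
  (isInner_iff hp).2 ⟨_, rfl, innerLoop_spec hp⟩

lemma isOuter_outerLoop (hp : p ∈ α.crossings) : α.IsOuter p ⟦α.outerLoop p⟧ :=
  (isOuter_iff hp).2 ⟨_, rfl, outerLoop_spec hp⟩

lemma subLoop_innerLoop (hp : p ∈ α.crossings) :
    ∃ c, SubLoop α (α.innerLoop p) (Homeomorph.refl S) (α.carc p) c (α.innerSet p) :=
  exists_subLoop_inner hp (innerLoop_spec hp).1 (innerLoop_spec hp).2

lemma subLoop_outerLoop (hp : p ∈ α.crossings) :
    ∃ c, SubLoop α (α.outerLoop p) (Homeomorph.refl S) (α.arc p)ᶜ c (α.outerSet p) :=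
  exists_subLoop_outer hp (outerLoop_spec hp).1 (outerLoop_spec hp).2

lemma mem_outerSet_iff (hp : p ∈ α.crossings) : q ∈ α.outerSet p ↔ q ∈ α.crossings ∧
    (α.Inside p q ∨ (α.Outside p q ∧ α.Outside q p)) := by
  rw [mem_outerSet]
  refine and_congr_right fun hq => ?_
  constructor
  · exact fun h => (h.inside_or hp hq).imp_right fun h' => ⟨h', h⟩
  · rintro (h | h)
    · exact h.outside hp hq
    · exact h.2

end PointedLoop

open PointedLoop

namespace SubLoop

variable {α β : PointedLoop S} {g : S ≃ₜ S} {A : Set Circle} {c : ℝ → ℝ} {N : Finset S}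
  {p q : S}

/-- Collapse maps compose, so a loop cut out of a subloop is a loop that traverses an intersection
of two sets in the original circle. The intermediate loop disappears from all later comparisons. -/
lemma traverses_inner (h : SubLoop α β g A c N) (hq : q ∈ N) :
    Traverses (g ∘ α.toFun) (A ∩ α.carc q) (β.innerLoop (g q)).toFun :=
  h.traverses (innerLoop_spec (h.mem_crossings hq)).1
    (fun _ hz hn => carc_frontier (h.mem_crossings hq) hz hn)
    fun t => by rw [h.mem_carc hq, Set.mem_inter_iff]

lemma traverses_outer (h : SubLoop α β g A c N) (hq : q ∈ N) :
    Traverses (g ∘ α.toFun) (A ∩ (α.arc q)ᶜ) (β.outerLoop (g q)).toFun :=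
  h.traverses (outerLoop_spec (h.mem_crossings hq)).1
    (fun _ hz hn => compl_arc_frontier (h.mem_crossings hq) hz hn)
    fun t => by rw [Set.mem_compl_iff, h.mem_arc hq, Set.mem_inter_iff, Set.mem_compl_iff]

end SubLoop

namespace PointedLoop

variable {α β : PointedLoop S} {p q : S}

/-- The closed arc of `q` is contained in that of `p`, so the intersection is the arc of `q` itself.
-/
lemma inner_inner (hp : p ∈ α.crossings) (hq : q ∈ α.crossings) (h : α.Inside q p) :
    (⟦(α.innerLoop p).innerLoop q⟧ : PointedLoopClass S) = ⟦α.innerLoop q⟧ := by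
  obtain ⟨c, hs⟩ := subLoop_innerLoop hp
  have hqN : q ∈ α.innerSet p := mem_innerSet.2 ⟨hq, h⟩
  have h1 := hs.traverses_inner hqN
  rw [Set.inter_eq_self_of_subset_right ((h.carc_subset hq hp).trans arc_subset_carc)] at h1
  refine mk_eq_of_traverses_same (isClosed_carc hq) h1 (innerLoop_spec hq).1 ?_
  rw [(innerLoop_spec hq).2]
  exact (innerLoop_spec (hs.mem_crossings hqN)).2.symm

/-- Both loops traverse the closed arc of `q` without the arc of `p`, and both are based over `q`.
-/
lemma inner_outer_eq_outer_inner (hp : p ∈ α.crossings) (hq : q ∈ α.crossings)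
    (h : α.Inside p q) :
    (⟦(α.outerLoop p).innerLoop q⟧ : PointedLoopClass S) = ⟦(α.innerLoop q).outerLoop p⟧ := by
  obtain ⟨c, hs⟩ := subLoop_outerLoop hp
  obtain ⟨c', hs'⟩ := subLoop_innerLoop hq
  have hqN : q ∈ α.outerSet p := mem_outerSet.2 ⟨hq, h.outside hp hq⟩
  have hpN : p ∈ α.innerSet q := mem_innerSet.2 ⟨hp, h⟩
  have h1 := hs.traverses_inner hqN
  rw [Set.inter_comm] at h1
  refine mk_eq_of_traverses_same ((isClosed_carc hq).inter (isOpen_arc hp).isClosed_compl) h1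
    (hs'.traverses_outer hpN) ?_
  have e1 := (outerLoop_spec (hs'.mem_crossings hpN)).2
  have e2 := (innerLoop_spec (hs.mem_crossings hqN)).2
  exact e1.trans ((innerLoop_spec hq).2.trans e2.symm)

lemma outer_outer_eq_outer (hp : p ∈ α.crossings) (hq : q ∈ α.crossings) (h : α.Inside p q) :
    (⟦(α.outerLoop p).outerLoop q⟧ : PointedLoopClass S) = ⟦α.outerLoop q⟧ := by
  obtain ⟨c, hs⟩ := subLoop_outerLoop hp
  have hqN : q ∈ α.outerSet p := mem_outerSet.2 ⟨hq, h.outside hp hq⟩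
  have h1 := hs.traverses_outer hqN
  rw [Set.inter_eq_self_of_subset_right
    (Set.compl_subset_compl.2 (arc_subset_carc.trans (h.carc_subset hp hq)))] at h1
  refine mk_eq_of_traverses_same (isOpen_arc hq).isClosed_compl h1 (outerLoop_spec hq).1 ?_
  rw [(outerLoop_spec hq).2]
  exact ((outerLoop_spec (hs.mem_crossings hqN)).2.trans (outerLoop_spec hp).2).symm

lemma inner_outer (hp : p ∈ α.crossings) (hq : q ∈ α.crossings) (h : α.Outside q p)
    (h' : α.Outside p q) :
    (⟦(α.outerLoop p).innerLoop q⟧ : PointedLoopClass S) = ⟦α.innerLoop q⟧ := by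
  obtain ⟨c, hs⟩ := subLoop_outerLoop hp
  have hqN : q ∈ α.outerSet p := mem_outerSet.2 ⟨hq, h⟩
  have h1 := hs.traverses_inner hqN
  have hsub : α.carc q ⊆ (α.arc p)ᶜ := fun z hz hz' =>
    Set.disjoint_left.1 (h.disjoint_carc hq hp h') hz (arc_subset_carc hz')
  rw [Set.inter_eq_self_of_subset_right hsub] at h1
  refine mk_eq_of_traverses_same (isClosed_carc hq) h1 (innerLoop_spec hq).1 ?_
  rw [(innerLoop_spec hq).2]
  exact (innerLoop_spec (hs.mem_crossings hqN)).2.symm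

/-- Both loops traverse the complement of the two arcs and keep the base point of `α`. -/
lemma outer_outer_comm (hp : p ∈ α.crossings) (hq : q ∈ α.crossings) (h : α.Outside q p)
    (h' : α.Outside p q) :
    (⟦(α.outerLoop p).outerLoop q⟧ : PointedLoopClass S) = ⟦(α.outerLoop q).outerLoop p⟧ := by
  obtain ⟨c, hs⟩ := subLoop_outerLoop hp
  obtain ⟨c', hs'⟩ := subLoop_outerLoop hq
  have hqN : q ∈ α.outerSet p := mem_outerSet.2 ⟨hq, h⟩
  have hpN : p ∈ α.outerSet q := mem_outerSet.2 ⟨hp, h'⟩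
  have h1 := hs.traverses_outer hqN
  rw [Set.inter_comm] at h1
  refine mk_eq_of_traverses_same
    ((isOpen_arc hq).isClosed_compl.inter (isOpen_arc hp).isClosed_compl) h1
    (hs'.traverses_outer hpN) ?_
  have e1 := (outerLoop_spec (hs.mem_crossings hqN)).2.trans (outerLoop_spec hp).2
  have e2 := (outerLoop_spec (hs'.mem_crossings hpN)).2.trans (outerLoop_spec hq).2
  exact e2.trans e1.symm

variable (R : Type*) [CommRing R]

/-- The value of the comultiplication on the class of a pointed loop. -/
def comulSum (α : PointedLoop S) : LoopModule R S ⊗[R] LoopModule R S :=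
  ∑ p ∈ α.crossings, ((α.crossingSign p : ℤ) : R) •
    (Finsupp.single ⟦α.innerLoop p⟧ (1 : R) ⊗ₜ[R] Finsupp.single ⟦α.outerLoop p⟧ (1 : R))

/-- An isotopy matches the crossings, their arcs and signs, and the base points. Therefore the sum
depends on the class alone. -/
lemma comulSum_congr [IsManifold (𝓡∂ 2) ∞ S] (hS : IsOrientedAtlas S) (h : α ≈ β) :
    α.comulSum R = β.comulSum R := by
  obtain ⟨g, c, hs, hb⟩ := exists_subLoop_of_equiv h
  refine Finset.sum_bij (fun p _ => g p) (fun p hp => hs.mem_crossings hp)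
    (fun p _ q _ e => g.injective e) (fun y hy => ?_) fun p hp => ?_
  · obtain ⟨q, hq, rfl⟩ := (hs.crossings y).1 hy
    exact ⟨q, hq, rfl⟩
  · have hp' := hs.mem_crossings hp
    have h1 := hs.traverses_inner hp
    have h2 := hs.traverses_outer hp
    rw [Set.univ_inter] at h1 h2
    have e1 : (⟦α.innerLoop p⟧ : PointedLoopClass S) = ⟦β.innerLoop (g p)⟧ := by
      refine PointedLoop.mk_eq_of_traverses (isClosed_carc hp) hs.iso (innerLoop_spec hp).1 h1 ?_
      rw [(innerLoop_spec hp).2, (innerLoop_spec hp').2]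
    have e2 : (⟦α.outerLoop p⟧ : PointedLoopClass S) = ⟦β.outerLoop (g p)⟧ := by
      refine PointedLoop.mk_eq_of_traverses (isOpen_arc hp).isClosed_compl hs.iso
        (outerLoop_spec hp).1 h2 ?_
      rw [(outerLoop_spec hp).2, (outerLoop_spec hp').2]
      obtain ⟨s, hs'⟩ := α.exists_lift
      have : Circle.exp (c s) = β.base := hb ⟨_, ⟨s, hs', rfl⟩, rfl⟩
      rw [← this, hs.map s trivial, hs']
    rw [e1, e2, hs.crossingSign_eq hS hp]

end PointedLoop

variable (R : Type*) [CommRing R]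

variable (S) in
/-- The comultiplication of loops. -/
def loopComul : LoopModule R S →ₗ[R] LoopModule R S ⊗[R] LoopModule R S :=
  Finsupp.linearCombination R fun a => a.out.comulSum R

lemma loopComul_single [IsManifold (𝓡∂ 2) ∞ S] (hS : IsOrientedAtlas S) (α : PointedLoop S) :
    loopComul S R (Finsupp.single ⟦α⟧ 1) = α.comulSum R := by
  rw [loopComul, Finsupp.linearCombination_single, one_smul]
  exact comulSum_congr R hS (Quotient.exact (Quotient.out_eq _))

lemma isLoopComul_loopComul [IsManifold (𝓡∂ 2) ∞ S] (hS : IsOrientedAtlas S) :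
    IsLoopComul (loopComul S R) := by
  intro α b c h
  rw [loopComul_single R hS, comulSum]
  refine Finset.sum_congr rfl fun p hp => ?_
  rw [(existsUnique_isInner hp).unique (h p hp).1 (isInner_innerLoop hp),
    (existsUnique_isOuter hp).unique (h p hp).2 (isOuter_outerLoop hp)]
  exact Int.cast_smul_eq_zsmul R (α.crossingSign p : ℤ)
    (Finsupp.single ⟦α.innerLoop p⟧ (1 : R) ⊗ₜ[R] Finsupp.single ⟦α.outerLoop p⟧ (1 : R))

open Classical in
-- The inner loop of `p` keeps the crossings nested in `p`; the outer loop keeps those around `p`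
-- and those independent of `p`. Crossings linked with `p` vanish, so nesting and independence
-- exhaust the pairs.
lemma isPreLieComul_loopComul [IsManifold (𝓡∂ 2) ∞ S] (hS : IsOrientedAtlas S) :
    IsPreLieComul (loopComul S R) := by
  refine isPreLieComul_finsupp fun a => ?_
  induction a using Quotient.inductionOn with
  | h α =>
    refine preLie_of_nested (loopComul S R) α.crossings α.Inside
      (fun p q => α.Outside p q ∧ α.Outside q p) (fun _ _ h => h.symm) (Finsupp.single ⟦α⟧ 1)
      (fun p => ((α.crossingSign p : ℤ) : R))
      (fun p => Finsupp.single ⟦α.innerLoop p⟧ 1) (fun p => Finsupp.single ⟦α.outerLoop p⟧ 1)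
      (fun q p => Finsupp.single ⟦(α.innerLoop p).outerLoop q⟧ 1)
      (fun p q => Finsupp.single ⟦(α.outerLoop p).outerLoop q⟧ 1) (loopComul_single R hS α)
      (fun p hp => ?_) (fun p hp => ?_) fun p hp q hq h => ?_
    · obtain ⟨c, hs⟩ := subLoop_innerLoop hp
      have hcr : (α.innerLoop p).crossings = α.crossings.filter fun q => α.Inside q p := by
        ext q
        rw [Finset.mem_filter, ← mem_innerSet]
        exact hs.mem_crossings_iff (q := q)
      rw [loopComul_single R hS, comulSum, hcr]
      refine Finset.sum_congr rfl fun q hq => ?_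
      obtain ⟨hq, hI⟩ := Finset.mem_filter.1 hq
      rw [inner_inner hp hq hI]
      congr 3
      exact hs.crossingSign_eq hS (mem_innerSet.2 ⟨hq, hI⟩)
    · obtain ⟨c, hs⟩ := subLoop_outerLoop hp
      have hcr : (α.outerLoop p).crossings = α.crossings.filter (fun q => α.Inside p q) ∪
          α.crossings.filter (fun q => α.Outside p q ∧ α.Outside q p) := by
        ext q
        rw [Finset.mem_union, Finset.mem_filter, Finset.mem_filter, ← and_or_left,
          ← mem_outerSet_iff hp]
        exact hs.mem_crossings_iff (q := q)
      have hsign : ∀ q ∈ α.outerSet p, (α.outerLoop p).crossingSign q = α.crossingSign q :=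
        fun q hq => hs.crossingSign_eq hS hq
      rw [loopComul_single R hS, comulSum, hcr, Finset.sum_union]
      · refine congr_arg₂ _ (Finset.sum_congr rfl fun q hq => ?_) ?_
        · obtain ⟨hq, hI⟩ := Finset.mem_filter.1 hq
          rw [inner_outer_eq_outer_inner hp hq hI, outer_outer_eq_outer hp hq hI,
            hsign q (mem_outerSet.2 ⟨hq, hI.outside hp hq⟩)]
        · refine Finset.sum_congr (by ext; simp) fun q hq => ?_
          obtain ⟨hq, h1, h2⟩ : q ∈ α.crossings ∧ α.Outside p q ∧ α.Outside q p := by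
            simpa using hq
          rw [inner_outer hp hq h2 h1, hsign q (mem_outerSet.2 ⟨hq, h2⟩)]
      · exact Finset.disjoint_filter.2 fun q _ h h' => h.not_outside hp h'.1
    · rw [outer_outer_comm hp hq h.2 h.1]

end LoopComul

/-! ### The homomorphism from loops to trees -/

section Eta

variable {S : Type*} [TopologicalSpace S] [ChartedSpace (EuclideanHalfSpace 2) S]

open PointedLoop

variable {α β : PointedLoop S} {p q : S} {H H₁ H₂ : Finset S} {g : S ≃ₜ S} {A : Set Circle}
  {c : ℝ → ℝ} {N : Finset S}

open Classical in
lemma SubLoop.image_mem_cuts_iff (h : SubLoop α β g A c N) (hN : H ⊆ N) :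
    H.image g ∈ β.cuts ↔ H ∈ α.cuts := by
  constructor
  · intro hH
    refine PointedLoop.mem_cuts.2 ⟨fun q hq => h.N_sub (hN hq), fun q hq r hr hne => ?_⟩
    have := (PointedLoop.mem_cuts.1 hH).2 (g q) (Finset.mem_image_of_mem g hq) (g r)
      (Finset.mem_image_of_mem g hr) (g.injective.ne hne)
    rwa [h.inside_iff (hN hq) (hN hr), h.outside_iff (hN hq) (hN hr)] at this
  · intro hH
    refine h.mem_cuts hH fun y => ?_
    rw [Finset.mem_image]
    exact exists_congr fun q => and_congr_right fun hq => (and_iff_right (hN hq)).symm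

open Classical in
lemma SubLoop.mem_cuts_iff_image (h : SubLoop α β g A c N) {H' : Finset S} :
    H' ∈ β.cuts ↔ ∃ H ∈ α.cuts, H ⊆ N ∧ H.image g = H' := by
  constructor
  · intro hH'
    obtain ⟨H, hH, rfl⟩ : ∃ H ⊆ N, H.image g = H' := by
      refine Finset.subset_image_iff.1 fun y hy => ?_
      obtain ⟨q, hq, rfl⟩ := (h.crossings y).1 ((PointedLoop.mem_cuts.1 hH').1 y hy)
      exact Finset.mem_image_of_mem g hq
    exact ⟨H, (h.image_mem_cuts_iff hH).1 hH', hH, rfl⟩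
  · rintro ⟨H, hH, hN, rfl⟩
    exact (h.image_mem_cuts_iff hN).2 hH

lemma SubLoop.mem_cuts_iff (h : SubLoop α β (Homeomorph.refl S) A c N) :
    H ∈ β.cuts ↔ H ∈ α.cuts ∧ H ⊆ N := by
  classical
  rw [h.mem_cuts_iff_image]
  have : ∀ K : Finset S, K.image (Homeomorph.refl S) = K := fun K => Finset.image_id
  simp only [this]
  exact ⟨fun ⟨K, h1, h2, h3⟩ => h3 ▸ ⟨h1, h2⟩, fun h => ⟨H, h.1, h.2, rfl⟩⟩

open Classical in
/-- The class of the dual tree of a cut. -/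
def PointedLoop.cutTree (α : PointedLoop S) (H : Finset S) : LoopTreeClass S :=
  if hH : H ∈ α.cuts then (existsUnique_isCutTree hH).choose else
    (existsUnique_isCutTree (α := α) (H := ∅) (PointedLoop.mem_cuts.2 (by simp))).choose

lemma PointedLoop.isCutTree_cutTree (hH : H ∈ α.cuts) : α.IsCutTree H (α.cutTree H) := by
  rw [cutTree, dif_pos hH]; exact (existsUnique_isCutTree hH).choose_spec.1

lemma PointedLoop.IsDualTree.cutTree_eq (hH : H ∈ α.cuts) {T : LoopTree S}
    (h : α.IsDualTree H T) : α.cutTree H = ⟦T⟧ :=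
  (existsUnique_isCutTree hH).unique (isCutTree_cutTree hH) ⟨T, rfl, h⟩

section Parts

variable {T : LoopTree S} {e : T.graph.edgeSet} {f : T.V ≃ Face α.toFun H}

/-- The vertices separated from the root by the edge `[p]` are the faces inside `p`. -/
lemma beyond_iff_faceIn (hH : H ∈ α.cuts)
    (hadj : ∀ v w, T.graph.Adj v w ↔ ∃ p, Face.Joins p (f v) (f w))
    (hroot : α.base ∈ (f T.root).arcs) {a b : T.V} (he : e.1 = s(a, b))
    (hJ : Face.Joins p (f a) (f b)) (v : T.V) : T.Beyond e v ↔ FaceIn (f v) p := by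
  have hreach : ∀ x y, (T.graph.deleteEdges {e.1}).Reachable x y →
      (FaceIn (f x) p ↔ FaceIn (f y) p) := by
    intro x y h
    refine faceIn_iff_of_reachable hH hJ (h.map (⟨f, fun {x y} hxy => ?_⟩ :
      T.graph.deleteEdges {e.1} →g (α.faceGraph H).deleteEdges {s(f a, f b)}))
    obtain ⟨h1, h2⟩ := SimpleGraph.deleteEdges_adj.1 hxy
    refine SimpleGraph.deleteEdges_adj.2 ⟨(hadj _ _).1 h1, fun h3 => h2 ?_⟩
    rw [Set.mem_singleton_iff, he]
    exact Sym2.map.injective f.injective h3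
  have hr : ¬ FaceIn (f T.root) p := (base_mem_arcs_iff hH).1 hroot p hJ.1
  have hfar : FaceIn (f (T.far e)) p := by
    obtain ⟨a', ha', hn⟩ := LoopTree.exists_near e
    have hn' : ¬ FaceIn (f a') p := fun h => hr ((hreach _ _ (not_not.1 hn)).2 h)
    have h1 := faceIn_of_joins hH hJ
    rw [he] at ha'
    rcases Sym2.eq_iff.1 ha' with ⟨rfl, h2⟩ | ⟨h2, rfl⟩
    · rw [← h2]; tauto
    · rw [← h2]; tauto
  constructor
  · intro hb
    exact (hreach _ _ (LoopTree.beyond_iff.1 hb)).1 hfar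
  · exact fun h h' => hr ((hreach _ _ h').2 h)

/-- The vertices beyond `[p]` are the faces inside `p`, along which the inner loop runs; the other
faces belong to the outer loop. Both halves are thus instances of `CutSubLoop.isDualTree`, rooted at
the far end of the edge and at the root. -/
lemma mk_upper_eq_cutTree [DecidableEq S] [IsManifold (𝓡∂ 2) ∞ S]
    (hS : IsOrientedAtlas S) (hH : H ∈ α.cuts)
    (hadj : ∀ v w, T.graph.Adj v w ↔ ∃ p, Face.Joins p (f v) (f w))
    (hroot : α.base ∈ (f T.root).arcs)
    (hlabel : ∀ v, ∃ β : GenericLoop S, ⟦β⟧ = T.label v ∧ Traverses α.toFun (f v).arcs β.toFun)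
    (hsign : ∀ v w p, Face.Joins p (f v) (f w) → T.sign s(v, w) = α.crossingSign p)
    (hccw : ∀ v a b c, T.ccw v a b c ↔ FaceCcw (f v) (f a) (f b) (f c))
    {a b : T.V} (he : e.1 = s(a, b)) (hJ : Face.Joins p (f a) (f b)) :
    (⟦T.upper e⟧ : LoopTreeClass S) = (α.innerLoop p).cutTree (H ∩ α.innerSet p) ∧
      (⟦T.lower e⟧ : LoopTreeClass S) = (α.outerLoop p).cutTree (H ∩ α.outerSet p) := by
  have hb := beyond_iff_faceIn hH hadj hroot he hJ
  have hp := hJ.1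
  have hpc := (mem_cuts.1 hH).1 p hp
  have hfar : FaceIn (f (T.far e)) p := (hb _).1 (LoopTree.far_beyond e)
  have hnin : p ∉ α.innerSet p := fun hm => not_inside_self hpc (mem_innerSet.1 hm).2
  have hnout : p ∉ α.outerSet p := fun hm => not_outside_self hpc (mem_outerSet.1 hm).2
  constructor
  · obtain ⟨c, hs⟩ := subLoop_innerLoop hpc
    have hF₀ : ∀ q ∈ H, FaceIn (f (T.far e)) q ↔ q = p ∨ α.Inside p q := by
      intro q hq
      by_cases hqp : q = p
      · rw [hqp]; exact iff_of_true hfar (Or.inl rfl)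
      · obtain ⟨-, -, h1, h2⟩ := (joins_iff hH).1 hJ
        have hm := LoopTree.far_mem e
        rw [he] at hm
        rcases Sym2.mem_iff.1 hm with e1 | e1 <;> rw [e1]
        · rw [h1 q hq hqp]; simp [hqp]
        · rw [h2 q hq hqp]; simp [hqp]
    have hc := hs.cutSubLoop_inner (H' := H ∩ α.innerSet p) hH hp hF₀ fun q => Finset.mem_inter
    refine (IsDualTree.cutTree_eq hc.cut' (hc.isDualTree hS (LoopTree.upper_isSub e) f hadj hlabel
      hsign hccw (fun v => ?_) rfl (exists_traverses_face hc.cut'))).symm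
    rw [LoopTree.mem_range_upper, hb]
    constructor
    · intro hF q hq hqN
      rw [hF₀ q hq, faceIn_iff_of_faceIn hH hp hF hq hqN]
    · exact fun hs => (hs p hp hnin).2 hfar
  · obtain ⟨c, hs⟩ := subLoop_outerLoop hpc
    have hF₀ : ∀ q ∈ H, ¬ FaceIn (f T.root) q := (base_mem_arcs_iff hH).1 hroot
    have hc := hs.cutSubLoop_outer (H' := H ∩ α.outerSet p) hH hp hF₀ fun q => Finset.mem_inter
    refine (IsDualTree.cutTree_eq hc.cut' (hc.isDualTree hS (LoopTree.lower_isSub e) f hadj hlabel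
      hsign hccw (fun v => ?_) rfl (exists_traverses_face hc.cut'))).symm
    rw [LoopTree.mem_range_lower, hb]
    constructor
    · intro hF q hq hqN
      exact iff_of_false (not_faceIn_of_not_faceIn hH hp hF hq hqN) (hF₀ q hq)
    · exact fun hs h => hF₀ p hp ((hs p hp hnout).1 h)

end Parts

variable (R : Type*) [CommRing R]

/-- The comultiplication of the dual tree of a cut. -/
lemma treeComul_cutTree [DecidableEq S] [IsManifold (𝓡∂ 2) ∞ S]
    (hS : IsOrientedAtlas S) (hH : H ∈ α.cuts) :
    treeComul S R (Finsupp.single (α.cutTree H) 1) = ∑ p ∈ H,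
      Finsupp.single ((α.innerLoop p).cutTree (H ∩ α.innerSet p)) (1 : R) ⊗ₜ[R]
        Finsupp.single ((α.outerLoop p).cutTree (H ∩ α.outerSet p)) (1 : R) := by
  obtain ⟨T, hT, f, h1, h2, h3, h4, h5⟩ := isCutTree_cutTree hH
  have hccw : ∀ v a b c, T.ccw v a b c ↔ FaceCcw (f v) (f a) (f b) (f c) := fun v a b c => by
    rw [h5]; simp only [FaceCcw, f.injective.ne_iff]
  rw [← hT, treeComul_single, LoopTree.cutSum, ← Finset.sum_coe_sort, ← finsum_eq_sum_of_fintype]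
  -- The edge dual to the chord of `p`. The two faces on the sides of a chord and the chord
  -- determine each other, so the sum over edges becomes a sum over `H`.
  have hex : ∀ p : H, ∃ e : T.graph.edgeSet, ∃ a b, e.1 = s(a, b) ∧
      Face.Joins p.1 (f a) (f b) := by
    rintro ⟨p, hp⟩
    obtain ⟨F, F', hJ, -⟩ := exists_joins hH hp
    rw [← f.apply_symm_apply F, ← f.apply_symm_apply F'] at hJ
    exact ⟨⟨s(f.symm F, f.symm F'), (h1 _ _).2 ⟨p, hJ⟩⟩, _, _, rfl, hJ⟩
  choose E a b hE hJ using hex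
  symm
  refine finsum_eq_of_bijective E ⟨fun p q hpq => ?_, fun e => ?_⟩ fun p => ?_
  · have h := hE p
    rw [hpq, hE q] at h
    refine Subtype.ext ?_
    rcases Sym2.eq_iff.1 h with ⟨e1, e2⟩ | ⟨e1, e2⟩
    · have := hJ q
      rw [e1, e2] at this
      exact joins_unique hH (hJ p) this
    · have := joins_symm (hJ q)
      rw [e1, e2] at this
      exact joins_unique hH (hJ p) this
  · obtain ⟨x, y, hxy⟩ : ∃ x y, e.1 = s(x, y) := by
      obtain ⟨⟨x, y⟩, he⟩ := e
      exact ⟨x, y, rfl⟩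
    have hadj : T.graph.Adj x y := by
      have := e.2
      rwa [hxy] at this
    obtain ⟨p, hp⟩ := (h1 x y).1 hadj
    refine ⟨⟨p, hp.1⟩, Subtype.ext ?_⟩
    rw [hE, hxy]
    have hJ' := hJ ⟨p, hp.1⟩
    obtain ⟨-, -, k1, k2⟩ := (joins_iff hH).1 hp
    obtain ⟨-, -, k3, k4⟩ := (joins_iff hH).1 hJ'
    have e1 := faceIn_of_joins hH hp
    have e2 := faceIn_of_joins hH hJ'
    have ext : ∀ {K L : T.V}, (∀ q ∈ H, q ≠ p → (FaceIn (f K) q ↔ α.Inside p q)) →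
        (∀ q ∈ H, q ≠ p → (FaceIn (f L) q ↔ α.Inside p q)) →
        (FaceIn (f K) p ↔ FaceIn (f L) p) → K = L := by
      intro K L hK hL hKL
      refine f.injective (face_ext hH fun q hq => ?_)
      by_cases e : q = p
      · rw [e, hKL]
      · rw [hK q hq e, hL q hq e]
    rw [Sym2.eq_iff]
    by_cases hc : FaceIn (f (a ⟨p, hp.1⟩)) p ↔ FaceIn (f x) p
    · exact Or.inl ⟨ext k3 k1 hc, ext k4 k2 (by tauto)⟩
    · exact Or.inr ⟨ext k3 k2 (by tauto), ext k4 k1 (by tauto)⟩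
  · obtain ⟨e1, e2⟩ := mk_upper_eq_cutTree hS hH h1 h2 h3 h4 hccw (hE p) (hJ p)
    rw [e1, e2]

/-- The value of `η` on the class of a pointed loop. -/
def PointedLoop.etaSum (α : PointedLoop S) : TreeModule R S :=
  ∑ H ∈ α.cuts, (((∏ p ∈ H, α.crossingSign p : ℤˣ) : ℤ) : R) • Finsupp.single (α.cutTree H) (1 : R)

/-- Taking images under the final homeomorphism is a bijection of the cuts that preserves nesting,
signs and dual trees. -/
lemma PointedLoop.etaSum_congr [IsManifold (𝓡∂ 2) ∞ S] (hS : IsOrientedAtlas S) (h : α ≈ β) :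
    α.etaSum R = β.etaSum R := by
  classical
  obtain ⟨g, c, hs, -⟩ := exists_subLoop_of_equiv h
  have hcr : ∀ H ∈ α.cuts, H ⊆ α.crossings := fun H hH => (mem_cuts.1 hH).1
  refine Finset.sum_bij (fun H _ => H.image g)
    (fun H hH => (hs.image_mem_cuts_iff (hcr H hH)).2 hH)
    (fun H _ K _ e => Finset.image_injective g.injective e) (fun K hK => ?_) fun H hH => ?_
  · obtain ⟨H, hH, -, e⟩ := hs.mem_cuts_iff_image.1 hK
    exact ⟨H, hH, e⟩
  · have h1 : β.cutTree (H.image g) = α.cutTree H :=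
      (existsUnique_isCutTree ((hs.image_mem_cuts_iff (hcr H hH)).2 hH)).unique
        (isCutTree_cutTree ((hs.image_mem_cuts_iff (hcr H hH)).2 hH))
        (hs.isCutTree hS hH (fun y => Finset.mem_image) (isCutTree_cutTree hH))
    rw [h1, Finset.prod_image g.injective.injOn]
    congr 3
    exact Finset.prod_congr rfl fun p hp => (hs.crossingSign_eq hS (hcr H hH hp)).symm

variable (S) in
/-- The map from loops to trees. -/
def etaMap : LoopModule R S →ₗ[R] TreeModule R S :=
  Finsupp.linearCombination R fun a => a.out.etaSum R

lemma etaMap_single [IsManifold (𝓡∂ 2) ∞ S] (hS : IsOrientedAtlas S) (α : PointedLoop S) :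
    etaMap S R (Finsupp.single ⟦α⟧ 1) = α.etaSum R := by
  rw [etaMap, Finsupp.linearCombination_single, one_smul]
  exact etaSum_congr R hS (Quotient.exact (Quotient.out_eq _))

lemma isEta_etaMap [IsManifold (𝓡∂ 2) ∞ S] (hS : IsOrientedAtlas S) : IsEta (etaMap S R) := by
  intro α τ h
  rw [etaMap_single R hS, etaSum]
  refine Finset.sum_congr rfl fun H hH => ?_
  rw [(existsUnique_isCutTree hH).unique (h H hH) (isCutTree_cutTree hH)]
  exact Int.cast_smul_eq_zsmul R _ (Finsupp.single (α.cutTree H) (1 : R))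

/-- Joining a cut of the inner loop and a cut of the outer loop. -/
lemma PointedLoop.insert_union_mem_cuts [DecidableEq S] (hp : p ∈ α.crossings) (h₁ : H₁ ∈ α.cuts)
    (h₂ : H₂ ∈ α.cuts) (h₁' : H₁ ⊆ α.innerSet p) (h₂' : H₂ ⊆ α.outerSet p) :
    insert p (H₁ ∪ H₂) ∈ α.cuts := by
  have i1 : ∀ q ∈ H₁, q ∈ α.crossings ∧ α.Inside q p := fun q hq => mem_innerSet.1 (h₁' hq)
  have i2 : ∀ q ∈ H₂, q ∈ α.crossings ∧ α.Outside q p := fun q hq => mem_outerSet.1 (h₂' hq)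
  have i3 : ∀ q ∈ H₁, ∀ r ∈ H₂, α.Outside r q := fun q hq r hr z hz hz' =>
    (i2 r hr).2 z hz (arc_subset_carc ((i1 q hq).2.carc_subset (i1 q hq).1 hp hz'))
  refine mem_cuts.2 ⟨fun q hq => ?_, fun q hq r hr hne => ?_⟩
  · rcases Finset.mem_insert.1 hq with rfl | hq
    · exact hp
    · rcases Finset.mem_union.1 hq with hq | hq
      · exact (i1 q hq).1
      · exact (i2 q hq).1
  · rw [Finset.mem_insert, Finset.mem_union] at hq hr
    rcases hq with rfl | hq | hq <;> rcases hr with rfl | hr | hr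
    · exact absurd rfl hne
    · exact Or.inl (i1 r hr).2
    · exact Or.inr (i2 r hr).2
    · exact Or.inr ((i1 q hq).2.outside (i1 q hq).1 hp)
    · exact (mem_cuts.1 h₁).2 q hq r hr hne
    · exact Or.inr (i3 q hq r hr)
    · exact (i2 q hq).2.inside_or hp (i2 q hq).1
    · exact (i3 r hr q hq).inside_or (i1 r hr).1 (i2 q hq).1
    · exact (mem_cuts.1 h₂).2 q hq r hr hne

end Eta

/-! ### Splitting a cut at one of its crossings -/

section Hom

variable {S : Type*} [TopologicalSpace S] [ChartedSpace (EuclideanHalfSpace 2) S]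

open PointedLoop

variable {α : PointedLoop S} {p q : S} {H H₁ H₂ : Finset S}

lemma PointedLoop.mem_cuts_of_subset (hH : H ∈ α.cuts) (h : H₁ ⊆ H) : H₁ ∈ α.cuts :=
  mem_cuts.2 ⟨fun q hq => (mem_cuts.1 hH).1 q (h hq),
    fun q hq r hr => (mem_cuts.1 hH).2 q (h hq) r (h hr)⟩

lemma PointedLoop.mem_cuts_innerLoop (hp : p ∈ α.crossings) :
    H ∈ (α.innerLoop p).cuts ↔ H ∈ α.cuts ∧ H ⊆ α.innerSet p := by
  obtain ⟨c, hs⟩ := subLoop_innerLoop hp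
  exact hs.mem_cuts_iff

lemma PointedLoop.mem_cuts_outerLoop (hp : p ∈ α.crossings) :
    H ∈ (α.outerLoop p).cuts ↔ H ∈ α.cuts ∧ H ⊆ α.outerSet p := by
  obtain ⟨c, hs⟩ := subLoop_outerLoop hp
  exact hs.mem_cuts_iff

lemma PointedLoop.disjoint_inner_outer : Disjoint (α.innerSet p) (α.outerSet p) :=
  Finset.disjoint_left.2 fun _ h h' =>
    (mem_innerSet.1 h).2.not_outside (mem_innerSet.1 h).1 (mem_outerSet.1 h').2

lemma PointedLoop.not_mem_innerSet_self (hp : p ∈ α.crossings) : p ∉ α.innerSet p :=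
  fun h => not_inside_self hp (mem_innerSet.1 h).2

lemma PointedLoop.not_mem_outerSet_self (hp : p ∈ α.crossings) : p ∉ α.outerSet p :=
  fun h => not_outside_self hp (mem_outerSet.1 h).2

/-- No chord of the cut meets that of `p`, so each of the other crossings is inside or outside `p`.
-/
lemma PointedLoop.insert_union_eq [DecidableEq S] (hH : H ∈ α.cuts) (hp : p ∈ H) :
    insert p ((H ∩ α.innerSet p) ∪ (H ∩ α.outerSet p)) = H := by
  ext q
  rw [Finset.mem_insert, Finset.mem_union, Finset.mem_inter, Finset.mem_inter]
  constructor
  · rintro (rfl | h | h)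
    · exact hp
    · exact h.1
    · exact h.1
  · intro hq
    by_cases e : p = q
    · exact Or.inl e.symm
    · have hqc := (mem_cuts.1 hH).1 q hq
      exact Or.inr (((mem_cuts.1 hH).2 p hp q hq e).imp (fun h => ⟨hq, mem_innerSet.2 ⟨hqc, h⟩⟩)
        fun h => ⟨hq, mem_outerSet.2 ⟨hqc, h⟩⟩)

lemma PointedLoop.prod_crossingSign_eq [IsManifold (𝓡∂ 2) ∞ S] (hS : IsOrientedAtlas S)
    [DecidableEq S] (hH : H ∈ α.cuts) (hp : p ∈ H) : ∏ q ∈ H, α.crossingSign q =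
      α.crossingSign p * ((∏ q ∈ H ∩ α.innerSet p, (α.innerLoop p).crossingSign q) *
        ∏ q ∈ H ∩ α.outerSet p, (α.outerLoop p).crossingSign q) := by
  have hpc := (mem_cuts.1 hH).1 p hp
  have hd : Disjoint (H ∩ α.innerSet p) (H ∩ α.outerSet p) :=
    disjoint_inner_outer.mono Finset.inter_subset_right Finset.inter_subset_right
  have hn : p ∉ (H ∩ α.innerSet p) ∪ (H ∩ α.outerSet p) := by
    rw [Finset.mem_union, Finset.mem_inter, Finset.mem_inter]
    rintro (h | h)
    · exact not_mem_innerSet_self hpc h.2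
    · exact not_mem_outerSet_self hpc h.2
  obtain ⟨c, hs⟩ := subLoop_innerLoop hpc
  obtain ⟨c', hs'⟩ := subLoop_outerLoop hpc
  conv_lhs => rw [← insert_union_eq hH hp]
  rw [Finset.prod_insert hn, Finset.prod_union hd]
  congr 2
  · exact Finset.prod_congr rfl fun q hq =>
      (hs.crossingSign_eq hS (Finset.mem_inter.1 hq).2).symm
  · exact Finset.prod_congr rfl fun q hq =>
      (hs'.crossingSign_eq hS (Finset.mem_inter.1 hq).2).symm

/-- Both sides are sums over triples consisting of `p`, a cut of its inner loop and a cut of its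
outer loop. A cut with a marked element `p` splits into such a triple, and every triple arises,
since a chord inside `p` does not meet a chord outside `p`. The sign of the cut is the product of
the three signs. -/
lemma isComulHom_etaMap [IsManifold (𝓡∂ 2) ∞ S] (hS : IsOrientedAtlas S) (R : Type*)
    [CommRing R] : IsComulHom (loopComul S R) (treeComul S R) (etaMap S R) := by
  classical
  refine Finsupp.lhom_ext' fun a => LinearMap.ext_ring ?_
  induction a using Quotient.inductionOn with
  | h α =>
    change treeComul S R (etaMap S R (Finsupp.single ⟦α⟧ 1)) =
      TensorProduct.map (etaMap S R) (etaMap S R) (loopComul S R (Finsupp.single ⟦α⟧ 1))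
    have hL : treeComul S R (α.etaSum R) = ∑ H ∈ α.cuts, ∑ p ∈ H,
        (((∏ q ∈ H, α.crossingSign q : ℤˣ) : ℤ) : R) •
          (Finsupp.single ((α.innerLoop p).cutTree (H ∩ α.innerSet p)) (1 : R) ⊗ₜ[R]
            Finsupp.single ((α.outerLoop p).cutTree (H ∩ α.outerSet p)) (1 : R)) := by
      rw [etaSum, map_sum]
      refine Finset.sum_congr rfl fun H hH => ?_
      rw [map_smul, treeComul_cutTree R hS hH, Finset.smul_sum]
    rw [etaMap_single R hS, loopComul_single R hS, hL, comulSum, map_sum,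
      Finset.sum_comm' (t' := α.crossings) (s' := fun p => α.cuts.filter fun H => p ∈ H)]
    · refine Finset.sum_congr rfl fun p hp => ?_
      rw [map_smul, TensorProduct.map_tmul, etaMap_single R hS, etaMap_single R hS, etaSum,
        etaSum, TensorProduct.sum_tmul, Finset.smul_sum]
      simp_rw [TensorProduct.tmul_sum, Finset.smul_sum]
      rw [← Finset.sum_product']
      refine Finset.sum_bij' (fun H _ => (H ∩ α.innerSet p, H ∩ α.outerSet p))
        (fun K _ => insert p (K.1 ∪ K.2)) (fun H hH => ?_) (fun K hK => ?_) (fun H hH => ?_)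
        (fun K hK => ?_) fun H hH => ?_
      · have hH' := (Finset.mem_filter.1 hH).1
        exact Finset.mem_product.2
          ⟨(mem_cuts_innerLoop hp).2 ⟨mem_cuts_of_subset hH' Finset.inter_subset_left,
            Finset.inter_subset_right⟩,
          (mem_cuts_outerLoop hp).2 ⟨mem_cuts_of_subset hH' Finset.inter_subset_left,
            Finset.inter_subset_right⟩⟩
      · obtain ⟨h1, h2⟩ := Finset.mem_product.1 hK
        rw [mem_cuts_innerLoop hp] at h1
        rw [mem_cuts_outerLoop hp] at h2
        exact Finset.mem_filter.2 ⟨insert_union_mem_cuts hp h1.1 h2.1 h1.2 h2.2,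
          Finset.mem_insert_self _ _⟩
      · exact insert_union_eq (Finset.mem_filter.1 hH).1 (Finset.mem_filter.1 hH).2
      · obtain ⟨h1, h2⟩ := Finset.mem_product.1 hK
        have h1 := ((mem_cuts_innerLoop hp).1 h1).2
        have h2 := ((mem_cuts_outerLoop hp).1 h2).2
        have hd := Finset.disjoint_left.1 (disjoint_inner_outer (α := α) (p := p))
        have hi := not_mem_innerSet_self hp
        have ho := not_mem_outerSet_self hp
        refine Prod.ext ?_ ?_
        · ext q
          simp only [Finset.mem_inter, Finset.mem_insert, Finset.mem_union]
          constructor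
          · rintro ⟨rfl | h | h, h'⟩
            · exact absurd h' hi
            · exact h
            · exact absurd (h2 h) (hd h')
          · exact fun h => ⟨Or.inr (Or.inl h), h1 h⟩
        · ext q
          simp only [Finset.mem_inter, Finset.mem_insert, Finset.mem_union]
          constructor
          · rintro ⟨rfl | h | h, h'⟩
            · exact absurd h' ho
            · exact absurd h' (hd (h1 h))
            · exact h
          · exact fun h => ⟨Or.inr (Or.inr h), h2 h⟩
      · obtain ⟨hH, hpH⟩ := Finset.mem_filter.1 hH
        rw [prod_crossingSign_eq hS hH hpH, TensorProduct.smul_tmul_smul, smul_smul]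
        congr 1
        push_cast
        rfl
    · intro H p
      rw [Finset.mem_filter]
      exact ⟨fun h => ⟨h, (mem_cuts.1 h.1).1 p h.2⟩, fun h => h.1⟩

end Hom

theorem mainTheorem1 (R : Type*) [CommRing R] (S : Type*) [TopologicalSpace S] [T2Space S]
    [ChartedSpace (EuclideanHalfSpace 2) S] [IsManifold (𝓡∂ 2) ∞ S] (hS : IsOrientedAtlas S) :
    (∀ (α : PointedLoop S), ∀ p ∈ α.crossings, (∃! b, α.IsInner p b) ∧ ∃! c, α.IsOuter p c) ∧
    (∀ (α : PointedLoop S), ∀ H ∈ α.cuts, ∃! τ, α.IsCutTree H τ) ∧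
    ∃ (ρL : LoopModule R S →ₗ[R] LoopModule R S ⊗[R] LoopModule R S)
      (ρT : TreeModule R S →ₗ[R] TreeModule R S ⊗[R] TreeModule R S)
      (η : LoopModule R S →ₗ[R] TreeModule R S),
      IsLoopComul ρL ∧ IsTreeComul ρT ∧ IsEta η ∧
      IsPreLieComul ρL ∧ IsPreLieComul ρT ∧ IsComulHom ρL ρT η := by
  refine ⟨fun α p hp => ⟨PointedLoop.existsUnique_isInner hp, PointedLoop.existsUnique_isOuter hp⟩,
    fun α H hH => PointedLoop.existsUnique_isCutTree hH,
    loopComul S R, treeComul S R, etaMap S R, isLoopComul_loopComul R hS,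
    isTreeComul_treeComul R, isEta_etaMap R hS, isPreLieComul_loopComul R hS,
    isPreLieComul_treeComul R, isComulHom_etaMap hS R⟩

end
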